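/- **Proposition 3.2.** Let $\Gamma$ be a finite graph with vertex set $\{1,\dots,n\}$, possibly with multiple edges but with no edge from a vertex back to itself, each vertex $i$ being labelled with a self-intersection $s_i\in\mathbb Z$, an area $a_i\in(0,\infty)$ and a genus $g_i\in\mathbb Z_{\ge 0}$. Let $Q$ be the $n\times n$ matrix with $Q_{ii}=s_i$ and, for $i\ne j$, $Q_{ij}$ equal to the number of edges between $i$ and $j$, and let $\mathbf a=(a_1,\dots,a_n)^T$. Suppose there is a vector $\mathbf z\in(0,\infty)^n$ with $$-Q\mathbf z=\frac1{2\pi}\mathbf a .$$ Then there exist a smooth symplectic $4$-manifold $(X,\omega)$ without boundary (Hausdorff and second countable), closed connected smoothly embedded symplectic surfaces $C_1,\dots,C_n\subset X$ with union $C$, a smooth function $f\colon X\to[0,\infty)$, and a vector field $V$ on $X\setminus C$ such that: 1. $(X,\omega,C,f,V)$ is a neighborhood $5$-tuple: any two of the surfaces $C_i,C_j$ with $i\neq j$ are $\omega$-orthogonal at each of their intersection points; $f^{-1}(0)=C$ and $f$ has no critical values in $(0,\infty)$; and $V$ is a smooth Liouville vector field on $X\setminus C$ (that is, $L_V\omega=\omega$)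 with $df(V)>0$ on $X\setminus C$. 2. The surfaces intersect according to $\Gamma$: for $i\ne j$, $C_i\cap C_j$ consists of exactly $Q_{ij}$ points. 3. For each $i$: $C_i\cdot C_i=s_i$, $\int_{C_i}\omega=a_i$, and $C_i$ has genus $g_i$ (with $C_i$ oriented by $\omega|_{C_i}$ and $X$ by $\omega\wedge\omega$). 4. For all sufficiently small $t>0$, $f^{-1}[0,t]$ is a compact $\omega$-convex neighborhood of $C$, i.e. a compact neighborhood with smooth boundary, near which there is a Liouville vector field that points transversely outward along the boundary. -/

import Mathlib

open scoped Manifold ContDiff Topology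

noncomputable section

/-! ### Plumbing graphs -/

/-- A finite graph with vertex set `Fin n`, multiple edges allowed and no edge from a vertex back
to itself, each vertex being labelled with a self-intersection, a genus and a positive area.
`edges i j` is the number of edges between `i` and `j`. -/
structure PlumbingGraph (n : ℕ) where
  selfInt : Fin n → ℤ
  genus : Fin n → ℕ
  area : Fin n → ℝ
  area_pos : ∀ i, 0 < area i
  edges : Fin n → Fin n → ℕ
  edges_symm : ∀ i j, edges i j = edges j i
  edges_self : ∀ i, edges i i = 0

/-- The intersection matrix: self-intersections on the diagonal, numbers of edges off it. -/
def PlumbingGraph.intersectionMatrix {n : ℕ} (Γ : PlumbingGraph n) : Matrix (Fin n) (Fin n) ℝ :=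
  Matrix.of fun i j => if i = j then (Γ.selfInt i : ℝ) else (Γ.edges i j : ℝ)

/-! ### Differential forms and vector fields on a manifold -/

/-- A (not necessarily smooth) differential `k`-form on a `d`-manifold `X`. -/
abbrev DiffForm (d : ℕ) (X : Type) [TopologicalSpace X] [ChartedSpace (EuclideanSpace ℝ (Fin d)) X]
    (k : ℕ) : Type :=
  ∀ x : X, TangentSpace (𝓡 d) x [⋀^Fin k]→L[ℝ] ℝ

/-- A (not necessarily smooth) vector field on a `d`-manifold `X`. -/
abbrev VecField (d : ℕ) (X : Type) [TopologicalSpace X]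
    [ChartedSpace (EuclideanSpace ℝ (Fin d)) X] : Type :=
  ∀ x : X, TangentSpace (𝓡 d) x

section Forms

variable {d : ℕ} {X : Type} [TopologicalSpace X] [ChartedSpace (EuclideanSpace ℝ (Fin d)) X]
  {k : ℕ}

/-- The coordinate expression of a form in the preferred chart at `x₀`: its pullback under the
inverse of the chart. It is meaningful on the target of the chart. -/
def DiffForm.inChart (Ω : DiffForm d X k) (x₀ : X) (y : EuclideanSpace ℝ (Fin d)) :
    EuclideanSpace ℝ (Fin d) [⋀^Fin k]→L[ℝ] ℝ :=
  (Ω ((extChartAt (𝓡 d) x₀).symm y)).compContinuousLinearMap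
    (mfderiv (𝓡 d) (𝓡 d) (extChartAt (𝓡 d) x₀).symm y)

/-- Smoothness of a form on a set (used for open sets only): all its coordinate expressions are
smooth. -/
def DiffForm.SmoothOn (Ω : DiffForm d X k) (s : Set X) : Prop :=
  ∀ x₀ : X, ContDiffOn ℝ ∞ (Ω.inChart x₀)
    ((extChartAt (𝓡 d) x₀).target ∩ (extChartAt (𝓡 d) x₀).symm ⁻¹' s)

/-- The exterior derivative, computed at `x` in the preferred chart at `x`. -/
def DiffForm.extD (Ω : DiffForm d X k) : DiffForm d X (k + 1) := fun x =>
  (extDeriv (Ω.inChart x) (extChartAt (𝓡 d) x x)).compContinuousLinearMap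
    (mfderiv (𝓡 d) (𝓡 d) (extChartAt (𝓡 d) x) x)

/-- The interior product `ι_V Ω`. -/
def DiffForm.contract (Ω : DiffForm d X (k + 1)) (V : VecField d X) : DiffForm d X k := fun x =>
  ContinuousAlternatingMap.curryLeft (E := EuclideanSpace ℝ (Fin d)) (Ω x) (V x)

/-- Smoothness of a vector field on a set, as a section of the tangent bundle. -/
def VecField.SmoothOn [IsManifold (𝓡 d) ∞ X] (V : VecField d X) (s : Set X) : Prop :=
  ContMDiffOn (𝓡 d) (𝓡 d).tangent ∞ (fun x => (⟨x, V x⟩ : TangentBundle (𝓡 d) X)) s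

/-- A symplectic form: a smooth, closed, nondegenerate 2-form. -/
structure DiffForm.IsSymplectic (Ω : DiffForm d X 2) : Prop where
  smooth : Ω.SmoothOn Set.univ
  closed : ∀ x, Ω.extD x = 0
  nondegenerate : ∀ x, ∀ u : TangentSpace (𝓡 d) x,
    (∀ w : TangentSpace (𝓡 d) x, Ω x ![u, w] = 0) → u = 0

/-- `V` is a Liouville vector field for `Ω` on the open set `s`: it is smooth on `s` and its
Lie derivative satisfies `L_V Ω = Ω` there, that is `d (ι_V Ω) = Ω` since `Ω` is closed. -/
def VecField.IsLiouvilleOn [IsManifold (𝓡 d) ∞ X] (V : VecField d X) (Ω : DiffForm d X 2)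
    (s : Set X) : Prop :=
  V.SmoothOn s ∧ ∀ x ∈ s, (Ω.contract V).extD x = Ω x

/-- The derivative `df(V)` at `x` of a real function `f` along `V`. -/
def VecField.derivAlong (V : VecField d X) (f : X → ℝ) (x : X) : ℝ :=
  mfderiv (𝓡 d) 𝓘(ℝ, ℝ) f x (V x)

end Forms

/-! ### Surfaces in a 4-manifold -/

section Surfaces

variable {X : Type} [TopologicalSpace X] [ChartedSpace (EuclideanSpace ℝ (Fin 4)) X]

variable (X) in
/-- A closed connected smooth surface smoothly embedded in the 4-manifold `X`. -/
structure EmbeddedSurface where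
  carrier : Type
  [top : TopologicalSpace carrier]
  [charted : ChartedSpace (EuclideanSpace ℝ (Fin 2)) carrier]
  [manifold : IsManifold (𝓡 2) ∞ carrier]
  [t2 : T2Space carrier]
  [compact : CompactSpace carrier]
  [connected : ConnectedSpace carrier]
  map : C(carrier, X)
  embedding : Manifold.IsSmoothEmbedding (𝓡 2) (𝓡 4) ∞ map

attribute [instance] EmbeddedSurface.top EmbeddedSurface.charted EmbeddedSurface.manifold
  EmbeddedSurface.t2 EmbeddedSurface.compact EmbeddedSurface.connected

/-- The subset of `X` occupied by the surface. -/
def EmbeddedSurface.image (S : EmbeddedSurface X) : Set X := Set.range S.map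

/-- The differential at `p` of a map from a surface to `X`. (Tangent spaces are by definition copies
of the model spaces; using the latter in the type lets vectors tangent to two surfaces at a common
point be put into one form.) -/
def surfaceDeriv {S : Type} [TopologicalSpace S] [ChartedSpace (EuclideanSpace ℝ (Fin 2)) S]
    (F : S → X) (p : S) : EuclideanSpace ℝ (Fin 2) →L[ℝ] EuclideanSpace ℝ (Fin 4) :=
  mfderiv (𝓡 2) (𝓡 4) F p

/-- The value `Ω_x(u, w)`. -/
def DiffForm.eval (Ω : DiffForm 4 X 2) (x : X) (u w : EuclideanSpace ℝ (Fin 4)) : ℝ :=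
  Ω x ![u, w]

/-- The surface is symplectic: `Ω` is nondegenerate on each of its tangent planes. -/
def EmbeddedSurface.IsSymplectic (Ω : DiffForm 4 X 2) (S : EmbeddedSurface X) : Prop :=
  ∀ p : S.carrier, ∀ u : EuclideanSpace ℝ (Fin 2), u ≠ 0 → ∃ w : EuclideanSpace ℝ (Fin 2),
    Ω.eval (S.map p) (surfaceDeriv S.map p u) (surfaceDeriv S.map p w) ≠ 0

/-- At each common point the tangent planes of the two surfaces are `Ω`-orthogonal. (For symplectic
surfaces this implies that they meet transversely and positively.) -/
def EmbeddedSurface.MeetOrthogonally (Ω : DiffForm 4 X 2) (S T : EmbeddedSurface X) : Prop :=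
  ∀ (p : S.carrier) (q : T.carrier), S.map p = T.map q → ∀ u w : EuclideanSpace ℝ (Fin 2),
    Ω.eval (S.map p) (surfaceDeriv S.map p u) (surfaceDeriv T.map q w) = 0

/-- The standard basis of the tangent plane of a surface (in the preferred chart). -/
abbrev stdVec (i : Fin 2) : EuclideanSpace ℝ (Fin 2) := EuclideanSpace.single i 1

/-- Half of `Ω ∧ Ω`, evaluated at four vectors; it orients `X` if `Ω` is symplectic. -/
def DiffForm.wedgeSq (Ω : DiffForm 4 X 2) (x : X) (a b c e : EuclideanSpace ℝ (Fin 4)) : ℝ :=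
  Ω.eval x a b * Ω.eval x c e - Ω.eval x a c * Ω.eval x b e + Ω.eval x a e * Ω.eval x b c

/-- `1` or `-1` according to whether the given basis of the tangent plane of the symplectic
surface `S` at `p` is positive for the orientation of `S` by `Ω`. -/
def EmbeddedSurface.basisSign (Ω : DiffForm 4 X 2) (S : EmbeddedSurface X) (p : S.carrier) : ℤ :=
  SignType.sign (Ω.eval (S.map p) (surfaceDeriv S.map p (stdVec 0))
    (surfaceDeriv S.map p (stdVec 1)))

/-- The sign of a transverse intersection point `h p = S.map q` of a map `h` defined on the
symplectic surface `S` with `S` itself, where `S` is oriented by `Ω` and `X` by `Ω ∧ Ω`. -/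
def EmbeddedSurface.crossingSign (Ω : DiffForm 4 X 2) (S : EmbeddedSurface X)
    (h : S.carrier → X) (p q : S.carrier) : ℤ :=
  S.basisSign Ω p * S.basisSign Ω q *
    SignType.sign (Ω.wedgeSq (S.map q)
      (surfaceDeriv h p (stdVec 0)) (surfaceDeriv h p (stdVec 1))
      (surfaceDeriv S.map q (stdVec 0)) (surfaceDeriv S.map q (stdVec 1)))

/-- `S · S = m`: the signed number of intersection points of `S` with a smooth map which is
homotopic to the inclusion of `S` and transverse to `S` is `m` (it does not depend on that map). -/
def EmbeddedSurface.HasSelfIntersection (Ω : DiffForm 4 X 2) (S : EmbeddedSurface X)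
    (m : ℤ) : Prop :=
  ∃ h : C(S.carrier, X), ContMDiff (𝓡 2) (𝓡 4) ∞ h ∧ ContinuousMap.Homotopic S.map h ∧
    (∀ p q, h p = S.map q →
      (surfaceDeriv h p).range ⊔ (surfaceDeriv S.map q).range = ⊤) ∧
    ∃ P : Finset (S.carrier × S.carrier), (∀ pq, pq ∈ P ↔ h pq.1 = S.map pq.2) ∧
      ∑ pq ∈ P, S.crossingSign Ω h pq.1 pq.2 = m

/-- `μ` is the area measure on the symplectic surface `S` given by the positive 2-form `Ω|_S`
(with `S` oriented by `Ω`): in each chart its density is the absolute value of the coefficient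
of `Ω|_S`. -/
def EmbeddedSurface.IsAreaMeasure (Ω : DiffForm 4 X 2) (S : EmbeddedSurface X)
    (μ : @MeasureTheory.Measure S.carrier (borel S.carrier)) : Prop :=
  ∀ (p : S.carrier) (A : Set S.carrier), @MeasurableSet S.carrier (borel S.carrier) A →
    A ⊆ (extChartAt (𝓡 2) p).source →
    μ A = ∫⁻ y in extChartAt (𝓡 2) p '' A, ENNReal.ofReal
      |Ω.eval (S.map ((extChartAt (𝓡 2) p).symm y))
        (surfaceDeriv (S.map ∘ (extChartAt (𝓡 2) p).symm) y (stdVec 0))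
        (surfaceDeriv (S.map ∘ (extChartAt (𝓡 2) p).symm) y (stdVec 1))|

/-- `∫_S Ω = a` for the symplectic surface `S` oriented by `Ω`. -/
def EmbeddedSurface.HasArea (Ω : DiffForm 4 X 2) (S : EmbeddedSurface X) (a : ℝ) : Prop :=
  ∃ μ : @MeasureTheory.Measure S.carrier (borel S.carrier),
    S.IsAreaMeasure Ω μ ∧ μ Set.univ = ENNReal.ofReal a

/-- The Euler characteristic of a finite simplicial complex, `V - E + F` in dimension two. -/
def simplicialEulerChar {N : ℕ} (K : Geometry.SimplicialComplex ℝ (EuclideanSpace ℝ (Fin N)))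
    (hK : K.faces.Finite) : ℤ :=
  ∑ s ∈ hK.toFinset, (-1) ^ (s.card - 1)

/-- The surface (which is closed, connected, and oriented once it is symplectic) has genus `g`:
it has a finite triangulation with Euler characteristic `2 - 2g` (any other one then has, too). -/
def EmbeddedSurface.HasGenus (S : EmbeddedSurface X) (g : ℕ) : Prop :=
  ∃ (N : ℕ) (K : Geometry.SimplicialComplex ℝ (EuclideanSpace ℝ (Fin N))) (hK : K.faces.Finite),
    Nonempty (S.carrier ≃ₜ K.space) ∧ simplicialEulerChar K hK = 2 - 2 * (g : ℤ)

/-! ### Neighborhood 5-tuples -/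

/-- `U` is a compact `Ω`-convex neighborhood of `C`: near its boundary, a smooth hypersurface,
there is a Liouville vector field that points outward transversely along the boundary
(`ρ` is a defining function of `U` near its boundary). -/
def IsConvexNeighborhood [IsManifold (𝓡 4) ∞ X] (Ω : DiffForm 4 X 2) (C U : Set X) : Prop :=
  IsCompact U ∧ C ⊆ interior U ∧
    ∃ (W : Set X) (V : VecField 4 X) (ρ : X → ℝ),
      IsOpen W ∧ frontier U ⊆ W ∧ V.IsLiouvilleOn Ω W ∧
      ContMDiffOn (𝓡 4) 𝓘(ℝ, ℝ) ∞ ρ W ∧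
      U ∩ W = {x ∈ W | ρ x ≤ 0} ∧ frontier U = {x ∈ W | ρ x = 0} ∧
      ∀ x ∈ frontier U, 0 < V.derivAlong ρ x

/-- `(X, Ω, C, f, V)` is a neighborhood 5-tuple, `C` being the union of the surfaces `C i`; the
values of `V` on `C` are irrelevant. -/
structure IsNeighborhood5Tuple [IsManifold (𝓡 4) ∞ X] (Ω : DiffForm 4 X 2) {n : ℕ}
    (C : Fin n → EmbeddedSurface X) (f : X → ℝ) (V : VecField 4 X) : Prop where
  symplectic : Ω.IsSymplectic
  surfaces_symplectic : ∀ i, (C i).IsSymplectic Ω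
  surfaces_orthogonal : ∀ i j, i ≠ j → (C i).MeetOrthogonally Ω (C j)
  smooth : ContMDiff (𝓡 4) 𝓘(ℝ, ℝ) ∞ f
  nonneg : ∀ x, 0 ≤ f x
  zero_iff : ∀ x, f x = 0 ↔ x ∈ ⋃ i, (C i).image
  no_critical_value : ∀ x, 0 < f x → mfderiv (𝓡 4) 𝓘(ℝ, ℝ) f x ≠ 0
  liouville : V.IsLiouvilleOn Ω (⋃ i, (C i).image)ᶜ
  deriv_pos : ∀ x ∈ (⋃ i, (C i).image)ᶜ, 0 < V.derivAlong f x

end Surfaces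

end

/-!
The manifold is built by gluing open subsets of `ℂ × ℂ`, with coordinates `(w, ζ)`, by maps which
preserve the standard symplectic form. A surface of genus `g` is the double of a disc with `g`
holes, so each vertex `i` of the graph contributes two *sheets*: the product of a neighborhood of a
disc with `g_i` holes in the `w`-plane with a small disc of fibres. In symplectic polar coordinates
`p = |w|² / 2`, `θ`, `P = |ζ|² / 2`, `ψ` the collars of the outer boundary `|w| = R` in the two
sheets are glued by the toric map `(p, θ, P, ψ) ↦ (R² - p + m P, -θ, P, ψ + m θ)` (`toricMap`),
which gives the zero section the self-intersection `-m`; this is taken to be `s_i`, which is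
negative by the hypothesis. The boundaries of the holes are glued in the same way without twist.
For each edge between `i` and `j` the sheets are glued by exchanging `w` (centred at a marked
point) and `ζ`. Every point is identified with at most one other point, so no cocycle condition
arises, and everything on the result is a family of objects on the sheets compatible with the
gluing maps (`GlueData`, `PlumbingModel`).

The Liouville field on a sheet is `(h(w), (1 / 2 + z_i / |ζ|²) ζ)`, where `h` is a planar field of
divergence one with prescribed residues and standard radial form near the holes, the marked points
and the outer boundary (`exists_planar_field`). Exchanging base and fibre at an edge forces the
residue `z_j` at a marked point. In toric coordinates the field is `(p + r) ∂_p + (P + z_i) ∂_P`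
near a boundary circle, and compatibility with the toric map is a linear condition on the residues.
At the outer boundary it reads `m z_i - ∑_j Q_ij z_j = R² - g ρ² = a_i / 2π`, with holes of radius
`ρ`: this is the `i`-th equation of the hypothesis (`flux`, `equivariant_liouville`).

The function is `|ζ|² / 2` times a weight which vanishes quadratically at the marked points.
Positivity of the `z_i` makes it increase along the Liouville field (`derivAlong_heightFun_pos`),
and its small sublevel sets are covered by compact tubes (`isConvexNeighborhood_sublevel`).

The area of a surface is that of its two discs with holes, `2 π (R² - g ρ²)` (`hasArea`). For the
self-intersection the surface is pushed off itself by a normal field which is constant on one sheet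
and winds `m` times around zero along the outer boundary of the other one; it has `m` zeros, which
are negative crossings (`hasSelfIntersection`). For the genus, the real axis and the boundary
circles cut the surface into four copies of a polygon with `2 g + 2` sides. Subdivided
barycentrically they form a simplicial complex with Euler characteristic `2 - 2 g`; surface and
complex are quotients of the same compact space by the same relation (`sum_faces`, `hasGenus`).
-/

/-! ### Manifolds glued from open subsets of a vector space -/

noncomputable section

open Set Filter

/-- Gluing data for a manifold modelled on `E`: open subsets `U i` ("sheets") of a vector space `F`
which is identified with `E` by `e`, and finitely many smooth maps `φ c`, each identifying an open
subset `D c` of the sheet `src c` with an open subset `D (rev c)` of the different sheet `tgt c`.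
The sets `D c` in one sheet are pairwise disjoint, so that each point of a sheet is identified
with at most one other point; hence no cocycle condition is needed. The field `separated` makes
the glued space Hausdorff. -/
structure GlueData (E F : Type) [NormedAddCommGroup E] [NormedSpace ℝ E]
    [NormedAddCommGroup F] [NormedSpace ℝ F] where
  e : E ≃L[ℝ] F
  ι : Type
  κ : Type
  [countable_ι : Countable ι]
  U : ι → Set F
  isOpen_U : ∀ i, IsOpen (U i)
  nonempty_U : ∀ i, (U i).Nonempty
  src : κ → ι
  tgt : κ → ι
  rev : κ → κ
  src_rev : ∀ c, src (rev c) = tgt c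
  tgt_rev : ∀ c, tgt (rev c) = src c
  src_ne_tgt : ∀ c, src c ≠ tgt c
  D : κ → Set F
  isOpen_D : ∀ c, IsOpen (D c)
  D_subset : ∀ c, D c ⊆ U (src c)
  φ : κ → F → F
  φ_mem : ∀ c, ∀ x ∈ D c, φ c x ∈ D (rev c)
  φ_rev : ∀ c, ∀ x ∈ D c, φ (rev c) (φ c x) = x
  smooth : ∀ c, ContDiffOn ℝ ∞ (φ c) (D c)
  eq_of_mem : ∀ c c', src c = src c' → ∀ x ∈ D c, x ∈ D c' → c = c'
  [finite_κ : Finite κ]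
  separated : ∀ c, ∀ x ∈ U (src c), x ∉ D c → ∀ y ∈ U (tgt c),
    ∃ N ∈ 𝓝 x, ∃ N' ∈ 𝓝 y, ∀ x' ∈ N, x' ∈ D c → φ c x' ∉ N'

namespace GlueData

attribute [instance] countable_ι finite_κ

variable {E F : Type} [NormedAddCommGroup E] [NormedSpace ℝ E]
  [NormedAddCommGroup F] [NormedSpace ℝ F] (G : GlueData E F)

/-- Two points `x` of the sheet `i` and `y` of the sheet `j` are identified. -/
def Rel (i : G.ι) (x : F) (j : G.ι) (y : F) : Prop :=
  (i = j ∧ x = y) ∨ ∃ c, G.src c = i ∧ G.tgt c = j ∧ x ∈ G.D c ∧ G.φ c x = y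

variable {G} in
lemma Rel.symm {i j : G.ι} {x y : F} (h : G.Rel i x j y) : G.Rel j y i x := by
  rcases h with ⟨rfl, rfl⟩ | ⟨c, rfl, rfl, hx, rfl⟩
  · exact .inl ⟨rfl, rfl⟩
  · exact .inr ⟨G.rev c, G.src_rev c, G.tgt_rev c, G.φ_mem c x hx, G.φ_rev c x hx⟩

variable {G} in
lemma Rel.trans {i j k : G.ι} {x y z : F} (h : G.Rel i x j y) (h' : G.Rel j y k z) :
    G.Rel i x k z := by
  rcases h with ⟨rfl, rfl⟩ | ⟨c, rfl, rfl, hx, rfl⟩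
  · exact h'
  rcases h' with ⟨rfl, rfl⟩ | ⟨c', h1, rfl, hx', rfl⟩
  · exact .inr ⟨c, rfl, rfl, hx, rfl⟩
  obtain rfl : G.rev c = c' :=
    G.eq_of_mem _ _ ((G.src_rev c).trans h1.symm) _ (G.φ_mem c x hx) hx'
  exact .inl ⟨(G.tgt_rev c).symm, (G.φ_rev c x hx).symm⟩

instance setoid : Setoid (Σ i, G.U i) where
  r p q := G.Rel p.1 p.2 q.1 q.2
  iseqv := ⟨fun _ => .inl ⟨rfl, rfl⟩, Rel.symm, Rel.trans⟩

/-- The glued space. -/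
def Space : Type := Quotient G.setoid

instance : TopologicalSpace G.Space := inferInstanceAs (TopologicalSpace (Quotient G.setoid))

open Classical in
/-- The point of the glued space represented by the point `x` of the sheet `i`
(a junk value if `x` is not in the sheet). -/
def pt (i : G.ι) (x : F) : G.Space :=
  if h : x ∈ G.U i then Quotient.mk G.setoid ⟨i, x, h⟩
  else Quotient.mk G.setoid ⟨i, (G.nonempty_U i).some, (G.nonempty_U i).some_mem⟩

lemma pt_of_mem {i : G.ι} {x : F} (h : x ∈ G.U i) :
    G.pt i x = Quotient.mk G.setoid ⟨i, x, h⟩ := dif_pos h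

/-- Two points of sheets represent the same point of the glued space exactly if they are equal or
one of the gluing maps takes one to the other. -/
lemma pt_eq_pt {i j : G.ι} {x y : F} (hx : x ∈ G.U i) (hy : y ∈ G.U j) :
    G.pt i x = G.pt j y ↔ G.Rel i x j y := by
  rw [G.pt_of_mem hx, G.pt_of_mem hy]
  exact Quotient.eq (r := G.setoid)

lemma φ_mem_U {c : G.κ} {x : F} (hx : x ∈ G.D c) : G.φ c x ∈ G.U (G.tgt c) :=
  G.src_rev c ▸ G.D_subset _ (G.φ_mem c x hx)

lemma pt_φ {c : G.κ} {x : F} (hx : x ∈ G.D c) :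
    G.pt (G.tgt c) (G.φ c x) = G.pt (G.src c) x :=
  ((G.pt_eq_pt (G.D_subset c hx) (G.φ_mem_U hx)).2 (.inr ⟨c, rfl, rfl, hx, rfl⟩)).symm

lemma exists_rep (p : G.Space) : ∃ i, ∃ x ∈ G.U i, G.pt i x = p := by
  obtain ⟨⟨i, x, hx⟩, rfl⟩ := Quotient.exists_rep p
  exact ⟨i, x, hx, G.pt_of_mem hx⟩

/-- No two points of one sheet are identified, as every gluing map joins two different sheets. -/
lemma pt_injOn (i : G.ι) : InjOn (G.pt i) (G.U i) := by
  intro x hx y hy h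
  rcases (G.pt_eq_pt hx hy).1 h with ⟨_, h⟩ | ⟨c, h1, h2, _⟩
  · exact h
  · exact absurd (h1.trans h2.symm) (G.src_ne_tgt c)

lemma isOpen_iff {O : Set G.Space} : IsOpen O ↔ ∀ i, IsOpen (G.U i ∩ G.pt i ⁻¹' O) := by
  have h1 : IsOpen O ↔ IsOpen (Quotient.mk G.setoid ⁻¹' O) := Iff.rfl
  rw [h1, isOpen_sigma_iff]
  refine forall_congr' fun i => ?_
  have : G.U i ∩ G.pt i ⁻¹' O = Subtype.val ''
      ((fun x : G.U i => (⟨i, x⟩ : Σ i, G.U i)) ⁻¹' (Quotient.mk G.setoid ⁻¹' O)) := by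
    ext x
    constructor
    · rintro ⟨hx, h⟩
      exact ⟨⟨x, hx⟩, by rwa [mem_preimage, G.pt_of_mem hx] at h, rfl⟩
    · rintro ⟨⟨x, hx⟩, h, rfl⟩
      exact ⟨hx, by rwa [mem_preimage, G.pt_of_mem hx]⟩
  rw [this, (G.isOpen_U i).isOpenEmbedding_subtypeVal.isOpen_iff_image_isOpen]

lemma continuousOn_pt (i : G.ι) : ContinuousOn (G.pt i) (G.U i) := by
  rw [continuousOn_open_iff (G.isOpen_U i)]
  exact fun O hO => G.isOpen_iff.1 hO i

lemma isOpen_image_pt {i : G.ι} {V : Set F} (hV : IsOpen V) (hVU : V ⊆ G.U i) :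
    IsOpen (G.pt i '' V) := by
  rw [isOpen_iff]
  intro j
  have : G.U j ∩ G.pt j ⁻¹' (G.pt i '' V) =
      {x ∈ V | j = i} ∪ ⋃ c, {x ∈ G.D c | (G.src c = j ∧ G.tgt c = i) ∧ G.φ c x ∈ V} := by
    ext x
    simp only [mem_inter_iff, mem_preimage, mem_image, mem_union, mem_iUnion]
    constructor
    · rintro ⟨hx, y, hy, h⟩
      rcases (G.pt_eq_pt hx (hVU hy)).1 h.symm with ⟨rfl, rfl⟩ | ⟨c, h1, h2, hc, rfl⟩
      · exact .inl ⟨hy, rfl⟩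
      · exact .inr ⟨c, hc, ⟨h1, h2⟩, hy⟩
    · rintro (⟨hx, rfl⟩ | ⟨c, hc, ⟨rfl, rfl⟩, hx⟩)
      · exact ⟨hVU hx, x, hx, rfl⟩
      · exact ⟨G.D_subset c hc, _, hx, G.pt_φ hc⟩
  rw [this]
  refine IsOpen.union ?_ (isOpen_iUnion fun c => ?_)
  · by_cases h : j = i
    · simpa [h] using hV
    · simp [h]
  · by_cases h : G.src c = j ∧ G.tgt c = i
    · have h' : {x ∈ G.D c | (G.src c = j ∧ G.tgt c = i) ∧ G.φ c x ∈ V} = G.D c ∩ G.φ c ⁻¹' V := by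
        ext x; simp [h]
      exact h' ▸ (G.smooth c).continuousOn.isOpen_inter_preimage (G.isOpen_D c) hV
    · simp [h]

/-- The coordinate of a point in the sheet `i`. -/
def coord (i : G.ι) (p : G.Space) : F := Function.invFunOn (G.pt i) (G.U i) p

lemma coord_pt {i : G.ι} {x : F} (hx : x ∈ G.U i) : G.coord i (G.pt i x) = x :=
  (G.pt_injOn i).leftInvOn_invFunOn hx

/-- The part of the glued space covered by the sheet `i`. -/
def range (i : G.ι) : Set G.Space := G.pt i '' G.U i

lemma coord_mem {i : G.ι} {p : G.Space} (hp : p ∈ G.range i) : G.coord i p ∈ G.U i :=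
  Function.invFunOn_mem hp

lemma pt_coord {i : G.ι} {p : G.Space} (hp : p ∈ G.range i) : G.pt i (G.coord i p) = p :=
  Function.invFunOn_eq hp

lemma pt_mem_range {i : G.ι} {x : F} (hx : x ∈ G.U i) : G.pt i x ∈ G.range i :=
  mem_image_of_mem _ hx

lemma isOpen_range (i : G.ι) : IsOpen (G.range i) := G.isOpen_image_pt (G.isOpen_U i) subset_rfl

/-- The chart with values in `E` given by the sheet `i`. -/
def sheetChart (i : G.ι) : OpenPartialHomeomorph G.Space E where
  toFun p := G.e.symm (G.coord i p)
  invFun y := G.pt i (G.e y)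
  source := G.range i
  target := G.e ⁻¹' G.U i
  map_source' p hp := by simpa using G.coord_mem hp
  map_target' y hy := G.pt_mem_range hy
  left_inv' p hp := by simpa using G.pt_coord hp
  right_inv' y hy := by simp [G.coord_pt (mem_preimage.1 hy)]
  open_source := G.isOpen_range i
  open_target := (G.isOpen_U i).preimage G.e.continuous
  continuousOn_toFun := by
    refine G.e.symm.continuous.comp_continuousOn ?_
    rw [continuousOn_open_iff (G.isOpen_range i)]
    intro V hV
    have : G.range i ∩ G.coord i ⁻¹' V = G.pt i '' (G.U i ∩ V) := by
      ext p
      constructor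
      · rintro ⟨⟨x, hx, rfl⟩, h⟩
        exact ⟨x, ⟨hx, by rwa [mem_preimage, G.coord_pt hx] at h⟩, rfl⟩
      · rintro ⟨x, ⟨hx, h⟩, rfl⟩
        exact ⟨G.pt_mem_range hx, by rwa [mem_preimage, G.coord_pt hx]⟩
    rw [this]
    exact G.isOpen_image_pt ((G.isOpen_U i).inter hV) inter_subset_left
  continuousOn_invFun := (G.continuousOn_pt i).comp G.e.continuous.continuousOn fun _ h => h

/-- The sheet whose chart is the preferred one at `p`. -/
def sheet (p : G.Space) : G.ι := (G.exists_rep p).choose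

lemma mem_range_sheet (p : G.Space) : p ∈ G.range (G.sheet p) := by
  obtain ⟨x, hx, h⟩ := (G.exists_rep p).choose_spec
  exact ⟨x, hx, h⟩

instance : ChartedSpace E G.Space where
  atlas := Set.range G.sheetChart
  chartAt p := G.sheetChart (G.sheet p)
  mem_chart_source := G.mem_range_sheet
  chart_mem_atlas _ := mem_range_self _

lemma chartAt_eq (p : G.Space) : chartAt E p = G.sheetChart (G.sheet p) := rfl

/-- The change of coordinates from the sheet `i` to the sheet `j`. -/
def trans (i j : G.ι) (x : F) : F := G.coord j (G.pt i x)

lemma trans_self_eventuallyEq {i : G.ι} {x : F} (hx : x ∈ G.U i) : G.trans i i =ᶠ[𝓝 x] id := by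
  filter_upwards [(G.isOpen_U i).mem_nhds hx] with y hy using G.coord_pt hy

lemma trans_eventuallyEq {c : G.κ} {x : F} (hx : x ∈ G.D c) :
    G.trans (G.src c) (G.tgt c) =ᶠ[𝓝 x] G.φ c := by
  filter_upwards [(G.isOpen_D c).mem_nhds hx] with y hy
  rw [trans, ← G.pt_φ hy, G.coord_pt (G.φ_mem_U hy)]

/-- Where two sheets overlap, the change of coordinates is locally the identity or one of the
gluing maps. -/
lemma trans_cases {i j : G.ι} {x : F} (hx : x ∈ G.U i) (h : G.pt i x ∈ G.range j) :
    (i = j ∧ G.trans i j =ᶠ[𝓝 x] id) ∨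
      ∃ c, G.src c = i ∧ G.tgt c = j ∧ x ∈ G.D c ∧ G.trans i j =ᶠ[𝓝 x] G.φ c := by
  obtain ⟨y, hy, hxy⟩ := h
  rcases (G.pt_eq_pt hx hy).1 hxy.symm with ⟨rfl, rfl⟩ | ⟨c, rfl, rfl, hc, rfl⟩
  · exact .inl ⟨rfl, G.trans_self_eventuallyEq hx⟩
  · exact .inr ⟨c, rfl, rfl, hc, G.trans_eventuallyEq hc⟩

lemma contDiffAt_trans {i j : G.ι} {x : F} (hx : x ∈ G.U i) (h : G.pt i x ∈ G.range j) :
    ContDiffAt ℝ ∞ (G.trans i j) x := by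
  rcases G.trans_cases hx h with ⟨-, h⟩ | ⟨c, rfl, rfl, hc, h⟩
  · exact contDiffAt_id.congr_of_eventuallyEq h
  · exact ((G.smooth c).contDiffAt ((G.isOpen_D c).mem_nhds hc)).congr_of_eventuallyEq h

instance : IsManifold 𝓘(ℝ, E) ∞ G.Space := by
  refine isManifold_of_contDiffOn _ _ _ ?_
  rintro _ _ ⟨i, rfl⟩ ⟨j, rfl⟩
  intro y hy
  have hy1 : G.e y ∈ G.U i := hy.1.1
  have hy2 : G.pt i (G.e y) ∈ G.range j := hy.1.2
  have := (G.e.symm.contDiff.contDiffAt (n := ∞)).comp y ((G.contDiffAt_trans hy1 hy2).comp y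
    (G.e.contDiff.contDiffAt (n := ∞)))
  exact this.contDiffWithinAt

instance : T2Space G.Space := by
  refine ⟨fun p q hpq => ?_⟩
  obtain ⟨i, x, hx, rfl⟩ := G.exists_rep p
  obtain ⟨j, y, hy, rfl⟩ := G.exists_rep q
  -- It is enough to find neighborhoods in the two sheets without related points.
  suffices h : ∃ N ∈ 𝓝 x, ∃ N' ∈ 𝓝 y, ∀ x' ∈ N, ∀ y' ∈ N', ¬ G.Rel i x' j y' by
    obtain ⟨N, hN, N', hN', h⟩ := h
    obtain ⟨V, hVN, hV, hxV⟩ := mem_nhds_iff.1 hN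
    obtain ⟨V', hVN', hV', hxV'⟩ := mem_nhds_iff.1 hN'
    refine ⟨_, _, G.isOpen_image_pt (hV.inter (G.isOpen_U i)) inter_subset_right,
      G.isOpen_image_pt (hV'.inter (G.isOpen_U j)) inter_subset_right,
      mem_image_of_mem _ ⟨hxV, hx⟩, mem_image_of_mem _ ⟨hxV', hy⟩, ?_⟩
    rw [Set.disjoint_left]
    rintro _ ⟨a, ⟨ha, ha'⟩, rfl⟩ ⟨b, ⟨hb, hb'⟩, hab⟩
    exact h a (hVN ha) b (hVN' hb) ((G.pt_eq_pt ha' hb').1 hab.symm)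
  have hrel : ¬ G.Rel i x j y := fun h => hpq ((G.pt_eq_pt hx hy).2 h)
  by_cases hij : i = j
  · subst hij
    have hxy : x ≠ y := fun h => hrel (.inl ⟨rfl, h⟩)
    obtain ⟨N, N', hN, hN', hx, hy, hd⟩ := t2_separation hxy
    refine ⟨N, hN.mem_nhds hx, N', hN'.mem_nhds hy, ?_⟩
    rintro a ha b hb (⟨-, rfl⟩ | ⟨c, h1, h2, -⟩)
    · exact Set.disjoint_left.1 hd ha hb
    · exact G.src_ne_tgt c (h1.trans h2.symm)
  · have key : ∀ c, ∃ N ∈ 𝓝 x, ∃ N' ∈ 𝓝 y, ∀ x' ∈ N, G.src c = i → G.tgt c = j → x' ∈ G.D c →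
        G.φ c x' ∉ N' := by
      intro c
      by_cases hc : G.src c = i ∧ G.tgt c = j
      · obtain ⟨rfl, rfl⟩ := hc
        by_cases hxc : x ∈ G.D c
        · have hne : G.φ c x ≠ y := fun h => hrel (.inr ⟨c, rfl, rfl, hxc, h⟩)
          obtain ⟨N, N', hN, hN', h1, h2, hd⟩ := t2_separation hne
          refine ⟨G.φ c ⁻¹' N, ?_, N', hN'.mem_nhds h2, ?_⟩
          · exact ((G.smooth c).continuousOn.continuousAt ((G.isOpen_D c).mem_nhds hxc))
              (hN.mem_nhds h1)
          · exact fun x' hx' _ _ _ h => Set.disjoint_left.1 hd hx' h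
        · obtain ⟨N, hN, N', hN', h⟩ := G.separated c x hx hxc y hy
          exact ⟨N, hN, N', hN', fun x' hx' _ _ hD => h x' hx' hD⟩
      · exact ⟨univ, univ_mem, univ, univ_mem, fun _ _ h1 h2 => absurd ⟨h1, h2⟩ hc⟩
    choose N hN N' hN' h using key
    refine ⟨⋂ c, N c, (iInter_mem).2 hN, ⋂ c, N' c, (iInter_mem).2 hN', ?_⟩
    rintro a ha b hb (⟨h', -⟩ | ⟨c, h1, h2, h3, h4⟩)
    · exact hij h'
    · exact h c a (mem_iInter.1 ha c) h1 h2 h3 (h4 ▸ mem_iInter.1 hb c)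

instance [SecondCountableTopology F] : SecondCountableTopology G.Space := by
  have : SecondCountableTopology E := G.e.toHomeomorph.secondCountableTopology
  refine ChartedSpace.secondCountable_of_countable_cover E (s := ⋃ i, {p | G.sheet p = i ∧
    ∃ h : ∃ q, G.sheet q = i, p = h.choose}) ?_ ?_
  · refine eq_univ_of_forall fun p => ?_
    have h : ∃ q, G.sheet q = G.sheet p := ⟨p, rfl⟩
    refine mem_biUnion (mem_iUnion.2 ⟨G.sheet p, h.choose_spec, h, rfl⟩) ?_
    rw [chartAt_eq, h.choose_spec]
    exact G.mem_range_sheet p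
  · refine countable_iUnion fun i => Set.Subsingleton.countable ?_
    rintro p ⟨-, h, rfl⟩ q ⟨-, h', rfl⟩
    rfl

end GlueData
end

/-! ### Maps between glued manifolds -/

noncomputable section

open Set Filter

namespace GlueData

variable {E F : Type} [NormedAddCommGroup E] [NormedSpace ℝ E]
  [NormedAddCommGroup F] [NormedSpace ℝ F] (G : GlueData E F)

/-- The coordinate of `p` in its preferred sheet. -/
def base (p : G.Space) : F := G.coord (G.sheet p) p

lemma base_mem (p : G.Space) : G.base p ∈ G.U (G.sheet p) := G.coord_mem (G.mem_range_sheet p)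

lemma pt_base (p : G.Space) : G.pt (G.sheet p) (G.base p) = p := G.pt_coord (G.mem_range_sheet p)

lemma extChartAt_symm_apply (p : G.Space) (y : E) :
    (extChartAt 𝓘(ℝ, E) p).symm y = G.pt (G.sheet p) (G.e y) := by
  simp [extChartAt, chartAt_eq, sheetChart]

lemma extChartAt_apply (p q : G.Space) :
    extChartAt 𝓘(ℝ, E) p q = G.e.symm (G.coord (G.sheet p) q) := by
  simp [extChartAt, chartAt_eq, sheetChart]

lemma extChartAt_target (p : G.Space) :
    (extChartAt 𝓘(ℝ, E) p).target = G.e ⁻¹' G.U (G.sheet p) := by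
  simp [extChartAt, chartAt_eq, sheetChart]

lemma extChartAt_source (p : G.Space) :
    (extChartAt 𝓘(ℝ, E) p).source = G.range (G.sheet p) := by
  simp [extChartAt, chartAt_eq, sheetChart]

lemma extChartAt_self (p : G.Space) : extChartAt 𝓘(ℝ, E) p p = G.e.symm (G.base p) :=
  G.extChartAt_apply p p

lemma coord_eventuallyEq {i : G.ι} {x : F} (hx : x ∈ G.U i) {P : F → Prop}
    (h : ∀ᶠ y in 𝓝 x, P y) : ∀ᶠ q in 𝓝 (G.pt i x), q ∈ G.range i ∧ P (G.coord i q) := by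
  obtain ⟨V, hVP, hV, hxV⟩ := mem_nhds_iff.1 h
  have := (G.isOpen_image_pt (hV.inter (G.isOpen_U i)) inter_subset_right).mem_nhds
    (mem_image_of_mem (G.pt i) ⟨hxV, hx⟩)
  filter_upwards [this]
  rintro _ ⟨y, ⟨hy, hy'⟩, rfl⟩
  exact ⟨G.pt_mem_range hy', by rw [G.coord_pt hy']; exact hVP hy⟩

/-- The derivative of the change of coordinates from the sheet `i` to the preferred sheet. -/
def toPref (i : G.ι) (x : F) : F →L[ℝ] F := fderiv ℝ (G.trans i (G.sheet (G.pt i x))) x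

/-- The derivative of the change to the preferred sheet is the identity or that of a gluing map. So
whatever is invariant under the gluing maps is preserved by `toPref`. -/
lemma toPref_cases {i : G.ι} {x : F} (hx : x ∈ G.U i) :
    (G.sheet (G.pt i x) = i ∧ G.base (G.pt i x) = x ∧ G.toPref i x = .id ℝ F) ∨
      ∃ c, G.src c = i ∧ G.tgt c = G.sheet (G.pt i x) ∧ x ∈ G.D c ∧
        G.base (G.pt i x) = G.φ c x ∧ G.toPref i x = fderiv ℝ (G.φ c) x := by
  rcases G.trans_cases hx (G.mem_range_sheet (G.pt i x)) with ⟨h, h'⟩ | ⟨c, h1, h2, h3, h'⟩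
  · exact .inl ⟨h.symm, h'.eq_of_nhds, by rw [toPref, h'.fderiv_eq, fderiv_id]⟩
  · exact .inr ⟨c, h1, h2, h3, h'.eq_of_nhds, by rw [toPref, h'.fderiv_eq]⟩

lemma contMDiffAt_coord {i : G.ι} {x : F} (hx : x ∈ G.U i) :
    ContMDiffAt 𝓘(ℝ, E) 𝓘(ℝ, F) ∞ (G.coord i) (G.pt i x) := by
  have h : ContMDiffOn 𝓘(ℝ, E) 𝓘(ℝ, E) ∞ (G.sheetChart i) (G.sheetChart i).source :=
    contMDiffOn_of_mem_maximalAtlas (IsManifold.subset_maximalAtlas (mem_range_self i))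
  have h' := h.contMDiffAt ((G.isOpen_range i).mem_nhds (G.pt_mem_range hx))
  have h2 := (G.e.contDiff (n := ∞)).contMDiff.contMDiffAt.comp _ h'
  refine h2.congr_of_eventuallyEq (.of_eq ?_)
  ext q
  simp [sheetChart]

lemma contMDiffAt_pt {i : G.ι} {x : F} (hx : x ∈ G.U i) :
    ContMDiffAt 𝓘(ℝ, F) 𝓘(ℝ, E) ∞ (G.pt i) x := by
  have h : ContMDiffOn 𝓘(ℝ, E) 𝓘(ℝ, E) ∞ (G.sheetChart i).symm (G.sheetChart i).target :=
    contMDiffOn_symm_of_mem_maximalAtlas (IsManifold.subset_maximalAtlas (mem_range_self i))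
  have hx' : G.e.symm x ∈ (G.sheetChart i).target := by
    change G.e (G.e.symm x) ∈ G.U i
    simpa using hx
  have h' := h.contMDiffAt ((G.sheetChart i).open_target.mem_nhds hx')
  have h2 := ContMDiffAt.comp x h' (G.e.symm.contDiff (n := ∞)).contMDiff.contMDiffAt
  refine h2.congr_of_eventuallyEq (.of_eq ?_)
  ext q
  simp [sheetChart]

/-- Smoothness of a map on the glued space is smoothness of its expressions on the sheets. -/
lemma contMDiffAt_of_comp_pt {E' : Type} [NormedAddCommGroup E'] [NormedSpace ℝ E'] {M : Type}
    [TopologicalSpace M] [ChartedSpace E' M] {H : G.Space → M} {i : G.ι} {x : F}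
    (hx : x ∈ G.U i) (h : ContMDiffAt 𝓘(ℝ, F) 𝓘(ℝ, E') ∞ (H ∘ G.pt i) x) :
    ContMDiffAt 𝓘(ℝ, E) 𝓘(ℝ, E') ∞ H (G.pt i x) := by
  have h1 : ContMDiffAt 𝓘(ℝ, F) 𝓘(ℝ, E') ∞ (H ∘ G.pt i) (G.coord i (G.pt i x)) := by
    rwa [G.coord_pt hx]
  refine (h1.comp _ (G.contMDiffAt_coord hx)).congr_of_eventuallyEq ?_
  filter_upwards [G.coord_eventuallyEq hx (P := fun _ => True) (.of_forall fun _ => trivial)]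
    with q hq
  simp [G.pt_coord hq.1]

lemma continuousAt_of_comp_pt {Z : Type*} [TopologicalSpace Z] {H : G.Space → Z} {i : G.ι} {x : F}
    (hx : x ∈ G.U i) (h : ContinuousAt (H ∘ G.pt i) x) : ContinuousAt H (G.pt i x) := by
  have h1 : ContinuousAt (H ∘ G.pt i) (G.coord i (G.pt i x)) := by rwa [G.coord_pt hx]
  refine (h1.comp (G.contMDiffAt_coord hx).continuousAt).congr ?_
  filter_upwards [G.coord_eventuallyEq hx (P := fun _ => True) (.of_forall fun _ => trivial)]
    with q hq
  simp [G.pt_coord hq.1]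

/-- The function on the glued space given by functions on the sheets. It is meant for families
which are compatible with the gluing maps. -/
def lift {Z : Type*} (h : G.ι → F → Z) (p : G.Space) : Z := h (G.sheet p) (G.base p)

lemma lift_pt {Z : Type*} {h : G.ι → F → Z}
    (hh : ∀ c, ∀ x ∈ G.D c, h (G.tgt c) (G.φ c x) = h (G.src c) x) {i : G.ι} {x : F}
    (hx : x ∈ G.U i) : G.lift h (G.pt i x) = h i x := by
  rw [lift]
  rcases G.toPref_cases hx with ⟨h1, h2, -⟩ | ⟨c, rfl, h2, h3, h4, -⟩
  · rw [h1, h2]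
  · rw [← h2, h4, hh c x h3]

/-- The derivative of a map from a vector space into the glued space. -/
lemma mfderiv_of_eventuallyEq_pt {E' : Type} [NormedAddCommGroup E'] [NormedSpace ℝ E']
    {K : E' → G.Space} {y : E'} {j : G.ι} {h : E' → F} (hy : h y ∈ G.U j)
    (hd : DifferentiableAt ℝ h y) (hK : K =ᶠ[𝓝 y] fun y' => G.pt j (h y')) :
    (mfderiv 𝓘(ℝ, E') 𝓘(ℝ, E) K y : E' →L[ℝ] E) =
      (G.e.symm : F →L[ℝ] E) ∘L (G.toPref j (h y)) ∘L (fderiv ℝ h y) := by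
  have h0 : K y = G.pt j (h y) := hK.eq_of_nhds
  have hcont : ContinuousAt K y := by
    refine ContinuousAt.congr ?_ hK.symm
    exact ((G.continuousOn_pt j).continuousAt ((G.isOpen_U j).mem_nhds hy)).comp
      hd.continuousAt
  have hw : writtenInExtChartAt 𝓘(ℝ, E') 𝓘(ℝ, E) y K =ᶠ[𝓝 y]
      fun y' => G.e.symm (G.trans j (G.sheet (G.pt j (h y))) (h y')) := by
    filter_upwards [hK] with y' hy'
    simp only [writtenInExtChartAt, extChartAt_model_space_eq_id, PartialEquiv.refl_symm,
      PartialEquiv.refl_coe, Function.comp_apply, id]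
    rw [hy', h0, extChartAt_apply, trans]
  have hd2 : HasFDerivAt (fun y' => G.e.symm (G.trans j (G.sheet (G.pt j (h y))) (h y')))
      ((G.e.symm : F →L[ℝ] E) ∘L (G.toPref j (h y)) ∘L (fderiv ℝ h y)) y := by
    have h1 : HasFDerivAt (G.trans j (G.sheet (G.pt j (h y)))) (G.toPref j (h y)) (h y) :=
      ((G.contDiffAt_trans hy (G.mem_range_sheet _)).differentiableAt (by simp)).hasFDerivAt
    exact G.e.symm.hasFDerivAt.comp y (h1.comp y hd.hasFDerivAt)
  have hM : HasMFDerivAt 𝓘(ℝ, E') 𝓘(ℝ, E) K y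
      ((G.e.symm : F →L[ℝ] E) ∘L (G.toPref j (h y)) ∘L (fderiv ℝ h y)) := by
    refine ⟨hcont, ?_⟩
    have := hd2.congr_of_eventuallyEq hw
    exact this.hasFDerivWithinAt
  exact hM.mfderiv

lemma mfderiv_extChartAt_symm (p : G.Space) {y : E} (hy : G.e y ∈ G.U (G.sheet p)) :
    (mfderiv 𝓘(ℝ, E) 𝓘(ℝ, E) (extChartAt 𝓘(ℝ, E) p).symm y : E →L[ℝ] E) =
      (G.e.symm : F →L[ℝ] E) ∘L (G.toPref (G.sheet p) (G.e y)) ∘L (G.e : E →L[ℝ] F) := by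
  have h := G.mfderiv_of_eventuallyEq_pt (K := (extChartAt 𝓘(ℝ, E) p).symm) (y := y)
    (j := G.sheet p) (h := G.e) hy G.e.differentiableAt
    (.of_forall fun y' => G.extChartAt_symm_apply p y')
  rw [h, G.e.fderiv]

/-- The derivative, in preferred coordinates, of a map between glued spaces. -/
lemma mfderiv_of_eventuallyEq {E' F' : Type} [NormedAddCommGroup E'] [NormedSpace ℝ E']
    [NormedAddCommGroup F'] [NormedSpace ℝ F'] (G' : GlueData E' F') {H : G'.Space → G.Space}
    {p : G'.Space} {j : G.ι} {h : F' → F} (hy : h (G'.base p) ∈ G.U j)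
    (hd : DifferentiableAt ℝ h (G'.base p))
    (hH : ∀ᶠ x in 𝓝 (G'.base p), H (G'.pt (G'.sheet p) x) = G.pt j (h x)) :
    (mfderiv 𝓘(ℝ, E') 𝓘(ℝ, E) H p : E' →L[ℝ] E) =
      (G.e.symm : F →L[ℝ] E) ∘L (G.toPref j (h (G'.base p))) ∘L (fderiv ℝ h (G'.base p)) ∘L
        (G'.e : E' →L[ℝ] F') := by
  have hp : H p = G.pt j (h (G'.base p)) := by
    have := hH.self_of_nhds
    rwa [G'.pt_base] at this
  have hcont : ContinuousAt H p := by
    have : ContinuousAt H (G'.pt (G'.sheet p) (G'.base p)) := by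
      refine G'.continuousAt_of_comp_pt (G'.base_mem p) ?_
      refine ContinuousAt.congr ?_ (hH.mono fun x hx => hx.symm)
      exact ((G.continuousOn_pt j).continuousAt ((G.isOpen_U j).mem_nhds hy)).comp
        hd.continuousAt
    rwa [G'.pt_base] at this
  have he : Tendsto G'.e (𝓝 (extChartAt 𝓘(ℝ, E') p p)) (𝓝 (G'.base p)) := by
    rw [extChartAt_self]
    have := G'.e.continuous.continuousAt (x := G'.e.symm (G'.base p))
    rwa [ContinuousAt, G'.e.apply_symm_apply] at this
  have hw : writtenInExtChartAt 𝓘(ℝ, E') 𝓘(ℝ, E) p H =ᶠ[𝓝 (extChartAt 𝓘(ℝ, E') p p)]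
      fun y' => G.e.symm (G.trans j (G.sheet (G.pt j (h (G'.base p)))) (h (G'.e y'))) := by
    filter_upwards [he.eventually hH] with y' hy'
    simp only [writtenInExtChartAt, Function.comp_apply]
    rw [extChartAt_symm_apply, hy', hp, extChartAt_apply, trans]
  have hd2 : HasFDerivAt
      (fun y' => G.e.symm (G.trans j (G.sheet (G.pt j (h (G'.base p)))) (h (G'.e y'))))
      ((G.e.symm : F →L[ℝ] E) ∘L (G.toPref j (h (G'.base p))) ∘L (fderiv ℝ h (G'.base p)) ∘L
        (G'.e : E' →L[ℝ] F')) (extChartAt 𝓘(ℝ, E') p p) := by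
    have h1 : HasFDerivAt (G.trans j (G.sheet (G.pt j (h (G'.base p)))))
        (G.toPref j (h (G'.base p))) (h (G'.base p)) :=
      ((G.contDiffAt_trans hy (G.mem_range_sheet _)).differentiableAt (by simp)).hasFDerivAt
    have h2 := h1.comp _ hd.hasFDerivAt
    rw [extChartAt_self]
    have h3 : G'.e (G'.e.symm (G'.base p)) = G'.base p := G'.e.apply_symm_apply _
    rw [← h3] at h2
    have h4 := G.e.symm.hasFDerivAt.comp _ (h2.comp _ G'.e.hasFDerivAt)
    rw [h3] at h4
    exact h4
  have hM : HasMFDerivAt 𝓘(ℝ, E') 𝓘(ℝ, E) H p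
      ((G.e.symm : F →L[ℝ] E) ∘L (G.toPref j (h (G'.base p))) ∘L (fderiv ℝ h (G'.base p)) ∘L
        (G'.e : E' →L[ℝ] F')) := by
    refine ⟨hcont, ?_⟩
    have := hd2.congr_of_eventuallyEq hw
    exact this.hasFDerivWithinAt
  exact hM.mfderiv

/-- The derivative, in preferred coordinates, of a real function on a glued space. -/
lemma mfderiv_real {f : G.Space → ℝ} {p : G.Space} {h : F → ℝ}
    (hd : DifferentiableAt ℝ h (G.base p))
    (hf : ∀ᶠ x in 𝓝 (G.base p), f (G.pt (G.sheet p) x) = h x) :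
    (mfderiv 𝓘(ℝ, E) 𝓘(ℝ, ℝ) f p : E →L[ℝ] ℝ) = (fderiv ℝ h (G.base p)) ∘L (G.e : E →L[ℝ] F) := by
  have hcont : ContinuousAt f p := by
    have : ContinuousAt f (G.pt (G.sheet p) (G.base p)) := by
      refine G.continuousAt_of_comp_pt (G.base_mem p) ?_
      exact ContinuousAt.congr hd.continuousAt (hf.mono fun x hx => hx.symm)
    rwa [G.pt_base] at this
  have he : Tendsto G.e (𝓝 (extChartAt 𝓘(ℝ, E) p p)) (𝓝 (G.base p)) := by
    rw [extChartAt_self]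
    have := G.e.continuous.continuousAt (x := G.e.symm (G.base p))
    rwa [ContinuousAt, G.e.apply_symm_apply] at this
  have hw : writtenInExtChartAt 𝓘(ℝ, E) 𝓘(ℝ, ℝ) p f =ᶠ[𝓝 (extChartAt 𝓘(ℝ, E) p p)]
      fun y' => h (G.e y') := by
    filter_upwards [he.eventually hf] with y' hy'
    simp only [writtenInExtChartAt, Function.comp_apply, extChartAt_model_space_eq_id,
      PartialEquiv.refl_coe, id]
    rw [extChartAt_symm_apply, hy']
  have hd2 : HasFDerivAt (fun y' => h (G.e y'))
      ((fderiv ℝ h (G.base p)) ∘L (G.e : E →L[ℝ] F)) (extChartAt 𝓘(ℝ, E) p p) := by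
    have h2 := hd.hasFDerivAt
    rw [extChartAt_self]
    have h3 : G.e (G.e.symm (G.base p)) = G.base p := G.e.apply_symm_apply _
    rw [← h3] at h2
    have h4 := h2.comp _ G.e.hasFDerivAt
    rw [h3] at h4
    exact h4
  have hM : HasMFDerivAt 𝓘(ℝ, E) 𝓘(ℝ, ℝ) f p
      ((fderiv ℝ h (G.base p)) ∘L (G.e : E →L[ℝ] F)) := by
    refine ⟨hcont, ?_⟩
    have := hd2.congr_of_eventuallyEq hw
    exact this.hasFDerivWithinAt
  exact hM.mfderiv

end GlueData
end

/-! ### Forms and vector fields on glued manifolds -/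

noncomputable section

open Set Filter

section BilinearForms

variable {E F : Type} [NormedAddCommGroup E] [NormedSpace ℝ E]
  [NormedAddCommGroup F] [NormedSpace ℝ F]

/-- The alternating 2-form on `E` which corresponds to an alternating bilinear form on `F` under a
linear equivalence. -/
def altForm (e : E ≃L[ℝ] F) (B : F →L[ℝ] F →L[ℝ] ℝ) (hB : ∀ u, B u u = 0) :
    E [⋀^Fin 2]→L[ℝ] ℝ where
  toFun v := B (e (v 0)) (e (v 1))
  map_update_add' v i x y := by
    fin_cases i <;> simp
  map_update_smul' v i c x := by
    fin_cases i <;> simp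
  map_eq_zero_of_eq' v i j h hij := by
    have : v 0 = v 1 := by
      fin_cases i <;> fin_cases j <;> simp_all
    rw [this, hB]
  cont := by fun_prop

lemma altForm_apply (e : E ≃L[ℝ] F) (B : F →L[ℝ] F →L[ℝ] ℝ) (hB : ∀ u, B u u = 0)
    (v : Fin 2 → E) : altForm e B hB v = B (e (v 0)) (e (v 1)) := rfl

lemma swap_of_alternating {B : F →L[ℝ] F →L[ℝ] ℝ} (hB : ∀ u, B u u = 0) (a b : F) :
    B a b = -B b a := by
  have h := hB (a + b)
  simp only [map_add, add_apply, hB] at h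
  linarith

/-- The exterior derivative of `ι_u B` for a constant form `B`. -/
lemma extDeriv_curryLeft (e : E ≃L[ℝ] F) {B : F →L[ℝ] F →L[ℝ] ℝ} (hB : ∀ u, B u u = 0)
    {u : E → E} {x : E} (hu : DifferentiableAt ℝ u x) (v : Fin 2 → E) :
    extDeriv (fun y => ContinuousAlternatingMap.curryLeft (altForm e B hB) (u y)) x v =
      B (e (fderiv ℝ u x (v 0))) (e (v 1)) + B (e (v 0)) (e (fderiv ℝ u x (v 1))) := by
  have h1 : HasFDerivAt (fun y => ContinuousAlternatingMap.curryLeft (altForm e B hB) (u y))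
      ((ContinuousAlternatingMap.curryLeft (altForm e B hB)) ∘L fderiv ℝ u x) x :=
    (ContinuousAlternatingMap.curryLeft (altForm e B hB)).hasFDerivAt.comp x hu.hasFDerivAt
  rw [extDeriv, h1.fderiv, ContinuousAlternatingMap.alternatizeUncurryFin_apply,
    Fin.sum_univ_two, swap_of_alternating hB (e (v 0))]
  simp [altForm_apply, Fin.removeNth]
  rfl

end BilinearForms

namespace GlueData

variable {d : ℕ} {F : Type} [NormedAddCommGroup F] [NormedSpace ℝ F]
  (G : GlueData (EuclideanSpace ℝ (Fin d)) F)

/-- The form `B` is invariant under the gluing maps. -/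
def Preserves (B : F →L[ℝ] F →L[ℝ] ℝ) : Prop :=
  ∀ c, ∀ x ∈ G.D c, ∀ a b, B (fderiv ℝ (G.φ c) x a) (fderiv ℝ (G.φ c) x b) = B a b

/-- The 2-form on the glued space which is the constant form `B` in each sheet. -/
def form (B : F →L[ℝ] F →L[ℝ] ℝ) (hB : ∀ u, B u u = 0) : DiffForm d G.Space 2 :=
  fun _ => altForm G.e B hB

variable {B : F →L[ℝ] F →L[ℝ] ℝ} {hB : ∀ u, B u u = 0}

variable {G} in
/-- A form which is invariant under the gluing maps has the same expression in all sheets. -/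
lemma Preserves.toPref (hG : G.Preserves B) {i : G.ι} {x : F} (hx : x ∈ G.U i) (a b : F) :
    B (G.toPref i x a) (G.toPref i x b) = B a b := by
  rcases G.toPref_cases hx with ⟨-, -, h⟩ | ⟨c, -, -, h3, -, h⟩
  · rw [h]; rfl
  · rw [h, hG c x h3]

/-- In the preferred chart at a point, the form of the glued space is constant near this point. -/
lemma form_inChart (hG : G.Preserves B) (p : G.Space) {y : EuclideanSpace ℝ (Fin d)}
    (hy : G.e y ∈ G.U (G.sheet p)) : (G.form B hB).inChart p y = altForm G.e B hB := by
  ext v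
  have h := G.mfderiv_extChartAt_symm p hy
  change B (G.e ((mfderiv 𝓘(ℝ, EuclideanSpace ℝ (Fin d)) 𝓘(ℝ, EuclideanSpace ℝ (Fin d))
      (extChartAt 𝓘(ℝ, EuclideanSpace ℝ (Fin d)) p).symm y :
        EuclideanSpace ℝ (Fin d) →L[ℝ] EuclideanSpace ℝ (Fin d)) (v 0)))
    (G.e ((mfderiv 𝓘(ℝ, EuclideanSpace ℝ (Fin d)) 𝓘(ℝ, EuclideanSpace ℝ (Fin d))
      (extChartAt 𝓘(ℝ, EuclideanSpace ℝ (Fin d)) p).symm y :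
        EuclideanSpace ℝ (Fin d) →L[ℝ] EuclideanSpace ℝ (Fin d)) (v 1))) = B _ _
  rw [h]
  have key : ∀ a : EuclideanSpace ℝ (Fin d), G.e (((G.e.symm : F →L[ℝ] EuclideanSpace ℝ (Fin d)) ∘L
      (G.toPref (G.sheet p) (G.e y)) ∘L (G.e : EuclideanSpace ℝ (Fin d) →L[ℝ] F)) a) =
      G.toPref (G.sheet p) (G.e y) (G.e a) := fun a => G.e.apply_symm_apply _
  exact (congrArg₂ (fun a b => B a b) (key _) (key _)).trans (hG.toPref hy _ _)

lemma eventually_e_mem (p : G.Space) {N : Set F} (hN : N ∈ 𝓝 (G.base p)) :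
    ∀ᶠ y in 𝓝 (extChartAt 𝓘(ℝ, EuclideanSpace ℝ (Fin d)) p p), G.e y ∈ N := by
  refine G.e.continuous.continuousAt.eventually ?_
  rw [extChartAt_self, G.e.apply_symm_apply]
  exact hN

lemma mfderiv_extChartAt_self (p : G.Space) :
    (mfderiv 𝓘(ℝ, EuclideanSpace ℝ (Fin d)) 𝓘(ℝ, EuclideanSpace ℝ (Fin d))
      (extChartAt 𝓘(ℝ, EuclideanSpace ℝ (Fin d)) p) p :
        EuclideanSpace ℝ (Fin d) →L[ℝ] EuclideanSpace ℝ (Fin d)) = .id ℝ _ := by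
  have h := mfderiv_chartAt_eq_tangentCoordChange (I := 𝓘(ℝ, EuclideanSpace ℝ (Fin d)))
    (x := p) (y := p) (mem_chart_source _ p)
  refine ContinuousLinearMap.ext fun v => ?_
  have h2 := tangentCoordChange_self (I := 𝓘(ℝ, EuclideanSpace ℝ (Fin d))) (x := p) (z := p)
    (v := v) (mem_extChartAt_source p)
  rw [← h] at h2
  exact h2

/-- The form of the glued space is closed, as it is constant in suitable charts. -/
theorem isSymplectic_form (hG : G.Preserves B) (hnd : ∀ u, (∀ w, B u w = 0) → u = 0) :
    (G.form B hB).IsSymplectic where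
  smooth p := by
    refine (contDiffOn_const (c := altForm G.e B hB)).congr fun y hy => ?_
    refine G.form_inChart hG p ?_
    have := hy.1
    rwa [extChartAt_target] at this
  closed p := by
    have h : (G.form B hB).inChart p =ᶠ[𝓝 (extChartAt 𝓘(ℝ, EuclideanSpace ℝ (Fin d)) p p)]
        fun _ => altForm G.e B hB := by
      filter_upwards [G.eventually_e_mem p ((G.isOpen_U _).mem_nhds (G.base_mem p))] with y hy
      exact G.form_inChart hG p hy
    have h2 : extDeriv ((G.form B hB).inChart p)
        (extChartAt 𝓘(ℝ, EuclideanSpace ℝ (Fin d)) p p) = 0 := by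
      rw [h.extDeriv_eq, extDeriv, fderiv_fun_const]
      ext v
      simp [ContinuousAlternatingMap.alternatizeUncurryFin_apply]
    rw [DiffForm.extD, h2]
    rfl
  nondegenerate p u hu := by
    have h : G.e u = 0 := hnd _ fun w => by
      have h : B (G.e u) (G.e (G.e.symm w)) = 0 := hu (G.e.symm w)
      rwa [G.e.apply_symm_apply] at h
    exact G.e.map_eq_zero_iff.1 h

/-- The vector field on the glued space with components `v i` in the sheets. -/
def field (v : G.ι → F → F) : VecField d G.Space :=
  fun p => G.e.symm (v (G.sheet p) (G.base p))

/-- The family `v` of vector fields on the sheets is invariant under the gluing maps, away from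
the sets `S i`. -/
def Equivariant (S : G.ι → Set F) (v : G.ι → F → F) : Prop :=
  ∀ c, ∀ x ∈ G.D c, x ∈ S (G.src c) → fderiv ℝ (G.φ c) x (v (G.src c) x) = v (G.tgt c) (G.φ c x)

variable {G} in
lemma Equivariant.toPref {S : G.ι → Set F} {v : G.ι → F → F} (hv : G.Equivariant S v) {i : G.ι}
    {x : F} (hx : x ∈ G.U i) (hxS : x ∈ S i) :
    G.toPref i x (v i x) = v (G.sheet (G.pt i x)) (G.base (G.pt i x)) := by
  rcases G.toPref_cases hx with ⟨h1, h2, h⟩ | ⟨c, rfl, h2, h3, h4, h⟩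
  · rw [h, h1, h2]; rfl
  · rw [h, ← h2, h4, hv c x h3 hxS]

/-- The charts at different points may belong to different sheets; equivariance takes care of the
change of trivialization of the tangent bundle. -/
lemma field_smoothOn {S : G.ι → Set F} {v : G.ι → F → F} (hv : G.Equivariant S v)
    (hS : ∀ c, ∀ x ∈ G.D c, x ∈ S (G.src c) ↔ G.φ c x ∈ S (G.tgt c))
    (hSo : ∀ i, IsOpen (S i))
    (hvs : ∀ i, ∀ x ∈ G.U i, x ∈ S i → ContDiffAt ℝ ∞ (v i) x) :
    (G.field v).SmoothOn {p | G.lift (fun i x => x ∈ S i) p} := by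
  intro p hp
  refine ContMDiffAt.contMDiffWithinAt ?_
  rw [Bundle.contMDiffAt_section]
  have hS' : ∀ i, ∀ x ∈ G.U i, G.lift (fun i x => x ∈ S i) (G.pt i x) ↔ x ∈ S i :=
    fun i x hx => by
      rw [G.lift_pt (h := fun i x => x ∈ S i) (fun c x hx => propext (hS c x hx).symm) hx]
  have hb : G.base p ∈ S (G.sheet p) := hp
  have hsm : ContMDiffAt 𝓘(ℝ, EuclideanSpace ℝ (Fin d)) 𝓘(ℝ, EuclideanSpace ℝ (Fin d)) ∞
      (fun q => G.e.symm (v (G.sheet p) (G.coord (G.sheet p) q)))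
      (G.pt (G.sheet p) (G.base p)) := by
    refine G.contMDiffAt_of_comp_pt (G.base_mem p) ?_
    refine ContDiffAt.contMDiffAt ?_
    refine (G.e.symm.contDiff.contDiffAt.comp _
      (hvs _ _ (G.base_mem p) hb)).congr_of_eventuallyEq ?_
    filter_upwards [(G.isOpen_U _).mem_nhds (G.base_mem p)] with x hx
    simp [G.coord_pt hx]
  rw [G.pt_base] at hsm
  refine hsm.congr_of_eventuallyEq ?_
  have hev := G.coord_eventuallyEq (G.base_mem p) ((hSo _).mem_nhds hb)
  rw [G.pt_base] at hev
  filter_upwards [hev] with q hq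
  rw [TangentBundle.trivializationAt_apply]
  obtain ⟨hq1, hq2⟩ := hq
  have hq3 : G.lift (fun i x => x ∈ S i) q := by
    rw [← G.pt_coord hq1]
    exact (hS' _ _ (G.coord_mem hq1)).2 hq2
  have hq4 : G.base q ∈ S (G.sheet q) := hq3
  have hsrc : q ∈ (extChartAt 𝓘(ℝ, EuclideanSpace ℝ (Fin d)) q).source ∩
      (extChartAt 𝓘(ℝ, EuclideanSpace ℝ (Fin d)) p).source := by
    rw [G.extChartAt_source, G.extChartAt_source]
    exact ⟨G.mem_range_sheet q, hq1⟩
  have h1 := hasFDerivWithinAt_tangentCoordChange hsrc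
  -- The coordinate change of the tangent bundle is inverse to `toPref`.
  have hsrc' : q ∈ (extChartAt 𝓘(ℝ, EuclideanSpace ℝ (Fin d)) p).source ∩
      (extChartAt 𝓘(ℝ, EuclideanSpace ℝ (Fin d)) q).source := ⟨hsrc.2, hsrc.1⟩
  have h2 := hasFDerivWithinAt_tangentCoordChange hsrc'
  have h3 : tangentCoordChange 𝓘(ℝ, EuclideanSpace ℝ (Fin d)) p q q
      (G.e.symm (v (G.sheet p) (G.coord (G.sheet p) q))) = G.field v q := by
    have hf : HasFDerivAt (fun y => G.e.symm (G.trans (G.sheet p) (G.sheet q) (G.e y)))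
        ((G.e.symm : F →L[ℝ] EuclideanSpace ℝ (Fin d)) ∘L
          (G.toPref (G.sheet p) (G.coord (G.sheet p) q)) ∘L
          (G.e : EuclideanSpace ℝ (Fin d) →L[ℝ] F)) (G.e.symm (G.coord (G.sheet p) q)) := by
      have h1 : HasFDerivAt (G.trans (G.sheet p) (G.sheet q))
          (G.toPref (G.sheet p) (G.coord (G.sheet p) q)) (G.coord (G.sheet p) q) := by
        have := ((G.contDiffAt_trans (G.coord_mem hq1)
          (G.mem_range_sheet _)).differentiableAt (by simp)).hasFDerivAt
        rwa [← toPref, G.pt_coord hq1] at this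
      have h3 : G.e (G.e.symm (G.coord (G.sheet p) q)) = G.coord (G.sheet p) q :=
        G.e.apply_symm_apply _
      rw [← h3] at h1
      have h4 := G.e.symm.hasFDerivAt.comp _ (h1.comp _ G.e.hasFDerivAt)
      rw [h3] at h4
      exact h4
    have hf2 := h2
    rw [G.extChartAt_apply] at hf2
    have heq : (extChartAt 𝓘(ℝ, EuclideanSpace ℝ (Fin d)) q ∘
        (extChartAt 𝓘(ℝ, EuclideanSpace ℝ (Fin d)) p).symm) =
        fun y => G.e.symm (G.trans (G.sheet p) (G.sheet q) (G.e y)) := by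
      ext1 y
      rw [Function.comp_apply, G.extChartAt_symm_apply, G.extChartAt_apply, trans]
    rw [heq] at hf2
    have huniq : tangentCoordChange 𝓘(ℝ, EuclideanSpace ℝ (Fin d)) p q q = _ :=
      (hf2.hasFDerivAt (by simp)).unique hf
    rw [huniq]
    have h5 := hv.toPref (G.coord_mem hq1) hq2
    rw [G.pt_coord hq1] at h5
    simp [h5, field]
  have h4 := tangentCoordChange_comp (I := 𝓘(ℝ, EuclideanSpace ℝ (Fin d))) (w := p) (x := q)
    (y := p) (z := q) (v := G.e.symm (v (G.sheet p) (G.coord (G.sheet p) q)))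
    ⟨hsrc', hsrc.2⟩
  rw [h3, tangentCoordChange_self hsrc.2] at h4
  exact h4

/-- By Cartan's formula, and since the form is constant in charts, the Liouville condition is the
algebraic condition `hdiv` on the derivative of the field in each sheet. -/
theorem isLiouvilleOn_field (hG : G.Preserves B) {S : G.ι → Set F} {v : G.ι → F → F}
    (hv : G.Equivariant S v)
    (hS : ∀ c, ∀ x ∈ G.D c, x ∈ S (G.src c) ↔ G.φ c x ∈ S (G.tgt c))
    (hSo : ∀ i, IsOpen (S i))
    (hvs : ∀ i, ∀ x ∈ G.U i, x ∈ S i → ContDiffAt ℝ ∞ (v i) x)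
    (hdiv : ∀ i, ∀ x ∈ G.U i, x ∈ S i → ∀ a b,
      B (fderiv ℝ (v i) x a) b + B a (fderiv ℝ (v i) x b) = B a b) :
    (G.field v).IsLiouvilleOn (G.form B hB) {p | G.lift (fun i x => x ∈ S i) p} := by
  refine ⟨G.field_smoothOn hv hS hSo hvs, fun p hp => ?_⟩
  have hb : G.base p ∈ S (G.sheet p) := hp
  have hloc : ((G.form B hB).contract (G.field v)).inChart p
      =ᶠ[𝓝 (extChartAt 𝓘(ℝ, EuclideanSpace ℝ (Fin d)) p p)]
      fun y => ContinuousAlternatingMap.curryLeft (altForm G.e B hB)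
        (G.e.symm (v (G.sheet p) (G.e y))) := by
    filter_upwards [G.eventually_e_mem p ((G.isOpen_U _).mem_nhds (G.base_mem p)),
      G.eventually_e_mem p ((hSo _).mem_nhds hb)] with y hy hyS
    ext w
    have h := G.mfderiv_extChartAt_symm p hy
    change B (G.e (G.field v ((extChartAt 𝓘(ℝ, EuclideanSpace ℝ (Fin d)) p).symm y)))
      (G.e ((mfderiv 𝓘(ℝ, EuclideanSpace ℝ (Fin d)) 𝓘(ℝ, EuclideanSpace ℝ (Fin d))
        (extChartAt 𝓘(ℝ, EuclideanSpace ℝ (Fin d)) p).symm y :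
          EuclideanSpace ℝ (Fin d) →L[ℝ] EuclideanSpace ℝ (Fin d)) (w 0))) =
      B (G.e (G.e.symm (v (G.sheet p) (G.e y)))) (G.e (w 0))
    rw [h, G.extChartAt_symm_apply, field, ← hv.toPref hy hyS]
    have key : ∀ a : EuclideanSpace ℝ (Fin d),
        G.e (((G.e.symm : F →L[ℝ] EuclideanSpace ℝ (Fin d)) ∘L
        (G.toPref (G.sheet p) (G.e y)) ∘L (G.e : EuclideanSpace ℝ (Fin d) →L[ℝ] F)) a) =
        G.toPref (G.sheet p) (G.e y) (G.e a) := fun a => G.e.apply_symm_apply _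
    rw [G.e.apply_symm_apply, G.e.apply_symm_apply]
    exact (congrArg _ (key _)).trans (hG.toPref hy _ _)
  have hd : HasFDerivAt (fun y => G.e.symm (v (G.sheet p) (G.e y)))
      ((G.e.symm : F →L[ℝ] EuclideanSpace ℝ (Fin d)) ∘L (fderiv ℝ (v (G.sheet p)) (G.base p)) ∘L
          (G.e : EuclideanSpace ℝ (Fin d) →L[ℝ] F)) (G.e.symm (G.base p)) := by
    have h1 := ((hvs _ _ (G.base_mem p) hb).differentiableAt (by simp)).hasFDerivAt
    have h3 : G.e (G.e.symm (G.base p)) = G.base p := G.e.apply_symm_apply _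
    rw [← h3] at h1
    have h4 := G.e.symm.hasFDerivAt.comp _ (h1.comp _ G.e.hasFDerivAt)
    rw [h3] at h4
    exact h4
  have hext : ∀ w : Fin 2 → EuclideanSpace ℝ (Fin d),
      extDeriv (((G.form B hB).contract (G.field v)).inChart p)
      (extChartAt 𝓘(ℝ, EuclideanSpace ℝ (Fin d)) p p) w = altForm G.e B hB w := by
    intro w
    rw [hloc.extDeriv_eq, G.extChartAt_self]
    refine (extDeriv_curryLeft G.e hB hd.differentiableAt w).trans ?_
    rw [hd.fderiv]
    have h := hdiv _ _ (G.base_mem p) hb (G.e (w 0)) (G.e (w 1))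
    simp only [ContinuousLinearMap.comp_apply, ContinuousLinearEquiv.coe_coe,
      G.e.apply_symm_apply]
    exact h
  ext w
  have hM := G.mfderiv_extChartAt_self p
  change extDeriv (((G.form B hB).contract (G.field v)).inChart p)
      (extChartAt 𝓘(ℝ, EuclideanSpace ℝ (Fin d)) p p) (fun i =>
        (mfderiv 𝓘(ℝ, EuclideanSpace ℝ (Fin d)) 𝓘(ℝ, EuclideanSpace ℝ (Fin d))
        (extChartAt 𝓘(ℝ, EuclideanSpace ℝ (Fin d)) p) p) (w i)) = altForm G.e B hB w
  rw [hM]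
  exact hext w

end GlueData
end

/-! ### Toric symplectic maps of `ℂ × ℂ` -/

noncomputable section

open Set Filter ComplexConjugate

/-- The standard area form of the plane. -/
def areaForm : ℂ →L[ℝ] ℂ →L[ℝ] ℝ :=
  (ContinuousLinearMap.compL ℝ ℂ ℂ ℝ Complex.imCLM) ∘L (ContinuousLinearMap.mul ℝ ℂ) ∘L
    (Complex.conjCLE : ℂ →L[ℝ] ℂ)

lemma areaForm_apply (a b : ℂ) : areaForm a b = (conj a * b).im := rfl

lemma areaForm_apply' (a b : ℂ) : areaForm a b = a.re * b.im - a.im * b.re := by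
  simp [areaForm_apply]; ring

lemma areaForm_self (a : ℂ) : areaForm a a = 0 := by rw [areaForm_apply']; ring

lemma areaForm_mul (k a b : ℂ) : areaForm (k * a) (k * b) = ‖k‖ ^ 2 * areaForm a b := by
  rw [← Complex.normSq_eq_norm_sq, Complex.normSq_apply]
  simp only [areaForm_apply', Complex.mul_re, Complex.mul_im]
  ring

lemma eq_zero_of_areaForm {a : ℂ} (h : ∀ b, areaForm a b = 0) : a = 0 := by
  have h1 := h 1
  have h2 := h Complex.I
  simp only [areaForm_apply', Complex.one_re, Complex.one_im, Complex.I_re, Complex.I_im] at h1 h2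
  apply Complex.ext <;> simp <;> linarith

/-- The standard symplectic form of `ℂ × ℂ`. -/
def sympForm : ℂ × ℂ →L[ℝ] ℂ × ℂ →L[ℝ] ℝ :=
  areaForm.bilinearComp (.fst ℝ ℂ ℂ) (.fst ℝ ℂ ℂ) + areaForm.bilinearComp (.snd ℝ ℂ ℂ) (.snd ℝ ℂ ℂ)

lemma sympForm_apply (a b : ℂ × ℂ) : sympForm a b = areaForm a.1 b.1 + areaForm a.2 b.2 := rfl

lemma sympForm_self (a : ℂ × ℂ) : sympForm a a = 0 := by
  simp [sympForm_apply, areaForm_self]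

lemma eq_zero_of_sympForm {a : ℂ × ℂ} (h : ∀ b, sympForm a b = 0) : a = 0 := by
  refine Prod.ext (eq_zero_of_areaForm fun b => ?_) (eq_zero_of_areaForm fun b => ?_)
  · simpa [sympForm_apply] using h (b, 0)
  · simpa [sympForm_apply] using h (0, b)

/-- The square of the distance of the image point from the centre under `toricMap`. -/
def toricSq (c : ℂ) (r : ℝ) (m : ℕ) (x : ℂ × ℂ) : ℝ :=
  2 * r ^ 2 + m * ‖x.2‖ ^ 2 - ‖x.1 - c‖ ^ 2

/-- In symplectic polar coordinates `p = |w - c|² / 2`, `θ`, `P = |ζ|² / 2`, `ψ` of `ℂ × ℂ` this is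
the toric map `(p, θ, P, ψ) ↦ (r² - p + m P, -θ, P, ψ + m θ)`: it turns an annulus around the
circle of radius `r` inside out, and twists the second factor `m` times. -/
def toricMap (c : ℂ) (r : ℝ) (m : ℕ) (x : ℂ × ℂ) : ℂ × ℂ :=
  (c + conj (x.1 - c) * (√(toricSq c r m x) / ‖x.1 - c‖ : ℝ),
    x.2 * ((x.1 - c) / (‖x.1 - c‖ : ℝ)) ^ m)

/-- A function which vanishes on the hypersurface that `toricMap` reflects. -/
def toricGap (c : ℂ) (r : ℝ) (m : ℕ) (x : ℂ × ℂ) : ℝ :=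
  ‖x.1 - c‖ ^ 2 - r ^ 2 - m * ‖x.2‖ ^ 2 / 2

section ToricMap

variable {c : ℂ} {r : ℝ} {m : ℕ} {x : ℂ × ℂ}

lemma norm_toricMap_fst (hx : x.1 ≠ c) (hN : 0 < toricSq c r m x) :
    ‖(toricMap c r m x).1 - c‖ = √(toricSq c r m x) := by
  have h : 0 < ‖x.1 - c‖ := norm_pos_iff.2 (sub_ne_zero.2 hx)
  rw [toricMap]
  simp only [add_sub_cancel_left, norm_mul, RCLike.norm_conj, Complex.norm_real, norm_div,
    norm_norm]
  rw [Real.norm_of_nonneg (Real.sqrt_nonneg _)]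
  field_simp

lemma norm_toricMap_snd (hx : x.1 ≠ c) : ‖(toricMap c r m x).2‖ = ‖x.2‖ := by
  have h : 0 < ‖x.1 - c‖ := norm_pos_iff.2 (sub_ne_zero.2 hx)
  simp [toricMap, div_self h.ne']

lemma toricGap_toricMap (hx : x.1 ≠ c) (hN : 0 < toricSq c r m x) :
    toricGap c r m (toricMap c r m x) = -toricGap c r m x := by
  rw [toricGap, norm_toricMap_fst hx hN, norm_toricMap_snd hx, Real.sq_sqrt hN.le, toricSq,
    toricGap]
  ring

lemma toricSq_toricMap (hx : x.1 ≠ c) (hN : 0 < toricSq c r m x) :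
    toricSq c r m (toricMap c r m x) = ‖x.1 - c‖ ^ 2 := by
  rw [toricSq, norm_toricMap_fst hx hN, norm_toricMap_snd hx, Real.sq_sqrt hN.le, toricSq]
  ring

/-- `toricMap` is an involution. -/
lemma toricMap_toricMap (hx : x.1 ≠ c) (hN : 0 < toricSq c r m x) :
    toricMap c r m (toricMap c r m x) = x := by
  have h : 0 < ‖x.1 - c‖ := norm_pos_iff.2 (sub_ne_zero.2 hx)
  have hs : 0 < √(toricSq c r m x) := Real.sqrt_pos.2 hN
  have hC : ((‖x.1 - c‖ : ℝ) : ℂ) ≠ 0 := by exact_mod_cast h.ne'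
  have hsC : ((√(toricSq c r m x) : ℝ) : ℂ) ≠ 0 := by exact_mod_cast hs.ne'
  have h1 : (toricMap c r m x).1 - c =
      conj (x.1 - c) * (√(toricSq c r m x) / ‖x.1 - c‖ : ℝ) := by simp [toricMap]
  have h2 : (toricMap c r m x).2 = x.2 * ((x.1 - c) / (‖x.1 - c‖ : ℝ)) ^ m := rfl
  refine Prod.ext ?_ ?_
  · rw [toricMap, toricSq_toricMap hx hN, norm_toricMap_fst hx hN, h1, Real.sqrt_sq h.le]
    simp only [map_mul, Complex.conj_conj, Complex.conj_ofReal]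
    rw [Complex.ofReal_div, Complex.ofReal_div]
    field_simp
    ring
  · rw [toricMap, norm_toricMap_fst hx hN, h1, h2]
    simp only []
    rw [mul_assoc, ← mul_pow]
    have h3 : (x.1 - c) / (‖x.1 - c‖ : ℝ) * (conj (x.1 - c) *
        (√(toricSq c r m x) / ‖x.1 - c‖ : ℝ) / (√(toricSq c r m x) : ℝ)) = 1 := by
      have h4 : (x.1 - c) * conj (x.1 - c) = (‖x.1 - c‖ : ℂ) ^ 2 := Complex.mul_conj' _
      rw [Complex.ofReal_div]
      field_simp
      exact h4
    rw [h3, one_pow, mul_one]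

lemma contDiffAt_toricMap (hx : x.1 ≠ c) (hN : 0 < toricSq c r m x) :
    ContDiffAt ℝ ∞ (toricMap c r m) x := by
  have h1 : ContDiffAt ℝ ∞ (fun x : ℂ × ℂ => x.1 - c) x := contDiffAt_fst.sub contDiffAt_const
  have h2 : ContDiffAt ℝ ∞ (fun x : ℂ × ℂ => ‖x.1 - c‖) x := h1.norm ℝ (sub_ne_zero.2 hx)
  have h3 : ContDiffAt ℝ ∞ (toricSq c r m) x :=
    (contDiffAt_const.add (contDiffAt_const.mul (contDiffAt_snd.norm_sq ℝ))).sub (h1.norm_sq ℝ)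
  have h4 : ‖x.1 - c‖ ≠ 0 := norm_ne_zero_iff.2 (sub_ne_zero.2 hx)
  have h5 : ContDiffAt ℝ ∞ (fun x : ℂ × ℂ => ((√(toricSq c r m x) / ‖x.1 - c‖ : ℝ) : ℂ)) x :=
    Complex.ofRealCLM.contDiff.contDiffAt.comp x ((h3.sqrt hN.ne').div h2 h4)
  have h6 : ContDiffAt ℝ ∞ (fun x : ℂ × ℂ => conj (x.1 - c)) x :=
    Complex.conjCLE.contDiff.contDiffAt.comp x h1
  have h7 : ContDiffAt ℝ ∞ (fun x : ℂ × ℂ => (((‖x.1 - c‖ : ℝ) : ℂ))) x :=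
    Complex.ofRealCLM.contDiff.contDiffAt.comp x h2
  have h8 := (contDiffAt_const (c := c)).add (h6.mul h5) |>.prodMk
    (contDiffAt_snd.mul ((h1.mul (h7.inv (by exact_mod_cast h4))).pow m))
  exact h8

lemma hasDerivAt_norm_one_add (a : ℂ) : HasDerivAt (fun t : ℝ => ‖1 + t * a‖) a.re 0 := by
  have h1 : ∀ t : ℝ, ‖1 + t * a‖ = √(1 + (2 * a.re) * t + ‖a‖ ^ 2 * t ^ 2) := by
    intro t
    rw [Complex.norm_def, ← Complex.normSq_eq_norm_sq]
    congr 1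
    simp [Complex.normSq_apply]
    ring
  have h2 : HasDerivAt (fun t : ℝ => 1 + (2 * a.re) * t + ‖a‖ ^ 2 * t ^ 2) (2 * a.re) 0 := by
    have h := (((hasDerivAt_id (0 : ℝ)).const_mul (2 * a.re)).const_add 1).add
      (((hasDerivAt_id (0 : ℝ)).pow 2).const_mul (‖a‖ ^ 2))
    simp at h
    exact h
  have h3 := h2.sqrt (by simp)
  simp only [funext h1]
  convert h3 using 1
  simp

lemma hasDerivAt_norm_sq_add (z b : ℂ) :
    HasDerivAt (fun t : ℝ => ‖z + t * b‖ ^ 2) (2 * (conj z * b).re) 0 := by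
  have h1 : ∀ t : ℝ, ‖z + t * b‖ ^ 2 = ‖z‖ ^ 2 + (2 * (conj z * b).re) * t + ‖b‖ ^ 2 * t ^ 2 := by
    intro t
    simp only [← Complex.normSq_eq_norm_sq]
    simp [Complex.normSq_apply]
    ring
  have h := (((hasDerivAt_id (0 : ℝ)).const_mul (2 * (conj z * b).re)).const_add (‖z‖ ^ 2)).add
      (((hasDerivAt_id (0 : ℝ)).pow 2).const_mul (‖b‖ ^ 2))
  simp only [funext h1]
  simp at h ⊢
  exact h

/-- The derivative of `toricMap`, in directions written as `((w - c) a, b)`. -/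
lemma fderiv_toricMap (hx : x.1 ≠ c) (hN : 0 < toricSq c r m x) (a b : ℂ) :
    fderiv ℝ (toricMap c r m) x ((x.1 - c) * a, b) =
      (conj (x.1 - c) / (‖x.1 - c‖ : ℝ) * ⟨(m * (conj x.2 * b).re - ‖x.1 - c‖ ^ 2 * a.re) /
        √(toricSq c r m x), -(a.im * √(toricSq c r m x))⟩,
       ((x.1 - c) / (‖x.1 - c‖ : ℝ)) ^ m * (b + m * x.2 * (Complex.I * a.im))) := by
  set u := x.1 - c with hu
  have hpos : 0 < ‖u‖ := norm_pos_iff.2 (sub_ne_zero.2 hx)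
  have hC : ((‖u‖ : ℝ) : ℂ) ≠ 0 := by exact_mod_cast hpos.ne'
  have hs : 0 < √(toricSq c r m x) := Real.sqrt_pos.2 hN
  have hd := ((contDiffAt_toricMap hx hN).differentiableAt (by simp)).hasFDerivAt
  have hline : HasDerivAt (fun t : ℝ => x + t • (u * a, b)) (u * a, b) 0 := by
    simpa using ((hasDerivAt_id (0 : ℝ)).smul_const (u * a, b)).const_add x
  have hx0 : x = x + (0 : ℝ) • (u * a, b) := by simp
  have h1 := HasFDerivAt.comp_hasDerivAt (0 : ℝ) (hx0 ▸ hd) hline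
  rw [← hx0] at h1
  refine h1.unique ?_
  -- Along the line `t ↦ x + t (u a, b)`, the first component minus `c` is `u (1 + t a)`.
  set q : ℝ → ℝ := fun t => ‖1 + t * a‖ with hq
  have hq0 : q 0 = 1 := by simp [hq]
  have hq' : HasDerivAt q a.re 0 := hasDerivAt_norm_one_add a
  have hU : ∀ t : ℝ, (x + t • (u * a, b)).1 - c = u * (1 + t * a) := fun t => by
    simp [hu]; ring
  have hnU : ∀ t : ℝ, ‖(x + t • (u * a, b)).1 - c‖ = ‖u‖ * q t := fun t => by
    rw [hU, norm_mul]
  have hZ : ∀ t : ℝ, (x + t • (u * a, b)).2 = x.2 + t * b := fun t => by simp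
  have hNt : HasDerivAt (fun t : ℝ => toricSq c r m (x + t • (u * a, b)))
      (2 * (m * (conj x.2 * b).re - ‖u‖ ^ 2 * a.re)) 0 := by
    have h2 : ∀ t : ℝ, toricSq c r m (x + t • (u * a, b)) =
        2 * r ^ 2 + m * ‖x.2 + t * b‖ ^ 2 - (‖u‖ * q t) ^ 2 := fun t => by
      rw [toricSq, hnU, hZ]
    have h3 := (((hasDerivAt_norm_sq_add x.2 b).const_mul (m : ℝ)).const_add (2 * r ^ 2)).sub
      ((hq'.const_mul ‖u‖).pow 2)
    simp only [funext h2]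
    refine HasDerivAt.congr_deriv h3 ?_
    rw [hq0]; simp; ring
  have hN0 : toricSq c r m (x + (0 : ℝ) • (u * a, b)) = toricSq c r m x := by rw [← hx0]
  have hst := hNt.sqrt (by rw [hN0]; exact hN.ne')
  rw [hN0] at hst
  have hlin : HasDerivAt (fun t : ℝ => (1 + t * a : ℂ)) a 0 := by
    simpa using ((Complex.ofRealCLM.hasDerivAt (x := (0 : ℝ))).mul_const a).const_add 1
  have hlinc : HasDerivAt (fun t : ℝ => (1 + t * conj a : ℂ)) (conj a) 0 := by
    simpa using ((Complex.ofRealCLM.hasDerivAt (x := (0 : ℝ))).mul_const (conj a)).const_add 1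
  have hlinb : HasDerivAt (fun t : ℝ => (x.2 + t * b : ℂ)) b 0 := by
    simpa using ((Complex.ofRealCLM.hasDerivAt (x := (0 : ℝ))).mul_const b).const_add x.2
  refine HasDerivAt.prodMk ?_ ?_
  · have h2 := (hst.div (hq'.const_mul ‖u‖) (by rw [hq0]; simpa using hpos.ne')).ofReal_comp
    have h3 := ((hlinc.const_mul (conj u)).mul h2).const_add c
    refine (h3.congr_of_eventuallyEq (.of_forall fun t => ?_)).congr_deriv ?_
    · change c + conj ((x + t • (u * a, b)).1 - c) *
        (√(toricSq c r m (x + t • (u * a, b))) / ‖(x + t • (u * a, b)).1 - c‖ : ℝ) = _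
      rw [hnU, hU]
      simp
    · simp only [Pi.div_apply, hq0, Complex.ofReal_zero, zero_mul, add_zero, mul_one, zero_smul]
      have e1 : (⟨(m * (conj x.2 * b).re - ‖u‖ ^ 2 * a.re) /
        √(toricSq c r m x), -(a.im * √(toricSq c r m x))⟩ : ℂ) =
        (((m * (conj x.2 * b).re - ‖u‖ ^ 2 * a.re) / √(toricSq c r m x) : ℝ) : ℂ) -
          (a.im * √(toricSq c r m x) : ℝ) * Complex.I := by
        apply Complex.ext <;> simp only [Complex.sub_re, Complex.sub_im, Complex.mul_re,
          Complex.mul_im, Complex.ofReal_re, Complex.ofReal_im, Complex.I_re, Complex.I_im] <;> ring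
      have e2 : conj a = (a.re : ℂ) - a.im * Complex.I := by apply Complex.ext <;> simp
      rw [e1, e2]
      push_cast
      have hsC : ((√(toricSq c r m x) : ℝ) : ℂ) ≠ 0 := by exact_mod_cast hs.ne'
      have hsC2 : ((√(toricSq c r m x) : ℝ) : ℂ) ^ 2 = (toricSq c r m x : ℂ) := by
        rw [← Complex.ofReal_pow, Real.sq_sqrt hN.le]
      field_simp
      ring
  · have h2 := hq'.ofReal_comp
    have h3 := ((hlin.const_mul (u / (‖u‖ : ℝ))).div h2
      (by rw [hq0]; simp)).pow m
    have h4 := hlinb.mul h3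
    refine (h4.congr_of_eventuallyEq (.of_forall fun t => ?_)).congr_deriv ?_
    · change (x + t • (u * a, b)).2 *
        (((x + t • (u * a, b)).1 - c) / (‖(x + t • (u * a, b)).1 - c‖ : ℝ)) ^ m = _
      rw [hnU, hU, hZ]
      simp only [Pi.mul_apply, Pi.pow_apply, Pi.div_apply]
      congr 2
      push_cast
      ring
    · have e2 : a = (a.re : ℂ) + a.im * Complex.I := (Complex.re_add_im a).symm
      simp only [Pi.pow_apply, Pi.div_apply, hq0, Complex.ofReal_zero, zero_mul, add_zero, mul_one,
        Complex.ofReal_one, div_one, one_pow]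
      rcases Nat.eq_zero_or_pos m with rfl | hm
      · simp
      · obtain ⟨k, rfl⟩ : ∃ k, m = k + 1 := ⟨m - 1, by omega⟩
        have e3 : a - (a.re : ℂ) = Complex.I * a.im := by
          nth_rewrite 1 [e2]; ring
        have e4 : (u / (‖u‖ : ℝ)) * a - u / (‖u‖ : ℝ) * (a.re : ℂ) =
          u / (‖u‖ : ℝ) * (Complex.I * a.im) := by rw [← e3]; ring
        rw [e4]
        simp only [Nat.add_sub_cancel]
        push_cast
        ring

/-- `toricMap` preserves the standard symplectic form. -/
lemma sympForm_fderiv_toricMap (hx : x.1 ≠ c) (hN : 0 < toricSq c r m x) (v w : ℂ × ℂ) :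
    sympForm (fderiv ℝ (toricMap c r m) x v) (fderiv ℝ (toricMap c r m) x w) = sympForm v w := by
  have hu : x.1 - c ≠ 0 := sub_ne_zero.2 hx
  have hpos : 0 < ‖x.1 - c‖ := norm_pos_iff.2 hu
  have hs : 0 < √(toricSq c r m x) := Real.sqrt_pos.2 hN
  obtain ⟨v1, b⟩ := v
  obtain ⟨w1, b'⟩ := w
  obtain ⟨a, rfl⟩ : ∃ a, v1 = (x.1 - c) * a := ⟨v1 / (x.1 - c), by field_simp⟩
  obtain ⟨a', rfl⟩ : ∃ a, w1 = (x.1 - c) * a := ⟨w1 / (x.1 - c), by field_simp⟩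
  rw [fderiv_toricMap hx hN, fderiv_toricMap hx hN]
  simp only [sympForm_apply, areaForm_mul]
  have h1 : ‖conj (x.1 - c) / (‖x.1 - c‖ : ℝ)‖ = 1 := by
    rw [norm_div, RCLike.norm_conj, Complex.norm_real, norm_norm, div_self hpos.ne']
  have h2 : ‖((x.1 - c) / (‖x.1 - c‖ : ℝ)) ^ m‖ = 1 := by simp [div_self hpos.ne']
  rw [h1, h2]
  simp only [areaForm_apply', one_pow, one_mul, Complex.add_re, Complex.add_im, Complex.mul_re,
    Complex.mul_im, Complex.I_re, Complex.I_im, Complex.ofReal_re, Complex.ofReal_im,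
    Complex.conj_re, Complex.conj_im, Complex.natCast_re, Complex.natCast_im]
  field_simp
  ring

/-- `toricMap` carries a radial vector field of the form `(p + ρ) ∂_p + (P + z) ∂_P` to a field of
the same form. -/
lemma fderiv_toricMap_radial (hx : x.1 ≠ c) (hN : 0 < toricSq c r m x) (hx2 : x.2 ≠ 0)
    {ρ ρ' z : ℝ} (hρ : ρ + ρ' = m * z - r ^ 2) :
    fderiv ℝ (toricMap c r m) x ((1 / 2 + ρ / ‖x.1 - c‖ ^ 2 : ℝ) * (x.1 - c),
        (1 / 2 + z / ‖x.2‖ ^ 2 : ℝ) * x.2) =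
      ((1 / 2 + ρ' / ‖(toricMap c r m x).1 - c‖ ^ 2 : ℝ) * ((toricMap c r m x).1 - c),
        (1 / 2 + z / ‖(toricMap c r m x).2‖ ^ 2 : ℝ) * (toricMap c r m x).2) := by
  have hu : x.1 - c ≠ 0 := sub_ne_zero.2 hx
  have hpos : 0 < ‖x.1 - c‖ := norm_pos_iff.2 hu
  have hpos2 : 0 < ‖x.2‖ := norm_pos_iff.2 hx2
  have hs : 0 < √(toricSq c r m x) := Real.sqrt_pos.2 hN
  rw [norm_toricMap_fst hx hN, norm_toricMap_snd hx, mul_comm _ (x.1 - c), fderiv_toricMap hx hN]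
  have h1 : (toricMap c r m x).1 - c =
      conj (x.1 - c) * (√(toricSq c r m x) / ‖x.1 - c‖ : ℝ) := by simp [toricMap]
  have h2 : (toricMap c r m x).2 = x.2 * ((x.1 - c) / (‖x.1 - c‖ : ℝ)) ^ m := rfl
  refine Prod.ext ?_ ?_
  · rw [h1]
    have h3 : (conj x.2 * ((1 / 2 + z / ‖x.2‖ ^ 2 : ℝ) * x.2)).re = ‖x.2‖ ^ 2 / 2 + z := by
      have : conj x.2 * ((1 / 2 + z / ‖x.2‖ ^ 2 : ℝ) * x.2) =
          ((1 / 2 + z / ‖x.2‖ ^ 2 : ℝ) * ‖x.2‖ ^ 2 : ℝ) := by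
        rw [mul_left_comm, Complex.conj_mul']; push_cast; rfl
      rw [this, Complex.ofReal_re]
      field_simp
    have h4 : (⟨(m * (conj x.2 * ((1 / 2 + z / ‖x.2‖ ^ 2 : ℝ) * x.2)).re -
        ‖x.1 - c‖ ^ 2 * ((1 / 2 + ρ / ‖x.1 - c‖ ^ 2 : ℝ) : ℂ).re) / √(toricSq c r m x),
        -(((1 / 2 + ρ / ‖x.1 - c‖ ^ 2 : ℝ) : ℂ).im * √(toricSq c r m x))⟩ : ℂ) =
        ((1 / 2 + ρ' / √(toricSq c r m x) ^ 2) * √(toricSq c r m x) : ℝ) := by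
      rw [h3]
      apply Complex.ext
      · simp only [Complex.ofReal_re]
        have h5 : √(toricSq c r m x) ^ 2 = toricSq c r m x := Real.sq_sqrt hN.le
        field_simp
        rw [h5, toricSq]
        linear_combination (-2) * hρ
      · simp only [Complex.ofReal_im]
        ring
    simp only []
    rw [h4]
    push_cast
    ring
  · rw [h2]
    simp only [Complex.ofReal_im]
    push_cast
    ring

end ToricMap
end

/-! ### The plumbing as a glued manifold -/

noncomputable section

open Set Filter ComplexConjugate

/-- A criterion for the separation axiom of gluing data. -/
lemma separated_of_continuous {F : Type} [TopologicalSpace F] {D U : Set F} {φ : F → F}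
    {a b : F → ℝ} (ha : Continuous a) (hb : Continuous b) {t : ℝ} (hU : ∀ y ∈ U, b y < t)
    (hab : ∀ x ∈ D, b (φ x) = a x) {x y : F} (hx : t ≤ a x) (hy : y ∈ U) :
    ∃ N ∈ 𝓝 x, ∃ N' ∈ 𝓝 y, ∀ x' ∈ N, x' ∈ D → φ x' ∉ N' := by
  have h := hU y hy
  refine ⟨{x' | (b y + t) / 2 < a x'}, (isOpen_lt continuous_const ha).mem_nhds ?_,
    {y' | b y' < (b y + t) / 2}, (isOpen_lt hb continuous_const).mem_nhds ?_, ?_⟩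
  · change (b y + t) / 2 < a x
    linarith
  · change b y < (b y + t) / 2
    linarith
  · intro x' hx' hD h'
    have h'' : b (φ x') < (b y + t) / 2 := h'
    rw [hab x' hD] at h''
    exact lt_asymm h'' hx'

/-- The numbers needed to build the symplectic plumbing of a graph: for each vertex `i` the radius
`R i` of a disc with `genus i` holes of radius `ρ i` and with marked points, all at distance
at least `d i` from each other, the width `δ i` of the collars, the number `tw i` of twists of
the normal bundle along the outer boundary, the residue `z i`; finally the radius `ε` of the
fibres. -/
structure PlumbingModel {n : ℕ} (Γ : PlumbingGraph n) where
  R : Fin n → ℝ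
  ρ : Fin n → ℝ
  d : Fin n → ℝ
  δ : Fin n → ℝ
  z : Fin n → ℝ
  ε : ℝ
  tw : Fin n → ℕ
  d_pos : ∀ i, 0 < d i
  d_le : ∀ i, d i ≤ 1
  ρ_pos : ∀ i, 0 < ρ i
  ρ_le : ∀ i, 8 * ρ i ≤ d i
  δ_pos : ∀ i, 0 < δ i
  δ_le : ∀ i, 2 * δ i ≤ ρ i ^ 2
  R_ge : ∀ i, 2 * (d i * (Γ.genus i + ∑ j, Γ.edges i j + 2)) ≤ R i
  ε_pos : 0 < ε
  ε_le : ∀ i, 8 * ε ≤ d i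
  z_pos : ∀ i, 0 < z i
  tw_eq : ∀ i, (tw i : ℤ) = -Γ.selfInt i
  R_sq : ∀ i, R i ^ 2 = Γ.area i / (2 * Real.pi) + Γ.genus i * ρ i ^ 2
  flux : ∀ i, tw i * z i - ∑ j, Γ.edges i j * z j = Γ.area i / (2 * Real.pi)

namespace PlumbingModel

variable {n : ℕ} {Γ : PlumbingGraph n}

/-- The vector `z` of the hypothesis supplies the residues: the `i`-th equation of the linear system
is the field `flux`. -/
theorem nonempty (Γ : PlumbingGraph n) (hz : ∃ z : Fin n → ℝ, (∀ i, 0 < z i) ∧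
      -(Γ.intersectionMatrix.mulVec z) = (1 / (2 * Real.pi)) • Γ.area) :
    Nonempty (PlumbingModel Γ) := by
  obtain ⟨z, hz, h⟩ := hz
  have hrow : ∀ i, -(Γ.selfInt i : ℝ) * z i - ∑ j, Γ.edges i j * z j =
      Γ.area i / (2 * Real.pi) := by
    intro i
    have h1 := congrFun h i
    simp only [Pi.neg_apply, Matrix.mulVec, dotProduct, Pi.smul_apply, smul_eq_mul,
      PlumbingGraph.intersectionMatrix, Matrix.of_apply] at h1
    have h2 : ∀ j, (if i = j then (Γ.selfInt i : ℝ) else (Γ.edges i j : ℝ)) * z j =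
        (if i = j then (Γ.selfInt i : ℝ) * z j else 0) + Γ.edges i j * z j := by
      intro j
      split_ifs with hij
      · subst hij; simp [Γ.edges_self]
      · simp
    simp only [h2, Finset.sum_add_distrib, Finset.sum_ite_eq, Finset.mem_univ, if_true] at h1
    rw [div_eq_inv_mul, ← one_div, ← h1]
    ring
  have hA : ∀ i, 0 < Γ.area i / (2 * Real.pi) := fun i =>
    div_pos (Γ.area_pos i) Real.two_pi_pos
  -- The equation forces the self-intersections to be negative.
  have hs : ∀ i, 0 ≤ -Γ.selfInt i := by
    intro i
    by_contra hneg
    push Not at hneg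
    have h1 : (0 : ℝ) < Γ.selfInt i := by exact_mod_cast (by omega : 0 < Γ.selfInt i)
    have h2 : 0 ≤ ∑ j, (Γ.edges i j : ℝ) * z j :=
      Finset.sum_nonneg fun j _ => mul_nonneg (Nat.cast_nonneg _) (hz j).le
    nlinarith [hrow i, hA i, mul_pos h1 (hz i)]
  -- At most `T i` positions have to fit into a radius of the disc.
  set T : Fin n → ℝ := fun i => Γ.genus i + ∑ j, Γ.edges i j + 2 with hT
  have hT0 : ∀ i, 0 < T i := fun i => by positivity
  set d : Fin n → ℝ := fun i => min 1 (√(Γ.area i / (2 * Real.pi)) / (2 * T i)) with hd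
  have hd0 : ∀ i, 0 < d i := fun i =>
    lt_min one_pos (div_pos (Real.sqrt_pos.2 (hA i)) (mul_pos two_pos (hT0 i)))
  obtain ⟨ε, hε, hεd⟩ : ∃ ε : ℝ, 0 < ε ∧ ∀ i, 8 * ε ≤ d i := by
    have h1 : ∀ᶠ ε : ℝ in 𝓝[>] 0, ∀ i, 8 * ε ≤ d i := by
      rw [eventually_all]
      intro i
      have h2 : ∀ᶠ ε : ℝ in 𝓝 0, 8 * ε < d i :=
        (continuous_const.mul continuous_id).continuousAt.eventually_lt
          continuousAt_const (by simpa using hd0 i)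
      exact (h2.filter_mono nhdsWithin_le_nhds).mono fun _ h => h.le
    obtain ⟨ε, h2, h3⟩ := (h1.and self_mem_nhdsWithin).exists
    exact ⟨ε, h3, h2⟩
  have hR : ∀ i, 0 ≤ Γ.area i / (2 * Real.pi) + Γ.genus i * (d i / 8) ^ 2 := fun i =>
    add_nonneg (hA i).le (by positivity)
  refine ⟨{ R := fun i => √(Γ.area i / (2 * Real.pi) + Γ.genus i * (d i / 8) ^ 2)
            ρ := fun i => d i / 8
            d := d
            δ := fun i => (d i / 8) ^ 2 / 2
            z := z
            ε := ε
            tw := fun i => (-Γ.selfInt i).toNat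
            d_pos := hd0
            d_le := fun i => min_le_left _ _
            ρ_pos := fun i => by have := hd0 i; positivity
            ρ_le := fun i => by linarith
            δ_pos := fun i => by have := hd0 i; positivity
            δ_le := fun i => by linarith
            R_ge := fun i => ?_
            ε_pos := hε
            ε_le := hεd
            z_pos := hz
            tw_eq := fun i => Int.toNat_of_nonneg (hs i)
            R_sq := fun i => Real.sq_sqrt (hR i)
            flux := fun i => ?_ }⟩
  · have h1 : d i ≤ √(Γ.area i / (2 * Real.pi)) / (2 * T i) := min_le_right _ _
    rw [le_div_iff₀ (mul_pos two_pos (hT0 i))] at h1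
    calc 2 * (d i * T i) = d i * (2 * T i) := by ring
      _ ≤ _ := h1
      _ ≤ _ := Real.sqrt_le_sqrt (le_add_of_nonneg_right (by positivity))
  · rw [← hrow i]
    congr 2
    have := Int.toNat_of_nonneg (hs i)
    exact_mod_cast congrArg (Int.cast : ℤ → ℝ) this

variable (M : PlumbingModel Γ)

/-- The `k`-th marked position in the disc of the vertex `i`. Position `0` is not used, the
positions `1, …, genus i` are the centres of the holes, the following ones are those of the
plumbing points. -/
def pos (i : Fin n) (k : ℕ) : ℂ := ((M.d i * k : ℝ) : ℂ)

/-- The number of the position of a plumbing point. -/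
def plumbIdx (i : Fin n) (e : Σ j, Fin (Γ.edges i j)) : ℕ :=
  Γ.genus i + 1 + finSigmaFinEquiv e

/-- The plumbing points in the disc of the vertex `i`, one for each edge at `i`. -/
def plumb (i : Fin n) (e : Σ j, Fin (Γ.edges i j)) : ℂ := M.pos i (plumbIdx i e)

/-- The centre of a boundary circle of the disc with holes: `none` stands for the outer one. -/
def ctr (i : Fin n) (b : Option (Fin (Γ.genus i))) : ℂ := b.elim 0 fun k => M.pos i (k + 1)

/-- The radius of a boundary circle. -/
def rad (i : Fin n) (b : Option (Fin (Γ.genus i))) : ℝ := b.elim (M.R i) fun _ => M.ρ i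

/-- The twist of the normal bundle along a boundary circle. -/
def twist (i : Fin n) (b : Option (Fin (Γ.genus i))) : ℕ := b.elim (M.tw i) fun _ => 0

/-- `1` for the outer boundary circle, `-1` for the inner ones. -/
def sgn {i : Fin n} (b : Option (Fin (Γ.genus i))) : ℝ := b.elim 1 fun _ => -1

/-- A function on `ℂ × ℂ` which is negative inside of the boundary `b`, zero on it, and positive
outside. -/
def gap (i : Fin n) (b : Option (Fin (Γ.genus i))) (x : ℂ × ℂ) : ℝ :=
  sgn b * toricGap (M.ctr i b) (M.rad i b) (M.twist i b) x

/-- The sheets, which are disc bundles over open neighborhoods of a disc with holes. -/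
def sheetSet (i : Fin n) : Set (ℂ × ℂ) := {x | ‖x.2‖ < M.ε ∧ ∀ b, M.gap i b x < M.δ i}

variable {M} {i : Fin n}

lemma R_pos : 0 < M.R i := lt_of_lt_of_le (by have := M.d_pos i; positivity) (M.R_ge i)

lemma d_le_R : 4 * M.d i ≤ M.R i := by
  refine le_trans ?_ (M.R_ge i)
  have := M.d_pos i
  have h1 : (0 : ℝ) ≤ (Γ.genus i + ∑ j, Γ.edges i j : ℝ) := by positivity
  nlinarith

lemma δ_lt_rad (b : Option (Fin (Γ.genus i))) : M.δ i < M.rad i b ^ 2 := by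
  have h1 := M.δ_le i
  have h2 := M.δ_pos i
  have h3 := M.ρ_pos i
  have h4 := M.ρ_le i
  have h5 := d_le_R (M := M) (i := i)
  cases b with
  | none =>
    change _ < M.R i ^ 2
    nlinarith [R_pos (M := M) (i := i)]
  | some k =>
    change _ < M.ρ i ^ 2
    linarith

lemma norm_pos_le {k : ℕ} (hk : k ≤ Γ.genus i + ∑ j, Γ.edges i j) :
    ‖M.pos i k‖ + 2 * M.d i ≤ M.R i / 2 := by
  have h1 := M.R_ge i
  have h2 := M.d_pos i
  have h3 : (k : ℝ) ≤ Γ.genus i + ∑ j, Γ.edges i j := by exact_mod_cast hk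
  rw [pos, Complex.norm_real, Real.norm_of_nonneg (by positivity)]
  nlinarith [mul_le_mul_of_nonneg_left h3 h2.le]

lemma le_norm_pos_sub {k l : ℕ} (h : k ≠ l) : M.d i ≤ ‖M.pos i k - M.pos i l‖ := by
  have h2 := M.d_pos i
  rw [pos, pos, ← Complex.ofReal_sub, Complex.norm_real, ← mul_sub, norm_mul,
    Real.norm_of_nonneg h2.le]
  have : (1 : ℝ) ≤ ‖(k : ℝ) - l‖ := by
    have : (1 : ℤ) ≤ |(k : ℤ) - l| := Int.one_le_abs (sub_ne_zero.2 (by exact_mod_cast h))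
    rw [Real.norm_eq_abs]
    exact_mod_cast this
  nlinarith

lemma plumbIdx_le (e : Σ j, Fin (Γ.edges i j)) :
    plumbIdx i e ≤ Γ.genus i + ∑ j, Γ.edges i j := by
  have := (finSigmaFinEquiv e).2
  unfold plumbIdx
  omega

lemma plumbIdx_injective : Function.Injective (plumbIdx (Γ := Γ) i) := by
  intro e e' h
  refine finSigmaFinEquiv.injective (Fin.ext ?_)
  unfold plumbIdx at h
  omega

/-- Near a position which is not the centre of a hole, one is well inside of all boundaries. -/
lemma gap_le_of_near_pos {k : ℕ} (hk : k ≤ Γ.genus i + ∑ j, Γ.edges i j)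
    (hk' : ∀ l : Fin (Γ.genus i), (l : ℕ) + 1 ≠ k) {x : ℂ × ℂ}
    (hx : ‖x.1 - M.pos i k‖ ≤ M.d i / 4) (b : Option (Fin (Γ.genus i))) :
    M.gap i b x ≤ -M.δ i := by
  have h1 := M.δ_le i
  have h2 := M.δ_pos i
  have h3 := M.ρ_pos i
  have h4 := M.ρ_le i
  have h5 := d_le_R (M := M) (i := i)
  have h6 := M.d_pos i
  cases b with
  | none =>
    change 1 * (‖x.1 - 0‖ ^ 2 - M.R i ^ 2 - M.tw i * ‖x.2‖ ^ 2 / 2) ≤ _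
    have h7 : ‖x.1 - 0‖ ≤ M.R i / 2 := by
      have : x.1 - 0 = (x.1 - M.pos i k) + M.pos i k := by ring
      rw [this]
      linarith [norm_add_le (x.1 - M.pos i k) (M.pos i k), norm_pos_le (M := M) hk]
    have h8 : (0 : ℝ) ≤ M.tw i * ‖x.2‖ ^ 2 / 2 := by positivity
    have h9 : M.δ i ≤ M.R i ^ 2 / 4 := by nlinarith
    nlinarith [norm_nonneg (x.1 - 0)]
  | some l =>
    change -1 * (‖x.1 - M.pos i (l + 1)‖ ^ 2 - M.ρ i ^ 2 - (0 : ℕ) * ‖x.2‖ ^ 2 / 2) ≤ _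
    have h7 : 3 * M.d i / 4 ≤ ‖x.1 - M.pos i (l + 1)‖ := by
      have h8 := le_norm_pos_sub (M := M) (i := i) (hk' l)
      have : M.pos i (l + 1) - M.pos i k = (x.1 - M.pos i k) - (x.1 - M.pos i (l + 1)) := by ring
      rw [this] at h8
      linarith [norm_sub_le (x.1 - M.pos i k) (x.1 - M.pos i (l + 1))]
    push_cast
    nlinarith

/-- Near one boundary, one is well inside of the others. -/
lemma gap_le_of_near {b b' : Option (Fin (Γ.genus i))} (hb : b ≠ b') {x : ℂ × ℂ}
    (hx : |M.gap i b x| < M.δ i) : M.gap i b' x ≤ -M.δ i := by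
  have h1 := M.δ_le i
  have h2 := M.δ_pos i
  have h3 := M.ρ_pos i
  have h4 := M.ρ_le i
  have h5 := d_le_R (M := M) (i := i)
  have h6 := M.d_pos i
  cases b with
  | none =>
    change |1 * (‖x.1 - 0‖ ^ 2 - M.R i ^ 2 - M.tw i * ‖x.2‖ ^ 2 / 2)| < _ at hx
    have h8 : (0 : ℝ) ≤ M.tw i * ‖x.2‖ ^ 2 / 2 := by positivity
    have h9 := (abs_lt.1 hx).1
    have h10 : 3 * M.R i / 4 ≤ ‖x.1‖ := by
      rw [sub_zero] at h9
      by_contra hcon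
      push Not at hcon
      have h9 : M.δ i ≤ M.R i ^ 2 / 4 := by nlinarith
      nlinarith [norm_nonneg x.1]
    cases b' with
    | none => exact absurd rfl hb
    | some l =>
      change -1 * (‖x.1 - M.pos i (l + 1)‖ ^ 2 - M.ρ i ^ 2 - (0 : ℕ) * ‖x.2‖ ^ 2 / 2) ≤ _
      have h11 := norm_pos_le (M := M) (i := i) (k := l + 1) (by have := l.2; omega)
      have h12 : M.R i / 4 ≤ ‖x.1 - M.pos i (l + 1)‖ := by
        linarith [norm_sub_norm_le x.1 (M.pos i (l + 1))]
      push_cast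
      nlinarith
  | some k =>
    change |-1 * (‖x.1 - M.pos i (k + 1)‖ ^ 2 - M.ρ i ^ 2 - (0 : ℕ) * ‖x.2‖ ^ 2 / 2)| < _ at hx
    have h9 := (abs_lt.1 hx).1
    push_cast at h9
    have h10 : ‖x.1 - M.pos i (k + 1)‖ ≤ M.d i / 4 := by
      by_contra hcon
      push Not at hcon
      nlinarith
    cases b' with
    | none =>
      change 1 * (‖x.1 - 0‖ ^ 2 - M.R i ^ 2 - M.tw i * ‖x.2‖ ^ 2 / 2) ≤ _
      have h7 : ‖x.1 - 0‖ ≤ M.R i / 2 := by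
        have : x.1 - 0 = (x.1 - M.pos i (k + 1)) + M.pos i (k + 1) := by ring
        rw [this]
        linarith [norm_add_le (x.1 - M.pos i (k + 1)) (M.pos i (k + 1)),
          norm_pos_le (M := M) (i := i) (k := k + 1) (by have := k.2; omega)]
      have h8 : (0 : ℝ) ≤ M.tw i * ‖x.2‖ ^ 2 / 2 := by positivity
      have h9 : M.δ i ≤ M.R i ^ 2 / 4 := by nlinarith
      nlinarith [norm_nonneg (x.1 - 0)]
    | some l =>
      change -1 * (‖x.1 - M.pos i (l + 1)‖ ^ 2 - M.ρ i ^ 2 - (0 : ℕ) * ‖x.2‖ ^ 2 / 2) ≤ _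
      have hkl : (k : ℕ) + 1 ≠ l + 1 := fun h => hb (by congr 1; exact Fin.ext (by omega))
      have h7 : 3 * M.d i / 4 ≤ ‖x.1 - M.pos i (l + 1)‖ := by
        have h8 := le_norm_pos_sub (M := M) (i := i) hkl.symm
        have : M.pos i (l + 1) - M.pos i (k + 1) =
          (x.1 - M.pos i (k + 1)) - (x.1 - M.pos i (l + 1)) := by ring
        rw [this] at h8
        linarith [norm_sub_le (x.1 - M.pos i (k + 1)) (x.1 - M.pos i (l + 1))]
      push_cast
      nlinarith

lemma continuous_gap (b : Option (Fin (Γ.genus i))) : Continuous (M.gap i b) := by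
  unfold gap toricGap
  fun_prop

lemma abs_gap (b : Option (Fin (Γ.genus i))) (x : ℂ × ℂ) :
    |M.gap i b x| = |toricGap (M.ctr i b) (M.rad i b) (M.twist i b) x| := by
  cases b <;> simp [gap, sgn]

lemma ne_ctr {b : Option (Fin (Γ.genus i))} {x : ℂ × ℂ} (hx : |M.gap i b x| < M.δ i) :
    x.1 ≠ M.ctr i b := by
  rw [abs_gap] at hx
  intro h
  have h1 := (abs_lt.1 hx).1
  have h2 := δ_lt_rad (M := M) b
  rw [toricGap, h, sub_self, norm_zero] at h1
  have h3 : (0 : ℝ) ≤ M.twist i b * ‖x.2‖ ^ 2 / 2 := by positivity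
  nlinarith

lemma toricSq_pos {b : Option (Fin (Γ.genus i))} {x : ℂ × ℂ} (hx : |M.gap i b x| < M.δ i) :
    0 < toricSq (M.ctr i b) (M.rad i b) (M.twist i b) x := by
  rw [abs_gap] at hx
  have h1 := (abs_lt.1 hx).2
  have h2 := δ_lt_rad (M := M) b
  have h3 : (0 : ℝ) ≤ M.twist i b * ‖x.2‖ ^ 2 / 2 := by positivity
  rw [toricGap] at h1
  rw [toricSq]
  linarith

/-- The map which glues the two sheets of the vertex `i` along the boundary `b`. -/
def flip (M : PlumbingModel Γ) (i : Fin n) (b : Option (Fin (Γ.genus i))) : ℂ × ℂ → ℂ × ℂ :=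
  toricMap (M.ctr i b) (M.rad i b) (M.twist i b)

lemma gap_flip {b : Option (Fin (Γ.genus i))} {x : ℂ × ℂ} (hx : |M.gap i b x| < M.δ i) :
    M.gap i b (M.flip i b x) = -M.gap i b x := by
  rw [gap, flip, toricGap_toricMap (ne_ctr hx) (toricSq_pos hx), gap]
  ring

lemma norm_flip_snd {b : Option (Fin (Γ.genus i))} {x : ℂ × ℂ} (hx : |M.gap i b x| < M.δ i) :
    ‖(M.flip i b x).2‖ = ‖x.2‖ := norm_toricMap_snd (ne_ctr hx)

/-- The collar of a sheet along the boundary `b`. -/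
def collar (M : PlumbingModel Γ) (i : Fin n) (b : Option (Fin (Γ.genus i))) : Set (ℂ × ℂ) :=
  {x | ‖x.2‖ < M.ε ∧ |M.gap i b x| < M.δ i}

lemma collar_subset (b : Option (Fin (Γ.genus i))) : M.collar i b ⊆ M.sheetSet i := by
  rintro x ⟨h1, h2⟩
  refine ⟨h1, fun b' => ?_⟩
  by_cases h : b = b'
  · subst h; exact (abs_lt.1 h2).2
  · have := gap_le_of_near h h2
    have := M.δ_pos i
    linarith

lemma flip_mem_collar {b : Option (Fin (Γ.genus i))} {x : ℂ × ℂ} (hx : x ∈ M.collar i b) :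
    M.flip i b x ∈ M.collar i b :=
  ⟨by rw [norm_flip_snd hx.2]; exact hx.1, by rw [gap_flip hx.2, abs_neg]; exact hx.2⟩

lemma flip_flip {b : Option (Fin (Γ.genus i))} {x : ℂ × ℂ} (hx : |M.gap i b x| < M.δ i) :
    M.flip i b (M.flip i b x) = x := toricMap_toricMap (ne_ctr hx) (toricSq_pos hx)

lemma collar_disjoint {b b' : Option (Fin (Γ.genus i))} {x : ℂ × ℂ} (hx : x ∈ M.collar i b)
    (hx' : x ∈ M.collar i b') : b = b' := by
  by_contra h
  have h1 := gap_le_of_near h hx.2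
  have h2 := (abs_lt.1 hx'.2).1
  linarith

/-- The polydisc around a plumbing point. -/
def polydisc (M : PlumbingModel Γ) (i : Fin n) (e : Σ j, Fin (Γ.edges i j)) : Set (ℂ × ℂ) :=
  {x | ‖x.1 - M.plumb i e‖ < M.ε ∧ ‖x.2‖ < M.ε}

lemma gap_le_of_near_plumb (e : Σ j, Fin (Γ.edges i j)) {x : ℂ × ℂ}
    (hx : ‖x.1 - M.plumb i e‖ ≤ M.d i / 4) (b : Option (Fin (Γ.genus i))) :
    M.gap i b x ≤ -M.δ i :=
  gap_le_of_near_pos (plumbIdx_le e) (fun l => by unfold plumbIdx; have := l.2; omega) hx b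

lemma gap_le_of_mem_polydisc {e : Σ j, Fin (Γ.edges i j)} {x : ℂ × ℂ} (hx : x ∈ M.polydisc i e)
    (b : Option (Fin (Γ.genus i))) : M.gap i b x ≤ -M.δ i :=
  gap_le_of_near_plumb e (by have := M.ε_le i; have := M.ε_pos; linarith [hx.1]) b

lemma polydisc_subset (e : Σ j, Fin (Γ.edges i j)) : M.polydisc i e ⊆ M.sheetSet i := by
  intro x hx
  refine ⟨hx.2, fun b => ?_⟩
  have := gap_le_of_mem_polydisc hx b
  have := M.δ_pos i
  linarith

lemma eq_of_near_plumb {e e' : Σ j, Fin (Γ.edges i j)} {w : ℂ}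
    (hx : ‖w - M.plumb i e‖ < M.d i / 2) (hx' : ‖w - M.plumb i e'‖ < M.d i / 2) : e = e' := by
  by_contra h
  have h1 := le_norm_pos_sub (M := M) (i := i) fun h' => h (plumbIdx_injective h')
  have h2 : M.pos i (plumbIdx i e) - M.pos i (plumbIdx i e') =
      (w - M.plumb i e') - (w - M.plumb i e) := by simp [plumb]
  rw [h2] at h1
  linarith [norm_sub_le (w - M.plumb i e') (w - M.plumb i e)]

lemma polydisc_disjoint {e e' : Σ j, Fin (Γ.edges i j)} {x : ℂ × ℂ} (hx : x ∈ M.polydisc i e)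
    (hx' : x ∈ M.polydisc i e') : e = e' := by
  have := M.ε_le i
  have := M.ε_pos
  exact eq_of_near_plumb (M := M) (w := x.1) (by linarith [hx.1]) (by linarith [hx'.1])

lemma collar_polydisc_disjoint {b : Option (Fin (Γ.genus i))} {e : Σ j, Fin (Γ.edges i j)}
    {x : ℂ × ℂ} (hx : x ∈ M.collar i b) (hx' : x ∈ M.polydisc i e) : False := by
  have h1 := gap_le_of_mem_polydisc hx' b
  have h2 := (abs_lt.1 hx.2).1
  linarith

lemma isOpen_sheetSet (i : Fin n) : IsOpen (M.sheetSet i) := by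
  have : M.sheetSet i = {x | ‖x.2‖ < M.ε} ∩ ⋂ b, {x | M.gap i b x < M.δ i} := by
    ext x; simp [sheetSet]
  rw [this]
  exact (isOpen_lt (by fun_prop) continuous_const).inter
    (isOpen_iInter_of_finite fun b => isOpen_lt (continuous_gap b) continuous_const)

lemma isOpen_collar (b : Option (Fin (Γ.genus i))) : IsOpen (M.collar i b) := by
  have : M.collar i b = {x | ‖x.2‖ < M.ε} ∩ {x | |M.gap i b x| < M.δ i} := rfl
  rw [this]
  exact (isOpen_lt (by fun_prop) continuous_const).inter
    (isOpen_lt (continuous_gap b).abs continuous_const)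

lemma isOpen_polydisc (e : Σ j, Fin (Γ.edges i j)) : IsOpen (M.polydisc i e) := by
  have : M.polydisc i e = {x | ‖x.1 - M.plumb i e‖ < M.ε} ∩ {x | ‖x.2‖ < M.ε} := rfl
  rw [this]
  exact (isOpen_lt (by fun_prop) continuous_const).inter
    (isOpen_lt (by fun_prop) continuous_const)

lemma zero_mem_sheetSet : (0 : ℂ × ℂ) ∈ M.sheetSet i := by
  refine ⟨by simpa using M.ε_pos, fun b => ?_⟩
  have h := gap_le_of_near_pos (M := M) (i := i) (k := 0) (by omega) (fun l => by omega)
    (x := 0) (by have := M.d_pos i; simp [pos]; linarith) b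
  have := M.δ_pos i
  linarith

lemma contDiffOn_flip (b : Option (Fin (Γ.genus i))) :
    ContDiffOn ℝ ∞ (M.flip i b) (M.collar i b) := fun _ hx =>
  (contDiffAt_toricMap (ne_ctr hx.2) (toricSq_pos hx.2)).contDiffWithinAt

variable (M) in
/-- The other end of an edge. -/
def otherEnd (c : Σ (i : Fin n) (j : Fin n), Fin (Γ.edges i j)) :
    Σ (i : Fin n) (j : Fin n), Fin (Γ.edges i j) :=
  ⟨c.2.1, c.1, Fin.cast (Γ.edges_symm _ _) c.2.2⟩

variable (M) in
/-- The gluing map of the plumbing at an edge exchanges base and fibre. -/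
def swap (c : Σ (i : Fin n) (j : Fin n), Fin (Γ.edges i j)) (x : ℂ × ℂ) : ℂ × ℂ :=
  (M.plumb c.2.1 (otherEnd c).2 + x.2, x.1 - M.plumb c.1 c.2)

/-- Coordinates on `ℝ⁴`. -/
def coords4 : EuclideanSpace ℝ (Fin 4) ≃L[ℝ] ℂ × ℂ :=
  LinearEquiv.toContinuousLinearEquiv
    { toFun := fun x => (⟨x 0, x 1⟩, ⟨x 2, x 3⟩)
      invFun := fun p => !₂[p.1.re, p.1.im, p.2.re, p.2.im]
      map_add' := fun x y => by
        refine Prod.ext (Complex.ext ?_ ?_) (Complex.ext ?_ ?_) <;> simp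
      map_smul' := fun c x => by
        refine Prod.ext (Complex.ext ?_ ?_) (Complex.ext ?_ ?_) <;> simp
      left_inv := fun x => by ext k; fin_cases k <;> rfl
      right_inv := fun p => rfl }

/-- Coordinates on `ℝ²`. -/
def coords2 : EuclideanSpace ℝ (Fin 2) ≃L[ℝ] ℂ :=
  LinearEquiv.toContinuousLinearEquiv
    { toFun := fun x => ⟨x 0, x 1⟩
      invFun := fun p => !₂[p.re, p.im]
      map_add' := fun x y => by refine Complex.ext ?_ ?_ <;> simp
      map_smul' := fun c x => by refine Complex.ext ?_ ?_ <;> simp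
      left_inv := fun x => by ext k; fin_cases k <;> rfl
      right_inv := fun p => rfl }

variable (M) in
/-- The gluing data of the plumbing: two sheets for each vertex `i`, glued to each other along the
`genus i + 1` boundaries, and to the sheets of the adjacent vertices by plumbing. -/
def glue : GlueData (EuclideanSpace ℝ (Fin 4)) (ℂ × ℂ) where
  e := coords4
  ι := Fin n × Bool
  κ := (Σ i : Fin n, Option (Fin (Γ.genus i)) × Bool) ⊕
    (Σ (i : Fin n) (j : Fin n), Fin (Γ.edges i j))
  U s := M.sheetSet s.1
  isOpen_U s := isOpen_sheetSet s.1
  nonempty_U s := ⟨0, zero_mem_sheetSet⟩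
  src := Sum.elim (fun c => (c.1, c.2.2)) (fun c => (c.1, true))
  tgt := Sum.elim (fun c => (c.1, !c.2.2)) (fun c => (c.2.1, true))
  rev := Sum.map (fun c => ⟨c.1, c.2.1, !c.2.2⟩) otherEnd
  src_rev c := by rcases c with c | c <;> rfl
  tgt_rev c := by rcases c with ⟨i, b, s⟩ | c <;> simp [otherEnd]
  src_ne_tgt c := by
    rcases c with ⟨i, b, s⟩ | ⟨i, j, k⟩
    · simp
    · intro h
      have hij : i = j := congrArg Prod.fst h
      subst hij
      -- The two ends of an edge are different vertices.
      have h0 := Γ.edges_self i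
      have := k.2
      omega
  D := Sum.elim (fun c => M.collar c.1 c.2.1) (fun c => M.polydisc c.1 c.2)
  isOpen_D c := by
    rcases c with c | c
    · exact isOpen_collar c.2.1
    · exact isOpen_polydisc c.2
  D_subset c := by
    rcases c with c | c
    · exact collar_subset c.2.1
    · exact polydisc_subset c.2
  φ := Sum.elim (fun c => M.flip c.1 c.2.1) M.swap
  φ_mem c x hx := by
    rcases c with c | c
    · exact flip_mem_collar hx
    · exact ⟨by simpa [swap, otherEnd] using hx.2, hx.1⟩
  φ_rev c x hx := by
    rcases c with c | c
    · exact flip_flip hx.2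
    · simp [swap, otherEnd]
  smooth c := by
    rcases c with c | c
    · exact contDiffOn_flip c.2.1
    · exact ((contDiff_const.add contDiff_snd).prodMk
        (contDiff_fst.sub contDiff_const)).contDiffOn
  eq_of_mem c c' h x hx hx' := by
    rcases c with ⟨i, b, s⟩ | ⟨i, e⟩ <;> rcases c' with ⟨i', b', s'⟩ | ⟨i', e'⟩ <;>
      simp only [Sum.elim_inl, Sum.elim_inr, Prod.mk.injEq] at h <;> obtain ⟨rfl, h⟩ := h
    · obtain rfl := collar_disjoint hx hx'
      rw [h]
    · exact (collar_polydisc_disjoint hx hx').elim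
    · exact (collar_polydisc_disjoint hx' hx).elim
    · obtain rfl := polydisc_disjoint hx hx'
      rfl
  separated c x hx hxD y hy := by
    rcases c with c | c
    · refine separated_of_continuous (a := fun x => -M.gap c.1 c.2.1 x) (b := M.gap c.1 c.2.1)
        (t := M.δ c.1) (continuous_gap _).neg (continuous_gap _) (fun y hy => hy.2 c.2.1)
        (fun x hx => gap_flip hx.2) ?_ hy
      by_contra h
      push Not at h
      exact hxD ⟨hx.1, abs_lt.2 ⟨by linarith, hx.2 c.2.1⟩⟩
    · refine separated_of_continuous (a := fun x => ‖x.1 - M.plumb c.1 c.2‖)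
        (b := fun x => ‖x.2‖) (t := M.ε) (by fun_prop) (by fun_prop) (fun y hy => hy.1)
        (fun x hx => rfl) ?_ hy
      by_contra h
      push Not at h
      exact hxD ⟨h, hx.1⟩

variable (M) in
/-- The gluing data of the surface of the vertex `i`: two copies of a disc with holes. -/
def surfaceGlue (i : Fin n) : GlueData (EuclideanSpace ℝ (Fin 2)) ℂ where
  e := coords2
  ι := Bool
  κ := Option (Fin (Γ.genus i)) × Bool
  U _ := {w | (w, 0) ∈ M.sheetSet i}
  isOpen_U _ := (isOpen_sheetSet i).preimage (by fun_prop : Continuous fun w : ℂ => (w, (0 : ℂ)))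
  nonempty_U _ := ⟨0, zero_mem_sheetSet⟩
  src c := c.2
  tgt c := !c.2
  rev c := (c.1, !c.2)
  src_rev _ := rfl
  tgt_rev c := by simp
  src_ne_tgt c := by simp
  D c := {w | (w, 0) ∈ M.collar i c.1}
  isOpen_D c := (isOpen_collar c.1).preimage (by fun_prop : Continuous fun w : ℂ => (w, (0 : ℂ)))
  D_subset c := fun w hw => collar_subset c.1 hw
  φ c w := (M.flip i c.1 (w, 0)).1
  φ_mem c w hw := by
    have h := flip_mem_collar hw
    have h2 : (M.flip i c.1 (w, 0)).2 = 0 := by simp [flip, toricMap]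
    have h3 : M.flip i c.1 (w, 0) = ((M.flip i c.1 (w, 0)).1, 0) := Prod.ext rfl h2
    rw [h3] at h
    exact h
  φ_rev c w hw := by
    have h2 : (M.flip i c.1 (w, 0)).2 = 0 := by simp [flip, toricMap]
    have h3 : ((M.flip i c.1 (w, 0)).1, 0) = M.flip i c.1 (w, 0) := Prod.ext rfl h2.symm
    rw [h3, flip_flip hw.2]
  smooth c := contDiff_fst.comp_contDiffOn ((contDiffOn_flip c.1).comp
    (contDiff_id.prodMk contDiff_const).contDiffOn fun _ h => h)
  eq_of_mem c c' h w hw hw' := Prod.ext (collar_disjoint hw hw') h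
  separated c x hx hxD y hy := by
    refine separated_of_continuous (a := fun x => -M.gap i c.1 (x, 0))
        (b := fun x => M.gap i c.1 (x, 0))
        (t := M.δ i) ((continuous_gap _).neg.comp (by fun_prop))
        ((continuous_gap _).comp (by fun_prop)) (fun y hy => hy.2 c.1)
        (fun x hx => ?_) ?_ hy
    · have h2 : (M.flip i c.1 (x, 0)).2 = 0 := by simp [flip, toricMap]
      have h3 : ((M.flip i c.1 (x, 0)).1, 0) = M.flip i c.1 (x, 0) := Prod.ext rfl h2.symm
      rw [h3, gap_flip hx.2]
    · by_contra h
      push Not at h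
      exact hxD ⟨hx.1, abs_lt.2 ⟨by linarith, hx.2 c.1⟩⟩

end PlumbingModel
end

/-! ### Planar vector fields of constant divergence -/

noncomputable section

open Set Filter ComplexConjugate

/-- The vector dual to a linear form with respect to the area form. -/
def areaDual : (ℂ →L[ℝ] ℝ) →L[ℝ] ℂ :=
  LinearMap.toContinuousLinearMap
    { toFun := fun L => ⟨L Complex.I, -L 1⟩
      map_add' := fun L L' => by apply Complex.ext <;> simp; ring
      map_smul' := fun c L => by apply Complex.ext <;> simp }

lemma areaForm_areaDual (L : ℂ →L[ℝ] ℝ) (b : ℂ) : areaForm (areaDual L) b = L b := by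
  have h : b = b.re • (1 : ℂ) + b.im • Complex.I := by
    apply Complex.ext <;> simp
  conv_rhs => rw [h, map_add, map_smul, map_smul]
  rw [areaForm_apply']
  simp only [areaDual, LinearMap.coe_toContinuousLinearMap', LinearMap.coe_mk, AddHom.coe_mk,
    smul_eq_mul]
  ring

lemma areaForm_injective {a b : ℂ} (h : ∀ c, areaForm a c = areaForm b c) : a = b := by
  rw [← sub_eq_zero]
  exact eq_zero_of_areaForm fun c => by rw [map_sub, sub_apply, h, sub_self]

/-- A planar field expands area at unit rate at a point where its derivative is `T` -/
def UnitDiv (t : ℝ) (T : ℂ →L[ℝ] ℂ) : Prop :=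
  ∀ a b, areaForm (T a) b + areaForm a (T b) = t * areaForm a b

lemma UnitDiv.add {t t' : ℝ} {T T' : ℂ →L[ℝ] ℂ} (h : UnitDiv t T) (h' : UnitDiv t' T') :
    UnitDiv (t + t') (T + T') := fun a b => by
  have h1 := h a b
  have h2 := h' a b
  simp only [add_apply, map_add]
  linear_combination h1 + h2

lemma UnitDiv.sum {ι : Type*} {s : Finset ι} {T : ι → ℂ →L[ℝ] ℂ} (h : ∀ i, UnitDiv 0 (T i)) :
    UnitDiv 0 (∑ i ∈ s, T i) := by
  classical
  induction s using Finset.induction_on with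
  | empty => intro a b; simp
  | insert i s hi ih =>
    rw [Finset.sum_insert hi]
    simpa using (h i).add ih

/-- Hamiltonian vector fields preserve the area. -/
lemma unitDiv_hamiltonian {F : ℂ → ℝ} {w : ℂ} (hF : ContDiff ℝ ∞ F) :
    ∃ T, HasFDerivAt (fun w => areaDual (fderiv ℝ F w)) T w ∧ UnitDiv 0 T := by
  have h1 : ContDiff ℝ ∞ (fderiv ℝ F) := hF.fderiv_right (by simp)
  have h2 := (h1.differentiable (by simp) w).hasFDerivAt
  refine ⟨_, areaDual.hasFDerivAt.comp w h2, fun a b => ?_⟩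
  have h3 : IsSymmSndFDerivAt ℝ F w :=
    hF.contDiffAt.isSymmSndFDerivAt (by simpa using WithTop.coe_le_coe.2 (le_top : (2 : ℕ∞) ≤ ⊤))
  have h4 := h3 a b
  rw [← neg_neg (areaForm a _), ← swap_of_alternating areaForm_self]
  simp only [ContinuousLinearMap.comp_apply, areaForm_areaDual]
  rw [h4]; ring

/-- The Hamiltonian function of the field `conj (g' / g)` is the imaginary part of `log g`, wherever
the branch cut is avoided. -/
lemma areaDual_im_log {g : ℂ → ℂ} {g' w : ℂ} (hg : HasDerivAt g g' w)
    (h : g w ∈ Complex.slitPlane) :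
    HasFDerivAt (fun w => (Complex.log (g w)).im)
      (areaForm (conj (g' / g w))) w := by
  have h1 := Complex.imCLM.hasFDerivAt.comp w ((hg.clog h).hasFDerivAt.restrictScalars ℝ)
  refine h1.congr_fderiv ?_
  ext b; simp [areaForm_apply, mul_comm]

/-- The radial field `1 / conj (w - q)` with a unit residue at `q` preserves the area. -/
lemma unitDiv_inv {q w : ℂ} (h : w ≠ q) :
    ∃ T, HasFDerivAt (fun w => (conj (w - q))⁻¹) T w ∧ UnitDiv 0 T := by
  have h0 : w - q ≠ 0 := sub_ne_zero.2 h
  have h1 : HasDerivAt (fun w => (w - q)⁻¹) (-1 / (w - q) ^ 2) w :=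
    ((hasDerivAt_id w).sub_const q).inv h0
  generalize -1 / (w - q) ^ 2 = k at h1
  have h2 := (Complex.conjCLE : ℂ →L[ℝ] ℂ).hasFDerivAt.comp w (h1.hasFDerivAt.restrictScalars ℝ)
  refine ⟨_, h2.congr_of_eventuallyEq (.of_forall fun w => by simp), fun a b => ?_⟩
  simp [areaForm_apply]
  ring

/-- A product with a cutoff function is smooth if the other factor is smooth where the cutoff
function does not vanish. -/
lemma contDiff_cutoff_mul {E : Type*} [NormedAddCommGroup E] [NormedSpace ℝ E] {χ G : E → ℝ}
    (hχ : ContDiff ℝ ∞ χ) (h : ∀ w, χ =ᶠ[𝓝 w] 0 ∨ ContDiffAt ℝ ∞ G w) :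
    ContDiff ℝ ∞ fun w => χ w * G w := by
  rw [contDiff_iff_contDiffAt]
  intro w
  rcases h w with h | h
  · exact (contDiffAt_const (c := (0 : ℝ))).congr_of_eventuallyEq (h.mono fun x hx => by simp [hx])
  · exact hχ.contDiffAt.mul h

lemma inv_conj_eq (u : ℂ) (t : ℝ) : (t : ℂ) * (conj u)⁻¹ = (t / ‖u‖ ^ 2 : ℝ) * u := by
  rcases eq_or_ne u 0 with rfl | hu
  · simp
  have h1 : u * conj u = (‖u‖ : ℂ) ^ 2 := Complex.mul_conj' _
  have h2 : conj u ≠ 0 := by simpa using hu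
  have h3 : (‖u‖ : ℂ) ≠ 0 := by simpa using hu
  push_cast
  field_simp
  linear_combination -t * h1

/-- There is a vector field on the plane with prescribed residues at given points which expands
the area at unit rate and is a standard radial field near each of these points and far away from
them. -/
theorem exists_planar_field {ι : Type*} [Fintype ι] (q : ι → ℂ) (res : ι → ℝ) {d R : ℝ}
    (hd : 0 < d) (hsep : Pairwise fun a b => d ≤ ‖q a - q b‖) (hq : ∀ a, ‖q a‖ + d ≤ R / 2)
    (hR : 0 < R) :
    ∃ h : ℂ → ℂ, (∀ w, (∀ a, w ≠ q a) → ContDiffAt ℝ ∞ h w) ∧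
      (∀ w, (∀ a, w ≠ q a) → UnitDiv 1 (fderiv ℝ h w)) ∧
      (∀ a w, ‖w - q a‖ < d / 4 → h w = (1 / 2 + res a / ‖w - q a‖ ^ 2 : ℝ) * (w - q a)) ∧
      (∀ w, 3 * R / 4 ≤ ‖w‖ → h w = (1 / 2 + (∑ a, res a) / ‖w‖ ^ 2 : ℝ) * w) := by
  classical
  let χ : ∀ a, ContDiffBump (q a) := fun a => ⟨d / 4, d / 2, by linarith, by linarith⟩
  let χo : ContDiffBump (0 : ℂ) := ⟨R / 2, 5 * R / 8, by linarith, by linarith⟩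
  -- The Hamiltonian functions correcting the field near the point `q a`, and far away.
  let G : ι → ℂ → ℝ := fun a w => areaForm (-(q a / 2)) w +
    ∑ b ∈ Finset.univ.erase a, -res b * (Complex.log ((w - q b) / (q a - q b))).im
  let Go : ℂ → ℝ := fun w => ∑ b, -res b * (Complex.log (1 - q b / w)).im
  have hslit : ∀ a b, b ≠ a → ∀ w, ‖w - q a‖ < d →
      (w - q b) / (q a - q b) ∈ Complex.slitPlane := by
    intro a b hb w hw
    have h1 := hsep hb.symm
    have h2 : q a - q b ≠ 0 := norm_pos_iff.1 (hd.trans_le h1)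
    have h3 : (w - q b) / (q a - q b) = 1 + (w - q a) / (q a - q b) := by field_simp; ring
    rw [h3]
    refine Complex.mem_slitPlane_of_norm_lt_one ?_
    rw [norm_div, div_lt_one (hd.trans_le h1)]
    exact hw.trans_le h1
  have hslito : ∀ b w, R / 2 ≤ ‖w‖ → 1 - q b / w ∈ Complex.slitPlane := by
    intro b w hw
    have h1 := hq b
    rw [sub_eq_add_neg]
    refine Complex.mem_slitPlane_of_norm_lt_one ?_
    have h2 : 0 < ‖w‖ := by linarith
    rw [norm_neg, norm_div, div_lt_one h2]
    linarith
  have hG' : ∀ a w, ‖w - q a‖ < d → HasFDerivAt (G a) (areaForm (-(q a / 2) +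
      ∑ b ∈ Finset.univ.erase a, -(res b * (conj (w - q b))⁻¹))) w := by
    intro a w hw
    have h1 := (areaForm (-(q a / 2))).hasFDerivAt (x := w) |>.add
      (HasFDerivAt.fun_sum (u := Finset.univ.erase a) fun b hb =>
        (areaDual_im_log (((hasDerivAt_id w).sub_const (q b)).div_const (q a - q b))
        (hslit a b (Finset.ne_of_mem_erase hb) w hw)).const_mul (-res b))
    refine h1.congr_fderiv ?_
    rw [map_add, map_sum]
    congr 1
    refine Finset.sum_congr rfl fun b hb => ?_
    have h2 : q a - q b ≠ 0 :=
      norm_pos_iff.1 (hd.trans_le (hsep (Finset.ne_of_mem_erase hb).symm))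
    have h3 : 1 / (q a - q b) / ((w - q b) / (q a - q b)) = (w - q b)⁻¹ := by
      have h4 : (w - q b) / (q a - q b) ≠ 0 :=
        Complex.slitPlane_ne_zero (hslit a b (Finset.ne_of_mem_erase hb) w hw)
      have h5 : w - q b ≠ 0 := fun h => h4 (by rw [h, zero_div])
      field_simp
    simp only [id]
    rw [h3, map_inv₀, ← map_smul]
    congr 1
    simp
  have hGo' : ∀ w, R / 2 ≤ ‖w‖ → HasFDerivAt Go (areaForm (
      ∑ b, (res b * (conj w)⁻¹ - res b * (conj (w - q b))⁻¹))) w := by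
    intro w hw
    have hw0 : w ≠ 0 := norm_pos_iff.1 (by linarith)
    have h1 := HasFDerivAt.fun_sum (u := Finset.univ) fun b _ =>
        (areaDual_im_log (((hasDerivAt_inv hw0).const_mul (q b)).const_sub 1)
        (hslito b w hw)).const_mul (-res b)
    refine h1.congr_fderiv ?_
    rw [map_sum]
    refine Finset.sum_congr rfl fun b hb => ?_
    have h4 : 1 - q b / w ≠ 0 := Complex.slitPlane_ne_zero (hslito b w hw)
    have h5 : w - q b ≠ 0 := fun h => h4 (by rw [← sub_eq_zero.1 h, div_self hw0, sub_self])
    have h3 : -(q b * -(w ^ 2)⁻¹) / (1 - q b * w⁻¹) = (w - q b)⁻¹ - w⁻¹ := by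
      have h6 : 1 - q b * w⁻¹ ≠ 0 := h4
      field_simp
      ring
    rw [h3, map_sub, map_inv₀, map_inv₀, ← map_smul]
    congr 1
    simp
    ring
  have hGs : ∀ a w, ‖w - q a‖ < d → ContDiffAt ℝ ∞ (G a) w := fun a w hw =>
    (areaForm (-(q a / 2))).contDiff.contDiffAt.add <| ContDiffAt.sum fun b hb =>
      contDiffAt_const.mul <| Complex.imCLM.contDiff.contDiffAt.comp w <|
        ((Complex.contDiffAt_log (hslit a b (Finset.ne_of_mem_erase hb) w hw)).restrict_scalars
          ℝ).comp w ((contDiffAt_id.sub contDiffAt_const).div_const _)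
  have hGos : ∀ w, R / 2 ≤ ‖w‖ → ContDiffAt ℝ ∞ Go w := fun w hw =>
    ContDiffAt.sum fun b _ => contDiffAt_const.mul <| Complex.imCLM.contDiff.contDiffAt.comp w <|
      ((Complex.contDiffAt_log (hslito b w hw)).restrict_scalars ℝ).comp w
        (contDiffAt_const.sub (contDiffAt_const.mul
          (contDiffAt_id.inv (norm_pos_iff.1 (by linarith : 0 < ‖w‖)))))
  -- Cutting off the Hamiltonian functions, rather than the fields, keeps the divergence.
  let F : ℂ → ℝ := fun w => ∑ a, χ a w * G a w + (1 - χo w) * Go w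
  have hF : ContDiff ℝ ∞ F := by
    refine ContDiff.add (ContDiff.sum fun a _ => contDiff_cutoff_mul (χ a).contDiff fun w => ?_)
      (contDiff_cutoff_mul (contDiff_const.sub χo.contDiff) fun w => ?_)
    · by_cases hw : ‖w - q a‖ < d
      · exact .inr (hGs a w hw)
      · left
        have h1 : w ∈ {w' | d / 2 < ‖w' - q a‖} := show d / 2 < ‖w - q a‖ by linarith
        filter_upwards [(isOpen_lt continuous_const (by fun_prop)).mem_nhds h1] with w' hw'
        exact (χ a).zero_of_le_dist (by rw [dist_eq_norm]; exact le_of_lt hw')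
    · by_cases hw : R / 2 ≤ ‖w‖
      · exact .inr (hGos w hw)
      · left
        have h1 : w ∈ {w' | ‖w'‖ < R / 2} := show ‖w‖ < R / 2 by linarith
        filter_upwards [(isOpen_lt (by fun_prop) continuous_const).mem_nhds h1] with w' hw'
        have : χo w' = 1 := χo.one_of_mem_closedBall (by
          rw [mem_closedBall_zero_iff]; exact le_of_lt hw')
        simp [this]
  have hχ0 : ∀ a w, d / 2 ≤ ‖w - q a‖ → χ a w = 0 := fun a w hw =>
    (χ a).zero_of_le_dist (by rw [dist_eq_norm]; exact hw)
  have hFG : ∀ a w, ‖w - q a‖ < d / 4 → F =ᶠ[𝓝 w] G a := by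
    intro a w hw
    have h1 : w ∈ {w' | ‖w' - q a‖ < d / 4} := hw
    filter_upwards [(isOpen_lt (by fun_prop) continuous_const).mem_nhds h1] with w' hw'
    have hw' : ‖w' - q a‖ < d / 4 := hw'
    have h2 : χ a w' = 1 := (χ a).one_of_mem_closedBall (by
      rw [mem_closedBall_iff_norm]; exact hw'.le)
    have h3 : χo w' = 1 := χo.one_of_mem_closedBall (by
      rw [mem_closedBall_zero_iff]
      have := norm_add_le (w' - q a) (q a)
      rw [sub_add_cancel] at this
      change ‖w'‖ ≤ R / 2
      linarith [hq a])
    have h4 : ∑ b, χ b w' * G b w' = χ a w' * G a w' := by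
      refine Finset.sum_eq_single a (fun b _ hb => ?_) (by simp)
      rw [hχ0, zero_mul]
      have h5 : d ≤ ‖q b - q a‖ := hsep hb
      have h6 : q b - q a = (w' - q a) - (w' - q b) := by ring
      rw [h6] at h5
      linarith [norm_sub_le (w' - q a) (w' - q b)]
    simp only [F, h4, h2, h3]
    ring
  have hFGo : ∀ w, 3 * R / 4 ≤ ‖w‖ → F =ᶠ[𝓝 w] Go := by
    intro w hw
    have h1 : w ∈ {w' | 5 * R / 8 < ‖w'‖} := show 5 * R / 8 < ‖w‖ by linarith
    filter_upwards [(isOpen_lt continuous_const (by fun_prop)).mem_nhds h1] with w' hw'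
    have hw' : 5 * R / 8 < ‖w'‖ := hw'
    have h3 : χo w' = 0 := χo.zero_of_le_dist (by rw [dist_zero_right]; exact hw'.le)
    have h4 : ∑ b, χ b w' * G b w' = 0 := by
      refine Finset.sum_eq_zero fun b _ => ?_
      rw [hχ0, zero_mul]
      linarith [norm_sub_norm_le w' (q b), hq b]
    simp only [F, h4, h3]
    ring
  have hdual : ∀ a, areaDual (areaForm a) = a := fun a =>
    areaForm_injective fun c => areaForm_areaDual _ _
  -- The field `w / 2` has divergence one; the other summands have divergence zero.
  refine ⟨fun w => (1 / 2 : ℝ) • w + ∑ a, res a • (conj (w - q a))⁻¹ + areaDual (fderiv ℝ F w),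
    fun w hw => ?_, fun w hw => ?_, fun a w hw => ?_, fun w hw => ?_⟩
  · refine ((contDiffAt_id.const_smul (1 / 2 : ℝ)).add (ContDiffAt.sum fun a _ =>
      (ContDiffAt.inv ?_ ?_).const_smul (res a))).add
      (areaDual.contDiff.comp (hF.fderiv_right (m := ∞) le_rfl)).contDiffAt
    · exact Complex.conjCLE.contDiff.contDiffAt.comp w (contDiffAt_id.sub contDiffAt_const)
    · exact (map_ne_zero _).2 (sub_ne_zero.2 (hw a))
  · obtain ⟨T, hT, hT'⟩ := unitDiv_hamiltonian (w := w) hF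
    choose S hS hS' using fun a => unitDiv_inv (hw a)
    have h1 : HasFDerivAt (fun w : ℂ => (1 / 2 : ℝ) • w)
        ((1 / 2 : ℝ) • ContinuousLinearMap.id ℝ ℂ) w :=
      ((1 / 2 : ℝ) • ContinuousLinearMap.id ℝ ℂ).hasFDerivAt
    have h2 := (h1.add (HasFDerivAt.fun_sum (u := Finset.univ) fun a _ =>
      (hS a).const_smul (res a))).add hT
    have h3 : UnitDiv 1 ((1 / 2 : ℝ) • ContinuousLinearMap.id ℝ ℂ) := fun a b => by
      simp only [smul_apply, ContinuousLinearMap.id_apply, map_smul, smul_eq_mul]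
      ring
    have h4 : UnitDiv 0 (∑ a, res a • S a) := UnitDiv.sum fun c a b => by
      have := hS' c a b
      simp only [smul_apply, map_smul, smul_eq_mul]
      linear_combination res c * this
    refine Eq.mp (congrArg (UnitDiv 1) h2.fderiv.symm) ?_
    simpa using (h3.add h4).add hT'
  · simp only []
    rw [(hFG a w hw).fderiv_eq, (hG' a w (by linarith)).fderiv, hdual,
      ← Finset.add_sum_erase _ _ (Finset.mem_univ a)]
    have h1 := inv_conj_eq (w - q a) (res a)
    simp only [Complex.real_smul, Finset.sum_neg_distrib]
    rw [h1]
    push_cast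
    ring
  · simp only []
    rw [(hFGo w hw).fderiv_eq, (hGo' w (by linarith)).fderiv, hdual, Finset.sum_sub_distrib]
    have h1 := inv_conj_eq w (∑ a, res a)
    rw [Complex.ofReal_sum, Finset.sum_mul] at h1
    simp only [Complex.real_smul]
    rw [h1]
    push_cast
    ring
end

/-! ### The Liouville field of the plumbing -/

noncomputable section

open Set Filter ComplexConjugate

/-- A smooth nondecreasing function which is `t / 2` for `t ≤ a` and `1` for `2 * a ≤ t`. -/
def ramp (a t : ℝ) : ℝ :=
  (1 - Real.smoothTransition ((t - a) / a)) * (t / 2) + Real.smoothTransition ((t - a) / a)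

lemma contDiff_ramp (a : ℝ) : ContDiff ℝ ∞ (ramp a) := by
  have h : ContDiff ℝ ∞ fun t : ℝ => Real.smoothTransition ((t - a) / a) :=
    Real.smoothTransition.contDiff.comp (by fun_prop)
  exact ((contDiff_const.sub h).mul (contDiff_id.div_const 2)).add h

lemma ramp_of_le {a t : ℝ} (ha : 0 < a) (h : t ≤ a) : ramp a t = t / 2 := by
  rw [ramp, Real.smoothTransition.zero_of_nonpos (div_nonpos_of_nonpos_of_nonneg (by linarith)
    ha.le)]
  ring

lemma ramp_of_ge {a t : ℝ} (ha : 0 < a) (h : 2 * a ≤ t) : ramp a t = 1 := by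
  rw [ramp, Real.smoothTransition.one_of_one_le (by rw [le_div_iff₀ ha]; linarith)]
  ring

lemma ramp_pos {a t : ℝ} (ht : 0 < t) : 0 < ramp a t := by
  have h1 := Real.smoothTransition.nonneg ((t - a) / a)
  have h2 := Real.smoothTransition.le_one ((t - a) / a)
  rw [ramp]
  rcases h1.eq_or_lt with h | h
  · rw [← h]; linarith
  · nlinarith [mul_nonneg (sub_nonneg.2 h2) ht.le]

lemma ramp_nonneg {a t : ℝ} (ht : 0 ≤ t) : 0 ≤ ramp a t := by
  have h1 := Real.smoothTransition.nonneg ((t - a) / a)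
  have h2 := Real.smoothTransition.le_one ((t - a) / a)
  rw [ramp]
  nlinarith [mul_nonneg (sub_nonneg.2 h2) ht]

lemma deriv_ramp_nonneg {a t : ℝ} (ha : 0 < a) (ha1 : a ≤ 1) : 0 ≤ deriv (ramp a) t := by
  rcases lt_or_ge (2 * a) t with h | h
  · have : ramp a =ᶠ[𝓝 t] fun _ => 1 := by
      filter_upwards [lt_mem_nhds h] with s hs using ramp_of_ge ha hs.le
    rw [this.deriv_eq, deriv_const]
  · set σ : ℝ → ℝ := fun t => Real.smoothTransition ((t - a) / a)
    have hσ : ContDiff ℝ ∞ σ := Real.smoothTransition.contDiff.comp (by fun_prop)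
    have hm : Monotone σ := fun x y hxy => Real.smoothTransition.monotone (by gcongr)
    have h1 := (hσ.differentiable (by simp) t).hasDerivAt
    have h2 := ((h1.const_sub 1).mul ((hasDerivAt_id t).div_const 2)).add h1
    have h3 : deriv (ramp a) t = _ := h2.deriv
    rw [h3]
    have h4 : 0 ≤ deriv σ t := hm.deriv_nonneg
    have h5 : σ t ≤ 1 := Real.smoothTransition.le_one _
    simp only [id]
    nlinarith

namespace PlumbingModel

variable {n : ℕ} {Γ : PlumbingGraph n} (M : PlumbingModel Γ)

lemma preserves_glue : M.glue.Preserves sympForm := by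
  rintro (c | c) x hx a b
  · exact sympForm_fderiv_toricMap (ne_ctr hx.2) (toricSq_pos hx.2) a b
  · have h : HasFDerivAt (M.swap c) ((ContinuousLinearMap.snd ℝ ℂ ℂ).prod (.fst ℝ ℂ ℂ)) x :=
      ((ContinuousLinearMap.snd ℝ ℂ ℂ).hasFDerivAt.const_add _).prodMk
        ((ContinuousLinearMap.fst ℝ ℂ ℂ).hasFDerivAt.sub_const _)
    change sympForm (fderiv ℝ (M.swap c) x a) (fderiv ℝ (M.swap c) x b) = _
    rw [h.fderiv]
    simp [sympForm_apply, add_comm]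

lemma fderiv_swap (c : Σ (i : Fin n) (j : Fin n), Fin (Γ.edges i j)) (x a : ℂ × ℂ) :
    fderiv ℝ (M.swap c) x a = (a.2, a.1) := by
  have h : HasFDerivAt (M.swap c) ((ContinuousLinearMap.snd ℝ ℂ ℂ).prod (.fst ℝ ℂ ℂ)) x :=
      ((ContinuousLinearMap.snd ℝ ℂ ℂ).hasFDerivAt.const_add _).prodMk
        ((ContinuousLinearMap.fst ℝ ℂ ℂ).hasFDerivAt.sub_const _)
  rw [h.fderiv]; rfl

variable {M} in
/-- The outer collar lies where the planar field is standard at infinity. -/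
lemma norm_of_mem_outer {i : Fin n} {x : ℂ × ℂ} (hx : |M.gap i none x| < M.δ i) :
    3 * M.R i / 4 ≤ ‖x.1‖ := by
  have h1 := M.δ_le i
  have h3 := M.ρ_pos i
  have h4 := M.ρ_le i
  have h5 := d_le_R (M := M) (i := i)
  have h6 := M.d_pos i
  change |1 * (‖x.1 - 0‖ ^ 2 - M.R i ^ 2 - M.tw i * ‖x.2‖ ^ 2 / 2)| < _ at hx
  have h8 : (0 : ℝ) ≤ M.tw i * ‖x.2‖ ^ 2 / 2 := by positivity
  have h9 := (abs_lt.1 hx).1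
  rw [sub_zero] at h9
  by_contra hcon
  push Not at hcon
  have h9 : M.δ i ≤ M.R i ^ 2 / 4 := by nlinarith
  nlinarith [norm_nonneg x.1]

variable {M} in
/-- The inner collars lie where the planar field is standard near the centres of the holes. -/
lemma norm_of_mem_inner {i : Fin n} {k : Fin (Γ.genus i)} {x : ℂ × ℂ}
    (hx : |M.gap i (some k) x| < M.δ i) : ‖x.1 - M.pos i (k + 1)‖ < M.d i / 4 := by
  have h1 := M.δ_le i
  have h3 := M.ρ_pos i
  have h4 := M.ρ_le i
  change |-1 * (‖x.1 - M.pos i (k + 1)‖ ^ 2 - M.ρ i ^ 2 - (0 : ℕ) * ‖x.2‖ ^ 2 / 2)| < _ at hx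
  have h9 := (abs_lt.1 hx).1
  push_cast at h9
  by_contra hcon
  push Not at hcon
  nlinarith

variable {M} in
lemma ne_hole_of_mem {i : Fin n} {x : ℂ × ℂ} (hx : x ∈ M.sheetSet i) (k : Fin (Γ.genus i)) :
    x.1 ≠ M.pos i (k + 1) := by
  intro h
  have h1 : -1 * (‖x.1 - M.pos i (k + 1)‖ ^ 2 - M.ρ i ^ 2 - (0 : ℕ) * ‖x.2‖ ^ 2 / 2) < M.δ i :=
    hx.2 (some k)
  rw [h, sub_self, norm_zero] at h1
  have h2 := M.δ_le i
  have h3 := M.δ_pos i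
  push_cast at h1
  linarith

lemma le_norm_plumb_sub_hole {i : Fin n} (k : Fin (Γ.genus i)) (e : Σ j, Fin (Γ.edges i j)) :
    M.d i ≤ ‖M.pos i (k + 1) - M.plumb i e‖ :=
  le_norm_pos_sub (by unfold plumbIdx; have := k.2; omega)

/-- The components in the base direction of the Liouville field on the sheets. On the second sheet
all residues are zero; on the first one they are `z j` at a plumbing point on an edge to `j`, so
that the plumbing can exchange base and fibre, and `-ρ²` in the holes. The sum of the residues of
the two sheets at a boundary is what `toricMap` asks for: at the outer boundary this is the
equation `flux`. -/
lemma exists_baseField : ∃ h : Fin n × Bool → ℂ → ℂ,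
    (∀ i s, ∀ x ∈ M.sheetSet i, (s = true → ∀ e, x.1 ≠ M.plumb i e) →
      ContDiffAt ℝ ∞ (h (i, s)) x.1 ∧ UnitDiv 1 (fderiv ℝ (h (i, s)) x.1)) ∧
    (∀ i b, ∃ r : Bool → ℝ, r true + r false = M.twist i b * M.z i - M.rad i b ^ 2 ∧
      ∀ s x, |M.gap i b x| < M.δ i →
        h (i, s) x.1 = (1 / 2 + r s / ‖x.1 - M.ctr i b‖ ^ 2 : ℝ) * (x.1 - M.ctr i b)) ∧
    (∀ i e w, ‖w - M.plumb i e‖ < M.d i / 4 → h (i, true) w =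
      (1 / 2 + M.z e.1 / ‖w - M.plumb i e‖ ^ 2 : ℝ) * (w - M.plumb i e)) := by
  have hq : ∀ i k, k ≤ Γ.genus i + ∑ j, Γ.edges i j → ‖M.pos i k‖ + M.d i ≤ M.R i / 2 :=
    fun i k hk => by have := norm_pos_le (M := M) hk; have := M.d_pos i; linarith
  have h1 : ∀ i, _ := fun i => exists_planar_field (ι := Fin (Γ.genus i) ⊕ Σ j, Fin (Γ.edges i j))
    (Sum.elim (fun k => M.pos i (k + 1)) (M.plumb i))
    (Sum.elim (fun _ => -M.ρ i ^ 2) (fun e => M.z e.1)) (M.d_pos i) (by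
      rintro (k | e) (l | e') hne
      · exact le_norm_pos_sub fun h => hne (by congr 1; exact Fin.ext (by omega))
      · exact M.le_norm_plumb_sub_hole k e'
      · change _ ≤ ‖M.plumb i e - M.pos i (l + 1)‖
        rw [norm_sub_rev]; exact M.le_norm_plumb_sub_hole l e
      · exact le_norm_pos_sub fun h => hne (by rw [plumbIdx_injective h]))
    (by
      rintro (k | e)
      · exact hq i _ (by have := k.2; omega)
      · exact hq i _ (plumbIdx_le e)) (R_pos (M := M) (i := i))
  have h2 : ∀ i, _ := fun i => exists_planar_field (ι := Fin (Γ.genus i))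
    (fun k => M.pos i (k + 1)) (fun _ => 0) (M.d_pos i)
    (fun k l hne => le_norm_pos_sub fun h => hne (Fin.ext (by omega)))
    (fun k => hq i _ (by have := k.2; omega)) (R_pos (M := M) (i := i))
  choose h1 h1s h1d h1n h1o using h1
  choose h2 h2s h2d h2n h2o using h2
  refine ⟨fun s => if s.2 then h1 s.1 else h2 s.1, ?_, ?_, ?_⟩
  · rintro i (_ | _) x hx hs
    · exact ⟨h2s i x.1 (ne_hole_of_mem hx), h2d i x.1 (ne_hole_of_mem hx)⟩
    · have : ∀ a, x.1 ≠ Sum.elim (fun k : Fin (Γ.genus i) => M.pos i (k + 1)) (M.plumb i) a := by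
        rintro (k | e)
        · exact ne_hole_of_mem hx k
        · exact hs rfl e
      exact ⟨h1s i x.1 this, h1d i x.1 this⟩
  · rintro i (_ | k)
    · refine ⟨fun s => if s then ∑ e : Σ j, Fin (Γ.edges i j), M.z e.1 - Γ.genus i * M.ρ i ^ 2
        else 0, ?_, ?_⟩
      · have h3 := M.flux i
        have h4 := M.R_sq i
        have h5 : ∑ e : Σ j, Fin (Γ.edges i j), M.z e.1 = ∑ j, Γ.edges i j * M.z j := by
          rw [Fintype.sum_sigma]; simp
        change (∑ e : Σ j, Fin (Γ.edges i j), M.z e.1 - Γ.genus i * M.ρ i ^ 2) + 0 =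
          M.tw i * M.z i - M.R i ^ 2
        linarith
      · rintro (_ | _) x hx
        · have := h2o i x.1 (norm_of_mem_outer hx)
          simpa [ctr] using this
        · have := h1o i x.1 (norm_of_mem_outer hx)
          rw [Fintype.sum_sum_type] at this
          simp only [Sum.elim_inl, Sum.elim_inr, Finset.sum_const, Finset.card_univ,
            Fintype.card_fin, nsmul_eq_mul] at this
          change h1 i x.1 = (1 / 2 + (∑ e : Σ j, Fin (Γ.edges i j), M.z e.1 -
            Γ.genus i * M.ρ i ^ 2) / ‖x.1 - 0‖ ^ 2 : ℝ) * (x.1 - 0)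
          rw [this, sub_zero]
          congr 4
          ring
    · refine ⟨fun s => if s then - M.ρ i ^ 2 else 0, ?_, ?_⟩
      · change -M.ρ i ^ 2 + 0 = ((0 : ℕ) : ℝ) * M.z i - M.ρ i ^ 2
        push_cast; ring
      · rintro (_ | _) x hx
        · exact h2n i k x.1 (norm_of_mem_inner hx)
        · exact h1n i (.inl k) x.1 (norm_of_mem_inner hx)
  · intro i e w hw
    exact h1n i (.inr e) w hw

/-- The component in the base direction of the Liouville field on a sheet. -/
def baseField : Fin n × Bool → ℂ → ℂ := M.exists_baseField.choose

/-- The Liouville field on a sheet. Its fibre component has the residue `z i` along the surface. -/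
def liouville (s : Fin n × Bool) (x : ℂ × ℂ) : ℂ × ℂ :=
  (M.baseField s x.1, (1 / 2 + M.z s.1 / ‖x.2‖ ^ 2 : ℝ) * x.2)

/-- The complement of the union of all surfaces in a sheet. -/
def offSurfaces (s : Fin n × Bool) : Set (ℂ × ℂ) :=
  {x | x.2 ≠ 0 ∧ (s.2 = true → ∀ e, x.1 ≠ M.plumb s.1 e)}

variable {M} in
lemma far_of_mem_collar {i : Fin n} {b : Option (Fin (Γ.genus i))} {x : ℂ × ℂ}
    (hx : |M.gap i b x| < M.δ i) (e : Σ j, Fin (Γ.edges i j)) :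
    M.d i / 4 < ‖x.1 - M.plumb i e‖ := by
  by_contra h
  push Not at h
  linarith [gap_le_of_near_plumb e h b, (abs_lt.1 hx).1]

variable {M} in
lemma ne_plumb_of_mem_collar {i : Fin n} {b : Option (Fin (Γ.genus i))} {x : ℂ × ℂ}
    (hx : |M.gap i b x| < M.δ i) (e : Σ j, Fin (Γ.edges i j)) : x.1 ≠ M.plumb i e := by
  intro h
  have h1 := far_of_mem_collar hx e
  rw [h, sub_self, norm_zero] at h1
  linarith [M.d_pos i]

lemma offSurfaces_compat (c : M.glue.κ) (x : ℂ × ℂ) (hx : x ∈ M.glue.D c) :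
    x ∈ M.offSurfaces (M.glue.src c) ↔ M.glue.φ c x ∈ M.offSurfaces (M.glue.tgt c) := by
  rcases c with ⟨i, b, s⟩ | c
  · have hx : x ∈ M.collar i b := hx
    have h2 := flip_mem_collar hx
    have h3 := norm_flip_snd hx.2
    change (x.2 ≠ 0 ∧ _) ↔ ((M.flip i b x).2 ≠ 0 ∧ _)
    rw [← norm_ne_zero_iff, ← norm_ne_zero_iff (a := (M.flip i b x).2), h3]
    exact and_congr_right fun _ => ⟨fun _ _ e => ne_plumb_of_mem_collar h2.2 e,
      fun _ _ e => ne_plumb_of_mem_collar hx.2 e⟩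
  · have hx : x ∈ M.polydisc c.1 c.2 := hx
    have hx' : M.swap c x ∈ M.polydisc (otherEnd c).1 (otherEnd c).2 :=
      M.glue.φ_mem (.inr c) x hx
    have h1 : ∀ {c : Σ (i : Fin n) (j : Fin n), Fin (Γ.edges i j)} {x : ℂ × ℂ},
        x ∈ M.polydisc c.1 c.2 →
        (x ∈ M.offSurfaces (c.1, true) ↔ x.2 ≠ 0 ∧ x.1 - M.plumb c.1 c.2 ≠ 0) := by
      intro c x hx
      refine and_congr_right fun _ => ⟨fun h => sub_ne_zero.2 (h rfl _), fun h _ e he => ?_⟩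
      have h3 : x ∈ M.polydisc c.1 e := ⟨by rw [he]; simpa using M.ε_pos, hx.2⟩
      rw [polydisc_disjoint hx h3] at h
      exact h (sub_eq_zero.2 he)
    refine (h1 hx).trans (Iff.trans ?_ (h1 hx').symm)
    change _ ↔ x.1 - M.plumb c.1 c.2 ≠ 0 ∧
      M.plumb c.2.1 (otherEnd c).2 + x.2 - M.plumb c.2.1 (otherEnd c).2 ≠ 0
    rw [add_sub_cancel_left]
    exact and_comm

lemma isOpen_offSurfaces (s : Fin n × Bool) : IsOpen (M.offSurfaces s) := by
  have : M.offSurfaces s = {x | x.2 ≠ 0} ∩ {x | s.2 = true → ∀ e, x.1 ≠ M.plumb s.1 e} := rfl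
  rw [this]
  refine (isOpen_ne_fun continuous_snd continuous_const).inter ?_
  by_cases h : s.2 = true
  · simp only [h, true_imp_iff, ofPred_forall]
    exact isOpen_iInter_of_finite fun e => isOpen_ne_fun continuous_fst continuous_const
  · simp [h]

lemma equivariant_liouville : M.glue.Equivariant M.offSurfaces M.liouville := by
  obtain ⟨-, hb, hc⟩ := M.exists_baseField.choose_spec
  rintro (⟨i, b, s⟩ | c) x hx hxS
  · have hx : x ∈ M.collar i b := hx
    have h2 := flip_mem_collar hx
    obtain ⟨r, hr, hrs⟩ := hb i b
    change fderiv ℝ (toricMap (M.ctr i b) (M.rad i b) (M.twist i b)) x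
      (M.exists_baseField.choose (i, s) x.1, _) =
        (M.exists_baseField.choose (i, !s) (M.flip i b x).1, _)
    rw [hrs s x hx.2, hrs (!s) _ h2.2]
    exact fderiv_toricMap_radial (ne_ctr hx.2) (toricSq_pos hx.2) hxS.1
      (show r s + r (!s) = M.twist i b * M.z i - M.rad i b ^ 2 by
        rw [← hr]; cases s <;> simp [add_comm])
  · have hx : x ∈ M.polydisc c.1 c.2 := hx
    have hd : ∀ i, M.ε < M.d i / 4 := fun i => by
      have := M.ε_le i
      have := M.ε_pos
      linarith
    change fderiv ℝ (M.swap c) x (M.exists_baseField.choose (c.1, true) x.1, _) =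
      (M.exists_baseField.choose (c.2.1, true) (M.plumb c.2.1 (otherEnd c).2 + x.2), _)
    rw [fderiv_swap, hc c.1 c.2 x.1 (hx.1.trans (hd _)), hc c.2.1 (otherEnd c).2 _ (by
      rw [add_sub_cancel_left]; exact hx.2.trans (hd _)), add_sub_cancel_left]
    rfl

/-- The symplectic form of the plumbing. -/
abbrev Ω : DiffForm 4 M.glue.Space 2 := M.glue.form sympForm sympForm_self

/-- The complement of the union of the surfaces in the plumbing. -/
def offSet : Set M.glue.Space := {p | M.glue.lift (fun s x => x ∈ M.offSurfaces s) p}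

lemma isSymplectic_Ω : M.Ω.IsSymplectic :=
  M.glue.isSymplectic_form M.preserves_glue fun _ => eq_zero_of_sympForm

lemma hasFDerivAt_radial (z : ℝ) {ζ : ℂ} (h : ζ ≠ 0) :
    ∃ T, HasFDerivAt (fun ζ : ℂ => ((1 / 2 + z / ‖ζ‖ ^ 2 : ℝ) * ζ : ℂ)) T ζ ∧ UnitDiv 1 T := by
  obtain ⟨T, hT, hT'⟩ := unitDiv_inv h
  have h1 := (((1 / 2 : ℝ) • ContinuousLinearMap.id ℝ ℂ).hasFDerivAt (x := ζ)).add
    (hT.const_smul z)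
  refine ⟨_, h1.congr_of_eventuallyEq (.of_forall fun ζ => ?_), fun a b => ?_⟩
  · have h2 := inv_conj_eq ζ z
    simp only [Pi.add_apply, smul_apply, ContinuousLinearMap.id_apply, Complex.real_smul, sub_zero,
      Pi.smul_apply]
    rw [h2]
    push_cast
    ring
  · have := hT' a b
    simp only [add_apply, smul_apply, ContinuousLinearMap.id_apply, map_add, map_smul, smul_eq_mul]
    linear_combination z * this

lemma isLiouvilleOn_field : (M.glue.field M.liouville).IsLiouvilleOn M.Ω M.offSet := by
  obtain ⟨ha, -, -⟩ := M.exists_baseField.choose_spec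
  refine M.glue.isLiouvilleOn_field M.preserves_glue M.equivariant_liouville
    M.offSurfaces_compat M.isOpen_offSurfaces (fun s x hx hxS => ?_) (fun s x hx hxS a b => ?_)
  · refine ((ha s.1 s.2 x hx hxS.2).1.comp x contDiffAt_fst).prodMk
      (ContDiffAt.mul ?_ contDiffAt_snd)
    refine Complex.ofRealCLM.contDiff.contDiffAt.comp x (contDiffAt_const.add
      (contDiffAt_const.div (contDiffAt_snd.norm_sq ℝ) ?_))
    simpa using hxS.1
  · obtain ⟨h1, h2⟩ := ha s.1 s.2 x hx hxS.2
    obtain ⟨T, hT, hT'⟩ := hasFDerivAt_radial (M.z s.1) hxS.1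
    have h3 := ((h1.differentiableAt (by simp)).hasFDerivAt.comp x
      (ContinuousLinearMap.fst ℝ ℂ ℂ).hasFDerivAt).prodMk
      (hT.comp x (ContinuousLinearMap.snd ℝ ℂ ℂ).hasFDerivAt)
    have h4 : fderiv ℝ (M.liouville s) x = _ := h3.fderiv
    rw [h4]
    have h5 := h2 a.1 b.1
    have h6 := hT' a.2 b.2
    simp only [sympForm_apply]
    simp only [ContinuousLinearMap.prod_apply, ContinuousLinearMap.comp_apply,
      ContinuousLinearMap.coe_fst', ContinuousLinearMap.coe_snd']
    linear_combination h5 + h6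

end PlumbingModel
end

/-! ### Convex neighborhoods of the surfaces -/

noncomputable section

open Set Filter ComplexConjugate

namespace PlumbingModel

variable {n : ℕ} {Γ : PlumbingGraph n} (M : PlumbingModel Γ)

/-- A function on the base of a sheet which vanishes exactly at the plumbing points and is `1` away
from them. -/
def weight (s : Fin n × Bool) (w : ℂ) : ℝ :=
  if s.2 then ∏ e, ramp (M.ε ^ 2) (‖w - M.plumb s.1 e‖ ^ 2) else 1

/-- The function whose sublevel sets are the convex neighborhoods of the surfaces. -/
def height (s : Fin n × Bool) (x : ℂ × ℂ) : ℝ := ‖x.2‖ ^ 2 / 2 * M.weight s x.1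

lemma contDiff_weight (s : Fin n × Bool) : ContDiff ℝ ∞ (M.weight s) := by
  unfold weight
  split_ifs
  · exact contDiff_prod fun e _ => (contDiff_ramp _).comp
      ((contDiff_id.sub contDiff_const).norm_sq ℝ)
  · exact contDiff_const

lemma contDiff_height (s : Fin n × Bool) : ContDiff ℝ ∞ (M.height s) :=
  ((contDiff_snd.norm_sq ℝ).div_const _).mul ((M.contDiff_weight s).comp contDiff_fst)

lemma weight_nonneg (s : Fin n × Bool) (w : ℂ) : 0 ≤ M.weight s w := by
  unfold weight
  split_ifs
  · exact Finset.prod_nonneg fun e _ => ramp_nonneg (by positivity)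
  · exact zero_le_one

lemma weight_pos {s : Fin n × Bool} {w : ℂ} (h : s.2 = true → ∀ e, w ≠ M.plumb s.1 e) :
    0 < M.weight s w := by
  unfold weight
  split_ifs with hs
  · refine Finset.prod_pos fun e _ => ramp_pos ?_
    have := norm_pos_iff.2 (sub_ne_zero.2 (h hs e))
    positivity
  · exact zero_lt_one

variable {M}

lemma sq_ε_pos : 0 < M.ε ^ 2 := by have := M.ε_pos; positivity

lemma ramp_of_far {u : ℂ} (h : 2 * M.ε ≤ ‖u‖) : ramp (M.ε ^ 2) (‖u‖ ^ 2) = 1 := by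
  refine ramp_of_ge sq_ε_pos ?_
  nlinarith [M.ε_pos]

lemma two_ε_le (i : Fin n) : 2 * M.ε ≤ M.d i / 4 := by linarith [M.ε_le i]

lemma weight_of_far {s : Fin n × Bool} {w : ℂ} (h : ∀ e, 2 * M.ε ≤ ‖w - M.plumb s.1 e‖) :
    M.weight s w = 1 := by
  unfold weight
  split_ifs
  · exact Finset.prod_eq_one fun e _ => ramp_of_far (h e)
  · rfl

lemma weight_of_near {i : Fin n} {e : Σ j, Fin (Γ.edges i j)} {w : ℂ}
    (h : ‖w - M.plumb i e‖ < M.d i / 4) :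
    M.weight (i, true) w = ramp (M.ε ^ 2) (‖w - M.plumb i e‖ ^ 2) := by
  rw [weight, if_pos rfl]
  refine Finset.prod_eq_single e (fun e' _ hne => ramp_of_far ?_) (by simp)
  by_contra hlt
  push Not at hlt
  have h1 := two_ε_le (M := M) i
  have h2 := M.d_pos i
  exact hne (eq_of_near_plumb (M := M) (w := w) (by linarith) (by linarith))

lemma weight_of_near' {i : Fin n} {e : Σ j, Fin (Γ.edges i j)} {w : ℂ}
    (h : ‖w - M.plumb i e‖ < M.ε) : M.weight (i, true) w = ‖w - M.plumb i e‖ ^ 2 / 2 := by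
  have h1 : ‖w - M.plumb i e‖ < M.d i / 4 := by
    have := two_ε_le (M := M) i
    have := M.ε_pos
    linarith
  rw [weight_of_near h1, ramp_of_le sq_ε_pos]
  have := norm_nonneg (w - M.plumb i e)
  nlinarith [M.ε_pos]

lemma weight_plumb_add {i : Fin n} (e : Σ j, Fin (Γ.edges i j)) {u : ℂ} (h : ‖u‖ < M.ε) :
    M.weight (i, true) (M.plumb i e + u) = ‖u‖ ^ 2 / 2 := by
  have h1 : M.plumb i e + u - M.plumb i e = u := by ring
  rw [weight_of_near' (by rwa [h1]), h1]

lemma weight_of_mem_collar {i : Fin n} {b : Option (Fin (Γ.genus i))} {x : ℂ × ℂ}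
    (hx : |M.gap i b x| < M.δ i) (s : Bool) : M.weight (i, s) x.1 = 1 :=
  weight_of_far fun e => (two_ε_le i).trans (far_of_mem_collar hx e).le

/-- Near a plumbing point the height is `‖x.2‖ ^ 2 * ‖x.1 - p‖ ^ 2 / 4`, which is symmetric in base
and fibre. -/
lemma height_compat (c : M.glue.κ) (x : ℂ × ℂ) (hx : x ∈ M.glue.D c) :
    M.height (M.glue.tgt c) (M.glue.φ c x) = M.height (M.glue.src c) x := by
  rcases c with ⟨i, b, s⟩ | c
  · have hx : x ∈ M.collar i b := hx
    have h2 := flip_mem_collar hx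
    change ‖(M.flip i b x).2‖ ^ 2 / 2 * M.weight (i, !s) (M.flip i b x).1 =
      ‖x.2‖ ^ 2 / 2 * M.weight (i, s) x.1
    rw [weight_of_mem_collar hx.2, weight_of_mem_collar h2.2, norm_flip_snd hx.2]
  · have hx : x ∈ M.polydisc c.1 c.2 := hx
    change ‖x.1 - M.plumb c.1 c.2‖ ^ 2 / 2 *
      M.weight (c.2.1, true) (M.plumb c.2.1 (otherEnd c).2 + x.2) =
      ‖x.2‖ ^ 2 / 2 * M.weight (c.1, true) x.1
    have h1 : M.weight (c.2.1, true) (M.plumb c.2.1 (otherEnd c).2 + x.2) = _ :=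
      weight_plumb_add (otherEnd c).2 hx.2
    rw [weight_of_near' hx.1, h1]
    ring

variable (M) in
/-- The function `height` on the plumbing. -/
def heightFun : M.glue.Space → ℝ := M.glue.lift M.height

lemma heightFun_pt {s : Fin n × Bool} {x : ℂ × ℂ} (hx : x ∈ M.sheetSet s.1) :
    M.heightFun (M.glue.pt s x) = M.height s x := M.glue.lift_pt height_compat hx

lemma contMDiff_heightFun : ContMDiff (𝓡 4) 𝓘(ℝ, ℝ) ∞ M.heightFun := by
  intro p
  obtain ⟨s, x, hx, rfl⟩ := M.glue.exists_rep p
  refine M.glue.contMDiffAt_of_comp_pt hx ?_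
  refine ((M.contDiff_height s).contMDiff.contMDiffAt).congr_of_eventuallyEq ?_
  filter_upwards [(M.glue.isOpen_U s).mem_nhds hx] with y hy using heightFun_pt hy

lemma heightFun_nonneg (p : M.glue.Space) : 0 ≤ M.heightFun p :=
  mul_nonneg (by positivity) (M.weight_nonneg _ _)

lemma height_pos_iff {s : Fin n × Bool} {x : ℂ × ℂ} :
    0 < M.height s x ↔ x ∈ M.offSurfaces s := by
  constructor
  · intro h
    refine ⟨fun h0 => ?_, fun hs e he => ?_⟩
    · rw [height, h0, norm_zero] at h
      simp at h
    · have : M.weight s x.1 = 0 := by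
        rw [weight, if_pos hs]
        refine Finset.prod_eq_zero (Finset.mem_univ e) ?_
        rw [he, sub_self, norm_zero, ramp_of_le sq_ε_pos] <;> simp [M.ε_pos.le]
      rw [height, this, mul_zero] at h
      exact lt_irrefl _ h
  · intro h
    have := norm_pos_iff.2 h.1
    exact mul_pos (by positivity) (M.weight_pos h.2)

lemma heightFun_pos_iff (p : M.glue.Space) : 0 < M.heightFun p ↔ p ∈ M.offSet := height_pos_iff

/-- The weight is nondecreasing along the Liouville field, as this points away from the plumbing
points, where the weight is not constant: the residues `z j` are positive. -/
lemma fderiv_weight_nonneg {i : Fin n} {s : Bool} {x : ℂ × ℂ} (hx : x ∈ M.offSurfaces (i, s)) :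
    0 ≤ fderiv ℝ (M.weight (i, s)) x.1 (M.baseField (i, s) x.1) := by
  obtain ⟨-, -, hc⟩ := M.exists_baseField.choose_spec
  by_cases h : ∃ e, s = true ∧ ‖x.1 - M.plumb i e‖ < M.d i / 4
  · obtain ⟨e, rfl, he⟩ := h
    have h1 : M.weight (i, true) =ᶠ[𝓝 x.1]
        fun w => ramp (M.ε ^ 2) (‖w - M.plumb i e‖ ^ 2) := by
      have h2 : x.1 ∈ {w | ‖w - M.plumb i e‖ < M.d i / 4} := he
      filter_upwards [(isOpen_lt (by fun_prop) continuous_const).mem_nhds h2] with w hw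
        using weight_of_near hw
    have h3 : M.baseField (i, true) x.1 = _ := hc i e x.1 he
    have h4 : HasFDerivAt (fun w => ‖w - M.plumb i e‖ ^ 2) _ x.1 :=
      (((hasFDerivAt_id x.1).sub_const (M.plumb i e))).norm_sq
    have h5 := ((contDiff_ramp (M.ε ^ 2)).differentiable (by simp) _).hasDerivAt.comp_hasFDerivAt
      x.1 h4
    have h6 : fderiv ℝ (fun w => ramp (M.ε ^ 2) (‖w - M.plumb i e‖ ^ 2)) x.1 = _ := h5.fderiv
    rw [h1.fderiv_eq, h6, h3]
    have h7 : 0 < ‖x.1 - M.plumb i e‖ := norm_pos_iff.2 (sub_ne_zero.2 (hx.2 rfl e))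
    have h8 := M.z_pos e.1
    have h9 : M.ε ^ 2 ≤ 1 := by nlinarith [M.ε_le i, M.d_le i, M.ε_pos]
    simp only [smul_apply, smul_eq_mul, id]
    refine mul_nonneg (deriv_ramp_nonneg sq_ε_pos h9) ?_
    simp only [ContinuousLinearMap.comp_apply, innerSL_apply_apply, ContinuousLinearMap.id_apply]
    rw [← Complex.real_smul, inner_smul_right, real_inner_self_eq_norm_sq]
    positivity
  · push Not at h
    have h1 : M.weight (i, s) =ᶠ[𝓝 x.1] fun _ => 1 := by
      cases s with
      | false => exact .of_forall fun w => rfl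
      | true =>
        have h2 : ∀ᶠ w in 𝓝 x.1, ∀ e, M.ε ^ 2 * 2 < ‖w - M.plumb i e‖ ^ 2 := by
          rw [eventually_all]
          intro e
          refine (ContinuousAt.eventually_lt continuousAt_const
            (by fun_prop : ContinuousAt (fun w => ‖w - M.plumb i e‖ ^ 2) x.1) ?_)
          have := h e rfl
          have h3 := two_ε_le (M := M) i
          have h4 : 2 * M.ε ≤ ‖x.1 - M.plumb i e‖ := h3.trans this
          nlinarith [M.ε_pos]
        filter_upwards [h2] with w hw
        rw [weight, if_pos rfl]
        exact Finset.prod_eq_one fun e _ => ramp_of_ge sq_ε_pos (by linarith [hw e])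
    rw [h1.fderiv_eq]
    simp

/-- The height increases along the Liouville field: the factor `‖x.2‖ ^ 2` does since `z i` is
positive, and the weight does not decrease. -/
lemma derivAlong_heightFun_pos {p : M.glue.Space} (hp : p ∈ M.offSet) :
    0 < (M.glue.field M.liouville).derivAlong M.heightFun p := by
  set s := M.glue.sheet p with hs
  set x := M.glue.base p with hx
  have hxS : x ∈ M.offSurfaces s := hp
  have h1 := M.glue.mfderiv_real (f := M.heightFun) (p := p) (h := M.height s)
    ((M.contDiff_height s).differentiable (by simp) _) (by
      filter_upwards [(M.glue.isOpen_U s).mem_nhds (M.glue.base_mem p)] with y hy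
        using heightFun_pt hy)
  have h2 : (M.glue.field M.liouville).derivAlong M.heightFun p =
      fderiv ℝ (M.height s) x (M.liouville s x) := by
    refine (congrArg (fun T : EuclideanSpace ℝ (Fin 4) →L[ℝ] ℝ =>
      T (M.glue.e.symm (M.liouville s x))) h1).trans ?_
    simp [hx]
  rw [h2]
  have h3 : HasFDerivAt (fun x : ℂ × ℂ => ‖x.2‖ ^ 2) _ x := (hasFDerivAt_snd (𝕜 := ℝ)).norm_sq
  have h4 := ((M.contDiff_weight s).differentiable (by simp) x.1).hasFDerivAt.comp x
    (hasFDerivAt_fst (𝕜 := ℝ))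
  have h5 : fderiv ℝ (M.height s) x = _ := ((h3.mul_const (1 / 2)).mul h4 |>.congr_of_eventuallyEq
    (.of_forall fun y => by simp [height, div_eq_mul_inv])).fderiv
  rw [h5]
  have h6 := fderiv_weight_nonneg (i := s.1) (s := s.2) hxS
  have h7 := M.weight_pos hxS.2
  have h8 := norm_pos_iff.2 hxS.1
  have h9 : inner ℝ x.2 (M.liouville s x).2 = ‖x.2‖ ^ 2 / 2 + M.z s.1 := by
    change inner ℝ x.2 ((1 / 2 + M.z s.1 / ‖x.2‖ ^ 2 : ℝ) * x.2) = _
    rw [← Complex.real_smul, inner_smul_right, real_inner_self_eq_norm_sq]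
    field_simp
  have h10 := M.z_pos s.1
  simp only [add_apply, smul_apply, smul_eq_mul, ContinuousLinearMap.comp_apply,
    ContinuousLinearMap.coe_fst', ContinuousLinearMap.coe_snd', innerSL_apply_apply,
    Function.comp_apply, h9]
  have h11 : (M.liouville s x).1 = M.baseField (s.1, s.2) x.1 := rfl
  rw [h11]
  have h12 : 0 ≤ ‖x.2‖ ^ 2 * (1 / 2) * fderiv ℝ (M.weight s) x.1 (M.baseField (s.1, s.2) x.1) :=
    mul_nonneg (by positivity) h6
  have : 0 < M.weight s x.1 * (1 / 2 * 2 • (‖x.2‖ ^ 2 / 2 + M.z s.1)) := by positivity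
  exact add_pos_of_nonneg_of_pos h12 this

lemma mfderiv_heightFun_ne_zero {p : M.glue.Space} (hp : p ∈ M.offSet) :
    mfderiv (𝓡 4) 𝓘(ℝ, ℝ) M.heightFun p ≠ 0 := by
  intro h
  have h1 := derivAlong_heightFun_pos hp
  rw [VecField.derivAlong, h] at h1
  exact lt_irrefl _ h1

lemma contMDiff_heightFun_sub (t : ℝ) :
    ContMDiff (𝓡 4) 𝓘(ℝ, ℝ) ∞ fun p => M.heightFun p - t :=
  contMDiff_heightFun.sub contMDiff_const

lemma mfderiv_heightFun_sub (t : ℝ) (p : M.glue.Space) :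
    (mfderiv (𝓡 4) 𝓘(ℝ, ℝ) (fun p => M.heightFun p - t) p : EuclideanSpace ℝ (Fin 4) →L[ℝ] ℝ) =
      mfderiv (𝓡 4) 𝓘(ℝ, ℝ) M.heightFun p := by
  have h1 := (M.contDiff_height (M.glue.sheet p)).differentiable (by simp) (M.glue.base p)
  have h2 : ∀ᶠ y in 𝓝 (M.glue.base p), M.heightFun (M.glue.pt (M.glue.sheet p) y) =
      M.height (M.glue.sheet p) y := by
    filter_upwards [(M.glue.isOpen_U _).mem_nhds (M.glue.base_mem p)] with y hy
      using heightFun_pt hy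
  have h3 := M.glue.mfderiv_real (f := fun p => M.heightFun p - t)
    (h := fun y => M.height (M.glue.sheet p) y - t) (p := p) (h1.sub_const t)
    (h2.mono fun y hy => by simp only [hy])
  have h4 := M.glue.mfderiv_real (f := M.heightFun) (p := p) h1 h2
  refine h3.trans (Eq.trans ?_ h4.symm)
  rw [fderiv_sub_const]

variable (M) in
/-- The closed tubes, which cover the small sublevel sets of the height function. -/
def tube (i : Fin n) : Set (ℂ × ℂ) := {x | ‖x.2‖ ≤ M.ε / 2 ∧ ∀ b, M.gap i b x ≤ 0}

lemma tube_subset {i : Fin n} : M.tube i ⊆ M.sheetSet i := fun x hx =>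
  ⟨by linarith [hx.1, M.ε_pos], fun b => (hx.2 b).trans_lt (M.δ_pos i)⟩

lemma isCompact_tube (i : Fin n) : IsCompact (M.tube i) := by
  refine Metric.isCompact_of_isClosed_isBounded ?_ ?_
  · have : M.tube i = {x | ‖x.2‖ ≤ M.ε / 2} ∩ ⋂ b, {x | M.gap i b x ≤ 0} := by
      ext x; simp [tube]
    rw [this]
    exact (isClosed_le (by fun_prop) continuous_const).inter
      (isClosed_iInter fun b => isClosed_le (continuous_gap b) continuous_const)
  · refine (Metric.isBounded_closedBall (x := (0 : ℂ × ℂ))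
      (r := M.ε + √(M.R i ^ 2 + M.tw i * M.ε ^ 2))).subset fun x hx => ?_
    rw [mem_closedBall_zero_iff, Prod.norm_def]
    have h1 := hx.2 none
    have h2 := hx.1
    have h3 := M.ε_pos
    change 1 * (‖x.1 - 0‖ ^ 2 - M.R i ^ 2 - M.tw i * ‖x.2‖ ^ 2 / 2) ≤ 0 at h1
    rw [sub_zero] at h1
    have h4 : ‖x.2‖ ^ 2 ≤ M.ε ^ 2 := by nlinarith [norm_nonneg x.2]
    have h5 : M.tw i * ‖x.2‖ ^ 2 ≤ M.tw i * M.ε ^ 2 :=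
      mul_le_mul_of_nonneg_left h4 (Nat.cast_nonneg _)
    have h6 : 0 ≤ M.tw i * ‖x.2‖ ^ 2 := by positivity
    refine max_le ?_ ?_
    · refine le_trans (Real.le_sqrt_of_sq_le ?_) (le_add_of_nonneg_left h3.le)
      linarith
    · linarith [Real.sqrt_nonneg (M.R i ^ 2 + M.tw i * M.ε ^ 2)]

/-- Each point is represented by a point which lies on the inner side of all boundaries. -/
lemma exists_rep_core (p : M.glue.Space) : ∃ (s : Fin n × Bool) (x : ℂ × ℂ), ‖x.2‖ < M.ε ∧
    (∀ b, M.gap s.1 b x ≤ 0) ∧ M.glue.pt s x = p := by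
  obtain ⟨s, x, hx, rfl⟩ := M.glue.exists_rep p
  have hx : x ∈ M.sheetSet s.1 := hx
  by_cases h : ∀ b, M.gap s.1 b x ≤ 0
  · exact ⟨s, x, hx.1, h, rfl⟩
  · push Not at h
    obtain ⟨b, hb⟩ := h
    have hδ := M.δ_pos s.1
    have hxb : x ∈ M.collar s.1 b := ⟨hx.1, abs_lt.2 ⟨by linarith, hx.2 b⟩⟩
    have h2 := flip_mem_collar hxb
    refine ⟨(s.1, !s.2), M.flip s.1 b x, h2.1, fun b' => ?_,
      M.glue.pt_φ (c := .inl ⟨s.1, b, s.2⟩) hxb⟩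
    by_cases hbb : b = b'
    · subst hbb
      have : M.gap s.1 b (M.flip s.1 b x) = -M.gap s.1 b x := gap_flip hxb.2
      change M.gap s.1 b (M.flip s.1 b x) ≤ 0
      linarith
    · have : M.gap s.1 b' (M.flip s.1 b x) ≤ -M.δ s.1 := gap_le_of_near hbb h2.2
      change M.gap s.1 b' (M.flip s.1 b x) ≤ 0
      linarith

/-- A point at small height which is far out in the fibre lies over a neighborhood of a plumbing
point. Exchanging base and fibre brings it close to the surface of the other vertex. -/
lemma sublevel_subset {t : ℝ} (ht : t < M.ε ^ 4 / 64) :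
    {p | M.heightFun p ≤ t} ⊆ ⋃ s : Fin n × Bool, M.glue.pt s '' M.tube s.1 := by
  intro p hp
  obtain ⟨s, x, hx, hg, rfl⟩ := exists_rep_core p
  have hxU : x ∈ M.sheetSet s.1 := ⟨hx, fun b => (hg b).trans_lt (M.δ_pos _)⟩
  have hp : M.height s x ≤ t := by
    have : M.heightFun (M.glue.pt s x) ≤ t := hp
    rwa [heightFun_pt hxU] at this
  by_cases h : ‖x.2‖ ≤ M.ε / 2
  · exact mem_iUnion.2 ⟨s, x, ⟨h, hg⟩, rfl⟩
  push Not at h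
  have hε := M.ε_pos
  have hε1 : M.ε ^ 2 / 8 ≤ 1 := by nlinarith [M.ε_le s.1, M.d_le s.1]
  -- The point is far out in the fibre, so its weight has to be small.
  have hw : M.weight s x.1 < M.ε ^ 2 / 8 := by
    by_contra hcon
    push Not at hcon
    have h1 : M.ε ^ 2 / 4 ≤ ‖x.2‖ ^ 2 := by nlinarith
    have h2 : M.ε ^ 2 / 4 / 2 * (M.ε ^ 2 / 8) ≤ ‖x.2‖ ^ 2 / 2 * M.weight s x.1 := by gcongr
    rw [height] at hp
    nlinarith
  obtain ⟨i, s⟩ := s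
  obtain ⟨e, rfl, he⟩ : ∃ e, s = true ∧ ‖x.1 - M.plumb i e‖ < M.ε / 2 := by
    by_cases h1 : ∃ e, s = true ∧ ‖x.1 - M.plumb i e‖ < M.d i / 4
    · obtain ⟨e, rfl, he⟩ := h1
      refine ⟨e, rfl, ?_⟩
      by_contra hcon
      push Not at hcon
      rw [weight_of_near he, ramp] at hw
      have h2 := Real.smoothTransition.nonneg ((‖x.1 - M.plumb i e‖ ^ 2 - M.ε ^ 2) / M.ε ^ 2)
      have h3 := Real.smoothTransition.le_one ((‖x.1 - M.plumb i e‖ ^ 2 - M.ε ^ 2) / M.ε ^ 2)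
      have h4 : M.ε ^ 2 / 4 ≤ ‖x.1 - M.plumb i e‖ ^ 2 := by nlinarith
      nlinarith
    · push Not at h1
      have : M.weight (i, s) x.1 = 1 := by
        cases s with
        | false => rfl
        | true => exact weight_of_far fun e => (two_ε_le i).trans (h1 e rfl)
      linarith
  have hxP : x ∈ M.polydisc i e := ⟨by linarith, hx⟩
  have h2 : M.swap ⟨i, e⟩ x ∈ M.polydisc e.1 (otherEnd ⟨i, e⟩).2 :=
    M.glue.φ_mem (.inr ⟨i, e⟩) x hxP
  refine mem_iUnion.2 ⟨(e.1, true), M.swap ⟨i, e⟩ x, ⟨he.le, fun b => ?_⟩,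
    M.glue.pt_φ (c := .inr ⟨i, e⟩) hxP⟩
  have := gap_le_of_mem_polydisc h2 b
  have := M.δ_pos e.1
  linarith

lemma isCompact_sublevel {t : ℝ} (ht : t < M.ε ^ 4 / 64) :
    IsCompact {p | M.heightFun p ≤ t} := by
  refine IsCompact.of_isClosed_subset (isCompact_iUnion fun s => ?_)
    (isClosed_le contMDiff_heightFun.continuous continuous_const) (sublevel_subset ht)
  exact (isCompact_tube s.1).image_of_continuousOn
    ((M.glue.continuousOn_pt s).mono tube_subset)

/-- The height has no positive critical value, hence no local maximum on a level set. -/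
lemma frontier_sublevel {t : ℝ} (ht : 0 < t) :
    frontier {p | M.heightFun p ≤ t} = {p | M.heightFun p = t} := by
  refine Subset.antisymm
    (frontier_le_subset_eq contMDiff_heightFun.continuous continuous_const) fun p hp => ?_
  have hp : M.heightFun p = t := hp
  refine ⟨subset_closure hp.le, fun hi => ?_⟩
  have hoff : p ∈ M.offSet := (heightFun_pos_iff p).1 (hp ▸ ht)
  have h1 := (M.contDiff_height (M.glue.sheet p)).differentiable (by simp) (M.glue.base p)
  have h2 : ∀ᶠ y in 𝓝 (M.glue.base p), M.heightFun (M.glue.pt (M.glue.sheet p) y) =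
      M.height (M.glue.sheet p) y := by
    filter_upwards [(M.glue.isOpen_U _).mem_nhds (M.glue.base_mem p)] with y hy
      using heightFun_pt hy
  have h4 := M.glue.mfderiv_real (f := M.heightFun) (p := p) h1 h2
  have h5 : IsLocalMax (M.height (M.glue.sheet p)) (M.glue.base p) := by
    have h6 : ContinuousAt (M.glue.pt (M.glue.sheet p)) (M.glue.base p) :=
      (M.glue.continuousOn_pt _).continuousAt ((M.glue.isOpen_U _).mem_nhds (M.glue.base_mem p))
    have h7 : ∀ᶠ q in 𝓝 p, M.heightFun q ≤ t := mem_interior_iff_mem_nhds.1 hi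
    rw [← M.glue.pt_base p] at h7
    filter_upwards [h6.eventually h7, h2] with y hy hy2
    rw [← hy2]
    refine hy.trans (le_of_eq ?_)
    have := h2.self_of_nhds
    rw [M.glue.pt_base] at this
    rw [← this, hp]
  rw [h5.fderiv_eq_zero] at h4
  exact mfderiv_heightFun_ne_zero hoff (h4.trans (ContinuousLinearMap.zero_comp _))

lemma isConvexNeighborhood_sublevel {t : ℝ} (ht : 0 < t) (ht' : t < M.ε ^ 4 / 64) :
    IsConvexNeighborhood M.Ω M.offSetᶜ {p | M.heightFun p ≤ t} := by
  have hoff : M.offSet = {p | 0 < M.heightFun p} := ext fun p => (heightFun_pos_iff p).symm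
  refine ⟨isCompact_sublevel ht', ?_, M.offSet, M.glue.field M.liouville,
    fun p => M.heightFun p - t, ?_, ?_, M.isLiouvilleOn_field,
    (contMDiff_heightFun_sub t).contMDiffOn, ?_, ?_, ?_⟩
  · refine fun p hp => mem_interior.2 ⟨{p | M.heightFun p < t},
      fun q hq => (show M.heightFun q ≤ t from le_of_lt hq),
      isOpen_lt contMDiff_heightFun.continuous continuous_const, ?_⟩
    rw [hoff] at hp
    exact lt_of_le_of_lt (not_lt.1 (show ¬0 < M.heightFun p from hp)) ht
  · rw [hoff]
    exact isOpen_lt continuous_const contMDiff_heightFun.continuous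
  · rw [frontier_sublevel ht, hoff]
    intro p hp
    have hp : M.heightFun p = t := hp
    exact ht.trans_eq hp.symm
  · ext p
    simp [and_comm]
  · rw [frontier_sublevel ht, hoff]
    ext p
    simp only [mem_ofPred_eq, sub_eq_zero]
    exact ⟨fun h => ⟨ht.trans_eq h.symm, h⟩, fun h => h.2⟩
  · intro p hp
    rw [frontier_sublevel ht] at hp
    have hp : M.heightFun p = t := hp
    have h1 := derivAlong_heightFun_pos ((heightFun_pos_iff p).1 (hp ▸ ht))
    rw [VecField.derivAlong] at h1 ⊢
    exact h1.trans_eq (congrArg (fun T : EuclideanSpace ℝ (Fin 4) →L[ℝ] ℝ => T _)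
      (mfderiv_heightFun_sub t p).symm)

end PlumbingModel
end

/-! ### The surfaces as doubles of discs with holes -/

noncomputable section

open Set Filter ComplexConjugate

namespace PlumbingModel

variable {n : ℕ} {Γ : PlumbingGraph n} {M : PlumbingModel Γ} {i : Fin n}

variable (M) in
/-- The closed disc with holes. -/
def core (i : Fin n) : Set ℂ := {w | ∀ b, M.gap i b (w, 0) ≤ 0}

lemma gap_none (w : ℂ) : M.gap i none (w, 0) = ‖w‖ ^ 2 - M.R i ^ 2 := by
  simp [gap, toricGap, sgn, ctr, rad]

lemma gap_some (k : Fin (Γ.genus i)) (w : ℂ) :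
    M.gap i (some k) (w, 0) = M.ρ i ^ 2 - ‖w - M.pos i (k + 1)‖ ^ 2 := by
  simp [gap, toricGap, sgn, ctr, rad]

lemma mem_core {w : ℂ} :
    w ∈ M.core i ↔ ‖w‖ ≤ M.R i ∧ ∀ k : Fin (Γ.genus i), M.ρ i ≤ ‖w - M.pos i (k + 1)‖ := by
  have h1 := M.ρ_pos i
  have h2 := R_pos (M := M) (i := i)
  constructor
  · intro h
    have h3 := h none
    rw [gap_none] at h3
    refine ⟨abs_le_of_sq_le_sq' (by linarith) h2.le |>.2, fun k => ?_⟩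
    have h4 := h (some k)
    rw [gap_some] at h4
    exact abs_le_of_sq_le_sq' (by linarith) (norm_nonneg _) |>.2
  · rintro ⟨h3, h4⟩ (_ | k)
    · rw [gap_none]
      nlinarith [norm_nonneg w]
    · rw [gap_some]
      nlinarith [h4 k]

lemma core_subset {w : ℂ} (hw : w ∈ M.core i) : (w, 0) ∈ M.sheetSet i :=
  ⟨by simpa using M.ε_pos, fun b => (hw b).trans_lt (M.δ_pos i)⟩

lemma isCompact_core (i : Fin n) : IsCompact (M.core i) := by
  refine Metric.isCompact_of_isClosed_isBounded ?_
    ((Metric.isBounded_closedBall (x := (0 : ℂ)) (r := M.R i)).subset fun w hw => ?_)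
  · have : M.core i = ⋂ b, {w | M.gap i b (w, 0) ≤ 0} := by ext; simp [core]
    rw [this]
    exact isClosed_iInter fun b => isClosed_le ((continuous_gap b).comp (by fun_prop))
      continuous_const
  · rw [mem_closedBall_zero_iff]
    exact (mem_core.1 hw).1

lemma conj_pos (k : ℕ) : conj (M.pos i k) = M.pos i k := Complex.conj_ofReal _

lemma conj_ctr (b : Option (Fin (Γ.genus i))) : conj (M.ctr i b) = M.ctr i b := by
  cases b
  · exact map_zero _
  · exact conj_pos _

lemma norm_conj_sub_pos (w : ℂ) (k : ℕ) : ‖conj w - M.pos i k‖ = ‖w - M.pos i k‖ := by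
  rw [← RCLike.norm_conj (w - M.pos i k), map_sub, conj_pos]

lemma gap_conj (b : Option (Fin (Γ.genus i))) (w : ℂ) :
    M.gap i b (conj w, 0) = M.gap i b (w, 0) := by
  cases b with
  | none => rw [gap_none, gap_none, RCLike.norm_conj]
  | some k => rw [gap_some, gap_some, norm_conj_sub_pos]

lemma conj_mem_core {w : ℂ} (hw : w ∈ M.core i) : conj w ∈ M.core i := fun b => by
  rw [gap_conj]; exact hw b

/-- The boundary circles are glued by complex conjugation. -/
lemma flip_of_gap_eq_zero {b : Option (Fin (Γ.genus i))} {w : ℂ} (h : M.gap i b (w, 0) = 0) :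
    M.flip i b (w, 0) = (conj w, 0) := by
  have hd : |M.gap i b (w, 0)| < M.δ i := by rw [h, abs_zero]; exact M.δ_pos i
  have h1 := ne_ctr hd
  have h2 : 0 < ‖w - M.ctr i b‖ := norm_pos_iff.2 (sub_ne_zero.2 h1)
  have h3 : toricSq (M.ctr i b) (M.rad i b) (M.twist i b) (w, 0) = ‖w - M.ctr i b‖ ^ 2 := by
    have h4 := abs_gap (M := M) b (w, 0)
    rw [h, abs_zero] at h4
    have h4 := abs_eq_zero.1 h4.symm
    rw [toricGap] at h4
    rw [toricSq]
    linarith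
  rw [flip, toricMap, h3, Real.sqrt_sq h2.le, div_self h2.ne', map_sub, conj_ctr]
  simp

lemma flip_zero_snd (b : Option (Fin (Γ.genus i))) (w : ℂ) :
    M.flip i b (w, 0) = ((M.flip i b (w, 0)).1, 0) := Prod.ext rfl (by simp [flip, toricMap])

lemma exists_rep_surface (p : (M.surfaceGlue i).Space) :
    ∃ s : Bool, ∃ w ∈ M.core i, (M.surfaceGlue i).pt s w = p := by
  obtain ⟨s, w, hw, rfl⟩ := (M.surfaceGlue i).exists_rep p
  have hw : (w, 0) ∈ M.sheetSet i := hw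
  by_cases h : w ∈ M.core i
  · exact ⟨s, w, h, rfl⟩
  · have h' : ∃ b, 0 < M.gap i b (w, 0) := by
      by_contra hcon
      push Not at hcon
      exact h hcon
    obtain ⟨b, hb⟩ := h'
    have hδ := M.δ_pos i
    have hwb : (w, 0) ∈ M.collar i b := ⟨hw.1, abs_lt.2 ⟨by linarith, hw.2 b⟩⟩
    have h2 := flip_mem_collar hwb
    refine ⟨!s, (M.flip i b (w, 0)).1, fun b' => ?_, (M.surfaceGlue i).pt_φ (c := (b, s)) hwb⟩
    rw [← flip_zero_snd]
    by_cases hbb : b = b'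
    · subst hbb
      rw [gap_flip hwb.2]
      linarith
    · linarith [gap_le_of_near hbb h2.2]

/-- On the discs with holes only boundary points of different sheets are identified, namely with
their conjugates. -/
lemma surface_pt_eq {s s' : Bool} {w w' : ℂ} (hw : w ∈ M.core i) (hw' : w' ∈ M.core i) :
    (M.surfaceGlue i).pt s w = (M.surfaceGlue i).pt s' w' ↔
      (s = s' ∧ w = w') ∨ (s ≠ s' ∧ w' = conj w ∧ ∃ b, M.gap i b (w, 0) = 0) := by
  refine ((M.surfaceGlue i).pt_eq_pt (core_subset hw) (core_subset hw')).trans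
    (or_congr Iff.rfl ⟨?_, ?_⟩)
  · rintro ⟨⟨b, t⟩, rfl, rfl, hD, h⟩
    have hD : (w, 0) ∈ M.collar i b := hD
    have h : (M.flip i b (w, 0)).1 = w' := h
    have h1 := gap_flip hD.2
    rw [flip_zero_snd, h] at h1
    have h2 : M.gap i b (w, 0) = 0 := by linarith [hw b, hw' b]
    refine ⟨by simp [surfaceGlue], ?_, b, h2⟩
    rw [← h, flip_of_gap_eq_zero h2]
  · rintro ⟨h1, rfl, b, h2⟩
    have hD : (w, 0) ∈ M.collar i b :=
      ⟨by simpa using M.ε_pos, by rw [h2, abs_zero]; exact M.δ_pos i⟩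
    refine ⟨(b, s), rfl, ?_, hD, ?_⟩
    · cases s <;> cases s' <;> first | rfl | exact absurd rfl h1
    · exact congrArg Prod.fst (flip_of_gap_eq_zero h2)

instance : CompactSpace (M.surfaceGlue i).Space := by
  refine ⟨?_⟩
  have : (univ : Set (M.surfaceGlue i).Space) =
      ⋃ s : Bool, (M.surfaceGlue i).pt s '' M.core i := by
    refine (eq_univ_of_forall fun p => ?_).symm
    obtain ⟨s, w, hw, rfl⟩ := exists_rep_surface p
    exact mem_iUnion.2 ⟨s, w, hw, rfl⟩
  rw [this]
  exact isCompact_iUnion fun s => (isCompact_core i).image_of_continuousOn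
    (((M.surfaceGlue i).continuousOn_pt s).mono fun w hw => core_subset hw)

variable (M) in
/-- The upper half of the disc with holes. -/
def upperCore (i : Fin n) : Set ℂ := {w | w ∈ M.core i ∧ 0 ≤ w.im}

variable (M) in
/-- The upper half disc. -/
def halfDisc (i : Fin n) : Set ℂ := {w | ‖w‖ ≤ M.R i ∧ 0 ≤ w.im}

variable (M) in
/-- The upper boundary of the holes as a graph over the real axis. It is meant to be zero outside of
the holes, which uses that the square root of a negative number is zero. -/
def profile (i : Fin n) (x : ℝ) : ℝ :=
  ∑ k : Fin (Γ.genus i), √(M.ρ i ^ 2 - (x - M.d i * (k + 1)) ^ 2)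

variable (M) in
lemma continuous_profile (i : Fin n) : Continuous (M.profile i) := by
  unfold profile
  fun_prop

/-- The summands of the profile are not zero over disjoint intervals. -/
lemma profile_cases (x : ℝ) :
    (M.profile i x = 0 ∧ ∀ k : Fin (Γ.genus i), M.ρ i ≤ |x - M.d i * (k + 1)|) ∨
    ∃ k : Fin (Γ.genus i), |x - M.d i * (k + 1)| < M.ρ i ∧
      M.profile i x = √(M.ρ i ^ 2 - (x - M.d i * (k + 1)) ^ 2) := by
  have h1 := M.ρ_pos i
  have hsqrt : ∀ k : Fin (Γ.genus i), M.ρ i ≤ |x - M.d i * (k + 1)| →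
      √(M.ρ i ^ 2 - (x - M.d i * (k + 1)) ^ 2) = 0 := fun k hk => by
    refine Real.sqrt_eq_zero_of_nonpos ?_
    have : M.ρ i ^ 2 ≤ |x - M.d i * (k + 1)| ^ 2 := by gcongr
    rw [sq_abs] at this
    linarith
  by_cases h : ∃ k : Fin (Γ.genus i), |x - M.d i * (k + 1)| < M.ρ i
  · obtain ⟨k, hk⟩ := h
    refine .inr ⟨k, hk, Finset.sum_eq_single k (fun l _ hl => hsqrt l ?_) (by simp)⟩
    have h2 := le_norm_pos_sub (M := M) (i := i) (k := (l : ℕ) + 1) (l := (k : ℕ) + 1)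
      fun h => hl (Fin.ext (by omega))
    have h3 : M.pos i ((l : ℕ) + 1) - M.pos i ((k : ℕ) + 1) =
        (((x - M.d i * (k + 1)) - (x - M.d i * (l + 1)) : ℝ) : ℂ) := by
      simp [pos]
    rw [h3, Complex.norm_real, Real.norm_eq_abs] at h2
    have h4 := abs_sub (x - M.d i * (k + 1)) (x - M.d i * (l + 1))
    have h5 := M.ρ_le i
    linarith
  · push Not at h
    exact .inl ⟨Finset.sum_eq_zero fun k _ => hsqrt k (h k), h⟩

lemma profile_nonneg (x : ℝ) : 0 ≤ M.profile i x := Finset.sum_nonneg fun _ _ => Real.sqrt_nonneg _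

lemma profile_le (x : ℝ) : M.profile i x ≤ M.R i / 4 := by
  have h1 := M.ρ_pos i
  have h2 := M.ρ_le i
  have h3 := d_le_R (M := M) (i := i)
  have h4 := M.d_pos i
  rcases profile_cases (M := M) (i := i) x with h | ⟨k, -, h⟩
  · rw [h.1]; linarith
  · rw [h]
    refine (Real.sqrt_le_left (by linarith)).2 ?_
    nlinarith [sq_nonneg (x - M.d i * (k + 1))]

lemma le_sqrt_of_profile_ne_zero {x : ℝ} (h : M.profile i x ≠ 0) :
    M.R i / 2 ≤ √(M.R i ^ 2 - x ^ 2) := by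
  rcases profile_cases (M := M) (i := i) x with h' | ⟨k, hk, -⟩
  · exact absurd h'.1 h
  have h1 := M.ρ_pos i
  have h2 := M.ρ_le i
  have h3 := d_le_R (M := M) (i := i)
  have h4 := M.d_pos i
  have h5 := norm_pos_le (M := M) (i := i) (k := (k : ℕ) + 1) (by have := k.2; omega)
  rw [pos, Complex.norm_real, Real.norm_of_nonneg (by positivity)] at h5
  push_cast at h5
  have h6 : |x| ≤ M.R i / 2 := by
    have := abs_sub_abs_le_abs_sub x (M.d i * (k + 1))
    rw [abs_of_nonneg (a := M.d i * (k + 1)) (by positivity)] at this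
    linarith
  refine Real.le_sqrt_of_sq_le ?_
  have h7 : x ^ 2 ≤ (M.R i / 2) ^ 2 := by
    rw [← sq_abs]; gcongr
  nlinarith

lemma norm_sq_sub_pos (w : ℂ) (k : ℕ) :
    ‖w - M.pos i (k + 1)‖ ^ 2 = (w.re - M.d i * (k + 1)) ^ 2 + w.im ^ 2 := by
  rw [← Complex.normSq_eq_norm_sq, Complex.normSq_apply]
  simp [pos]
  ring

lemma norm_sq_eq (w : ℂ) : ‖w‖ ^ 2 = w.re ^ 2 + w.im ^ 2 := by
  rw [← Complex.normSq_eq_norm_sq, Complex.normSq_apply]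
  ring

lemma mem_halfDisc {w : ℂ} :
    w ∈ M.halfDisc i ↔ |w.re| ≤ M.R i ∧ 0 ≤ w.im ∧ w.im ≤ √(M.R i ^ 2 - w.re ^ 2) := by
  have h1 := R_pos (M := M) (i := i)
  constructor
  · rintro ⟨h2, h3⟩
    refine ⟨(Complex.abs_re_le_norm w).trans h2, h3, Real.le_sqrt_of_sq_le ?_⟩
    have : ‖w‖ ^ 2 ≤ M.R i ^ 2 := by gcongr
    rw [norm_sq_eq] at this
    linarith
  · rintro ⟨h2, h3, h4⟩
    refine ⟨abs_le_of_sq_le_sq' ?_ h1.le |>.2, h3⟩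
    have h5 : w.re ^ 2 ≤ M.R i ^ 2 := sq_le_sq' (abs_le.1 h2).1 (abs_le.1 h2).2
    have h6 : w.im ^ 2 ≤ √(M.R i ^ 2 - w.re ^ 2) ^ 2 := by gcongr
    rw [Real.sq_sqrt (by linarith)] at h6
    rw [norm_sq_eq]
    linarith

lemma mem_upperCore {w : ℂ} : w ∈ M.upperCore i ↔
    |w.re| ≤ M.R i ∧ M.profile i w.re ≤ w.im ∧ w.im ≤ √(M.R i ^ 2 - w.re ^ 2) := by
  have h1 := M.ρ_pos i
  have key : w ∈ M.upperCore i ↔ w ∈ M.halfDisc i ∧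
      ∀ k : Fin (Γ.genus i), M.ρ i ≤ ‖w - M.pos i (k + 1)‖ := by
    change (_ ∧ _) ↔ (_ ∧ _) ∧ _
    rw [mem_core]
    tauto
  rw [key, mem_halfDisc]
  constructor
  · rintro ⟨⟨h2, h3, h4⟩, h5⟩
    refine ⟨h2, ?_, h4⟩
    rcases profile_cases (M := M) (i := i) w.re with h | ⟨k, -, h⟩
    · rw [h.1]; exact h3
    · rw [h, Real.sqrt_le_left h3]
      have h6 : M.ρ i ^ 2 ≤ ‖w - M.pos i (k + 1)‖ ^ 2 := by gcongr; exact h5 k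
      rw [norm_sq_sub_pos] at h6
      linarith
  · rintro ⟨h2, h3, h4⟩
    refine ⟨⟨h2, (profile_nonneg _).trans h3, h4⟩, fun k => ?_⟩
    refine abs_le_of_sq_le_sq' ?_ (norm_nonneg _) |>.2
    have h5 : √(M.ρ i ^ 2 - (w.re - M.d i * (k + 1)) ^ 2) ≤ w.im :=
      (Finset.single_le_sum (f := fun k : Fin (Γ.genus i) =>
        √(M.ρ i ^ 2 - (w.re - M.d i * (k + 1)) ^ 2)) (fun _ _ => Real.sqrt_nonneg _)
        (Finset.mem_univ k)).trans h3
    rw [Real.sqrt_le_left ((profile_nonneg _).trans h3)] at h5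
    rw [norm_sq_sub_pos]
    linarith

variable (M) in
/-- The vertical scaling factor of the map from the half disc to the upper half of the disc with
holes. The denominator is the height of the half disc, unless the profile vanishes. -/
def scale (i : Fin n) (x : ℝ) : ℝ :=
  1 - M.profile i x / max (√(M.R i ^ 2 - x ^ 2)) (M.R i / 2)

lemma scale_pos (x : ℝ) : 0 < M.scale i x := by
  have h1 := R_pos (M := M) (i := i)
  rw [scale, sub_pos, div_lt_one (lt_max_of_lt_right (by linarith))]
  exact lt_max_of_lt_right (by linarith [profile_le (M := M) (i := i) x])

/-- The upper boundary of the half disc is mapped to itself. -/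
lemma scale_mul_sqrt (x : ℝ) :
    M.profile i x + √(M.R i ^ 2 - x ^ 2) * M.scale i x = √(M.R i ^ 2 - x ^ 2) := by
  rw [scale]
  by_cases h : M.profile i x = 0
  · rw [h]; simp
  · have h1 := le_sqrt_of_profile_ne_zero h
    have h2 := R_pos (M := M) (i := i)
    have h3 : √(M.R i ^ 2 - x ^ 2) ≠ 0 := by
      intro h0
      rw [h0] at h1
      linarith
    rw [max_eq_left h1]
    field_simp
    ring

variable (M) in
lemma continuous_scale (i : Fin n) : Continuous (M.scale i) := by
  have h := M.continuous_profile i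
  have h1 := R_pos (M := M) (i := i)
  unfold scale
  refine continuous_const.sub (h.div (by fun_prop) fun x => ?_)
  exact (lt_max_of_lt_right (by linarith)).ne'

variable (M) in
/-- A map from the half disc to the upper half of the disc with holes. -/
def straighten (i : Fin n) (w : ℂ) : ℂ := ⟨w.re, M.profile i w.re + w.im * M.scale i w.re⟩

variable (M) in
lemma continuous_straighten (i : Fin n) : Continuous (M.straighten i) := by
  have h1 := M.continuous_profile i
  have h2 := M.continuous_scale i
  have : M.straighten i = fun w => Complex.equivRealProdCLM.symm
      (w.re, M.profile i w.re + w.im * M.scale i w.re) := rfl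
  rw [this]
  fun_prop

lemma bijOn_straighten : BijOn (M.straighten i) (M.halfDisc i) (M.upperCore i) := by
  refine ⟨fun w hw => ?_, fun w _ w' _ h => ?_, fun w hw => ?_⟩
  · rw [mem_halfDisc] at hw
    rw [mem_upperCore]
    have h1 := scale_pos (M := M) (i := i) w.re
    refine ⟨hw.1, le_add_of_nonneg_right (mul_nonneg hw.2.1 h1.le), ?_⟩
    change M.profile i w.re + w.im * M.scale i w.re ≤ √(M.R i ^ 2 - w.re ^ 2)
    rw [← scale_mul_sqrt (M := M) (i := i)]
    gcongr
    exact hw.2.2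
  · have h1 : w.re = w'.re :=
      (congrArg Complex.re h : (M.straighten i w).re = (M.straighten i w').re)
    have h2 : M.profile i w.re + w.im * M.scale i w.re =
      M.profile i w'.re + w'.im * M.scale i w'.re :=
        (congrArg Complex.im h : (M.straighten i w).im = (M.straighten i w').im)
    rw [← h1] at h2
    refine Complex.ext h1 (mul_right_cancel₀ (scale_pos (M := M) (i := i) w.re).ne' ?_)
    linarith
  · rw [mem_upperCore] at hw
    have h1 := scale_pos (M := M) (i := i) w.re
    refine ⟨⟨w.re, (w.im - M.profile i w.re) / M.scale i w.re⟩, ?_, ?_⟩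
    · rw [mem_halfDisc]
      refine ⟨hw.1, div_nonneg (by linarith) h1.le, (div_le_iff₀ h1).2 ?_⟩
      have := scale_mul_sqrt (M := M) (i := i) w.re
      simp only
      linarith
    · refine Complex.ext rfl ?_
      change M.profile i w.re + (w.im - M.profile i w.re) / M.scale i w.re * M.scale i w.re = w.im
      rw [div_mul_cancel₀ _ h1.ne']
      ring

lemma convex_halfDisc : Convex ℝ (M.halfDisc i) := by
  have : M.halfDisc i = Metric.closedBall 0 (M.R i) ∩ {w | 0 ≤ w.im} := by
    ext w; simp [halfDisc]
  rw [this]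
  exact (convex_closedBall _ _).inter (convex_halfSpace_im_ge 0)

lemma isConnected_upperCore : IsConnected (M.upperCore i) := by
  rw [← bijOn_straighten.image_eq]
  refine IsConnected.image ⟨⟨0, ?_⟩, convex_halfDisc.isPreconnected⟩ _
    (M.continuous_straighten i).continuousOn
  exact ⟨by simpa using (R_pos (M := M) (i := i)).le, by simp⟩

variable (M) in
/-- The surface is the union of four copies of the upper half of the disc with holes, one for each
sheet `s` and each half `h` of the surface. As the sheets are glued by conjugation, a half of the
surface consists of the upper half of one sheet and the lower half of the other one. -/
def piece (i : Fin n) (s h : Bool) (w : ℂ) : (M.surfaceGlue i).Space :=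
  (M.surfaceGlue i).pt s (if s = h then w else conj w)

lemma unfold_mem_core {w : ℂ} (hw : w ∈ M.core i) (P : Prop) [Decidable P] :
    (if P then w else conj w) ∈ M.core i := by
  split_ifs
  · exact hw
  · exact conj_mem_core hw

lemma continuousOn_piece (s h : Bool) : ContinuousOn (M.piece i s h) (M.upperCore i) := by
  refine ((M.surfaceGlue i).continuousOn_pt s).comp ?_ fun w hw =>
    core_subset (unfold_mem_core hw.1 _)
  split_ifs
  · exact continuousOn_id
  · exact Complex.continuous_conj.continuousOn

lemma exists_piece (p : (M.surfaceGlue i).Space) :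
    ∃ s h, ∃ w ∈ M.upperCore i, M.piece i s h w = p := by
  obtain ⟨s, w, hw, rfl⟩ := exists_rep_surface p
  rcases le_total 0 w.im with h | h
  · exact ⟨s, s, w, ⟨hw, h⟩, by simp [piece]⟩
  · exact ⟨s, !s, conj w, ⟨conj_mem_core hw, by simpa using h⟩, by simp [piece]⟩

/-- Two pieces with different sheets meet along the boundary circles, and two pieces with different
halves along the real axis. -/
lemma piece_eq_piece {s h s' h' : Bool} {w w' : ℂ} (hw : w ∈ M.upperCore i)
    (hw' : w' ∈ M.upperCore i) : M.piece i s h w = M.piece i s' h' w' ↔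
      w = w' ∧ (s = s' ∨ ∃ b, M.gap i b (w, 0) = 0) ∧ (h = h' ∨ w.im = 0) := by
  have hconj : ∀ w : ℂ, conj w = w ↔ w.im = 0 := fun w => by
    rw [Complex.conj_eq_iff_im]
  have heq : ∀ {w w' : ℂ}, w ∈ M.upperCore i → w' ∈ M.upperCore i →
      (w = conj w' ↔ w = w' ∧ w.im = 0) := fun {w w'} hw hw' => by
    constructor
    · intro h
      have h1 : w.im = -w'.im := by rw [h]; simp
      have h2 : w.im = 0 := by linarith [hw.2, hw'.2]
      have h3 : w'.im = 0 := by linarith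
      exact ⟨by rw [h, (hconj w').2 h3], h2⟩
    · rintro ⟨rfl, h⟩
      exact ((hconj w).2 h).symm
  have heq' : ∀ {w w' : ℂ}, w ∈ M.upperCore i → w' ∈ M.upperCore i →
      (conj w = w' ↔ w = w' ∧ w.im = 0) := fun {w w'} hw hw' => by
    rw [← heq hw hw']
    constructor <;> rintro rfl <;> simp
  rw [piece, piece, surface_pt_eq (unfold_mem_core hw.1 _) (unfold_mem_core hw'.1 _)]
  have hg : (∃ b, M.gap i b ((if s = h then w else conj w), 0) = 0) ↔
      ∃ b, M.gap i b (w, 0) = 0 := by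
    split_ifs
    · rfl
    · simp only [gap_conj]
  rw [hg]
  have hinj : conj w = conj w' ↔ w = w' := (starRingEnd ℂ).injective.eq_iff
  have h1 := heq hw hw'
  have h2 := heq' hw hw'
  have h3 := heq hw' hw
  have h4 := heq' hw' hw
  have h5 : w = w' → w.im = w'.im := fun h => by rw [h]
  cases s <;> cases h <;> cases s' <;> cases h' <;>
    simp only [Complex.conj_conj, if_true, if_false, reduceCtorEq, ne_eq, not_true_eq_false,
      not_false_eq_true, true_and, false_and, or_false, false_or, true_or, and_true, hinj, h1, h2,
      h3, h4, eq_comm (a := w') (b := w)] <;> grind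

instance : ConnectedSpace (M.surfaceGlue i).Space := by
  rw [connectedSpace_iff_univ]
  set A : Bool → Bool → Set (M.surfaceGlue i).Space := fun s h => M.piece i s h '' M.upperCore i
  have hA : ∀ s h, IsConnected (A s h) := fun s h =>
    isConnected_upperCore.image _ (continuousOn_piece s h)
  have hR := R_pos (M := M) (i := i)
  -- The real point on the outer boundary lies in all four pieces.
  have h0 : ((M.R i : ℝ) : ℂ) ∈ M.upperCore i := by
    refine ⟨mem_core.2 ⟨by simp [abs_of_pos hR], fun k => ?_⟩, by simp⟩
    have h5 := norm_pos_le (M := M) (i := i) (k := (k : ℕ) + 1) (by have := k.2; omega)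
    have h6 := norm_sub_norm_le ((M.R i : ℝ) : ℂ) (M.pos i (k + 1))
    rw [Complex.norm_real, Real.norm_of_nonneg hR.le] at h6
    linarith [M.ρ_le i, M.ρ_pos i]
  have h1 : ∀ s h, M.piece i true true (M.R i : ℝ) ∈ A s h := fun s h =>
    ⟨_, h0, (piece_eq_piece h0 h0).2 ⟨rfl, .inr ⟨none, by rw [gap_none]; simp⟩, .inr (by simp)⟩⟩
  have h2 : (univ : Set (M.surfaceGlue i).Space) = ⋃₀ (range fun q : Bool × Bool => A q.1 q.2) := by
    refine (eq_univ_of_forall fun p => ?_).symm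
    obtain ⟨s, h, w, hw, rfl⟩ := exists_piece p
    exact ⟨A s h, ⟨(s, h), rfl⟩, w, hw, rfl⟩
  rw [h2]
  refine ⟨⟨_, _, ⟨(true, true), rfl⟩, h1 true true⟩,
    isPreconnected_sUnion (M.piece i true true (M.R i : ℝ)) _ ?_ ?_⟩
  · rintro _ ⟨q, rfl⟩
    exact h1 _ _
  · rintro _ ⟨q, rfl⟩
    exact (hA _ _).isPreconnected

end PlumbingModel
end

/-! ### The surfaces as symplectic submanifolds -/

noncomputable section

open Set Filter ComplexConjugate

namespace GlueData

variable {E F : Type} [NormedAddCommGroup E] [NormedSpace ℝ E]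
  [NormedAddCommGroup F] [NormedSpace ℝ F] (G : GlueData E F)

lemma toPref_φ {c : G.κ} {x : F} (hx : x ∈ G.D c) :
    G.toPref (G.src c) x = G.toPref (G.tgt c) (G.φ c x) ∘L fderiv ℝ (G.φ c) x := by
  have h1 := G.pt_φ hx
  have h2 : G.trans (G.src c) (G.sheet (G.pt (G.src c) x)) =ᶠ[𝓝 x]
      G.trans (G.tgt c) (G.sheet (G.pt (G.tgt c) (G.φ c x))) ∘ G.φ c := by
    filter_upwards [(G.isOpen_D c).mem_nhds hx] with y hy
    simp only [trans, Function.comp_apply]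
    rw [G.pt_φ hy, h1]
  rw [toPref, h2.fderiv_eq, fderiv_comp]
  · rfl
  · exact (G.contDiffAt_trans (G.φ_mem_U hx) (G.mem_range_sheet _)).differentiableAt (by simp)
  · exact ((G.smooth c).contDiffAt ((G.isOpen_D c).mem_nhds hx)).differentiableAt (by simp)

end GlueData

namespace PlumbingModel

variable {n : ℕ} {Γ : PlumbingGraph n} {M : PlumbingModel Γ} {i : Fin n}

variable (M) in
/-- The inclusion of a surface into the plumbing, as the zero section. -/
def inclusion (i : Fin n) : (M.surfaceGlue i).Space → M.glue.Space :=
  (M.surfaceGlue i).lift fun s w => M.glue.pt (i, s) (w, 0)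

lemma inclusion_pt {s : Bool} {w : ℂ} (hw : (w, 0) ∈ M.sheetSet i) :
    M.inclusion i ((M.surfaceGlue i).pt s w) = M.glue.pt (i, s) (w, 0) := by
  refine (M.surfaceGlue i).lift_pt (fun c x hx => ?_) hw
  have h1 : M.glue.pt (i, c.2) (x, 0) = M.glue.pt (i, !c.2) (M.flip i c.1 (x, 0)) :=
    (M.glue.pt_φ (c := .inl ⟨i, c⟩) hx).symm
  rw [flip_zero_snd] at h1
  exact h1.symm

lemma exists_rep_sheet (p : (M.surfaceGlue i).Space) :
    ∃ (s : Bool) (w : ℂ), (w, 0) ∈ M.sheetSet i ∧ (M.surfaceGlue i).pt s w = p :=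
  (M.surfaceGlue i).exists_rep p

lemma contMDiff_inclusion : ContMDiff (𝓡 2) (𝓡 4) ∞ (M.inclusion i) := by
  intro p
  obtain ⟨s, w, hw, rfl⟩ := (M.surfaceGlue i).exists_rep p
  refine (M.surfaceGlue i).contMDiffAt_of_comp_pt hw ?_
  have h1 : ContMDiffAt 𝓘(ℝ, ℂ) 𝓘(ℝ, ℂ × ℂ) ∞ (fun w : ℂ => (w, (0 : ℂ))) w :=
    (contDiffAt_id.prodMk contDiffAt_const).contMDiffAt
  refine (ContMDiffAt.comp w (M.glue.contMDiffAt_pt (i := (i, s)) (x := (w, 0)) hw)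
    h1).congr_of_eventuallyEq ?_
  filter_upwards [((M.surfaceGlue i).isOpen_U s).mem_nhds hw] with y hy using inclusion_pt hy

/-- Points of different sheets of the surface which agree in the plumbing are identified by a collar
map: the plumbing maps join sheets of different vertices. -/
lemma inclusion_injective : Function.Injective (M.inclusion i) := by
  intro p q hpq
  obtain ⟨s, w, hw, rfl⟩ := exists_rep_sheet p
  obtain ⟨s', w', hw', rfl⟩ := exists_rep_sheet q
  rw [inclusion_pt hw, inclusion_pt hw'] at hpq
  rcases (M.glue.pt_eq_pt (i := (i, s)) (j := (i, s')) hw hw').1 hpq with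
    ⟨h1, h2⟩ | ⟨⟨i', b, t⟩ | ⟨i', j, k⟩, h1, h2, h3, h4⟩
  · obtain rfl : s = s' := congrArg Prod.snd h1
    obtain rfl : w = w' := congrArg Prod.fst h2
    rfl
  · obtain ⟨rfl, rfl⟩ : i' = i ∧ t = s := ⟨congrArg Prod.fst h1, congrArg Prod.snd h1⟩
    obtain rfl : (!t) = s' := congrArg Prod.snd h2
    refine ((M.surfaceGlue i').pt_φ (c := (b, t)) h3).symm.trans ?_
    exact congrArg ((M.surfaceGlue i').pt (!t)) (congrArg Prod.fst h4)
  · obtain rfl : i' = i := congrArg Prod.fst h1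
    obtain rfl : j = i' := congrArg Prod.fst h2
    have := Γ.edges_self j
    have := k.2
    omega

lemma isSmoothEmbedding_inclusion :
    Manifold.IsSmoothEmbedding (𝓡 2) (𝓡 4) ∞ (M.inclusion i) := by
  refine ⟨?_, (contMDiff_inclusion.continuous.isClosedEmbedding inclusion_injective).isEmbedding⟩
  refine Manifold.IsImmersionOfComplement.isImmersion (F := ℂ) fun p => ?_
  obtain ⟨s, w, hw, rfl⟩ := exists_rep_sheet p
  refine Manifold.IsImmersionAtOfComplement.mk_of_continuousAt
    contMDiff_inclusion.continuous.continuousAt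
    ((coords2.prodCongr (ContinuousLinearEquiv.refl ℝ ℂ)).trans coords4.symm)
    ((M.surfaceGlue i).sheetChart s) (M.glue.sheetChart (i, s))
    ((M.surfaceGlue i).pt_mem_range hw) ?_
    (IsManifold.subset_maximalAtlas (mem_range_self s))
    (IsManifold.subset_maximalAtlas (mem_range_self (i, s))) ?_
  · rw [inclusion_pt hw]
    exact M.glue.pt_mem_range (i := (i, s)) hw
  · intro y hy
    have hy : (coords2 y, 0) ∈ M.sheetSet i := by
      have : (M.surfaceGlue i).e y ∈ (M.surfaceGlue i).U s := by
        simpa [GlueData.sheetChart] using hy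
      exact this
    have h1 : M.inclusion i ((M.surfaceGlue i).pt s (coords2 y)) =
      M.glue.pt (i, s) (coords2 y, 0) := inclusion_pt hy
    change coords4.symm (M.glue.coord (i, s) (M.inclusion i ((M.surfaceGlue i).pt s (coords2 y)))) =
      coords4.symm (coords2 y, 0)
    rw [h1, M.glue.coord_pt (i := (i, s)) hy]

variable (M) in
/-- The surface of the vertex `i`. -/
def surface (i : Fin n) : EmbeddedSurface M.glue.Space where
  carrier := (M.surfaceGlue i).Space
  map := ⟨M.inclusion i, contMDiff_inclusion.continuous⟩
  embedding := isSmoothEmbedding_inclusion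

/-- The derivative, in preferred coordinates, of a map from a surface to the plumbing which maps
the sheet `s` to the sheet `t`. -/
lemma surfaceDeriv_eq {H : (M.surfaceGlue i).Space → M.glue.Space} {p : (M.surfaceGlue i).Space}
    {t : Fin n × Bool} {h : ℂ → ℂ × ℂ} (hy : h ((M.surfaceGlue i).base p) ∈ M.sheetSet t.1)
    (hd : DifferentiableAt ℝ h ((M.surfaceGlue i).base p))
    (hH : ∀ᶠ x in 𝓝 ((M.surfaceGlue i).base p),
      H ((M.surfaceGlue i).pt ((M.surfaceGlue i).sheet p) x) = M.glue.pt t (h x))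
    (u : EuclideanSpace ℝ (Fin 2)) :
    coords4 (surfaceDeriv H p u) = M.glue.toPref t (h ((M.surfaceGlue i).base p))
      (fderiv ℝ h ((M.surfaceGlue i).base p) (coords2 u)) := by
  have h1 := M.glue.mfderiv_of_eventuallyEq (M.surfaceGlue i) (j := t) hy hd hH
  refine (congrArg (fun T : EuclideanSpace ℝ (Fin 2) →L[ℝ] EuclideanSpace ℝ (Fin 4) =>
    coords4 (T u)) h1).trans ?_
  exact coords4.apply_symm_apply _

lemma surfaceDeriv_inclusion (p : (M.surfaceGlue i).Space) (u : EuclideanSpace ℝ (Fin 2)) :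
    coords4 (surfaceDeriv (M.inclusion i) p u) =
      M.glue.toPref (i, (M.surfaceGlue i).sheet p) ((M.surfaceGlue i).base p, 0)
        (coords2 u, 0) := by
  have h0 := (M.surfaceGlue i).base_mem p
  have h1 : HasFDerivAt (fun w : ℂ => (w, (0 : ℂ))) (ContinuousLinearMap.inl ℝ ℂ ℂ)
    ((M.surfaceGlue i).base p) := (ContinuousLinearMap.inl ℝ ℂ ℂ).hasFDerivAt
  rw [surfaceDeriv_eq (t := (i, (M.surfaceGlue i).sheet p)) (h := fun w : ℂ => (w, (0 : ℂ))) h0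
    h1.differentiableAt ?_, h1.fderiv]
  · rfl
  · filter_upwards [((M.surfaceGlue i).isOpen_U _).mem_nhds h0] with y hy using inclusion_pt hy

lemma eval_Ω (x : M.glue.Space) (u w : EuclideanSpace ℝ (Fin 4)) :
    M.Ω.eval x u w = sympForm (coords4 u) (coords4 w) := rfl

lemma eval_inclusion (x : M.glue.Space) (p : (M.surfaceGlue i).Space)
    (u w : EuclideanSpace ℝ (Fin 2)) :
    M.Ω.eval x (surfaceDeriv (M.inclusion i) p u) (surfaceDeriv (M.inclusion i) p w) =
      areaForm (coords2 u) (coords2 w) := by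
  rw [eval_Ω, surfaceDeriv_inclusion, surfaceDeriv_inclusion,
    M.preserves_glue.toPref (i := (i, (M.surfaceGlue i).sheet p)) ((M.surfaceGlue i).base_mem p)]
  simp [sympForm_apply]

lemma isSymplectic_surface (i : Fin n) : (M.surface i).IsSymplectic M.Ω := by
  intro p u hu
  have h0 : coords2 u ≠ 0 := fun h => hu (coords2.map_eq_zero_iff.1 h)
  by_contra hcon
  push Not at hcon
  refine h0 (eq_zero_of_areaForm fun b => ?_)
  have h1 := hcon (coords2.symm b)
  have h2 := eval_inclusion (M := M) (i := i) (M.inclusion i p) p u (coords2.symm b)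
  rw [coords2.apply_symm_apply] at h2
  exact h2.symm.trans h1

lemma plumb_mem (i : Fin n) (e : Σ j, Fin (Γ.edges i j)) :
    (M.plumb i e, (0 : ℂ)) ∈ M.polydisc i e := by
  constructor <;> simpa using M.ε_pos

lemma swap_plumb (c : Σ (i : Fin n) (j : Fin n), Fin (Γ.edges i j)) :
    M.swap c (M.plumb c.1 c.2, 0) = (M.plumb c.2.1 (otherEnd c).2, 0) := by
  simp [swap]

variable (M) in
/-- A plumbing point on a surface. -/
def plumbPt (i : Fin n) (e : Σ j, Fin (Γ.edges i j)) : (M.surfaceGlue i).Space :=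
  (M.surfaceGlue i).pt true (M.plumb i e)

lemma inclusion_plumbPt (e : Σ j, Fin (Γ.edges i j)) :
    M.inclusion i (M.plumbPt i e) = M.glue.pt (i, true) (M.plumb i e, 0) :=
  inclusion_pt (polydisc_subset e (plumb_mem i e))

lemma inclusion_plumbPt_otherEnd (c : Σ (i : Fin n) (j : Fin n), Fin (Γ.edges i j)) :
    M.inclusion c.2.1 (M.plumbPt c.2.1 (otherEnd c).2) = M.inclusion c.1 (M.plumbPt c.1 c.2) := by
  have h1 : M.glue.pt (c.2.1, true) (M.swap c (M.plumb c.1 c.2, 0)) =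
    M.glue.pt (c.1, true) (M.plumb c.1 c.2, 0) := M.glue.pt_φ (c := .inr c) (plumb_mem c.1 c.2)
  rw [swap_plumb] at h1
  rw [inclusion_plumbPt (i := c.1), ← h1]
  exact inclusion_plumbPt (i := c.2.1) (otherEnd c).2

/-- Two different surfaces meet in the plumbing points only. -/
lemma inclusion_eq_inclusion {j : Fin n} (hij : i ≠ j) {p : (M.surfaceGlue i).Space}
    {q : (M.surfaceGlue j).Space} (h : M.inclusion i p = M.inclusion j q) :
    ∃ k : Fin (Γ.edges i j), (M.surfaceGlue i).sheet p = true ∧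
      (M.surfaceGlue i).base p = M.plumb i ⟨j, k⟩ ∧ (M.surfaceGlue j).sheet q = true ∧
      (M.surfaceGlue j).base q = M.plumb j (otherEnd ⟨i, j, k⟩).2 := by
  have hw := (M.surfaceGlue i).base_mem p
  have hw' := (M.surfaceGlue j).base_mem q
  have h0 : M.glue.pt (i, (M.surfaceGlue i).sheet p) ((M.surfaceGlue i).base p, 0) =
      M.glue.pt (j, (M.surfaceGlue j).sheet q) ((M.surfaceGlue j).base q, 0) := h
  rcases (M.glue.pt_eq_pt (i := (i, (M.surfaceGlue i).sheet p))
    (j := (j, (M.surfaceGlue j).sheet q)) hw hw').1 h0 with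
    ⟨h1, -⟩ | ⟨⟨i', b, t⟩ | ⟨i', j', k⟩, h1, h2, h3, h4⟩
  · exact absurd (congrArg Prod.fst h1) hij
  · exact absurd ((congrArg Prod.fst h1 : i' = i).symm.trans (congrArg Prod.fst h2 : i' = j)) hij
  · obtain rfl : i' = i := congrArg Prod.fst h1
    obtain rfl : j' = j := congrArg Prod.fst h2
    have h5 : (M.surfaceGlue i').base p - M.plumb i' ⟨j', k⟩ = 0 := congrArg Prod.snd h4
    have h6 : M.plumb j' (otherEnd ⟨i', j', k⟩).2 + 0 = (M.surfaceGlue j').base q :=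
      congrArg Prod.fst h4
    exact ⟨k, (congrArg Prod.snd h1).symm, sub_eq_zero.1 h5, (congrArg Prod.snd h2).symm,
      by rw [← h6, add_zero]⟩

/-- At a plumbing point one surface is tangent to the base and the other one to the fibre. -/
lemma meetOrthogonally {j : Fin n} (hij : i ≠ j) :
    (M.surface i).MeetOrthogonally M.Ω (M.surface j) := by
  intro p q hpq u w
  obtain ⟨k, h1, h2, h3, h4⟩ := inclusion_eq_inclusion hij hpq
  have hu := surfaceDeriv_inclusion (M := M) p u
  have hw := surfaceDeriv_inclusion (M := M) q w
  rw [h1, h2] at hu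
  rw [h3, h4] at hw
  have h5 := M.glue.toPref_φ (c := .inr ⟨i, j, k⟩) (plumb_mem i ⟨j, k⟩)
  have h6 : M.glue.toPref (i, true) (M.plumb i ⟨j, k⟩, 0) (coords2 u, 0) =
      M.glue.toPref (j, true) (M.plumb j (otherEnd ⟨i, j, k⟩).2, 0) (0, coords2 u) := by
    refine (congrArg (fun T : ℂ × ℂ →L[ℝ] ℂ × ℂ => T (coords2 u, 0)) h5).trans ?_
    change M.glue.toPref (j, true) (M.swap ⟨i, j, k⟩ (M.plumb i ⟨j, k⟩, 0))
      (fderiv ℝ (M.swap ⟨i, j, k⟩) (M.plumb i ⟨j, k⟩, 0) (coords2 u, 0)) = _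
    rw [fderiv_swap]
    exact congrArg (fun x => M.glue.toPref (j, true) x (0, coords2 u)) (swap_plumb ⟨i, j, k⟩)
  have h7 : (M.plumb j (otherEnd ⟨i, j, k⟩).2, 0) ∈ M.sheetSet j :=
    polydisc_subset _ (plumb_mem j (otherEnd ⟨i, j, k⟩).2)
  have h8 := M.preserves_glue.toPref (i := (j, true)) h7 (0, coords2 u) (coords2 w, 0)
  rw [← h6, ← hu, ← hw] at h8
  refine Eq.trans h8 ?_
  simp [sympForm_apply]

lemma encard_inter {j : Fin n} (hij : i ≠ j) :
    ((M.surface i).image ∩ (M.surface j).image).encard = (Γ.edges i j : ℕ∞) := by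
  have h : (M.surface i).image ∩ (M.surface j).image =
      range fun k : Fin (Γ.edges i j) => M.inclusion i (M.plumbPt i ⟨j, k⟩) := by
    ext x
    constructor
    · rintro ⟨⟨p, rfl⟩, ⟨q, hq⟩⟩
      obtain ⟨k, h1, h2, -⟩ := inclusion_eq_inclusion (M := M) (p := p) (q := q) hij hq.symm
      refine ⟨k, ?_⟩
      change M.inclusion i _ = M.inclusion i p
      rw [← (M.surfaceGlue i).pt_base p, h1, h2, plumbPt]
    · rintro ⟨k, rfl⟩
      exact ⟨⟨_, rfl⟩, ⟨_, inclusion_plumbPt_otherEnd ⟨i, j, k⟩⟩⟩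
  have hinj : Function.Injective
      fun k : Fin (Γ.edges i j) => M.inclusion i (M.plumbPt i ⟨j, k⟩) := by
    intro k l hkl
    have h1 : M.plumbPt i ⟨j, k⟩ = M.plumbPt i ⟨j, l⟩ := inclusion_injective hkl
    have h2 := (M.surfaceGlue i).pt_injOn true (polydisc_subset _ (plumb_mem i ⟨j, k⟩))
      (polydisc_subset _ (plumb_mem i ⟨j, l⟩)) h1
    by_contra hne
    have h3 := le_norm_pos_sub (M := M) (i := i) (k := plumbIdx i ⟨j, k⟩) (l := plumbIdx i ⟨j, l⟩)
      fun h => hne (by simpa using plumbIdx_injective h)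
    have h4 : M.pos i (plumbIdx i ⟨j, k⟩) = M.pos i (plumbIdx i ⟨j, l⟩) := h2
    rw [h4, sub_self, norm_zero] at h3
    linarith [M.d_pos i]
  rw [h, ← image_univ, hinj.encard_image]
  simp

lemma iUnion_image : ⋃ i, (M.surface i).image = M.offSetᶜ := by
  have hlift : ∀ (s : Fin n × Bool) (x : ℂ × ℂ), x ∈ M.sheetSet s.1 →
      (M.glue.pt s x ∈ M.offSet ↔ x ∈ M.offSurfaces s) := fun s x hx =>
    iff_of_eq (M.glue.lift_pt (h := fun s x => x ∈ M.offSurfaces s)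
      (fun c x hx => propext (M.offSurfaces_compat c x hx).symm) hx)
  ext p
  rw [mem_iUnion]
  constructor
  · rintro ⟨i, q, rfl⟩
    obtain ⟨s, w, hw, rfl⟩ := exists_rep_sheet q
    change M.inclusion i _ ∉ _
    rw [inclusion_pt hw, hlift (i, s) _ hw]
    exact fun h => h.1 rfl
  · intro hp
    obtain ⟨⟨i, s⟩, ⟨w, ζ⟩, hx, rfl⟩ := M.glue.exists_rep p
    have hx : (w, ζ) ∈ M.sheetSet i := hx
    have hp : ¬ M.glue.pt (i, s) (w, ζ) ∈ M.offSet := hp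
    rw [hlift (i, s) _ hx] at hp
    by_cases hζ : ζ = 0
    · subst hζ
      exact ⟨i, (M.surfaceGlue i).pt s w, inclusion_pt hx⟩
    · have h1 : ∃ e, s = true ∧ w = M.plumb i e := by
        by_contra hcon
        push Not at hcon
        exact hp ⟨hζ, fun hs e => hcon e hs⟩
      obtain ⟨e, rfl, rfl⟩ := h1
      have hP : (M.plumb i e, ζ) ∈ M.polydisc i e := ⟨by simpa using M.ε_pos, hx.1⟩
      have h2 : M.swap ⟨i, e⟩ (M.plumb i e, ζ) = (M.plumb e.1 (otherEnd ⟨i, e⟩).2 + ζ, 0) := by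
        simp [swap]
      have h3 : M.swap ⟨i, e⟩ (M.plumb i e, ζ) ∈ M.sheetSet e.1 :=
        M.glue.φ_mem_U (c := .inr ⟨i, e⟩) hP
      refine ⟨e.1, (M.surfaceGlue e.1).pt true (M.plumb e.1 (otherEnd ⟨i, e⟩).2 + ζ), ?_⟩
      rw [h2] at h3
      refine (inclusion_pt h3).trans ?_
      have h4 : M.glue.pt (e.1, true) (M.swap ⟨i, e⟩ (M.plumb i e, ζ)) =
        M.glue.pt (i, true) (M.plumb i e, ζ) := M.glue.pt_φ (c := .inr ⟨i, e⟩) hP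
      rw [h2] at h4
      exact h4

theorem isNeighborhood5Tuple :
    IsNeighborhood5Tuple M.Ω M.surface M.heightFun (M.glue.field M.liouville) where
  symplectic := M.isSymplectic_Ω
  surfaces_symplectic := isSymplectic_surface
  surfaces_orthogonal _ _ hij := meetOrthogonally hij
  smooth := contMDiff_heightFun
  nonneg := heightFun_nonneg
  zero_iff x := by
    rw [iUnion_image, mem_compl_iff, ← heightFun_pos_iff, not_lt]
    exact ⟨fun h => h.le, fun h => le_antisymm h (heightFun_nonneg x)⟩
  no_critical_value x hx := mfderiv_heightFun_ne_zero ((heightFun_pos_iff x).1 hx)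
  liouville := by
    rw [iUnion_image, compl_compl]
    exact M.isLiouvilleOn_field
  deriv_pos x hx := by
    rw [iUnion_image, compl_compl] at hx
    exact derivAlong_heightFun_pos hx

end PlumbingModel
end

/-! ### The areas of the surfaces -/

noncomputable section

open Set Filter ComplexConjugate MeasureTheory

/-- A linear map of the plane scales the area form by its determinant. -/
lemma areaForm_map (T : ℂ →L[ℝ] ℂ) (a b : ℂ) :
    areaForm (T a) (T b) = T.det * areaForm a b := by
  have h1 : T.det = (T 1).re * (T Complex.I).im - (T 1).im * (T Complex.I).re := by
    rw [ContinuousLinearMap.det, ← LinearMap.det_toMatrix Complex.basisOneI, Matrix.det_fin_two]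
    simp [LinearMap.toMatrix_apply]
    ring
  have h2 : ∀ a : ℂ, T a = a.re • T 1 + a.im • T Complex.I := fun a => by
    rw [← map_smul, ← map_smul, ← map_add]
    congr 1
    apply Complex.ext <;> simp
  rw [h2 a, h2 b, h1]
  simp only [areaForm_apply', Complex.add_re, Complex.add_im, Complex.smul_re, Complex.smul_im,
    smul_eq_mul]
  ring

lemma PlumbingModel.coords2_apply (y : EuclideanSpace ℝ (Fin 2)) :
    PlumbingModel.coords2 y = ⟨y 0, y 1⟩ := rfl

lemma measurePreserving_coords2 : MeasurePreserving PlumbingModel.coords2 := by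
  have h : ⇑PlumbingModel.coords2 = Complex.orthonormalBasisOneI.repr.symm := by
    ext y
    rw [Complex.orthonormalBasisOneI_repr_symm_apply]
    apply Complex.ext <;> simp [PlumbingModel.coords2_apply]
  rw [h]
  exact Complex.orthonormalBasisOneI.measurePreserving_repr_symm

namespace PlumbingModel

variable {n : ℕ} {Γ : PlumbingGraph n} {M : PlumbingModel Γ} {i : Fin n}

lemma hasFDerivAt_flip {b : Option (Fin (Γ.genus i))} {w : ℂ} (hw : (w, 0) ∈ M.collar i b) :
    HasFDerivAt (fun w => (M.flip i b (w, 0)).1)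
      (ContinuousLinearMap.fst ℝ ℂ ℂ ∘L fderiv ℝ (M.flip i b) (w, 0) ∘L
        ContinuousLinearMap.inl ℝ ℂ ℂ) w := by
  have h1 : HasFDerivAt (fun w : ℂ => (w, (0 : ℂ))) (ContinuousLinearMap.inl ℝ ℂ ℂ) w :=
    (ContinuousLinearMap.inl ℝ ℂ ℂ).hasFDerivAt
  have h2 := ((contDiffOn_flip b).contDiffAt ((isOpen_collar b).mem_nhds hw)).differentiableAt
    (by simp) |>.hasFDerivAt
  exact (ContinuousLinearMap.fst ℝ ℂ ℂ).hasFDerivAt.comp w (h2.comp w h1)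

lemma areaForm_fderiv_flip {b : Option (Fin (Γ.genus i))} {w : ℂ} (hw : (w, 0) ∈ M.collar i b)
    (a c : ℂ) : areaForm (fderiv ℝ (fun w => (M.flip i b (w, 0)).1) w a)
      (fderiv ℝ (fun w => (M.flip i b (w, 0)).1) w c) = areaForm a c := by
  have h1 : HasFDerivAt (fun w : ℂ => (w, (0 : ℂ))) (ContinuousLinearMap.inl ℝ ℂ ℂ) w :=
    (ContinuousLinearMap.inl ℝ ℂ ℂ).hasFDerivAt
  have h2 := ((contDiffOn_flip b).contDiffAt ((isOpen_collar b).mem_nhds hw)).differentiableAt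
    (by simp) |>.hasFDerivAt
  have h3 := (ContinuousLinearMap.snd ℝ ℂ ℂ).hasFDerivAt.comp w (h2.comp w h1)
  have h4 : HasFDerivAt (fun w : ℂ => (M.flip i b (w, 0)).2) (0 : ℂ →L[ℝ] ℂ) w :=
    (hasFDerivAt_const (0 : ℂ) w).congr_of_eventuallyEq
      (.of_forall fun w => congrArg Prod.snd (flip_zero_snd b w))
  have h5 := h3.unique h4
  have h6 : ∀ a, (fderiv ℝ (M.flip i b) (w, 0) (a, 0)).2 = 0 := fun a =>
    congrArg (fun T : ℂ →L[ℝ] ℂ => T a) h5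
  have h7 := sympForm_fderiv_toricMap (ne_ctr hw.2) (toricSq_pos hw.2) (a, 0) (c, 0)
  have h8 : sympForm (fderiv ℝ (M.flip i b) (w, 0) (a, 0)) (fderiv ℝ (M.flip i b) (w, 0) (c, 0)) =
    sympForm (a, 0) (c, 0) := h7
  rw [sympForm_apply, h6, h6, sympForm_apply] at h8
  rw [(hasFDerivAt_flip hw).fderiv]
  simpa using h8

lemma abs_det_fderiv_flip {b : Option (Fin (Γ.genus i))} {w : ℂ} (hw : (w, 0) ∈ M.collar i b) :
    (fderiv ℝ (fun w => (M.flip i b (w, 0)).1) w).det = 1 := by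
  have h1 := areaForm_fderiv_flip hw 1 Complex.I
  rw [areaForm_map] at h1
  simpa [areaForm_apply'] using h1

lemma exists_collar_of_not_mem_core {w : ℂ} (hw : (w, 0) ∈ M.sheetSet i) (h : w ∉ M.core i) :
    ∃ b, 0 < M.gap i b (w, 0) ∧ (w, 0) ∈ M.collar i b := by
  have h' : ∃ b, 0 < M.gap i b (w, 0) := by
    by_contra hcon
    push Not at hcon
    exact h hcon
  obtain ⟨b, hb⟩ := h'
  have hδ := M.δ_pos i
  exact ⟨b, hb, hw.1, abs_lt.2 ⟨by linarith, hw.2 b⟩⟩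

variable (M) in
/-- The boundary circles of the disc with holes. -/
def circles (i : Fin n) : Set ℂ := {w | ∃ b, M.gap i b (w, 0) = 0}

lemma volume_circles : volume (M.circles i) = 0 := by
  have h : M.circles i ⊆ ⋃ b, Metric.sphere (M.ctr i b) (M.rad i b) := by
    rintro w ⟨b, hb⟩
    refine mem_iUnion.2 ⟨b, ?_⟩
    rw [mem_sphere_iff_norm]
    cases b with
    | none =>
      rw [gap_none] at hb
      change ‖w - 0‖ = M.R i
      rw [sub_zero, ← sq_eq_sq₀ (norm_nonneg _) R_pos.le]
      linarith
    | some k =>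
      rw [gap_some] at hb
      change ‖w - M.pos i (k + 1)‖ = M.ρ i
      rw [← sq_eq_sq₀ (norm_nonneg _) (M.ρ_pos i).le]
      linarith
  refine measure_mono_null h (measure_iUnion_null fun b => ?_)
  exact Measure.addHaar_sphere _ _ _

/-- The part of the image of `B` which lies in the disc with holes of the other sheet comes from the
part of `B` outside of the disc with holes, and the gluing map preserves areas. -/
lemma volume_other {s s' : Bool} (hs : s ≠ s') {B : Set ℂ} (hB : MeasurableSet B)
    (hBU : ∀ w ∈ B, (w, 0) ∈ M.sheetSet i) :
    volume (M.core i ∩ (M.surfaceGlue i).pt s' ⁻¹' ((M.surfaceGlue i).pt s '' B)) =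
      volume (B \ M.core i) := by
  set G := M.surfaceGlue i with hG
  have hs' : s' = !s := by cases s <;> cases s' <;> simp_all
  have key : ∀ w ∈ B \ M.core i, ∃ b, 0 < M.gap i b (w, 0) ∧ (w, 0) ∈ M.collar i b ∧
      G.trans s s' w = (M.flip i b (w, 0)).1 ∧
      G.trans s s' =ᶠ[𝓝 w] fun w => (M.flip i b (w, 0)).1 := by
    intro w hw
    obtain ⟨b, hb, hwb⟩ := exists_collar_of_not_mem_core (hBU w hw.1) hw.2
    have h1 : G.trans s (!s) =ᶠ[𝓝 w] fun w => (M.flip i b (w, 0)).1 :=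
      G.trans_eventuallyEq (c := (b, s)) hwb
    rw [← hs'] at h1
    exact ⟨b, hb, hwb, h1.eq_of_nhds, h1⟩
  have hpt : ∀ w ∈ B \ M.core i, G.pt s' (G.trans s s' w) = G.pt s w := by
    intro w hw
    obtain ⟨b, -, hwb, h1, -⟩ := key w hw
    rw [h1, hs']
    exact G.pt_φ (c := (b, s)) hwb
  -- The gluing map exchanges the two sides of a boundary circle.
  have himage : G.trans s s' '' (B \ M.core i) =
      (M.core i ∩ G.pt s' ⁻¹' (G.pt s '' B)) \ M.circles i := by
    ext w'
    constructor
    · rintro ⟨w, hw, rfl⟩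
      obtain ⟨b, hb, hwb, h1, -⟩ := key w hw
      have h2 := flip_mem_collar hwb
      have h3 := gap_flip hwb.2
      have h4 : ∀ b', M.gap i b' (G.trans s s' w, 0) < 0 := fun b' => by
        rw [h1, ← flip_zero_snd]
        by_cases hbb : b = b'
        · subst hbb
          rw [h3]
          linarith
        · linarith [gap_le_of_near hbb h2.2, M.δ_pos i]
      refine ⟨⟨fun b' => (h4 b').le, w, hw.1, (hpt w hw).symm⟩, ?_⟩
      rintro ⟨b', h5⟩
      linarith [h4 b']
    · rintro ⟨⟨h1, w, hw, h2⟩, h3⟩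
      have hwc : w ∉ M.core i := fun hwc => by
        rcases (surface_pt_eq h1 hwc).1 h2.symm with ⟨h4, -⟩ | ⟨-, -, h4⟩
        · exact hs h4.symm
        · exact h3 h4
      refine ⟨w, ⟨hw, hwc⟩, ?_⟩
      change G.coord s' (G.pt s w) = w'
      rw [h2]
      exact G.coord_pt (core_subset h1)
  rw [← measure_sdiff_null (s := _ ∩ _) (volume_circles (M := M) (i := i)), ← himage,
    ← lintegral_abs_det_fderiv_eq_addHaar_image volume (hB.diff (isCompact_core i).measurableSet)
    (f := G.trans s s') (f' := fderiv ℝ (G.trans s s')) (fun w hw => ?_) (fun w hw w' hw' h => ?_)]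
  · rw [setLIntegral_congr_fun (g := fun _ => 1) (hB.diff (isCompact_core i).measurableSet)]
    · simp
    · intro w hw
      obtain ⟨b, -, hwb, -, h1⟩ := key w hw
      simp only
      rw [h1.fderiv_eq, abs_det_fderiv_flip hwb]
      simp
  · obtain ⟨b, -, hwb, -, h1⟩ := key w hw
    refine DifferentiableAt.hasFDerivAt ?_ |>.hasFDerivWithinAt
    exact (hasFDerivAt_flip hwb).differentiableAt.congr_of_eventuallyEq h1
  · have h1 := hpt w hw
    rw [h, hpt w' hw'] at h1
    exact (G.pt_injOn s (hBU w' hw'.1) (hBU w hw.1) h1).symm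

variable (M) in
/-- The area measure on a surface: the Lebesgue measure on the two discs with holes. Their common
boundary is a null set. -/
def areaMeasure (i : Fin n) :
    @Measure (M.surfaceGlue i).Space (borel (M.surfaceGlue i).Space) :=
  let _ := borel (M.surfaceGlue i).Space
  Measure.map ((M.surfaceGlue i).pt true) (volume.restrict (M.core i)) +
    Measure.map ((M.surfaceGlue i).pt false) (volume.restrict (M.core i))

lemma areaMeasure_apply {A : Set (M.surfaceGlue i).Space}
    (hA : @MeasurableSet _ (borel (M.surfaceGlue i).Space) A) (s s' : Bool) (hs : s ≠ s') :
    M.areaMeasure i A = volume (M.core i ∩ (M.surfaceGlue i).pt s ⁻¹' A) +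
      volume (M.core i ∩ (M.surfaceGlue i).pt s' ⁻¹' A) := by
  let _ := borel (M.surfaceGlue i).Space
  have : BorelSpace (M.surfaceGlue i).Space := ⟨rfl⟩
  have h1 : ∀ s : Bool, Measure.map ((M.surfaceGlue i).pt s) (volume.restrict (M.core i)) A =
      volume (M.core i ∩ (M.surfaceGlue i).pt s ⁻¹' A) := by
    intro s
    have h2 : AEMeasurable ((M.surfaceGlue i).pt s) (volume.restrict (M.core i)) :=
      (((M.surfaceGlue i).continuousOn_pt s).mono fun w hw => core_subset hw).aemeasurable
        (isCompact_core i).measurableSet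
    rw [Measure.map_apply_of_aemeasurable h2 hA,
      Measure.restrict_apply' (isCompact_core i).measurableSet, inter_comm]
  have h2 : M.areaMeasure i A =
      Measure.map ((M.surfaceGlue i).pt true) (volume.restrict (M.core i)) A +
      Measure.map ((M.surfaceGlue i).pt false) (volume.restrict (M.core i)) A := rfl
  rw [h2, h1, h1]
  cases s <;> cases s'
  · exact absurd rfl hs
  · exact add_comm _ _
  · rfl
  · exact absurd rfl hs

lemma measurableSet_sheet_preimage {A : Set (M.surfaceGlue i).Space}
    (hA : @MeasurableSet _ (borel (M.surfaceGlue i).Space) A) (s : Bool) :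
    MeasurableSet ({w | (w, 0) ∈ M.sheetSet i} ∩ (M.surfaceGlue i).pt s ⁻¹' A) := by
  let _ := borel (M.surfaceGlue i).Space
  have : BorelSpace (M.surfaceGlue i).Space := ⟨rfl⟩
  have hU : IsOpen {w : ℂ | (w, (0 : ℂ)) ∈ M.sheetSet i} := (M.surfaceGlue i).isOpen_U s
  have h1 : Measurable fun w : {w : ℂ | (w, (0 : ℂ)) ∈ M.sheetSet i} =>
      (M.surfaceGlue i).pt s w :=
    (continuousOn_iff_continuous_domRestrict.1 ((M.surfaceGlue i).continuousOn_pt s)).measurable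
  have h2 := hU.measurableSet.subtype_image (h1 hA)
  convert h2 using 1
  ext w
  constructor
  · rintro ⟨hw, hw'⟩
    exact ⟨⟨w, hw⟩, hw', rfl⟩
  · rintro ⟨⟨w, hw⟩, hw', rfl⟩
    exact ⟨hw, hw'⟩

/-- In the preferred chart the area form is the constant form, so the integral is the Lebesgue
measure of the image of `A` in the sheet. -/
lemma areaMeasure_eq_lintegral (p : (M.surfaceGlue i).Space) {A : Set (M.surfaceGlue i).Space}
    (hA : @MeasurableSet _ (borel (M.surfaceGlue i).Space) A)
    (hAp : A ⊆ (extChartAt (𝓡 2) p).source) :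
    M.areaMeasure i A = ∫⁻ y in extChartAt (𝓡 2) p '' A, ENNReal.ofReal
      |M.Ω.eval (M.inclusion i ((extChartAt (𝓡 2) p).symm y))
        (surfaceDeriv (M.inclusion i ∘ (extChartAt (𝓡 2) p).symm) y (stdVec 0))
        (surfaceDeriv (M.inclusion i ∘ (extChartAt (𝓡 2) p).symm) y (stdVec 1))| := by
  set s : Bool := (M.surfaceGlue i).sheet p with hs
  set B : Set ℂ := {w | (w, 0) ∈ M.sheetSet i} ∩ (M.surfaceGlue i).pt s ⁻¹' A with hB
  have hBm : MeasurableSet B := measurableSet_sheet_preimage hA s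
  have hAB : A = (M.surfaceGlue i).pt s '' B := by
    have hAp : A ⊆ (extChartAt 𝓘(ℝ, EuclideanSpace ℝ (Fin 2)) p).source := hAp
    rw [(M.surfaceGlue i).extChartAt_source] at hAp
    ext q
    constructor
    · intro hq
      obtain ⟨w, hw, rfl⟩ := hAp hq
      exact ⟨w, ⟨hw, hq⟩, rfl⟩
    · rintro ⟨w, ⟨-, hw⟩, rfl⟩
      exact hw
  have himage : extChartAt (𝓡 2) p '' A = coords2 ⁻¹' B := by
    have h1 : ∀ w ∈ B, extChartAt (𝓡 2) p ((M.surfaceGlue i).pt s w) = coords2.symm w := fun w hw =>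
      ((M.surfaceGlue i).extChartAt_apply p _).trans
        (congrArg coords2.symm ((M.surfaceGlue i).coord_pt (i := s) hw.1))
    ext y
    constructor
    · rintro ⟨q, hq, rfl⟩
      rw [hAB] at hq
      obtain ⟨w, hw, rfl⟩ := hq
      rw [h1 w hw, mem_preimage, coords2.apply_symm_apply]
      exact hw
    · intro hy
      refine ⟨(M.surfaceGlue i).pt s (coords2 y), hy.2, ?_⟩
      rw [h1 _ hy, coords2.symm_apply_apply]
  have hdens : ∀ y ∈ coords2 ⁻¹' B, ENNReal.ofReal
      |M.Ω.eval (M.inclusion i ((extChartAt (𝓡 2) p).symm y))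
        (surfaceDeriv (M.inclusion i ∘ (extChartAt (𝓡 2) p).symm) y (stdVec 0))
        (surfaceDeriv (M.inclusion i ∘ (extChartAt (𝓡 2) p).symm) y (stdVec 1))| = 1 := by
    intro y hy
    have hyU : (coords2 y, (0 : ℂ)) ∈ M.sheetSet i := hy.1
    have h1 : HasFDerivAt (fun y : EuclideanSpace ℝ (Fin 2) => (coords2 y, (0 : ℂ)))
        ((ContinuousLinearMap.inl ℝ ℂ ℂ) ∘L (coords2 : EuclideanSpace ℝ (Fin 2) →L[ℝ] ℂ)) y :=
      ((ContinuousLinearMap.inl ℝ ℂ ℂ) ∘L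
        (coords2 : EuclideanSpace ℝ (Fin 2) →L[ℝ] ℂ)).hasFDerivAt
    have hU : IsOpen {w : ℂ | (w, (0 : ℂ)) ∈ M.sheetSet i} := (M.surfaceGlue i).isOpen_U s
    have h2 := M.glue.mfderiv_of_eventuallyEq_pt (j := (i, s))
      (K := M.inclusion i ∘ (extChartAt 𝓘(ℝ, EuclideanSpace ℝ (Fin 2)) p).symm) (y := y)
      (h := fun y => (coords2 y, (0 : ℂ))) hyU h1.differentiableAt (by
        filter_upwards [(hU.preimage coords2.continuous).mem_nhds hyU] with y' hy'
        exact (congrArg (M.inclusion i)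
          ((M.surfaceGlue i).extChartAt_symm_apply p y')).trans (inclusion_pt hy'))
    have h3 : ∀ u, coords4 (surfaceDeriv (M.inclusion i ∘ (extChartAt (𝓡 2) p).symm) y u) =
        M.glue.toPref (i, s) (coords2 y, 0) (coords2 u, 0) := fun u => by
      refine (congrArg (fun T : EuclideanSpace ℝ (Fin 2) →L[ℝ] EuclideanSpace ℝ (Fin 4) =>
        coords4 (T u)) h2).trans ?_
      refine (coords4.apply_symm_apply _).trans ?_
      rw [h1.fderiv]
      rfl
    have h4 := M.preserves_glue.toPref (i := (i, s)) hyU (coords2 (stdVec 0), 0)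
      (coords2 (stdVec 1), 0)
    rw [← h3, ← h3] at h4
    have h5 : sympForm (coords2 (stdVec 0), 0) (coords2 (stdVec 1), 0) = 1 := by
      simp [sympForm_apply, areaForm_apply', coords2_apply]
    rw [h5] at h4
    refine (congrArg (fun t : ℝ => ENNReal.ofReal |t|) h4).trans ?_
    simp
  have hBm' : MeasurableSet (coords2 ⁻¹' B) := coords2.continuous.measurable hBm
  rw [himage, setLIntegral_congr_fun (g := fun _ => 1) hBm' hdens, setLIntegral_one,
    measurePreserving_coords2.measure_preimage hBm.nullMeasurableSet,
    areaMeasure_apply hA s (!s) (by simp)]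
  have h1 : M.core i ∩ (M.surfaceGlue i).pt s ⁻¹' A = B ∩ M.core i := by
    ext w
    exact ⟨fun h => ⟨⟨core_subset h.1, h.2⟩, h.1⟩, fun h => ⟨h.2, h.1.2⟩⟩
  have h2 := volume_other (M := M) (i := i) (s := s) (s' := !s) (by simp) hBm fun w hw => hw.1
  rw [← hAB] at h2
  rw [h1, h2]
  exact measure_inter_add_sdiff B (isCompact_core i).measurableSet

lemma isAreaMeasure (i : Fin n) : (M.surface i).IsAreaMeasure M.Ω (M.areaMeasure i) :=
  fun p _ hA hAp => areaMeasure_eq_lintegral p hA hAp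

lemma volume_core : volume (M.core i) =
    ENNReal.ofReal (Real.pi * (M.R i ^ 2 - Γ.genus i * M.ρ i ^ 2)) := by
  have hR := R_pos (M := M) (i := i)
  have hρ := M.ρ_pos i
  have h1 : M.core i = Metric.closedBall 0 (M.R i) \
      ⋃ k : Fin (Γ.genus i), Metric.ball (M.pos i (k + 1)) (M.ρ i) := by
    ext w
    simp [mem_core, dist_eq_norm]
  have h2 : volume (⋃ k : Fin (Γ.genus i), Metric.ball (M.pos i (k + 1)) (M.ρ i)) =
      ENNReal.ofReal (Real.pi * (Γ.genus i * M.ρ i ^ 2)) := by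
    rw [measure_iUnion (fun k l hkl => ?_) fun k => Metric.isOpen_ball.measurableSet]
    · simp only [Complex.volume_ball]
      rw [tsum_fintype, Finset.sum_const, Finset.card_univ, Fintype.card_fin, nsmul_eq_mul,
        ← ENNReal.ofReal_pow hρ.le, ENNReal.ofReal_mul Real.pi_pos.le,
        ENNReal.ofReal_mul (by positivity), ENNReal.ofReal_natCast,
        ← NNReal.coe_real_pi, ENNReal.ofReal_coe_nnreal]
      ring
    · refine Metric.ball_disjoint_ball ?_
      rw [dist_eq_norm]
      have h3 := le_norm_pos_sub (M := M) (i := i) (k := (k : ℕ) + 1) (l := (l : ℕ) + 1)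
        fun h => hkl (Fin.ext (by omega))
      linarith [M.ρ_le i]
  rw [h1, measure_sdiff ?_ ?_ ?_, h2, Complex.volume_closedBall, mul_sub,
    ENNReal.ofReal_sub _ (by positivity), ENNReal.ofReal_mul (q := M.R i ^ 2) Real.pi_pos.le,
    ENNReal.ofReal_pow hR.le, mul_comm (ENNReal.ofReal Real.pi)]
  · congr 2
    rw [← NNReal.coe_real_pi, ENNReal.ofReal_coe_nnreal]
  · refine iUnion_subset fun k w hw => ?_
    rw [mem_ball_iff_norm] at hw
    rw [mem_closedBall_zero_iff]
    have h5 := norm_pos_le (M := M) (i := i) (k := (k : ℕ) + 1) (by have := k.2; omega)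
    have h6 := norm_sub_norm_le w (M.pos i (k + 1))
    linarith [M.ρ_le i, M.d_pos i]
  · exact (MeasurableSet.iUnion fun k => Metric.isOpen_ball.measurableSet).nullMeasurableSet
  · rw [h2]
    exact ENNReal.ofReal_ne_top

lemma hasArea (i : Fin n) : (M.surface i).HasArea M.Ω (Γ.area i) := by
  refine ⟨M.areaMeasure i, isAreaMeasure i, ?_⟩
  have h1 := areaMeasure_apply (M := M) (i := i) (A := univ) (@MeasurableSet.univ _ (borel _))
    true false (by simp)
  refine h1.trans ?_
  rw [preimage_univ, preimage_univ, inter_univ, volume_core, ← ENNReal.ofReal_add]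
  · congr 1
    rw [M.R_sq i]
    have := Real.pi_ne_zero
    field_simp
    ring
  all_goals
    rw [M.R_sq i, add_sub_cancel_right]
    have := M.R_sq i
    have := Γ.area_pos i
    have := Real.pi_pos
    positivity

end PlumbingModel
end

/-! ### Pushing a surface off itself -/

noncomputable section

open Set Filter ComplexConjugate

lemma smoothTransition_eq_half {x : ℝ} : Real.smoothTransition x = 1 / 2 ↔ x = 1 / 2 := by
  have h1 : Real.smoothTransition x = 1 / 2 ↔ expNegInvGlue x = expNegInvGlue (1 - x) := by
    rw [Real.smoothTransition, div_eq_div_iff (Real.smoothTransition.pos_denom x).ne' two_ne_zero]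
    constructor <;> intro h <;> linarith
  rw [h1]
  constructor
  · intro h
    have h2 : 0 < x := by
      by_contra hx
      rw [expNegInvGlue.zero_of_nonpos (not_lt.1 hx)] at h
      exact (expNegInvGlue.pos_of_pos (by linarith : 0 < 1 - x)).ne h
    have h3 : 0 < 1 - x := by
      by_contra hx
      rw [expNegInvGlue.zero_of_nonpos (not_lt.1 hx)] at h
      exact (expNegInvGlue.pos_of_pos h2).ne' h
    simp only [expNegInvGlue, not_le.2 h2, not_le.2 h3, if_false, Real.exp_eq_exp, neg_inj,
      inv_inj] at h
    linarith
  · rintro rfl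
    norm_num

lemma hasDerivAt_smoothTransition_half : HasDerivAt Real.smoothTransition 2 (1 / 2) := by
  have h1 : HasDerivAt expNegInvGlue (4 * expNegInvGlue (1 / 2)) (1 / 2) := by
    have h2 : expNegInvGlue =ᶠ[𝓝 (1 / 2 : ℝ)] fun x => Real.exp (-x⁻¹) := by
      filter_upwards [lt_mem_nhds (show (0 : ℝ) < 1 / 2 by norm_num)] with x hx
      simp [expNegInvGlue, not_le.2 hx]
    rw [h2.eq_of_nhds]
    refine HasDerivAt.congr_of_eventuallyEq ?_ h2
    refine ((hasDerivAt_inv (show (1 / 2 : ℝ) ≠ 0 by norm_num)).neg.exp).congr_deriv ?_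
    norm_num
    ring
  have h2 : HasDerivAt (fun x => expNegInvGlue (1 - x)) (-(4 * expNegInvGlue (1 / 2))) (1 / 2) := by
    have h3 : HasDerivAt expNegInvGlue (4 * expNegInvGlue (1 / 2)) (1 - 1 / 2) := by
      convert h1 using 1
      norm_num
    refine (h3.comp (1 / 2 : ℝ) ((hasDerivAt_id (1 / 2 : ℝ)).const_sub 1)).congr_deriv ?_
    ring
  have h3 := expNegInvGlue.pos_of_pos (show (0 : ℝ) < 1 / 2 by norm_num)
  refine (h1.div (h1.add h2) (Real.smoothTransition.pos_denom _).ne').congr_deriv ?_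
  simp only [Pi.add_apply, show (1 - 1 / 2 : ℝ) = 1 / 2 by norm_num]
  field_simp
  ring

namespace PlumbingModel

variable {n : ℕ} {Γ : PlumbingGraph n} {M : PlumbingModel Γ} {i : Fin n}

variable (M) in
/-- A cutoff function on the disc, `0` near all holes and `1` near the outer boundary. -/
def cutoff (i : Fin n) (w : ℂ) : ℝ := Real.smoothTransition (4 * ‖w‖ ^ 2 / M.R i ^ 2 - 1)

lemma cutoff_of_le {w : ℂ} (h : ‖w‖ ≤ M.R i / 2) : M.cutoff i w = 0 := by
  have hR := R_pos (M := M) (i := i)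
  refine Real.smoothTransition.zero_of_nonpos ?_
  rw [sub_nonpos, div_le_one (by positivity)]
  nlinarith [norm_nonneg w]

lemma cutoff_of_sq_ge {w : ℂ} (h : M.R i ^ 2 / 2 ≤ ‖w‖ ^ 2) : M.cutoff i w = 1 := by
  have hR := R_pos (M := M) (i := i)
  refine Real.smoothTransition.one_of_one_le ?_
  rw [le_sub_iff_add_le, le_div_iff₀ (by positivity)]
  linarith

variable (M) in
lemma contDiff_cutoff (i : Fin n) : ContDiff ℝ ∞ (M.cutoff i) :=
  Real.smoothTransition.contDiff.comp
    (((contDiff_const.mul (contDiff_norm_sq ℝ)).div_const _).sub contDiff_const)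

lemma contDiff_cutoff_smul {E : Type*} [NormedAddCommGroup E] [NormedSpace ℝ E] {g : ℂ → E}
    (hg : ∀ w ≠ 0, ContDiffAt ℝ ∞ g w) : ContDiff ℝ ∞ fun w => M.cutoff i w • g w := by
  have hR := R_pos (M := M) (i := i)
  rw [contDiff_iff_contDiffAt]
  intro w
  by_cases hw : w = 0
  · subst hw
    refine (contDiffAt_const (c := (0 : E))).congr_of_eventuallyEq ?_
    filter_upwards [Metric.ball_mem_nhds (0 : ℂ) (half_pos hR)] with w hw
    rw [cutoff_of_le (mem_ball_zero_iff.1 hw).le, zero_smul]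
  · exact (M.contDiff_cutoff i).contDiffAt.smul (hg w hw)

variable (M) in
/-- The factor by which the disc is stretched radially, so that its collars at height `c` are mapped
to those of the sheet. -/
def stretchFactor (i : Fin n) (c : ℝ) (w : ℂ) : ℝ :=
  √(1 + M.tw i * c ^ 2 / 2 * (M.cutoff i w / ‖w‖ ^ 2))

variable (M) in
/-- The phase of the normal component of the pushed-off surface: constant on one of the sheets,
winding around `0` at the outer boundary of the other one, as the gluing requires. -/
def phase (i : Fin n) (s : Bool) (w : ℂ) : ℂ :=
  if s then 1 else 1 - M.cutoff i w + M.cutoff i w * (conj w / (‖w‖ : ℝ)) ^ M.tw i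

variable (M) in
/-- The surface pushed off itself, on a sheet. -/
def pushoff (i : Fin n) (c : ℝ) (s : Bool) (w : ℂ) : ℂ × ℂ :=
  (w * (M.stretchFactor i c w : ℝ), c * M.phase i s w)

lemma cutoff_nonneg (w : ℂ) : 0 ≤ M.cutoff i w := Real.smoothTransition.nonneg _

lemma cutoff_le_one (w : ℂ) : M.cutoff i w ≤ 1 := Real.smoothTransition.le_one _

lemma stretchFactor_radicand_pos (c : ℝ) (w : ℂ) :
    0 < 1 + M.tw i * c ^ 2 / 2 * (M.cutoff i w / ‖w‖ ^ 2) := by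
  have := cutoff_nonneg (M := M) (i := i) w
  positivity

lemma stretchFactor_pos (c : ℝ) (w : ℂ) : 0 < M.stretchFactor i c w :=
  Real.sqrt_pos.2 (stretchFactor_radicand_pos c w)

lemma stretchFactor_of_cutoff {w : ℂ} (h : M.cutoff i w = 0) (c : ℝ) :
    M.stretchFactor i c w = 1 := by
  simp [stretchFactor, h]

variable (M) in
lemma norm_stretch_sq (i : Fin n) (c : ℝ) (w : ℂ) :
    ‖w * (M.stretchFactor i c w : ℝ)‖ ^ 2 = ‖w‖ ^ 2 + M.tw i * c ^ 2 / 2 * M.cutoff i w := by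
  rw [norm_mul, Complex.norm_real, Real.norm_of_nonneg (stretchFactor_pos c w).le, mul_pow,
    stretchFactor, Real.sq_sqrt (stretchFactor_radicand_pos c w).le]
  by_cases hw : w = 0
  · have := cutoff_of_le (M := M) (i := i) (w := 0)
      (by rw [norm_zero]; exact (half_pos R_pos).le)
    subst hw
    simp [this]
  · have : ‖w‖ ≠ 0 := norm_ne_zero_iff.2 hw
    field_simp

lemma norm_direction_pow {w : ℂ} (hw : w ≠ 0) (m : ℕ) : ‖(conj w / (‖w‖ : ℝ)) ^ m‖ = 1 := by
  simp [div_self (norm_ne_zero_iff.2 hw)]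

lemma ne_zero_of_cutoff {w : ℂ} (h : M.cutoff i w ≠ 0) : w ≠ 0 := by
  rintro rfl
  exact h (cutoff_of_le (by rw [norm_zero]; exact (half_pos R_pos).le))

lemma norm_phase_le (s : Bool) (w : ℂ) : ‖M.phase i s w‖ ≤ 1 := by
  cases s with
  | true => simp [phase]
  | false =>
    have h0 := cutoff_nonneg (M := M) (i := i) w
    have h1 := cutoff_le_one (M := M) (i := i) w
    have h2 : M.phase i false w = (1 - M.cutoff i w : ℝ) +
        (M.cutoff i w : ℝ) * (conj w / (‖w‖ : ℝ)) ^ M.tw i := by simp [phase]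
    rw [h2]
    refine (norm_add_le _ _).trans ?_
    rw [norm_mul, Complex.norm_real, Complex.norm_real, Real.norm_of_nonneg h0,
      Real.norm_of_nonneg (sub_nonneg.2 h1)]
    by_cases hw : M.cutoff i w = 0
    · simp [hw]
    · rw [norm_direction_pow (ne_zero_of_cutoff hw)]
      linarith

lemma phase_false_of_cutoff {w : ℂ} (h : M.cutoff i w = 1) :
    M.phase i false w = (conj w / (‖w‖ : ℝ)) ^ M.tw i := by
  simp [phase, h]

lemma norm_phase_of_cutoff (s : Bool) {w : ℂ} (h : M.cutoff i w = 1) : ‖M.phase i s w‖ = 1 := by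
  cases s with
  | true => simp [phase]
  | false =>
    rw [phase_false_of_cutoff h, norm_direction_pow (ne_zero_of_cutoff (by rw [h]; simp))]

lemma gap_none_apply (x : ℂ × ℂ) :
    M.gap i none x = ‖x.1‖ ^ 2 - M.R i ^ 2 - M.tw i * ‖x.2‖ ^ 2 / 2 := by
  simp [gap, toricGap, sgn, ctr, rad, twist]

lemma gap_some_apply (k : Fin (Γ.genus i)) (x : ℂ × ℂ) :
    M.gap i (some k) x = M.ρ i ^ 2 - ‖x.1 - M.pos i (k + 1)‖ ^ 2 := by
  simp [gap, toricGap, sgn, ctr, rad, twist]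

lemma norm_pushoff_snd {c : ℝ} (hc : 0 ≤ c) (s : Bool) (w : ℂ) :
    ‖(M.pushoff i c s w).2‖ = c * ‖M.phase i s w‖ := by
  rw [pushoff, norm_mul, Complex.norm_real, Real.norm_of_nonneg hc]

/-- Near the outer boundary the push-off preserves the defining function of the boundary. -/
lemma gap_none_pushoff {c : ℝ} (hc : 0 ≤ c) (s : Bool) {w : ℂ} (h : M.cutoff i w = 1) :
    M.gap i none (M.pushoff i c s w) = M.gap i none (w, 0) := by
  rw [gap_none_apply, norm_pushoff_snd hc, norm_phase_of_cutoff s h, gap_none_apply]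
  change ‖w * (M.stretchFactor i c w : ℝ)‖ ^ 2 - _ - _ = _
  rw [norm_stretch_sq, h]
  simp
  ring

lemma gap_some_of_norm_ge (k : Fin (Γ.genus i)) {x : ℂ × ℂ} (h : M.R i / 2 ≤ ‖x.1‖) :
    M.gap i (some k) x ≤ 0 := by
  have h5 := norm_pos_le (M := M) (i := i) (k := (k : ℕ) + 1) (by have := k.2; omega)
  have h6 := norm_sub_norm_le x.1 (M.pos i (k + 1))
  have h7 := M.ρ_le i
  have h8 := M.ρ_pos i
  rw [gap_some_apply, sub_nonpos]
  gcongr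
  linarith

lemma norm_le_stretch (c : ℝ) (w : ℂ) : ‖w‖ ≤ ‖w * (M.stretchFactor i c w : ℝ)‖ := by
  refine abs_le_of_sq_le_sq' ?_ (norm_nonneg _) |>.2
  rw [norm_stretch_sq]
  have := cutoff_nonneg (M := M) (i := i) w
  have : (0 : ℝ) ≤ M.tw i * c ^ 2 / 2 * M.cutoff i w := by positivity
  linarith

variable (M) in
/-- The heights at which the push-off is defined. -/
def IsSmall (i : Fin n) (c : ℝ) : Prop := 0 ≤ c ∧ c < M.ε ∧ M.tw i * c ^ 2 ≤ M.R i ^ 2 / 2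

lemma pushoff_mem {c : ℝ} (hc : M.IsSmall i c) (s : Bool) {w : ℂ} (hw : (w, 0) ∈ M.sheetSet i) :
    M.pushoff i c s w ∈ M.sheetSet i := by
  have hR := R_pos (M := M) (i := i)
  have hδ := M.δ_pos i
  refine ⟨?_, fun b => ?_⟩
  · rw [norm_pushoff_snd hc.1]
    nlinarith [norm_phase_le (M := M) (i := i) s w, hc.1, hc.2.1]
  · cases b with
    | none =>
      rcases le_or_gt (M.R i ^ 2 / 2) (‖w‖ ^ 2) with h | h
      · rw [gap_none_pushoff hc.1 s (cutoff_of_sq_ge h)]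
        exact hw.2 none
      · rw [gap_none_apply]
        change ‖w * (M.stretchFactor i c w : ℝ)‖ ^ 2 - _ - _ < _
        rw [norm_stretch_sq]
        have h1 := cutoff_nonneg (M := M) (i := i) w
        have h2 := cutoff_le_one (M := M) (i := i) w
        have h3 : (0 : ℝ) ≤ M.tw i * c ^ 2 := by positivity
        have h4 : 0 ≤ M.tw i * ‖(M.pushoff i c s w).2‖ ^ 2 / 2 := by positivity
        nlinarith [hc.2.2]
    | some k =>
      rcases le_or_gt ‖w‖ (M.R i / 2) with h | h
      · have h1 := hw.2 (some k)
        rw [gap_some_apply] at h1 ⊢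
        change _ - ‖w * (M.stretchFactor i c w : ℝ) - _‖ ^ 2 < _
        rw [stretchFactor_of_cutoff (cutoff_of_le h)]
        simpa using h1
      · exact (gap_some_of_norm_ge k (h.le.trans (norm_le_stretch c w))).trans_lt hδ

lemma cutoff_of_mem_outer {x : ℂ × ℂ} (hx : x ∈ M.collar i none) : M.cutoff i x.1 = 1 := by
  refine cutoff_of_sq_ge ?_
  have hR := R_pos (M := M) (i := i)
  have := M.norm_of_mem_outer hx.2
  nlinarith

lemma cutoff_of_mem_inner {k : Fin (Γ.genus i)} {x : ℂ × ℂ} (hx : x ∈ M.collar i (some k)) :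
    M.cutoff i x.1 = 0 := by
  refine cutoff_of_le ?_
  have h1 := M.norm_of_mem_inner hx.2
  have h2 := norm_pos_le (M := M) (i := i) (k := (k : ℕ) + 1) (by have := k.2; omega)
  have h3 := norm_sub_norm_le x.1 (M.pos i (k + 1))
  have h4 := M.d_pos i
  linarith

lemma flip_none (x : ℂ × ℂ) : M.flip i none x =
    (conj x.1 * (√(2 * M.R i ^ 2 + M.tw i * ‖x.2‖ ^ 2 - ‖x.1‖ ^ 2) / ‖x.1‖ : ℝ),
      x.2 * (x.1 / (‖x.1‖ : ℝ)) ^ M.tw i) := by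
  simp [flip, toricMap, toricSq, ctr, rad, twist]

lemma direction_mul {w : ℂ} {L : ℝ} (hL : 0 < L) :
    w * L / (‖w * L‖ : ℝ) = w / (‖w‖ : ℝ) := by
  have hLC : (L : ℂ) ≠ 0 := by exact_mod_cast hL.ne'
  rw [norm_mul, Complex.norm_real, Real.norm_of_nonneg hL.le, Complex.ofReal_mul,
    mul_div_mul_right _ _ hLC]

lemma phase_flip {w w' : ℂ} (s : Bool) (h1 : M.cutoff i w = 1) (h2 : M.cutoff i w' = 1)
    {t : ℝ} (ht : 0 < t) (hw' : w' = conj w * t) :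
    M.phase i s w * (w / (‖w‖ : ℝ)) ^ M.tw i = M.phase i (!s) w' := by
  cases s with
  | true =>
    have h3 : M.phase i true w = 1 := by simp [phase]
    rw [h3, one_mul, Bool.not_true, phase_false_of_cutoff h2, hw', map_mul, Complex.conj_conj,
      Complex.conj_ofReal, norm_mul, RCLike.norm_conj, ← norm_mul, direction_mul ht]
  | false =>
    have h3 : M.phase i (!false) w' = 1 := by simp [phase]
    have hA : ((‖w‖ : ℝ) : ℂ) ≠ 0 := by
      exact_mod_cast norm_ne_zero_iff.2 (ne_zero_of_cutoff (by rw [h1]; exact one_ne_zero))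
    have h4 : conj w * w = (‖w‖ : ℂ) ^ 2 := Complex.conj_mul' _
    have h5 : conj w / (‖w‖ : ℝ) * (w / (‖w‖ : ℝ)) = 1 := by
      field_simp
      exact h4
    rw [h3, phase_false_of_cutoff h1, ← mul_pow, h5, one_pow]

/-- The push-off is compatible with the gluing of the outer boundary. Radii match by the choice of
the stretching factor, and the phases match as the gluing turns the fibre `tw i` times. -/
lemma flip_pushoff_outer {c : ℝ} (hc : M.IsSmall i c) (s : Bool) {w : ℂ}
    (hw : (w, 0) ∈ M.collar i none) :
    M.flip i none (M.pushoff i c s w) = M.pushoff i c (!s) (M.flip i none (w, 0)).1 := by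
  have h1 : M.cutoff i w = 1 := cutoff_of_mem_outer (x := (w, 0)) hw
  have h2 : M.cutoff i (M.flip i none (w, 0)).1 = 1 := cutoff_of_mem_outer (flip_mem_collar hw)
  have hA : 0 < ‖w‖ := norm_pos_iff.2 (ne_zero_of_cutoff (by rw [h1]; exact one_ne_zero))
  obtain ⟨N, hNdef⟩ : ∃ N, N = 2 * M.R i ^ 2 - ‖w‖ ^ 2 := ⟨_, rfl⟩
  have hN : 0 < N := by
    have h3 := δ_lt_rad (M := M) (i := i) none
    have h4 := (abs_lt.1 hw.2).2
    rw [gap_none] at h4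
    have h5 : M.rad i none = M.R i := rfl
    rw [h5] at h3
    linarith
  have hflip : (M.flip i none (w, 0)).1 = conj w * (√N / ‖w‖ : ℝ) := by
    rw [flip_none, hNdef]
    simp
  have ht : 0 < √N / ‖w‖ := div_pos (Real.sqrt_pos.2 hN) hA
  have hphase := phase_flip s h1 h2 ht hflip
  have hL : 0 < M.stretchFactor i c w := stretchFactor_pos c w
  have hfac : M.stretchFactor i c (M.flip i none (w, 0)).1 * √N =
      √(N + M.tw i * c ^ 2 / 2) := by
    have hnflip : ‖(M.flip i none (w, 0)).1‖ ^ 2 = N := by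
      rw [hflip, norm_mul, RCLike.norm_conj, Complex.norm_real, Real.norm_of_nonneg ht.le,
        mul_div_cancel₀ _ hA.ne', Real.sq_sqrt hN.le]
    rw [stretchFactor, h2, hnflip, ← Real.sqrt_mul (by positivity)]
    congr 1
    field_simp
  have hsq : 2 * M.R i ^ 2 + M.tw i * ‖(M.pushoff i c s w).2‖ ^ 2 -
      ‖w * (M.stretchFactor i c w : ℝ)‖ ^ 2 = N + M.tw i * c ^ 2 / 2 := by
    rw [norm_pushoff_snd hc.1, norm_phase_of_cutoff s h1, norm_stretch_sq, h1, hNdef]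
    ring
  rw [flip_none]
  refine Prod.ext ?_ ?_
  · change conj (w * (M.stretchFactor i c w : ℝ)) * (√(2 * M.R i ^ 2 + M.tw i *
      ‖(M.pushoff i c s w).2‖ ^ 2 - ‖w * (M.stretchFactor i c w : ℝ)‖ ^ 2) /
        ‖w * (M.stretchFactor i c w : ℝ)‖ : ℝ) =
      (M.flip i none (w, 0)).1 * (M.stretchFactor i c (M.flip i none (w, 0)).1 : ℝ)
    rw [hsq, ← hfac]
    generalize M.stretchFactor i c (M.flip i none (w, 0)).1 = L' at *
    rw [hflip, norm_mul, Complex.norm_real, Real.norm_of_nonneg hL.le, map_mul,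
      Complex.conj_ofReal, mul_assoc, mul_assoc, ← Complex.ofReal_mul, ← Complex.ofReal_mul]
    congr 2
    field_simp
  · change c * M.phase i s w * (w * (M.stretchFactor i c w : ℝ) /
      (‖w * (M.stretchFactor i c w : ℝ)‖ : ℝ)) ^ M.tw i = c * M.phase i (!s) _
    rw [direction_mul hL, mul_assoc, hphase]

lemma pushoff_of_mem_inner (c : ℝ) (s : Bool) {k : Fin (Γ.genus i)} {x : ℂ × ℂ}
    (hx : x ∈ M.collar i (some k)) : M.pushoff i c s x.1 = (x.1, (c : ℂ)) := by
  have h0 := cutoff_of_mem_inner hx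
  have h1 : M.phase i s x.1 = 1 := by cases s <;> simp [phase, h0]
  rw [pushoff, stretchFactor_of_cutoff h0, h1]
  simp

lemma pushoff_mem_collar {c : ℝ} (hc : M.IsSmall i c) (s : Bool) {b : Option (Fin (Γ.genus i))}
    {w : ℂ} (hw : (w, 0) ∈ M.collar i b) : M.pushoff i c s w ∈ M.collar i b ∧
      M.flip i b (M.pushoff i c s w) = M.pushoff i c (!s) (M.flip i b (w, 0)).1 := by
  have hs := (pushoff_mem hc s (collar_subset b hw)).1
  cases b with
  | none =>
    refine ⟨⟨hs, ?_⟩, flip_pushoff_outer hc s hw⟩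
    rw [gap_none_pushoff hc.1 s (cutoff_of_mem_outer (x := (w, 0)) hw)]
    exact hw.2
  | some k =>
    have h0 : M.pushoff i c s w = (w, (c : ℂ)) :=
      pushoff_of_mem_inner c s (x := (w, 0)) hw
    refine ⟨⟨hs, ?_⟩, ?_⟩
    · have h1 := hw.2
      rw [h0, gap_some_apply]
      rwa [gap_some_apply] at h1
    · rw [h0, pushoff_of_mem_inner c (!s) (flip_mem_collar hw)]
      simp [flip, toricMap, toricSq, twist]

variable (M) in
/-- The push-off of a surface at height `c`. -/
def pushoffMap (i : Fin n) (c : ℝ) : (M.surfaceGlue i).Space → M.glue.Space :=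
  (M.surfaceGlue i).lift fun s w => M.glue.pt (i, s) (M.pushoff i c s w)

lemma pushoffMap_pt {c : ℝ} (hc : M.IsSmall i c) {s : Bool} {w : ℂ}
    (hw : (w, 0) ∈ M.sheetSet i) :
    M.pushoffMap i c ((M.surfaceGlue i).pt s w) = M.glue.pt (i, s) (M.pushoff i c s w) := by
  refine (M.surfaceGlue i).lift_pt (fun b x hx => ?_) hw
  obtain ⟨h1, h2⟩ := pushoff_mem_collar hc b.2 hx
  have h3 : M.glue.pt (i, !b.2) (M.flip i b.1 (M.pushoff i c b.2 x)) =
    M.glue.pt (i, b.2) (M.pushoff i c b.2 x) := M.glue.pt_φ (c := .inl ⟨i, b⟩) h1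
  rw [h2] at h3
  exact h3

variable (M) in
lemma contDiff_phase (i : Fin n) (s : Bool) : ContDiff ℝ ∞ (M.phase i s) := by
  cases s with
  | true => exact contDiff_const
  | false =>
    have h4 : ContDiff ℝ ∞ fun w => (M.cutoff i w : ℂ) :=
      Complex.ofRealCLM.contDiff.comp (M.contDiff_cutoff i)
    have h5 := contDiff_cutoff_smul (M := M) (i := i)
      (g := fun w : ℂ => (conj w / (‖w‖ : ℝ)) ^ M.tw i) fun w hw => by
        have h5 : ContDiffAt ℝ ∞ (fun w : ℂ => ((‖w‖ : ℝ) : ℂ)) w :=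
          Complex.ofRealCLM.contDiff.contDiffAt.comp w (contDiffAt_id.norm ℝ hw)
        have h6 : ContDiffAt ℝ ∞ (fun w : ℂ => conj w) w :=
          Complex.conjCLE.contDiff.contDiffAt
        exact (h6.mul (h5.inv (by exact_mod_cast norm_ne_zero_iff.2 hw))).pow _
    exact (contDiff_const.sub h4).add (by simpa only [Complex.real_smul] using h5)

variable (M) in
lemma contDiff_pushoff (i : Fin n) (s : Bool) :
    ContDiff ℝ ∞ fun x : ℝ × ℂ => M.pushoff i x.1 s x.2 := by
  have h1 : ContDiff ℝ ∞ fun w : ℂ => M.cutoff i w / ‖w‖ ^ 2 := by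
    have := contDiff_cutoff_smul (M := M) (i := i) (g := fun w : ℂ => (‖w‖ ^ 2)⁻¹) fun w hw =>
      (contDiff_norm_sq ℝ).contDiffAt.inv (pow_ne_zero 2 (norm_ne_zero_iff.2 hw))
    simpa only [smul_eq_mul, ← div_eq_mul_inv] using this
  have h2 : ContDiff ℝ ∞ fun x : ℝ × ℂ => M.stretchFactor i x.1 x.2 := by
    refine ContDiff.sqrt ?_ fun x => (stretchFactor_radicand_pos x.1 x.2).ne'
    exact contDiff_const.add (((contDiff_const.mul (contDiff_fst.pow 2)).div_const 2).mul
      (h1.comp contDiff_snd))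
  exact (contDiff_snd.mul (Complex.ofRealCLM.contDiff.comp h2)).prodMk
    ((Complex.ofRealCLM.contDiff.comp contDiff_fst).mul ((M.contDiff_phase i s).comp contDiff_snd))

lemma contDiff_pushoff_right (c : ℝ) (s : Bool) : ContDiff ℝ ∞ (M.pushoff i c s) :=
  (M.contDiff_pushoff i s).comp (contDiff_const.prodMk contDiff_id)

lemma contMDiff_pushoffMap {c : ℝ} (hc : M.IsSmall i c) :
    ContMDiff (𝓡 2) (𝓡 4) ∞ (M.pushoffMap i c) := by
  intro p
  obtain ⟨s, w, hw, rfl⟩ := (M.surfaceGlue i).exists_rep p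
  refine (M.surfaceGlue i).contMDiffAt_of_comp_pt hw ?_
  refine (ContMDiffAt.comp w (M.glue.contMDiffAt_pt (i := (i, s)) (pushoff_mem hc s hw))
    (contDiff_pushoff_right c s).contDiffAt.contMDiffAt).congr_of_eventuallyEq ?_
  filter_upwards [((M.surfaceGlue i).isOpen_U s).mem_nhds hw] with y hy using pushoffMap_pt hc hy

lemma IsSmall.mul {c t : ℝ} (hc : M.IsSmall i c) (ht : t ∈ Icc (0 : ℝ) 1) :
    M.IsSmall i (t * c) := by
  obtain ⟨h1, h2, h3⟩ := hc
  have h4 : t * c ≤ c := by nlinarith [ht.2]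
  have h5 : 0 ≤ t * c := mul_nonneg ht.1 h1
  refine ⟨h5, h4.trans_lt h2, le_trans ?_ h3⟩
  gcongr

lemma pushoffMap_zero (p : (M.surfaceGlue i).Space) : M.pushoffMap i 0 p = M.inclusion i p := by
  obtain ⟨s, w, hw, rfl⟩ := exists_rep_sheet p
  have hR := R_pos (M := M) (i := i)
  have h0 : M.IsSmall i 0 := ⟨le_rfl, M.ε_pos, by simp; positivity⟩
  rw [pushoffMap_pt h0 hw, inclusion_pt hw]
  simp [pushoff, stretchFactor]

lemma continuous_pushoffMap {c : ℝ} (hc : M.IsSmall i c) :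
    Continuous fun x : unitInterval × (M.surfaceGlue i).Space =>
      M.pushoffMap i (x.1 * c) x.2 := by
  rw [continuous_iff_continuousAt]
  rintro ⟨t, p⟩
  obtain ⟨s, w, hw, rfl⟩ := (M.surfaceGlue i).exists_rep p
  have h1 : ContinuousAt (fun x : unitInterval × (M.surfaceGlue i).Space =>
      M.pushoff i (x.1 * c) s ((M.surfaceGlue i).coord s x.2)) (t, (M.surfaceGlue i).pt s w) := by
    have h2 : ContinuousAt (fun x : unitInterval × (M.surfaceGlue i).Space =>
        ((x.1 : ℝ) * c, (M.surfaceGlue i).coord s x.2)) (t, (M.surfaceGlue i).pt s w) := by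
      refine ContinuousAt.prodMk ?_ ?_
      · exact ((continuous_subtype_val.comp continuous_fst).mul continuous_const).continuousAt
      · exact ContinuousAt.comp (x := (t, (M.surfaceGlue i).pt s w))
          ((M.surfaceGlue i).contMDiffAt_coord hw).continuousAt continuousAt_snd
    exact ContinuousAt.comp (x := (t, (M.surfaceGlue i).pt s w))
      (g := fun x : ℝ × ℂ => M.pushoff i x.1 s x.2)
      (M.contDiff_pushoff i s).continuous.continuousAt h2
  have h3 : M.pushoff i (t * c) s ((M.surfaceGlue i).coord s ((M.surfaceGlue i).pt s w)) ∈
      M.sheetSet i := by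
    rw [(M.surfaceGlue i).coord_pt hw]
    exact pushoff_mem (hc.mul t.2) s hw
  have h4 := ContinuousAt.comp (x := (t, (M.surfaceGlue i).pt s w)) (g := M.glue.pt (i, s))
    ((M.glue.continuousOn_pt (i, s)).continuousAt ((M.glue.isOpen_U (i, s)).mem_nhds h3)) h1
  refine h4.congr ?_
  have h5 : ∀ᶠ x : unitInterval × (M.surfaceGlue i).Space in 𝓝 (t, (M.surfaceGlue i).pt s w),
      x.2 ∈ (M.surfaceGlue i).range s :=
    continuousAt_snd.eventually
      (((M.surfaceGlue i).isOpen_range s).mem_nhds ((M.surfaceGlue i).pt_mem_range hw))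
  filter_upwards [h5]
  rintro ⟨t, p⟩ ⟨w, hw, rfl⟩
  have h6 : (M.surfaceGlue i).coord s ((M.surfaceGlue i).pt s w) = w :=
    (M.surfaceGlue i).coord_pt hw
  refine Eq.trans ?_ (pushoffMap_pt (hc.mul t.2) hw).symm
  change M.glue.pt (i, s) (M.pushoff i (t * c) s
    ((M.surfaceGlue i).coord s ((M.surfaceGlue i).pt s w))) = _
  rw [h6]

end PlumbingModel
end

/-! ### The self-intersection numbers -/

noncomputable section

open Set Filter ComplexConjugate

namespace PlumbingModel

variable {n : ℕ} {Γ : PlumbingGraph n} {M : PlumbingModel Γ} {i : Fin n}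

/-- The phase is a convex combination of two numbers of absolute value one, so it vanishes only as
the mean of two opposite ones. -/
lemma phase_eq_zero {w : ℂ} : M.phase i false w = 0 ↔
    M.cutoff i w = 1 / 2 ∧ (conj w / (‖w‖ : ℝ)) ^ M.tw i = -1 := by
  have h2 : M.phase i false w = (1 - M.cutoff i w : ℝ) +
      (M.cutoff i w : ℝ) * (conj w / (‖w‖ : ℝ)) ^ M.tw i := by simp [phase]
  rw [h2]
  constructor
  · intro h
    have h0 := cutoff_nonneg (M := M) (i := i) w
    have h1 := cutoff_le_one (M := M) (i := i) w
    have hw : w ≠ 0 := ne_zero_of_cutoff (M := M) (i := i) fun h3 => by simp [h3] at h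
    have h4 : M.cutoff i w = 1 / 2 := by
      have h5 := congrArg norm (eq_neg_of_add_eq_zero_left h)
      rw [norm_neg, norm_mul, norm_direction_pow hw, Complex.norm_real, Complex.norm_real,
        Real.norm_of_nonneg h0, Real.norm_of_nonneg (sub_nonneg.2 h1)] at h5
      linarith
    refine ⟨h4, ?_⟩
    rw [h4] at h
    push_cast at h
    linear_combination 2 * h
  · rintro ⟨h3, h4⟩
    rw [h3, h4]
    push_cast
    ring

lemma cutoff_eq_half {w : ℂ} : M.cutoff i w = 1 / 2 ↔ ‖w‖ ^ 2 = 3 / 8 * M.R i ^ 2 := by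
  have hR := R_pos (M := M) (i := i)
  rw [cutoff, smoothTransition_eq_half, sub_eq_iff_eq_add, div_eq_iff (by positivity)]
  constructor <;> intro h <;> linarith

/-- At a zero, the derivative of the phase in the direction `w * a`. -/
lemma hasDerivAt_phase {w : ℂ} (hw : M.phase i false w = 0) (a : ℂ) :
    HasDerivAt (fun t : ℝ => M.phase i false (w * (1 + t * a)))
      ⟨-12 * a.re, M.tw i / 2 * a.im⟩ 0 := by
  obtain ⟨h1, h2⟩ := phase_eq_zero.1 hw
  have h3 := cutoff_eq_half.1 h1
  have hR := R_pos (M := M) (i := i)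
  have hw0 : w ≠ 0 := ne_zero_of_cutoff (M := M) (i := i) (by rw [h1]; norm_num)
  have hw1 : ((‖w‖ : ℝ) : ℂ) ≠ 0 := by exact_mod_cast norm_ne_zero_iff.2 hw0
  have hq : HasDerivAt (fun t : ℝ => ‖1 + t * a‖) a.re 0 := hasDerivAt_norm_one_add a
  have hcut : HasDerivAt (fun t : ℝ => M.cutoff i (w * (1 + t * a))) (6 * a.re) 0 := by
    have h4 : HasDerivAt (fun t : ℝ => 4 * ‖w * (1 + t * a)‖ ^ 2 / M.R i ^ 2 - 1) (3 * a.re) 0 := by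
      have h5 : ∀ t : ℝ, 4 * ‖w * (1 + t * a)‖ ^ 2 / M.R i ^ 2 - 1 = 3 / 2 * ‖1 + t * a‖ ^ 2 - 1 :=
        fun t => by
          rw [norm_mul, mul_pow, h3]
          field_simp
          ring
      simp only [h5]
      refine (((hq.pow 2).const_mul (3 / 2)).sub_const 1).congr_deriv ?_
      simp
      ring
    have h6 : HasDerivAt Real.smoothTransition 2
        ((fun t : ℝ => 4 * ‖w * (1 + t * a)‖ ^ 2 / M.R i ^ 2 - 1) 0) := by
      have h7 : (fun t : ℝ => 4 * ‖w * (1 + t * a)‖ ^ 2 / M.R i ^ 2 - 1) 0 = 1 / 2 := by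
        simp only [Complex.ofReal_zero, zero_mul, add_zero, mul_one, h3]
        field_simp
        norm_num
      rw [h7]
      exact hasDerivAt_smoothTransition_half
    refine (h6.comp (0 : ℝ) h4).congr_deriv ?_
    ring
  have hlin : HasDerivAt (fun t : ℝ => (1 + t * conj a : ℂ)) (conj a) 0 := by
    simpa using ((Complex.ofRealCLM.hasDerivAt (x := (0 : ℝ))).mul_const (conj a)).const_add 1
  have hdir : HasDerivAt (fun t : ℝ => conj (w * (1 + t * a)) / (‖w * (1 + t * a)‖ : ℝ))
      (conj w / (‖w‖ : ℝ) * (-Complex.I * a.im)) 0 := by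
    have h4 : ∀ t : ℝ, conj (w * (1 + t * a)) / (‖w * (1 + t * a)‖ : ℝ) =
        conj w / (‖w‖ : ℝ) * ((1 + t * conj a) / (‖1 + t * a‖ : ℝ)) := fun t => by
      rw [norm_mul, map_mul, Complex.ofReal_mul, mul_div_mul_comm]
      simp
    simp only [h4]
    refine ((hlin.div hq.ofReal_comp (by simp)).const_mul _).congr_deriv ?_
    have e2 : conj a = (a.re : ℂ) - a.im * Complex.I := by apply Complex.ext <;> simp
    rw [e2]
    simp
    left
    ring
  have hpow := hdir.pow (M.tw i)
  have hsum := (hcut.ofReal_comp.const_sub 1).add (hcut.ofReal_comp.mul hpow)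
  refine (hsum.congr_of_eventuallyEq (.of_forall fun t => ?_)).congr_deriv ?_
  · simp [phase]
  · have h5 : (M.tw i : ℂ) * (conj w / (‖w‖ : ℝ)) ^ (M.tw i - 1) *
        (conj w / (‖w‖ : ℝ) * (-Complex.I * a.im)) = M.tw i * (Complex.I * a.im) := by
      rcases Nat.eq_zero_or_pos (M.tw i) with h0 | h0
      · rw [h0]; simp
      · have : (conj w / (‖w‖ : ℝ)) ^ (M.tw i - 1) * (conj w / (‖w‖ : ℝ)) = -1 := by
          rw [← pow_succ, Nat.sub_add_cancel h0, h2]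
        linear_combination (-M.tw i * Complex.I * a.im) * this
    simp only [Pi.pow_apply, Complex.ofReal_zero, zero_mul, add_zero, mul_one, h2, h1, h5]
    apply Complex.ext <;> simp <;> ring

/-- At a zero the phase is a local diffeomorphism which reverses the orientation. -/
lemma det_fderiv_phase_neg {w : ℂ} (hw : M.phase i false w = 0) :
    (fderiv ℝ (M.phase i false) w).det < 0 := by
  obtain ⟨h1, h2⟩ := phase_eq_zero.1 hw
  have htw : M.tw i ≠ 0 := by
    intro h0
    rw [h0, pow_zero] at h2
    norm_num at h2
  have hw0 : w ≠ 0 := ne_zero_of_cutoff (M := M) (i := i) (by rw [h1]; norm_num)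
  have hd : DifferentiableAt ℝ (M.phase i false) w :=
    ((M.contDiff_phase i false).differentiable (by simp)) w
  have h3 : ∀ a, fderiv ℝ (M.phase i false) w (w * a) = ⟨-12 * a.re, M.tw i / 2 * a.im⟩ := by
    intro a
    have hline : HasDerivAt (fun t : ℝ => w * (1 + t * a)) (w * a) 0 := by
      simpa using
        (((Complex.ofRealCLM.hasDerivAt (x := (0 : ℝ))).mul_const a).const_add 1).const_mul w
    have hw' : w = w * (1 + (0 : ℝ) * a) := by simp
    have h4 := HasFDerivAt.comp_hasDerivAt (0 : ℝ) (hw' ▸ hd.hasFDerivAt) hline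
    rw [← hw'] at h4
    exact h4.unique (hasDerivAt_phase hw a)
  have h4 := areaForm_map (fderiv ℝ (M.phase i false) w) (w * 1) (w * Complex.I)
  rw [h3, h3, areaForm_mul] at h4
  simp [areaForm_apply'] at h4
  have h5 : 0 < ‖w‖ ^ 2 := by have := norm_pos_iff.2 hw0; positivity
  have h6 : (0 : ℝ) < M.tw i := by exact_mod_cast Nat.pos_of_ne_zero htw
  by_contra hcon
  push Not at hcon
  nlinarith [mul_nonneg hcon h5.le]

/-- The push-off meets the surface exactly in the zeros of its phase. -/
lemma pushoffMap_eq_inclusion {c : ℝ} (hc : M.IsSmall i c) (hc0 : c ≠ 0)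
    {p q : (M.surfaceGlue i).Space} : M.pushoffMap i c p = M.inclusion i q ↔
      (M.surfaceGlue i).sheet p = false ∧ M.phase i false ((M.surfaceGlue i).base p) = 0 ∧
      (M.surfaceGlue i).sheet q = false ∧
      M.pushoff i c false ((M.surfaceGlue i).base p) = ((M.surfaceGlue i).base q, 0) := by
  have hw : ((M.surfaceGlue i).base p, 0) ∈ M.sheetSet i := (M.surfaceGlue i).base_mem p
  have hw' : ((M.surfaceGlue i).base q, 0) ∈ M.sheetSet i := (M.surfaceGlue i).base_mem q
  have h1 : M.pushoffMap i c p = M.glue.pt (i, (M.surfaceGlue i).sheet p)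
    (M.pushoff i c ((M.surfaceGlue i).sheet p) ((M.surfaceGlue i).base p)) := rfl
  have h2 : M.inclusion i q = M.glue.pt (i, (M.surfaceGlue i).sheet q)
    ((M.surfaceGlue i).base q, 0) := rfl
  have hm := pushoff_mem hc ((M.surfaceGlue i).sheet p) hw
  constructor
  swap
  · rintro ⟨h3, -, h5, h6⟩
    rw [h1, h2, h3, h5, h6]
  intro h
  rw [h1, h2] at h
  have hcC : (c : ℂ) ≠ 0 := by exact_mod_cast hc0
  -- A zero of the normal component can only be a zero of the phase on the second sheet.
  have key : (M.pushoff i c ((M.surfaceGlue i).sheet p) ((M.surfaceGlue i).base p)).2 = 0 →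
      (M.surfaceGlue i).sheet p = false ∧ M.phase i false ((M.surfaceGlue i).base p) = 0 := by
    intro h3
    have h4 := (mul_eq_zero.1 h3).resolve_left hcC
    have h5 : (M.surfaceGlue i).sheet p = false := by
      by_contra hcon
      have h6 : (M.surfaceGlue i).sheet p = true := Bool.eq_true_of_not_eq_false hcon
      rw [h6] at h4
      simp [phase] at h4
    rw [h5] at h4
    exact ⟨h5, h4⟩
  rcases (M.glue.pt_eq_pt (i := (i, (M.surfaceGlue i).sheet p))
    (j := (i, (M.surfaceGlue i).sheet q)) hm hw').1 h with
    ⟨h3, h4⟩ | ⟨⟨i', b, t⟩ | ⟨i', j, k⟩, h3, h4, h5, h6⟩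
  · obtain ⟨h5, h6⟩ := key (congrArg Prod.snd h4)
    have h7 : (M.surfaceGlue i).sheet p = (M.surfaceGlue i).sheet q := congrArg Prod.snd h3
    refine ⟨h5, h6, h7.symm.trans h5, ?_⟩
    rw [← h4, h5]
  · exfalso
    obtain rfl : i' = i := congrArg Prod.fst h3
    have h5 : M.pushoff i' c ((M.surfaceGlue i').sheet p) ((M.surfaceGlue i').base p) ∈
      M.collar i' b := h5
    have h7 : (M.flip i' b (M.pushoff i' c ((M.surfaceGlue i').sheet p)
      ((M.surfaceGlue i').base p))).2 = 0 := congrArg Prod.snd h6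
    obtain ⟨h8, h9⟩ := key (norm_eq_zero.1 (by rw [← norm_flip_snd h5.2, h7, norm_zero]))
    -- The zeros of the phase are too far from all the boundaries to lie in a collar.
    have h10 := cutoff_eq_half.1 (phase_eq_zero.1 h9).1
    have h11 := M.norm_stretch_sq i' c ((M.surfaceGlue i').base p)
    rw [(phase_eq_zero.1 h9).1, h10] at h11
    have hR := R_pos (M := M) (i := i')
    have hc2 := hc.2.2
    have htc : (0 : ℝ) ≤ M.tw i' * c ^ 2 := by positivity
    cases b with
    | none =>
      have h12 : 3 * M.R i' / 4 ≤ ‖(M.surfaceGlue i').base p *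
        (M.stretchFactor i' c ((M.surfaceGlue i').base p) : ℝ)‖ := M.norm_of_mem_outer h5.2
      nlinarith
    | some k =>
      have h12 : ‖(M.surfaceGlue i').base p *
        (M.stretchFactor i' c ((M.surfaceGlue i').base p) : ℝ) - M.pos i' (k + 1)‖ < M.d i' / 4 :=
        M.norm_of_mem_inner h5.2
      have h13 := norm_pos_le (M := M) (i := i') (k := (k : ℕ) + 1) (by have := k.2; omega)
      have h14 := norm_sub_norm_le ((M.surfaceGlue i').base p *
        (M.stretchFactor i' c ((M.surfaceGlue i').base p) : ℝ)) (M.pos i' (k + 1))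
      have h15 : ‖(M.surfaceGlue i').base p *
        (M.stretchFactor i' c ((M.surfaceGlue i').base p) : ℝ)‖ ≤ M.R i' / 2 := by
        linarith [M.d_pos i']
      nlinarith [norm_nonneg ((M.surfaceGlue i').base p *
        (M.stretchFactor i' c ((M.surfaceGlue i').base p) : ℝ))]
  · obtain rfl : i' = i := congrArg Prod.fst h3
    obtain rfl : j = i' := congrArg Prod.fst h4
    have := Γ.edges_self j
    have := k.2
    omega

lemma surfaceDeriv_pushoffMap {c : ℝ} (hc : M.IsSmall i c) {p : (M.surfaceGlue i).Space}
    {s : Bool} (hs : (M.surfaceGlue i).sheet p = s) (u : EuclideanSpace ℝ (Fin 2)) :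
    coords4 (surfaceDeriv (M.pushoffMap i c) p u) =
      M.glue.toPref (i, s) (M.pushoff i c s ((M.surfaceGlue i).base p))
        (fderiv ℝ (M.pushoff i c s) ((M.surfaceGlue i).base p) (coords2 u)) := by
  subst hs
  have h0 := (M.surfaceGlue i).base_mem p
  refine surfaceDeriv_eq (t := (i, (M.surfaceGlue i).sheet p)) (pushoff_mem hc _ h0)
    ((contDiff_pushoff_right c _).differentiable (by simp) _) ?_ u
  filter_upwards [((M.surfaceGlue i).isOpen_U _).mem_nhds h0] with y hy using pushoffMap_pt hc hy

lemma fderiv_pushoff_snd (c : ℝ) (s : Bool) (w a : ℂ) :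
    (fderiv ℝ (M.pushoff i c s) w a).2 = c * fderiv ℝ (M.phase i s) w a := by
  have h1 := ((contDiff_pushoff_right (M := M) (i := i) c s).differentiable (by simp) w).hasFDerivAt
  have h2 := (ContinuousLinearMap.snd ℝ ℂ ℂ).hasFDerivAt.comp w h1
  have h3 := (((M.contDiff_phase i s).differentiable (by simp) w).hasFDerivAt).const_mul (c : ℂ)
  exact congrArg (fun T : ℂ →L[ℝ] ℂ => T a) (h2.unique h3)

lemma coords2_stdVec_zero : coords2 (stdVec 0) = 1 := by
  apply Complex.ext <;> simp [coords2_apply]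

lemma coords2_stdVec_one : coords2 (stdVec 1) = Complex.I := by
  apply Complex.ext <;> simp [coords2_apply]

lemma basisSign_eq (p : (M.surfaceGlue i).Space) : (M.surface i).basisSign M.Ω p = 1 := by
  have h := eval_inclusion (M := M) (i := i) (M.inclusion i p) p (stdVec 0) (stdVec 1)
  rw [coords2_stdVec_zero, coords2_stdVec_one] at h
  have h2 : areaForm 1 Complex.I = 1 := by simp [areaForm_apply']
  rw [h2] at h
  refine (congrArg (fun t : ℝ => ((SignType.sign t : SignType) : ℤ)) h).trans ?_
  simp

lemma wedgeSq_eq (x : M.glue.Space) (a b c e : EuclideanSpace ℝ (Fin 4)) :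
    M.Ω.wedgeSq x a b c e = sympForm (coords4 a) (coords4 b) * sympForm (coords4 c) (coords4 e) -
      sympForm (coords4 a) (coords4 c) * sympForm (coords4 b) (coords4 e) +
      sympForm (coords4 a) (coords4 e) * sympForm (coords4 b) (coords4 c) := rfl

lemma wedgeSq_crossing {c : ℝ} (hc : M.IsSmall i c) (hc0 : c ≠ 0)
    {p q : (M.surfaceGlue i).Space} (h : M.pushoffMap i c p = M.inclusion i q) :
    M.Ω.wedgeSq (M.inclusion i q) (surfaceDeriv (M.pushoffMap i c) p (stdVec 0))
      (surfaceDeriv (M.pushoffMap i c) p (stdVec 1)) (surfaceDeriv (M.inclusion i) q (stdVec 0))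
      (surfaceDeriv (M.inclusion i) q (stdVec 1)) =
    c ^ 2 * (fderiv ℝ (M.phase i false) ((M.surfaceGlue i).base p)).det := by
  obtain ⟨h1, h2, h3, h4⟩ := (pushoffMap_eq_inclusion hc hc0).1 h
  have hq : ((M.surfaceGlue i).base q, 0) ∈ M.sheetSet i := (M.surfaceGlue i).base_mem q
  have hpres := M.preserves_glue.toPref (i := (i, false)) hq
  rw [wedgeSq_eq, surfaceDeriv_pushoffMap hc h1, surfaceDeriv_pushoffMap hc h1,
    surfaceDeriv_inclusion, surfaceDeriv_inclusion, h3, h4, hpres, hpres, hpres, hpres, hpres,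
    hpres, coords2_stdVec_zero, coords2_stdVec_one]
  have h5 := areaForm_map (fderiv ℝ (M.phase i false) ((M.surfaceGlue i).base p)) 1 Complex.I
  have h6 : areaForm 1 Complex.I = 1 := by simp [areaForm_apply']
  rw [h6, mul_one] at h5
  rw [← h5]
  simp only [sympForm_apply, fderiv_pushoff_snd, areaForm_mul, Complex.norm_real]
  simp [areaForm_apply']
  ring

/-- All crossings are negative, as the phase reverses the orientation at its zeros. -/
lemma crossingSign_pushoffMap {c : ℝ} (hc : M.IsSmall i c) (hc0 : c ≠ 0)
    {p q : (M.surfaceGlue i).Space} (h : M.pushoffMap i c p = M.inclusion i q) :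
    (M.surface i).crossingSign M.Ω (M.pushoffMap i c) p q = -1 := by
  have h1 := wedgeSq_crossing hc hc0 h
  have h2 := det_fderiv_phase_neg ((pushoffMap_eq_inclusion hc hc0).1 h).2.1
  have h3 : c ^ 2 * (fderiv ℝ (M.phase i false) ((M.surfaceGlue i).base p)).det < 0 :=
    mul_neg_of_pos_of_neg (by positivity) h2
  rw [← h1] at h3
  have h4 := sign_neg h3
  have h5 : (M.surface i).crossingSign M.Ω (M.pushoffMap i c) p q =
    (M.surface i).basisSign M.Ω p * (M.surface i).basisSign M.Ω q *
    SignType.sign (M.Ω.wedgeSq (M.inclusion i q)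
      (surfaceDeriv (M.pushoffMap i c) p (stdVec 0)) (surfaceDeriv (M.pushoffMap i c) p (stdVec 1))
      (surfaceDeriv (M.inclusion i) q (stdVec 0)) (surfaceDeriv (M.inclusion i) q (stdVec 1))) :=
    rfl
  rw [h5, h4, basisSign_eq, basisSign_eq]
  rfl

/-- The surface is tangent to the base, and the normal component of the push-off is a local
diffeomorphism. -/
lemma transverse_pushoffMap {c : ℝ} (hc : M.IsSmall i c) (hc0 : c ≠ 0)
    {p q : (M.surfaceGlue i).Space} (h : M.pushoffMap i c p = M.inclusion i q) :
    (surfaceDeriv (M.pushoffMap i c) p).range ⊔ (surfaceDeriv (M.inclusion i) q).range = ⊤ := by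
  obtain ⟨h1, h2, h3, h4⟩ := (pushoffMap_eq_inclusion hc hc0).1 h
  have hq : ((M.surfaceGlue i).base q, 0) ∈ M.sheetSet i := (M.surfaceGlue i).base_mem q
  have hcC : (c : ℂ) ≠ 0 := by exact_mod_cast hc0
  set T := M.glue.toPref (i, false) ((M.surfaceGlue i).base q, 0)
  have hT : Function.Surjective T := by
    refine (LinearMap.injective_iff_surjective (f := (T : ℂ × ℂ →ₗ[ℝ] ℂ × ℂ))).1 ?_
    rw [injective_iff_map_eq_zero]
    intro a ha
    refine eq_zero_of_sympForm fun b => ?_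
    have hpres := M.preserves_glue.toPref (i := (i, false)) hq a b
    have ha : T a = 0 := ha
    rw [← hpres]
    change sympForm (T a) (T b) = 0
    rw [ha]
    simp
  have hS : Function.Surjective (fderiv ℝ (M.phase i false) ((M.surfaceGlue i).base p)) := by
    have h5 := det_fderiv_phase_neg h2
    exact (LinearEquiv.ofIsUnitDet (f := ((fderiv ℝ (M.phase i false)
      ((M.surfaceGlue i).base p) : ℂ →L[ℝ] ℂ) : ℂ →ₗ[ℝ] ℂ)) (v := Complex.basisOneI)
      (v' := Complex.basisOneI) (by
        rw [LinearMap.det_toMatrix]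
        exact isUnit_iff_ne_zero.2 h5.ne)).surjective
  rw [eq_top_iff]
  intro v _
  obtain ⟨⟨x, y⟩, hxy⟩ := hT (coords4 v)
  obtain ⟨a, ha⟩ := hS (y / c)
  have h5 := surfaceDeriv_pushoffMap hc h1 (coords2.symm a)
  rw [coords2.apply_symm_apply, h4] at h5
  set D := fderiv ℝ (M.pushoff i c false) ((M.surfaceGlue i).base p) a with hD
  have hD2 : D.2 = y := by
    rw [hD, fderiv_pushoff_snd, ha]
    field_simp
  have h6 := surfaceDeriv_inclusion (M := M) q (coords2.symm (x - D.1))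
  rw [coords2.apply_symm_apply, h3] at h6
  have h7 : v = surfaceDeriv (M.pushoffMap i c) p (coords2.symm a) +
      surfaceDeriv (M.inclusion i) q (coords2.symm (x - D.1)) := by
    refine coords4.injective ?_
    rw [map_add, h5, h6, ← hxy]
    change T (x, y) = T D + T (x - D.1, 0)
    rw [← map_add]
    congr 1
    refine Prod.ext ?_ ?_
    · simp
    · simp [hD2]
  rw [h7]
  exact Submodule.add_mem_sup ⟨_, rfl⟩ ⟨_, rfl⟩

variable (M) in
/-- The self-intersections are negative. -/
lemma tw_pos (i : Fin n) : 0 < M.tw i := by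
  have h1 := M.flux i
  have h2 : 0 < Γ.area i / (2 * Real.pi) := div_pos (Γ.area_pos i) Real.two_pi_pos
  have h3 : 0 ≤ ∑ j, (Γ.edges i j : ℝ) * M.z j :=
    Finset.sum_nonneg fun j _ => mul_nonneg (Nat.cast_nonneg _) (M.z_pos j).le
  by_contra hcon
  rw [Nat.eq_zero_of_not_pos hcon] at h1
  simp only [Nat.cast_zero, zero_mul] at h1
  linarith

variable (M) in
/-- The zeros of the phase correspond to the roots of `η ^ m = -1`, with `m = tw i`. -/
lemma exists_zeros_phase (i : Fin n) :
    ∃ Z : Finset ℂ, Z.card = M.tw i ∧ ∀ w, w ∈ Z ↔ M.phase i false w = 0 := by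
  classical
  have hm := M.tw_pos i
  have hR := R_pos (M := M) (i := i)
  set f : Polynomial ℂ := Polynomial.X ^ M.tw i - Polynomial.C (-1) with hf
  have hf0 : f ≠ 0 := Polynomial.X_pow_sub_C_ne_zero hm _
  have hcard : f.roots.toFinset.card = M.tw i := by
    rw [Multiset.toFinset_card_of_nodup (Polynomial.nodup_roots
      (Polynomial.separable_X_pow_sub_C _ (by exact_mod_cast hm.ne') (by simp))),
      IsAlgClosed.card_roots_eq_natDegree, Polynomial.natDegree_X_pow_sub_C]
  have hmem : ∀ η, η ∈ f.roots.toFinset ↔ η ^ M.tw i = -1 := fun η => by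
    rw [Multiset.mem_toFinset, Polynomial.mem_roots hf0]
    simp [hf, add_eq_zero_iff_eq_neg]
  have hr : 0 < √(3 / 8) * M.R i := by positivity
  have hrC : ((√(3 / 8) * M.R i : ℝ) : ℂ) ≠ 0 := by exact_mod_cast hr.ne'
  have hr2 : (√(3 / 8) * M.R i) ^ 2 = 3 / 8 * M.R i ^ 2 := by
    rw [mul_pow, Real.sq_sqrt (by norm_num)]
  refine ⟨f.roots.toFinset.image fun η => (√(3 / 8) * M.R i : ℝ) * conj η, ?_, fun w => ?_⟩
  · rw [Finset.card_image_of_injective, hcard]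
    exact fun η η' h => (starRingEnd ℂ).injective (mul_left_cancel₀ hrC h)
  · rw [phase_eq_zero, cutoff_eq_half, Finset.mem_image]
    constructor
    · rintro ⟨η, hη, rfl⟩
      rw [hmem] at hη
      have hη1 : ‖η‖ = 1 := by
        have h1 := congrArg norm hη
        rw [norm_pow, norm_neg, norm_one] at h1
        exact (pow_eq_one_iff_of_nonneg (norm_nonneg _) hm.ne').1 h1
      have h2 : ‖((√(3 / 8) * M.R i : ℝ) : ℂ) * conj η‖ = √(3 / 8) * M.R i := by
        rw [norm_mul, RCLike.norm_conj, hη1, mul_one, Complex.norm_real,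
          Real.norm_of_nonneg hr.le]
      rw [h2]
      refine ⟨hr2, ?_⟩
      rw [map_mul, Complex.conj_conj, Complex.conj_ofReal, mul_div_cancel_left₀ _ hrC, hη]
    · rintro ⟨h1, h2⟩
      have h3 : ‖w‖ = √(3 / 8) * M.R i := by
        rw [← hr2] at h1
        exact (sq_eq_sq₀ (norm_nonneg _) hr.le).1 h1
      refine ⟨conj w / (‖w‖ : ℝ), (hmem _).2 h2, ?_⟩
      rw [h3, map_div₀, Complex.conj_conj, Complex.conj_ofReal, mul_div_cancel₀ _ hrC]

lemma mem_sheetSet_of_phase {w : ℂ} (hw : M.phase i false w = 0) : (w, 0) ∈ M.sheetSet i := by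
  have h1 := cutoff_eq_half.1 (phase_eq_zero.1 hw).1
  have hR := R_pos (M := M) (i := i)
  have hδ := M.δ_pos i
  refine ⟨by simpa using M.ε_pos, fun b => ?_⟩
  cases b with
  | none =>
    rw [gap_none, h1]
    nlinarith
  | some k =>
    refine (gap_some_of_norm_ge k ?_).trans_lt hδ
    change M.R i / 2 ≤ ‖w‖
    nlinarith [norm_nonneg w]

/-- The push-off meets the surface in `tw i = -selfInt i` points, all of them negative. -/
theorem hasSelfIntersection (i : Fin n) :
    (M.surface i).HasSelfIntersection M.Ω (Γ.selfInt i) := by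
  classical
  have hR := R_pos (M := M) (i := i)
  obtain ⟨c, hc, hc0⟩ : ∃ c, M.IsSmall i c ∧ 0 < c := by
    have h1 : ∀ᶠ c : ℝ in 𝓝[>] 0, c < M.ε :=
      (gt_mem_nhds M.ε_pos).filter_mono nhdsWithin_le_nhds
    have h2 : ∀ᶠ c : ℝ in 𝓝[>] 0, M.tw i * c ^ 2 < M.R i ^ 2 / 2 := by
      have h3 : ContinuousAt (fun c : ℝ => M.tw i * c ^ 2) 0 := by fun_prop
      exact (h3.eventually_lt continuousAt_const (by simp; positivity)).filter_mono
        nhdsWithin_le_nhds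
    obtain ⟨c, ⟨h3, h4⟩, h5⟩ := ((h1.and h2).and self_mem_nhdsWithin).exists
    have h5 : 0 < c := h5
    exact ⟨c, ⟨h5.le, h3, h4.le⟩, h5⟩
  obtain ⟨Z, hZ, hmemZ⟩ := M.exists_zeros_phase i
  have hcont : Continuous (M.pushoffMap i c) := (contMDiff_pushoffMap hc).continuous
  set pair : ℂ → (M.surfaceGlue i).Space × (M.surfaceGlue i).Space := fun w =>
    ((M.surfaceGlue i).pt false w, (M.surfaceGlue i).pt false (M.pushoff i c false w).1)
  have hpush : ∀ w ∈ Z, M.pushoff i c false w = ((M.pushoff i c false w).1, 0) := fun w hw =>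
    Prod.ext rfl (by rw [pushoff, (hmemZ w).1 hw]; simp)
  have hP : ∀ pq, pq ∈ Z.image pair ↔ M.pushoffMap i c pq.1 = M.inclusion i pq.2 := by
    rintro ⟨p, q⟩
    rw [Finset.mem_image]
    constructor
    · rintro ⟨w, hw, h⟩
      obtain ⟨rfl, rfl⟩ := Prod.mk.inj h
      have h1 := mem_sheetSet_of_phase ((hmemZ w).1 hw)
      have h2 := pushoff_mem hc false h1
      rw [hpush w hw] at h2
      refine (pushoffMap_pt hc h1).trans ?_
      refine Eq.trans ?_ (inclusion_pt h2).symm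
      rw [← hpush w hw]
    · intro h
      obtain ⟨h1, h2, h3, h4⟩ := (pushoffMap_eq_inclusion hc hc0.ne').1 h
      refine ⟨(M.surfaceGlue i).base p, (hmemZ _).2 h2, Prod.ext ?_ ?_⟩
      · have h5 := (M.surfaceGlue i).pt_base p
        rw [h1] at h5
        exact h5
      · have h5 := (M.surfaceGlue i).pt_base q
        rw [h3] at h5
        change (M.surfaceGlue i).pt false
          (M.pushoff i c false ((M.surfaceGlue i).base p)).1 = q
        rw [h4]
        exact h5
  refine ⟨⟨M.pushoffMap i c, hcont⟩, contMDiff_pushoffMap hc, ⟨?_⟩,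
    fun p q h => transverse_pushoffMap hc hc0.ne' h, Z.image pair, hP, ?_⟩
  · exact { toFun := fun x => M.pushoffMap i (x.1 * c) x.2
            continuous_toFun := continuous_pushoffMap hc
            map_zero_left := fun p => by
              change M.pushoffMap i ((0 : ℝ) * c) p = M.inclusion i p
              rw [zero_mul]
              exact pushoffMap_zero p
            map_one_left := fun p => by
              change M.pushoffMap i ((1 : ℝ) * c) p = M.pushoffMap i c p
              rw [one_mul] }
  · have hinj : Set.InjOn pair Z := fun w hw w' hw' h =>
      (M.surfaceGlue i).pt_injOn false (mem_sheetSet_of_phase ((hmemZ w).1 hw))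
        (mem_sheetSet_of_phase ((hmemZ w').1 hw')) (congrArg Prod.fst h)
    refine (Finset.sum_congr rfl fun pq hpq =>
      crossingSign_pushoffMap hc hc0.ne' ((hP pq).1 hpq)).trans ?_
    rw [Finset.sum_const, Finset.card_image_of_injOn hinj, hZ]
    have := M.tw_eq i
    simp only [mul_neg, mul_one, nsmul_eq_mul]
    linarith

end PlumbingModel
end

/-! ### Realizations of finite abstract simplicial complexes -/

noncomputable section

open Set Filter

/-- Two Hausdorff quotients of a compact space by the same equivalence relation are
homeomorphic. -/
lemma nonempty_homeomorph_of_kernel_eq {Z S T : Type*} [TopologicalSpace Z] [CompactSpace Z]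
    [TopologicalSpace S] [T2Space S] [TopologicalSpace T] [T2Space T] {f : Z → S} {g : Z → T}
    (hf : Continuous f) (hf' : Function.Surjective f) (hg : Continuous g)
    (hg' : Function.Surjective g) (h : ∀ z z', f z = f z' ↔ g z = g z') : Nonempty (S ≃ₜ T) := by
  have hqf := Topology.IsQuotientMap.of_surjective_continuous hf' hf
  have hqg := Topology.IsQuotientMap.of_surjective_continuous hg' hg
  have h1 : ∀ z, g (Function.surjInv hf' (f z)) = g z := fun z =>
    (h _ _).1 (Function.surjInv_eq hf' _)
  have h2 : ∀ z, f (Function.surjInv hg' (g z)) = f z := fun z =>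
    (h _ _).2 (Function.surjInv_eq hg' _)
  refine ⟨{ toFun := fun x => g (Function.surjInv hf' x)
            invFun := fun y => f (Function.surjInv hg' y)
            left_inv := fun x => ?_
            right_inv := fun y => ?_
            continuous_toFun := hqf.continuous_iff.2 (hg.congr fun z => (h1 z).symm)
            continuous_invFun := hqg.continuous_iff.2 (hf.congr fun z => (h2 z).symm) }⟩
  · simp only [h2, Function.surjInv_eq]
  · simp only [h1, Function.surjInv_eq]

section Realization

variable {V : Type} [Fintype V] [DecidableEq V]

/-- The vertices of a finite abstract simplicial complex, placed at the ends of the standard basis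
vectors. -/
def basisPt (v : V) : EuclideanSpace ℝ (Fin (Fintype.card V)) :=
  EuclideanSpace.single (Fintype.equivFin V v) 1

lemma basisPt_apply (v w : V) :
    (basisPt v : EuclideanSpace ℝ (Fin (Fintype.card V))) (Fintype.equivFin V w) =
      if w = v then 1 else 0 := by
  simp [basisPt]

lemma basisPt_injective : Function.Injective (basisPt (V := V)) := by
  intro v w h
  have h1 := congrArg (fun x : EuclideanSpace ℝ (Fin (Fintype.card V)) =>
    x (Fintype.equivFin V v)) h
  simp only [basisPt_apply, if_true] at h1
  by_contra hne
  simp [hne] at h1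

lemma linearIndependent_basisPt : LinearIndependent ℝ (basisPt (V := V)) := by
  rw [Fintype.linearIndependent_iff]
  intro c hc v
  have h1 := congrArg (fun x : EuclideanSpace ℝ (Fin (Fintype.card V)) =>
    x (Fintype.equivFin V v)) hc
  simpa [basisPt_apply] using h1

lemma mem_convexHull_basisPt {s : Finset V} {x : EuclideanSpace ℝ (Fin (Fintype.card V))} :
    x ∈ convexHull ℝ ((s.image basisPt : Finset (EuclideanSpace ℝ (Fin (Fintype.card V)))) :
      Set (EuclideanSpace ℝ (Fin (Fintype.card V)))) ↔
    (∀ v, 0 ≤ x (Fintype.equivFin V v)) ∧ ∑ v, x (Fintype.equivFin V v) = 1 ∧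
      ∀ v, x (Fintype.equivFin V v) ≠ 0 → v ∈ s := by
  rw [Finset.mem_convexHull']
  constructor
  · rintro ⟨w, hw0, hw1, rfl⟩
    rw [Finset.sum_image basisPt_injective.injOn] at hw1
    have key : ∀ v, (∑ y ∈ s.image basisPt, w y • y) (Fintype.equivFin V v) =
        if v ∈ s then w (basisPt v) else 0 := by
      intro v
      rw [Finset.sum_image basisPt_injective.injOn]
      simp [basisPt_apply]
    refine ⟨fun v => ?_, ?_, fun v hv => ?_⟩
    · rw [key]
      split_ifs with h
      · exact hw0 _ (Finset.mem_image_of_mem _ h)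
      · exact le_rfl
    · simp only [key]
      simpa using hw1
    · rw [key] at hv
      by_contra h
      exact hv (if_neg h)
  · rintro ⟨h0, h1, h2⟩
    have hz : ∀ v, v ∉ s → x (Fintype.equivFin V v) = 0 := fun v hv => by
      by_contra h
      exact hv (h2 v h)
    have hV : Nonempty V := by
      by_contra hV
      rw [not_nonempty_iff] at hV
      simp at h1
    have hinv : ∀ v : V, Function.invFun (basisPt (V := V)) (basisPt v) = v :=
      Function.leftInverse_invFun basisPt_injective
    refine ⟨fun y => x (Fintype.equivFin V (Function.invFun basisPt y)), ?_, ?_, ?_⟩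
    · exact fun y _ => h0 _
    · rw [Finset.sum_image basisPt_injective.injOn]
      simp only [hinv]
      rw [← h1]
      exact Finset.sum_subset (Finset.subset_univ s) fun v _ hv => hz v hv
    · rw [Finset.sum_image basisPt_injective.injOn]
      simp only [hinv]
      ext k
      obtain ⟨v, rfl⟩ := (Fintype.equivFin V).surjective k
      simp only [WithLp.ofLp_sum, Finset.sum_apply, PiLp.smul_apply, basisPt_apply, smul_eq_mul]
      by_cases h : v ∈ s
      · simp [h]
      · simp [h, hz v h]

/-- The geometric realization of a finite abstract simplicial complex with set of faces `F`. -/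
def realization (F : Finset (Finset V)) (hF : IsRelLowerSet (F : Set (Finset V)) Finset.Nonempty) :
    Geometry.SimplicialComplex ℝ (EuclideanSpace ℝ (Fin (Fintype.card V))) where
  faces := (F.image (Finset.image basisPt) : Finset _)
  isRelLowerSet_faces := by
    intro t ht
    obtain ⟨s, hs, rfl⟩ := Finset.mem_image.1 (Finset.mem_coe.1 ht)
    refine ⟨(hF hs).1.image _, fun u hu hu' => ?_⟩
    obtain ⟨s', hs', rfl⟩ := Finset.subset_image_iff.1 hu
    exact Finset.mem_coe.2 (Finset.mem_image_of_mem _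
      ((hF hs).2 hs' (Finset.image_nonempty.1 hu')))
  indep := by
    intro t ht
    refine linearIndependent_basisPt.affineIndependent.range.mono fun x hx => ?_
    obtain ⟨s, -, rfl⟩ := Finset.mem_image.1 (Finset.mem_coe.1 ht)
    obtain ⟨v, -, rfl⟩ := Finset.mem_image.1 (Finset.mem_coe.1 hx)
    exact mem_range_self v
  inter_subset_convexHull := by
    intro t u ht hu x hx
    obtain ⟨s, -, rfl⟩ := Finset.mem_image.1 (Finset.mem_coe.1 ht)
    obtain ⟨s', -, rfl⟩ := Finset.mem_image.1 (Finset.mem_coe.1 hu)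
    obtain ⟨h0, h1, h2⟩ := mem_convexHull_basisPt.1 hx.1
    obtain ⟨-, -, h3⟩ := mem_convexHull_basisPt.1 hx.2
    rw [← Finset.coe_inter, ← Finset.image_inter _ _ basisPt_injective]
    exact mem_convexHull_basisPt.2 ⟨h0, h1, fun v hv => Finset.mem_inter.2 ⟨h2 v hv, h3 v hv⟩⟩

variable (F : Finset (Finset V)) (hF : IsRelLowerSet (F : Set (Finset V)) Finset.Nonempty)

lemma mem_realization_space {x : EuclideanSpace ℝ (Fin (Fintype.card V))} :
    x ∈ (realization F hF).space ↔
      (∀ v, 0 ≤ x (Fintype.equivFin V v)) ∧ ∑ v, x (Fintype.equivFin V v) = 1 ∧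
        ∃ s ∈ F, ∀ v, x (Fintype.equivFin V v) ≠ 0 → v ∈ s := by
  rw [Geometry.SimplicialComplex.mem_space_iff]
  constructor
  · rintro ⟨t, ht, hx⟩
    obtain ⟨s, hs, rfl⟩ := Finset.mem_image.1 (Finset.mem_coe.1 ht)
    obtain ⟨h0, h1, h2⟩ := mem_convexHull_basisPt.1 hx
    exact ⟨h0, h1, s, hs, h2⟩
  · rintro ⟨h0, h1, s, hs, h2⟩
    exact ⟨_, Finset.mem_coe.2 (Finset.mem_image_of_mem _ hs),
      mem_convexHull_basisPt.2 ⟨h0, h1, h2⟩⟩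

lemma finite_realization_faces : (realization F hF).faces.Finite :=
  (F.image (Finset.image basisPt)).finite_toSet

lemma simplicialEulerChar_realization :
    simplicialEulerChar (realization F hF) (finite_realization_faces F hF) =
      ∑ s ∈ F, (-1) ^ (s.card - 1) := by
  have h : (finite_realization_faces F hF).toFinset = F.image (Finset.image basisPt) := by
    ext t
    rw [Set.Finite.mem_toFinset]
    exact Finset.mem_coe
  rw [simplicialEulerChar, h, Finset.sum_image]
  · exact Finset.sum_congr rfl fun s _ => by
      rw [Finset.card_image_of_injective _ basisPt_injective]
  · exact (Finset.image_injective basisPt_injective).injOn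

/-- A criterion for a space to be homeomorphic to the realization of a complex: both are the
quotient of a compact space by the same equivalence relation. -/
lemma nonempty_homeomorph_realization {Z S : Type*} [TopologicalSpace Z] [CompactSpace Z]
    [TopologicalSpace S] [T2Space S] {f : Z → S} (hf : Continuous f)
    (hf' : Function.Surjective f) {g : Z → V → ℝ} (hg : ∀ v, Continuous fun z => g z v)
    (hg0 : ∀ z v, 0 ≤ g z v) (hg1 : ∀ z, ∑ v, g z v = 1)
    (hgF : ∀ z, ∃ s ∈ F, ∀ v, g z v ≠ 0 → v ∈ s)
    (hg' : ∀ x : V → ℝ, (∀ v, 0 ≤ x v) → ∑ v, x v = 1 → (∃ s ∈ F, ∀ v, x v ≠ 0 → v ∈ s) →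
      ∃ z, g z = x) (h : ∀ z z', f z = f z' ↔ g z = g z') :
    Nonempty (S ≃ₜ (realization F hF).space) := by
  set G : Z → EuclideanSpace ℝ (Fin (Fintype.card V)) := fun z =>
    WithLp.toLp 2 fun k => g z ((Fintype.equivFin V).symm k) with hG
  have hGv : ∀ z v, G z (Fintype.equivFin V v) = g z v := fun z v => by simp [hG]
  have hmem : ∀ z, G z ∈ (realization F hF).space := fun z => by
    rw [mem_realization_space]
    simp only [hGv]
    exact ⟨hg0 z, hg1 z, hgF z⟩
  have hGc : Continuous G :=
    (PiLp.continuous_toLp 2 _).comp (continuous_pi fun k => hg _)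
  refine nonempty_homeomorph_of_kernel_eq hf hf' (hGc.subtype_mk hmem) ?_ fun z z' => ?_
  · rintro ⟨x, hx⟩
    obtain ⟨h0, h1, h2⟩ := (mem_realization_space F hF).1 hx
    obtain ⟨z, hz⟩ := hg' (fun v => x (Fintype.equivFin V v)) h0 h1 h2
    refine ⟨z, Subtype.ext ?_⟩
    ext k
    obtain ⟨v, rfl⟩ := (Fintype.equivFin V).surjective k
    rw [hGv, hz]
  · rw [h, Subtype.mk.injEq]
    constructor
    · intro h'
      simp only [hG, h']
    · intro h'
      ext v
      rw [← hGv, ← hGv, h']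

end Realization
end

/-! ### A triangulation with Euler characteristic `2 - 2 * g` -/

noncomputable section

open Set Filter

/-- The vertices of a triangulation of a closed surface of genus `g` which is glued from four
polygons with `2 * g + 2` sides: the corners of the polygons, the midpoints of their sides, and
their centres. The polygons are numbered by pairs of Booleans; all of them have the same corners,
and each side is shared by two of them. -/
abbrev PolygonVertex (g : ℕ) : Type := Fin (2 * g + 2) ⊕ (Fin (2 * g + 2) × Bool) ⊕ (Bool × Bool)

namespace PolygonVertex

variable {g : ℕ}

/-- Two polygons share the side `k` if they have the same label there. -/
def label (k : Fin (2 * g + 2)) (q : Bool × Bool) : Bool := if Even (k : ℕ) then q.1 else q.2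

/-- At most one corner, at most one midpoint and at most one centre, any two of which are
incident. -/
def IsFlag (x : Option (Fin (2 * g + 2)) × Option (Fin (2 * g + 2) × Bool) × Option (Bool × Bool)) :
    Prop :=
  (∀ k ∈ x.1, ∀ m ∈ x.2.1, k = m.1 ∨ k = m.1 + 1) ∧ ∀ m ∈ x.2.1, ∀ q ∈ x.2.2, label m.1 q = m.2

/-- The set of vertices of a flag. -/
def flagFace
    (x : Option (Fin (2 * g + 2)) × Option (Fin (2 * g + 2) × Bool) × Option (Bool × Bool)) :
    Finset (PolygonVertex g) :=
  x.1.toFinset.disjSum (x.2.1.toFinset.disjSum x.2.2.toFinset)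

open Classical in
variable (g) in
/-- The faces of the triangulation. -/
def faces : Finset (Finset (PolygonVertex g)) :=
  (Finset.univ.filter fun x => IsFlag x ∧ x ≠ (none, none, none)).image flagFace

lemma flagFace_injective : Function.Injective (flagFace (g := g)) := by
  rintro ⟨a, b, c⟩ ⟨a', b', c'⟩ h
  rw [flagFace, flagFace, Finset.disjSum_inj, Finset.disjSum_inj] at h
  obtain ⟨h1, h2, h3⟩ := h
  have key : ∀ {α : Type} {o o' : Option α}, o.toFinset = o'.toFinset → o = o' := by
    intro α o o' h
    ext x
    have h1 := Finset.ext_iff.1 h x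
    rwa [Option.mem_toFinset, Option.mem_toFinset] at h1
  exact Prod.ext (key h1) (Prod.ext (key h2) (key h3))

lemma exists_option_of_subset {α : Type} {o : Option α} {t : Finset α} (h : t ⊆ o.toFinset) :
    ∃ o' : Option α, t = o'.toFinset ∧ ∀ x ∈ o', x ∈ o := by
  cases o with
  | none => exact ⟨none, by simpa using h, by simp⟩
  | some a =>
    rw [Option.toFinset_some] at h
    rcases Finset.subset_singleton_iff.1 h with rfl | rfl
    · exact ⟨none, by simp, by simp⟩
    · exact ⟨some a, by simp, by simp⟩

lemma mem_faces {s : Finset (PolygonVertex g)} :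
    s ∈ faces g ↔ ∃ x, (IsFlag x ∧ x ≠ (none, none, none)) ∧ flagFace x = s := by
  simp [faces]

lemma flagFace_eq_empty {x} : flagFace (g := g) x = ∅ ↔ x = (none, none, none) := by
  rw [← flagFace_injective.eq_iff]
  rfl

variable (g) in
lemma isRelLowerSet_faces :
    IsRelLowerSet (faces g : Set (Finset (PolygonVertex g))) Finset.Nonempty := by
  intro s hs
  obtain ⟨⟨a, b, c⟩, ⟨⟨h1, h2⟩, h3⟩, rfl⟩ := mem_faces.1 (Finset.mem_coe.1 hs)
  refine ⟨Finset.nonempty_iff_ne_empty.2 fun h => h3 (flagFace_eq_empty.1 h), fun t ht ht' => ?_⟩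
  obtain ⟨a', ha, ha'⟩ := exists_option_of_subset (o := a) (t := t.toLeft) fun x hx => by
    have := ht (Finset.mem_toLeft.1 hx)
    simpa [flagFace] using this
  obtain ⟨b', hb, hb'⟩ := exists_option_of_subset (o := b) (t := t.toRight.toLeft) fun x hx => by
    have := ht (Finset.mem_toRight.1 (Finset.mem_toLeft.1 hx))
    simpa [flagFace] using this
  obtain ⟨c', hc, hc'⟩ := exists_option_of_subset (o := c) (t := t.toRight.toRight) fun x hx => by
    have := ht (Finset.mem_toRight.1 (Finset.mem_toRight.1 hx))
    simpa [flagFace] using this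
  have hface : flagFace (a', b', c') = t := by
    rw [flagFace]
    simp only
    rw [← ha, ← hb, ← hc, Finset.toLeft_disjSum_toRight, Finset.toLeft_disjSum_toRight]
  refine Finset.mem_coe.2 (mem_faces.2 ⟨(a', b', c'),
    ⟨⟨fun k hk m hm => h1 k (ha' k hk) m (hb' m hm),
      fun m hm q hq => h2 m (hb' m hm) q (hc' q hq)⟩, fun h => ?_⟩, hface⟩)
  rw [← flagFace_eq_empty, hface] at h
  exact ht'.ne_empty h

/-- The contribution of an optional vertex to the sign of a flag. -/
def optSign {α : Type} (o : Option α) : ℤ := o.elim 1 fun _ => -1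

lemma add_one_ne (j : Fin (2 * g + 2)) : j + 1 ≠ j := by
  intro h
  simp at h

open Classical in
lemma sum_optSign_corner (m : Option (Fin (2 * g + 2) × Bool)) :
    ∑ k : Option (Fin (2 * g + 2)),
      (if ∀ k' ∈ k, ∀ m' ∈ m, k' = m'.1 ∨ k' = m'.1 + 1 then optSign k else 0) =
      m.elim (1 - (2 * (g : ℤ) + 2)) fun _ => -1 := by
  cases m with
  | none => simp [Fintype.sum_option, optSign]; ring
  | some m =>
    have h : ∀ k : Fin (2 * g + 2), (if k = m.1 ∨ k = m.1 + 1 then (-1 : ℤ) else 0) =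
        (if k = m.1 then -1 else 0) + if k = m.1 + 1 then -1 else 0 := fun k => by
      by_cases h1 : k = m.1
      · subst h1; simp [(add_one_ne m.1).symm]
      · simp [h1]
    simp [Fintype.sum_option, optSign, h, Finset.sum_add_distrib]

open Classical in
lemma sum_optSign_center (m : Option (Fin (2 * g + 2) × Bool)) :
    ∑ q : Option (Bool × Bool),
      (if ∀ m' ∈ m, ∀ q' ∈ q, label m'.1 q' = m'.2 then optSign q else 0) =
      m.elim (-3) fun _ => -1 := by
  cases m with
  | none => simp [Fintype.sum_option, optSign]
  | some m =>
    obtain ⟨k, ε⟩ := m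
    cases ε <;> by_cases h : Even (k : ℕ) <;>
      simp [Fintype.sum_option, optSign, Fintype.sum_prod_type, label, h]

lemma neg_one_pow_card_flagFace {x} (hx : x ≠ (none, none, none)) :
    (-1 : ℤ) ^ ((flagFace (g := g) x).card - 1) =
      -(optSign x.2.1 * (optSign x.1 * optSign x.2.2)) := by
  obtain ⟨a, b, c⟩ := x
  cases a <;> cases b <;> cases c <;> simp [flagFace, optSign] at hx ⊢

variable (g) in
/-- The flags are counted by their midpoint: there are `4 * g + 4` midpoints, each incident with two
corners and two centres. -/
lemma sum_faces : ∑ s ∈ faces g, (-1 : ℤ) ^ (s.card - 1) = 2 - 2 * (g : ℤ) := by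
  classical
  rw [faces, Finset.sum_image flagFace_injective.injOn, Finset.sum_filter]
  have h1 : ∀ x : Option (Fin (2 * g + 2)) × Option (Fin (2 * g + 2) × Bool) × Option (Bool × Bool),
      (if IsFlag x ∧ x ≠ (none, none, none) then (-1 : ℤ) ^ ((flagFace x).card - 1) else 0) =
      (if x = (none, none, none) then 1 else 0) - optSign x.2.1 *
        ((if ∀ k' ∈ x.1, ∀ m' ∈ x.2.1, k' = m'.1 ∨ k' = m'.1 + 1 then optSign x.1 else 0) *
         (if ∀ m' ∈ x.2.1, ∀ q' ∈ x.2.2, label m'.1 q' = m'.2 then optSign x.2.2 else 0)) := by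
    intro x
    by_cases hx : x = (none, none, none)
    · subst hx
      simp [optSign]
    · by_cases h2 : IsFlag x
      · rw [if_pos ⟨h2, hx⟩, if_neg hx, if_pos h2.1, if_pos h2.2, neg_one_pow_card_flagFace hx]
        ring
      · rw [if_neg fun h => h2 h.1, if_neg hx]
        by_cases h3 : ∀ k' ∈ x.1, ∀ m' ∈ x.2.1, k' = m'.1 ∨ k' = m'.1 + 1
        · rw [if_neg (c := ∀ m' ∈ x.2.1, ∀ q' ∈ x.2.2, label m'.1 q' = m'.2) fun h => h2 ⟨h3, h⟩]
          simp
        · rw [if_neg h3]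
          simp
  simp only [h1]
  rw [Finset.sum_sub_distrib, Finset.sum_ite_eq', if_pos (Finset.mem_univ _),
    Fintype.sum_prod_type, Finset.sum_congr rfl fun a _ => Fintype.sum_prod_type _,
    Finset.sum_comm]
  simp only [← Finset.mul_sum]
  simp only [← Finset.sum_mul, sum_optSign_center]
  simp only [← mul_assoc, sum_optSign_corner]
  simp [Fintype.sum_option, optSign]
  ring

end PolygonVertex
end

/-! ### Barycentric coordinates on polygons -/

noncomputable section

open Set Filter unitInterval

namespace PolygonVertex

variable {g : ℕ}

/-- The barycentric coordinates of a point of one of the polygons. The point lies on the segment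
between the centre of the polygon `q` and the point of the side `j` at time `t`, at distance `r`
from the centre. -/
def coord (r t : ℝ) (j : Fin (2 * g + 2)) (q : Bool × Bool) : PolygonVertex g → ℝ
  | .inl k => (if k = j then r * max 0 (1 - 2 * t) else 0) +
      if k = j + 1 then r * max 0 (2 * t - 1) else 0
  | .inr (.inl m) => if m = (j, label j q) then r * (1 - |2 * t - 1|) else 0
  | .inr (.inr p) => if p = q then 1 - r else 0

/-- The points of the sides `j` and `j'` at the times `t` and `t'` agree. -/
def SamePoint (j : Fin (2 * g + 2)) (t : ℝ) (j' : Fin (2 * g + 2)) (t' : ℝ) : Prop :=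
  (j = j' ∧ t = t') ∨ (t = 1 ∧ t' = 0 ∧ j' = j + 1) ∨ (t = 0 ∧ t' = 1 ∧ j = j' + 1)

variable {r r' t t' : ℝ} {j j' : Fin (2 * g + 2)} {q q' : Bool × Bool}

lemma one_sub_abs_nonneg (ht : t ∈ I) : 0 ≤ 1 - |2 * t - 1| := by
  have : |2 * t - 1| ≤ 1 := abs_le.2 ⟨by linarith [ht.1], by linarith [ht.2]⟩
  linarith

lemma one_sub_abs_eq_zero_iff : 1 - |2 * t - 1| = 0 ↔ t = 0 ∨ t = 1 := by
  rw [sub_eq_zero, eq_comm, abs_eq zero_le_one]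
  constructor
  · rintro (h | h)
    · exact Or.inr (by linarith)
    · exact Or.inl (by linarith)
  · rintro (h | h) <;> rw [h] <;> norm_num

lemma coord_nonneg (hr : r ∈ I) (ht : t ∈ I) (v : PolygonVertex g) : 0 ≤ coord r t j q v := by
  have h1 := hr.1
  have h2 := hr.2
  have h3 := one_sub_abs_nonneg ht
  rcases v with k | m | p
  · exact add_nonneg (ite_nonneg (by positivity) le_rfl) (ite_nonneg (by positivity) le_rfl)
  · exact ite_nonneg (mul_nonneg h1 h3) le_rfl
  · exact ite_nonneg (by linarith) le_rfl

lemma sum_coord_center : ∑ p, coord r t j q (.inr (.inr p)) = 1 - r := by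
  simp [coord]

lemma sum_coord : ∑ v, coord r t j q v = 1 := by
  rw [Fintype.sum_sum_type, Fintype.sum_sum_type, sum_coord_center]
  simp only [coord, Finset.sum_add_distrib, Finset.sum_ite_eq', Finset.mem_univ, if_true]
  have h : max 0 (1 - 2 * t) + max 0 (2 * t - 1) = |2 * t - 1| := by
    rcases le_total (2 * t - 1) 0 with h | h
    · rw [max_eq_right (by linarith), max_eq_left h, abs_of_nonpos h]; ring
    · rw [max_eq_left (by linarith), max_eq_right h, abs_of_nonneg h]; ring
  linear_combination r * h

lemma exists_face_coord : ∃ s ∈ faces g, ∀ v, coord r t j q v ≠ 0 → v ∈ s := by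
  set k : Fin (2 * g + 2) := if t ≤ 1 / 2 then j else j + 1 with hk
  refine ⟨flagFace (some k, some (j, label j q), some q), mem_faces.2 ⟨_, ⟨⟨?_, ?_⟩, ?_⟩, rfl⟩, ?_⟩
  · rintro _ ⟨⟩ _ ⟨⟩
    simp only [hk]
    split_ifs <;> simp
  · rintro _ ⟨⟩ _ ⟨⟩
    rfl
  · simp
  · rintro (l | m | p) h
    · have hl : l = k := by
        by_contra hl
        refine h ?_
        simp only [hk] at hl
        simp only [coord]
        split_ifs at hl with ht
        · rw [if_neg hl, max_eq_left (by linarith)]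
          simp
        · rw [if_neg hl, max_eq_left (by linarith)]
          simp
      simp [flagFace, hl]
    · have hm : m = (j, label j q) := by
        by_contra hm
        exact h (if_neg hm)
      simp [flagFace, hm]
    · have hp : p = q := by
        by_contra hp
        exact h (if_neg hp)
      simp [flagFace, hp]

lemma exists_label_eq (k : Fin (2 * g + 2)) (ε : Bool) : ∃ q, label k q = ε :=
  ⟨(ε, ε), by simp [label]⟩

/-- Every point of the triangulated surface lies in one of the polygons. -/
lemma exists_coord_eq {x : PolygonVertex g → ℝ} (h0 : ∀ v, 0 ≤ x v) (h1 : ∑ v, x v = 1)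
    (hF : ∃ s ∈ faces g, ∀ v, x v ≠ 0 → v ∈ s) :
    ∃ r ∈ I, ∃ t ∈ I, ∃ j q, coord r t j q = x := by
  -- any flag extends to one with a centre and a midpoint
  obtain ⟨j, q, hj, hm, hq, hjj⟩ : ∃ j q, (∀ k, k ≠ j → k ≠ j + 1 → x (.inl k) = 0) ∧
      (∀ m, m ≠ (j, label j q) → x (.inr (.inl m)) = 0) ∧
      (∀ p, p ≠ q → x (.inr (.inr p)) = 0) ∧ (x (.inl j) = 0 ∨ x (.inl (j + 1)) = 0) := by
    obtain ⟨s, hs, hx⟩ := hF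
    obtain ⟨⟨a, b, c⟩, ⟨⟨h2, h3⟩, -⟩, rfl⟩ := mem_faces.1 hs
    have ha : ∀ k, k ∉ a → x (.inl k) = 0 := fun k hk => by
      by_contra h
      exact hk (by simpa [flagFace] using hx _ h)
    have hb : ∀ k, k ∉ b → x (.inr (.inl k)) = 0 := fun k hk => by
      by_contra h
      exact hk (by simpa [flagFace] using hx _ h)
    have hc : ∀ k, k ∉ c → x (.inr (.inr k)) = 0 := fun k hk => by
      by_contra h
      exact hk (by simpa [flagFace] using hx _ h)
    have hone : ∀ j : Fin (2 * g + 2), x (.inl j) = 0 ∨ x (.inl (j + 1)) = 0 := fun j => by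
      by_contra! h
      have h4 : j ∈ a := by by_contra h'; exact h.1 (ha _ h')
      have h5 : j + 1 ∈ a := by by_contra h'; exact h.2 (ha _ h')
      exact add_one_ne j (Option.mem_unique h5 h4)
    cases b with
    | some m =>
      obtain ⟨q, hq, hq'⟩ : ∃ q, label m.1 q = m.2 ∧ ∀ p, p ≠ q → x (.inr (.inr p)) = 0 := by
        cases c with
        | some q =>
          refine ⟨q, h3 m rfl q rfl, fun p hp => hc p fun h => hp ?_⟩
          exact (Option.some_injective _ h).symm
        | none =>
          obtain ⟨q, hq⟩ := exists_label_eq m.1 m.2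
          exact ⟨q, hq, fun p _ => hc p (by simp)⟩
      refine ⟨m.1, q, fun k hk hk' => ha k fun h => ?_, fun m' hm' => hb m' fun h => ?_, hq',
        hone _⟩
      · rcases h2 k h m rfl with h | h
        · exact hk h
        · exact hk' h
      · rw [hq] at hm'
        exact hm' (Option.some_injective _ h).symm
    | none =>
      obtain ⟨q, hq'⟩ : ∃ q, ∀ p, p ≠ q → x (.inr (.inr p)) = 0 := by
        cases c with
        | some q => exact ⟨q, fun p hp => hc p fun h => hp (Option.some_injective _ h).symm⟩
        | none => exact ⟨(true, true), fun p _ => hc p (by simp)⟩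
      obtain ⟨j, hj⟩ : ∃ j, ∀ k, k ≠ j → x (.inl k) = 0 := by
        cases a with
        | some j => exact ⟨j, fun p hp => ha p fun h => hp (Option.some_injective _ h).symm⟩
        | none => exact ⟨0, fun p _ => ha p (by simp)⟩
      exact ⟨j, q, fun k hk _ => hj k hk, fun m _ => hb m (by simp), hq', hone _⟩
  set A := x (.inl j) with hA
  set B := x (.inl (j + 1)) with hB
  set C := x (.inr (.inl (j, label j q))) with hC
  set D := x (.inr (.inr q)) with hD
  have hsum : A + B + C + D = 1 := by
    rw [Fintype.sum_sum_type, Fintype.sum_sum_type,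
      Fintype.sum_eq_add j (j + 1) (add_one_ne j).symm fun k hk => hj k hk.1 hk.2,
      Fintype.sum_eq_single (j, label j q) hm, Fintype.sum_eq_single q hq] at h1
    linarith
  have hA0 : 0 ≤ A := h0 _
  have hB0 : 0 ≤ B := h0 _
  have hC0 : 0 ≤ C := h0 _
  have hD0 : 0 ≤ D := h0 _
  suffices h : ∃ t ∈ I, (1 - D) * max 0 (1 - 2 * t) = A ∧ (1 - D) * max 0 (2 * t - 1) = B ∧
      (1 - D) * (1 - |2 * t - 1|) = C by
    obtain ⟨t, ht, h2, h3, h4⟩ := h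
    refine ⟨1 - D, ⟨by linarith, by linarith⟩, t, ht, j, q, ?_⟩
    ext (k | m | p)
    · simp only [coord, h2, h3]
      by_cases hk : k = j
      · subst hk
        rw [if_pos rfl, if_neg (add_one_ne k).symm, add_zero]
      · rw [if_neg hk, zero_add]
        split_ifs with hk'
        · rw [hk']
        · exact (hj k hk hk').symm
    · simp only [coord, h4]
      split_ifs with h
      · rw [h]
      · exact (hm m h).symm
    · simp only [coord, sub_sub_cancel]
      split_ifs with h
      · rw [h]
      · exact (hq p h).symm
  by_cases hD1 : D = 1
  · refine ⟨0, ⟨le_rfl, zero_le_one⟩, ?_⟩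
    rw [hD1, sub_self, zero_mul, zero_mul, zero_mul]
    exact ⟨by linarith, by linarith, by linarith⟩
  have hD' : 0 < 1 - D := lt_of_le_of_ne (by linarith) fun h => hD1 (by linarith)
  have hle : C / (1 - D) ≤ 1 := (div_le_one hD').2 (by linarith)
  have hge : 0 ≤ C / (1 - D) := by positivity
  have hmul : (1 - D) * (C / (1 - D)) = C := mul_div_cancel₀ C hD'.ne'
  rcases hjj with h | h
  · refine ⟨1 - C / (1 - D) / 2, ⟨by linarith, by linarith⟩, ?_⟩
    rw [max_eq_left (by linarith), max_eq_right (by linarith), abs_of_nonneg (by linarith)]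
    exact ⟨by linarith, by linarith, by linarith⟩
  · refine ⟨C / (1 - D) / 2, ⟨by linarith, by linarith⟩, ?_⟩
    rw [max_eq_right (by linarith), max_eq_left (by linarith), abs_of_nonpos (by linarith)]
    exact ⟨by linarith, by linarith, by linarith⟩

lemma SamePoint.symm (h : SamePoint j t j' t') : SamePoint j' t' j t := by
  rcases h with ⟨h1, h2⟩ | ⟨h1, h2, h3⟩ | ⟨h1, h2, h3⟩
  · exact Or.inl ⟨h1.symm, h2.symm⟩
  · exact Or.inr (Or.inr ⟨h2, h1, h3⟩)
  · exact Or.inr (Or.inl ⟨h2, h1, h3⟩)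

/-- The identifications of the polygons along their sides. -/
def Glued (r t : ℝ) (j : Fin (2 * g + 2)) (q : Bool × Bool) (r' t' : ℝ) (j' : Fin (2 * g + 2))
    (q' : Bool × Bool) : Prop :=
  r = r' ∧ (r ≠ 1 → q = q') ∧
    (r ≠ 0 → SamePoint j t j' t' ∧ (0 < t → t < 1 → label j q = label j q'))

lemma samePoint_of_coord_eq (ht : t ∈ I) (ht' : t' ∈ I) (hr : r ≠ 0)
    (h : coord r t j q = coord r t' j' q') :
    SamePoint j t j' t' ∧ (0 < t → t < 1 → label j q = label j q') := by
  have hin : ∀ k, ((if k = j then max 0 (1 - 2 * t) else 0) +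
      if k = j + 1 then max 0 (2 * t - 1) else 0) = (if k = j' then max 0 (1 - 2 * t') else 0) +
      if k = j' + 1 then max 0 (2 * t' - 1) else 0 := fun k => by
    have := congrFun h (.inl k)
    simp only [coord] at this
    refine mul_left_cancel₀ hr ?_
    simpa only [mul_add, mul_ite, mul_zero] using this
  have hmid : ∀ m, (if m = (j, label j q) then 1 - |2 * t - 1| else 0) =
      if m = (j', label j' q') then 1 - |2 * t' - 1| else 0 := fun m => by
    have := congrFun h (.inr (.inl m))
    simp only [coord] at this
    refine mul_left_cancel₀ hr ?_
    simpa only [mul_ite, mul_zero] using this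
  have hmid' := one_sub_abs_eq_zero_iff (t := t')
  rcases eq_or_lt_of_le ht.1 with h0 | h0
  · subst h0
    refine ⟨?_, fun h => absurd h (lt_irrefl _)⟩
    have h1 := hmid (j', label j' q')
    have h2 := hin j
    have h3 := (add_one_ne j).symm
    rw [if_pos rfl] at h1
    have h4 : t' = 0 ∨ t' = 1 := by
      rw [← hmid', ← h1]
      split_ifs <;> norm_num
    rcases h4 with rfl | rfl
    · norm_num [h3] at h2
      exact Or.inl ⟨h2, rfl⟩
    · norm_num [h3] at h2
      exact Or.inr (Or.inr ⟨rfl, rfl, h2⟩)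
  rcases eq_or_lt_of_le ht.2 with h1 | h1
  · subst h1
    refine ⟨?_, fun _ h => absurd h (lt_irrefl _)⟩
    have h1 := hmid (j', label j' q')
    have h2 := hin (j + 1)
    have h3 := add_one_ne j
    rw [if_pos rfl] at h1
    have h4 : t' = 0 ∨ t' = 1 := by
      rw [← hmid', ← h1]
      split_ifs <;> norm_num
    rcases h4 with rfl | rfl
    · norm_num [h3] at h2
      exact Or.inr (Or.inl ⟨rfl, rfl, h2.symm⟩)
    · norm_num [h3] at h2
      exact Or.inl ⟨h2, rfl⟩
  have hpos : 1 - |2 * t - 1| ≠ 0 := fun h => by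
    rcases one_sub_abs_eq_zero_iff.1 h with h | h <;> linarith
  have h2 := hmid (j, label j q)
  rw [if_pos rfl] at h2
  have h3 : (j, label j q) = (j', label j' q') := by
    by_contra hne
    rw [if_neg hne] at h2
    exact hpos h2
  rw [if_pos h3] at h2
  obtain ⟨rfl, h5⟩ := Prod.ext_iff.1 h3
  refine ⟨Or.inl ⟨rfl, ?_⟩, fun _ _ => h5⟩
  have h6 := hin j
  rw [if_pos rfl, if_pos rfl, if_neg (add_one_ne j).symm, if_neg (add_one_ne j).symm] at h6
  have h7 : |2 * t - 1| = |2 * t' - 1| := by linarith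
  rcases abs_eq_abs.1 h7 with h8 | h8
  · linarith
  rcases le_total t (1 / 2) with h9 | h9
  · rw [max_eq_right (by linarith), max_eq_left (by linarith)] at h6
    linarith
  · rw [max_eq_left (by linarith), max_eq_right (by linarith)] at h6
    linarith

/-- Barycentric coordinates separate points exactly up to the identifications of the polygons. -/
lemma coord_eq_coord_iff (ht : t ∈ I) (ht' : t' ∈ I) :
    coord r t j q = coord r' t' j' q' ↔ Glued r t j q r' t' j' q' := by
  constructor
  · intro h
    have hr : r = r' := by
      have h1 := sum_coord_center (r := r) (t := t) (j := j) (q := q)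
      rw [h, sum_coord_center] at h1
      linarith
    subst hr
    refine ⟨rfl, fun hr => ?_, fun hr => samePoint_of_coord_eq ht ht' hr h⟩
    by_contra hne
    have h1 := congrFun h (.inr (.inr q))
    simp only [coord, if_true, if_neg hne] at h1
    exact hr (by linarith)
  · rintro ⟨rfl, h1, h2⟩
    by_cases hr : r = 0
    · have hq : q = q' := h1 (by rw [hr]; exact zero_ne_one)
      subst hq hr
      ext (k | m | p) <;> simp [coord]
    obtain ⟨h3, h4⟩ := h2 hr
    have hcen : ∀ p, coord r t j q (.inr (.inr p)) = coord r t' j' q' (.inr (.inr p)) := fun p => by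
      by_cases hr1 : r = 1
      · simp [coord, hr1]
      · simp [coord, h1 hr1]
    ext (k | m | p)
    · rcases h3 with ⟨rfl, rfl⟩ | ⟨rfl, rfl, rfl⟩ | ⟨rfl, rfl, rfl⟩
      · rfl
      · norm_num [coord]
      · norm_num [coord]
    · by_cases hend : t = 0 ∨ t = 1
      · have hend' : t' = 0 ∨ t' = 1 := by
          rcases h3 with ⟨-, h⟩ | ⟨-, h, -⟩ | ⟨-, h, -⟩
          · rwa [← h]
          · exact Or.inl h
          · exact Or.inr h
        simp only [coord, one_sub_abs_eq_zero_iff.2 hend, one_sub_abs_eq_zero_iff.2 hend', mul_zero,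
          ite_self]
      · push Not at hend
        rcases h3 with ⟨rfl, rfl⟩ | ⟨h, -⟩ | ⟨h, -⟩
        · simp only [coord, h4 (lt_of_le_of_ne ht.1 hend.1.symm) (lt_of_le_of_ne ht.2 hend.2)]
        · exact absurd h hend.2
        · exact absurd h hend.1
    · exact hcen p

/-- A Hausdorff space which is glued from the four polygons is a triangulated surface with Euler
characteristic `2 - 2 * g`. -/
theorem exists_homeomorph {S : Type*} [TopologicalSpace S] [T2Space S]
    {f : ℝ → ℝ → Fin (2 * g + 2) → Bool × Bool → S}
    (hf : ∀ j q, Continuous fun x : I × I => f x.1 x.2 j q)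
    (hf' : ∀ p, ∃ r ∈ I, ∃ t ∈ I, ∃ j q, f r t j q = p)
    (h : ∀ r ∈ I, ∀ t ∈ I, ∀ j q, ∀ r' ∈ I, ∀ t' ∈ I, ∀ j' q',
      f r t j q = f r' t' j' q' ↔ Glued r t j q r' t' j' q') :
    ∃ (N : ℕ) (K : Geometry.SimplicialComplex ℝ (EuclideanSpace ℝ (Fin N))) (hK : K.faces.Finite),
      Nonempty (S ≃ₜ K.space) ∧ simplicialEulerChar K hK = 2 - 2 * (g : ℤ) := by
  refine ⟨_, realization (faces g) (isRelLowerSet_faces g), finite_realization_faces _ _, ?_, ?_⟩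
  · refine nonempty_homeomorph_realization (Z := (Fin (2 * g + 2) × (Bool × Bool)) × (I × I))
      (faces g) (isRelLowerSet_faces g) (f := fun z => f z.2.1 z.2.2 z.1.1 z.1.2)
      (g := fun z => coord z.2.1 z.2.2 z.1.1 z.1.2) ?_ (fun p => ?_) (fun v => ?_)
      (fun z v => coord_nonneg z.2.1.2 z.2.2.2 v) (fun z => sum_coord) (fun z => exists_face_coord)
      (fun x h0 h1 hF => ?_) fun z z' => ?_
    · exact continuous_prod_of_discrete_left.2 fun a => hf a.1 a.2
    · obtain ⟨r, hr, t, ht, j, q, rfl⟩ := hf' p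
      exact ⟨((j, q), (⟨r, hr⟩, ⟨t, ht⟩)), rfl⟩
    · refine continuous_prod_of_discrete_left.2 fun a => ?_
      rcases v with k | m | p <;> simp only [coord] <;> split_ifs <;> fun_prop
    · obtain ⟨r, hr, t, ht, j, q, rfl⟩ := exists_coord_eq h0 h1 hF
      exact ⟨((j, q), (⟨r, hr⟩, ⟨t, ht⟩)), rfl⟩
    · rw [coord_eq_coord_iff z.2.2.2 z'.2.2.2]
      exact h _ z.2.1.2 _ z.2.2.2 _ _ _ z'.2.1.2 _ z'.2.2.2 _ _
  · rw [simplicialEulerChar_realization, sum_faces]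

end PolygonVertex
end

/-! ### The half disc as a polygon -/

noncomputable section

open Set Filter ComplexConjugate unitInterval

namespace PlumbingModel

variable {n : ℕ} {Γ : PlumbingGraph n} {M : PlumbingModel Γ} {i : Fin n}

lemma profile_of_le {x : ℝ} {k : Fin (Γ.genus i)} (h : |x - M.d i * (k + 1)| ≤ M.ρ i) :
    M.profile i x = √(M.ρ i ^ 2 - (x - M.d i * (k + 1)) ^ 2) := by
  rcases profile_cases (M := M) (i := i) x with ⟨h1, h2⟩ | ⟨k', h1, h2⟩
  · rw [h1, ← sq_abs (x - _), le_antisymm h (h2 k), sub_self, Real.sqrt_zero]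
  · suffices h3 : k = k' by rw [h3, h2]
    by_contra hne
    have h4 := M.d_pos i
    have h5 := M.ρ_le i
    have h6 := M.ρ_pos i
    have h7 : (1 : ℝ) ≤ |(k : ℝ) - k'| := by
      have : (k : ℤ) - k' ≠ 0 := fun h => hne (Fin.ext (by omega))
      exact_mod_cast Int.one_le_abs this
    have h8 : M.d i ≤ |M.d i * (k + 1) - M.d i * (k' + 1)| := by
      have h9 : M.d i * (k + 1) - M.d i * (k' + 1) = M.d i * ((k : ℝ) - k') := by ring
      rw [h9, abs_mul, abs_of_pos h4]
      nlinarith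
    rw [abs_le] at h
    rw [abs_lt] at h1
    rcases le_abs.1 h8 with h9 | h9 <;> linarith

lemma im_straighten_eq_zero {w : ℂ} (hw : w ∈ M.halfDisc i) :
    (M.straighten i w).im = 0 ↔
      w.im = 0 ∧ ∀ k : Fin (Γ.genus i), M.ρ i ≤ |w.re - M.d i * (k + 1)| := by
  have h1 := profile_nonneg (M := M) (i := i) w.re
  have h2 := scale_pos (M := M) (i := i) w.re
  have h3 : (M.straighten i w).im = M.profile i w.re + w.im * M.scale i w.re := rfl
  have h4 : 0 ≤ w.im * M.scale i w.re := mul_nonneg hw.2 h2.le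
  rw [h3, add_eq_zero_iff_of_nonneg h1 h4, mul_eq_zero, or_iff_left h2.ne', and_comm]
  refine and_congr_right fun _ => ⟨fun h k => ?_, fun h => ?_⟩
  · by_contra! hk
    rw [profile_of_le hk.le, Real.sqrt_eq_zero', ← sq_abs (w.re - _)] at h
    nlinarith [abs_nonneg (w.re - M.d i * (k + 1))]
  · rcases profile_cases (M := M) (i := i) w.re with h5 | ⟨k, h5, -⟩
    · exact h5.1
    · exact absurd (h k) (not_le.2 h5)

lemma exists_gap_straighten_eq_zero {w : ℂ} (hw : w ∈ M.halfDisc i) :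
    (∃ b, M.gap i b (M.straighten i w, 0) = 0) ↔
      ‖w‖ = M.R i ∨ w.im = 0 ∧ ∃ k : Fin (Γ.genus i), |w.re - M.d i * (k + 1)| ≤ M.ρ i := by
  have hR := R_pos (M := M) (i := i)
  have h1 := profile_nonneg (M := M) (i := i) w.re
  have h2 := scale_pos (M := M) (i := i) w.re
  have hre : (M.straighten i w).re = w.re := rfl
  have him : (M.straighten i w).im = M.profile i w.re + w.im * M.scale i w.re := rfl
  have h4 : 0 ≤ w.im * M.scale i w.re := mul_nonneg hw.2 h2.le
  rw [Option.exists]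
  refine or_congr ?_ ?_
  · have h5 := (mem_halfDisc.1 hw).1
    have h6 : 0 ≤ M.R i ^ 2 - w.re ^ 2 := by
      rw [← sq_abs w.re]
      nlinarith [abs_nonneg w.re]
    have h7 : ‖w‖ = M.R i ↔ w.im = √(M.R i ^ 2 - w.re ^ 2) := by
      rw [← sq_eq_sq₀ (norm_nonneg w) hR.le, norm_sq_eq, ← sq_eq_sq₀ hw.2 (Real.sqrt_nonneg _),
        Real.sq_sqrt h6]
      constructor <;> intro h <;> linarith
    have h8 := scale_mul_sqrt (M := M) (i := i) w.re
    rw [gap_none, norm_sq_eq, hre, h7]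
    have h9 : (M.straighten i w).im = √(M.R i ^ 2 - w.re ^ 2) ↔ w.im = √(M.R i ^ 2 - w.re ^ 2) := by
      rw [him, ← h8, add_right_inj, mul_left_inj' h2.ne', h8]
    rw [← h9, ← sq_eq_sq₀ (by rw [him]; positivity) (Real.sqrt_nonneg _), Real.sq_sqrt h6]
    constructor <;> intro h <;> linarith
  · have hy : ∀ k : Fin (Γ.genus i), |w.re - M.d i * (k + 1)| ≤ M.ρ i →
        (M.gap i (some k) (M.straighten i w, 0) = 0 ↔ w.im = 0) := fun k hk => by
      have h5 : 0 ≤ M.ρ i ^ 2 - (w.re - M.d i * (k + 1)) ^ 2 := by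
        rw [← sq_abs (w.re - _)]
        nlinarith [abs_nonneg (w.re - M.d i * (k + 1)), M.ρ_pos i]
      have h6 : (M.straighten i w).im ^ 2 = M.profile i w.re ^ 2 ↔ w.im = 0 := by
        rw [sq_eq_sq₀ (by rw [him]; positivity) h1, him, add_eq_left, mul_eq_zero,
          or_iff_left h2.ne']
      rw [← h6, gap_some, norm_sq_sub_pos, hre, profile_of_le hk, Real.sq_sqrt h5]
      constructor <;> intro h <;> linarith
    constructor
    · rintro ⟨k, hk⟩
      have h5 : |w.re - M.d i * (k + 1)| ≤ M.ρ i := by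
        refine abs_le_of_sq_le_sq ?_ (M.ρ_pos i).le
        rw [gap_some, norm_sq_sub_pos, hre] at hk
        nlinarith [sq_nonneg (M.straighten i w).im]
      exact ⟨(hy k h5).1 hk, k, h5⟩
    · rintro ⟨h5, k, hk⟩
      exact ⟨k, (hy k hk).2 h5⟩

variable (M) in
/-- The points on the real axis where the half disc meets the circles which bound the core, from
left to right. -/
def node (i : Fin n) (k : ℕ) : ℝ :=
  if k = 0 then -M.R i else if 2 * Γ.genus i + 1 ≤ k then M.R i
  else if Even k then M.d i * (k / 2) + M.ρ i else M.d i * ((k + 1) / 2) - M.ρ i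

lemma node_zero : M.node i 0 = -M.R i := rfl

lemma node_last : M.node i (2 * Γ.genus i + 1) = M.R i := by
  simp [node]

lemma node_even {m : ℕ} (hm : m < Γ.genus i) :
    M.node i (2 * (m + 1)) = M.d i * (m + 1) + M.ρ i := by
  rw [node, if_neg (by omega), if_neg (by omega), if_pos (even_two_mul _)]
  push_cast
  ring

lemma node_odd {m : ℕ} (hm : m < Γ.genus i) :
    M.node i (2 * m + 1) = M.d i * (m + 1) - M.ρ i := by
  rw [node, if_neg (by omega), if_neg (by omega), if_neg (by simp)]
  push_cast
  ring

lemma node_lt_succ {k : ℕ} (hk : k < 2 * Γ.genus i + 1) : M.node i k < M.node i (k + 1) := by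
  have hR := R_pos (M := M) (i := i)
  have hR' := M.R_ge i
  have hd := M.d_pos i
  have h1 := M.ρ_pos i
  have h2 := M.ρ_le i
  have h3 : (0 : ℝ) ≤ ∑ j, (Γ.edges i j : ℝ) := by positivity
  obtain ⟨m, rfl | rfl⟩ := Nat.even_or_odd' k
  · rcases Nat.eq_zero_or_pos m with rfl | hm
    · rw [mul_zero, node_zero]
      rcases Nat.eq_zero_or_pos (Γ.genus i) with hg | hg
      · have := node_last (M := M) (i := i)
        rw [hg, mul_zero] at this
        rw [this]
        linarith
      · have := node_odd (M := M) hg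
        rw [mul_zero] at this
        rw [this]
        push_cast
        linarith
    · obtain ⟨m, rfl⟩ := Nat.exists_eq_succ_of_ne_zero hm.ne'
      rw [Nat.succ_eq_add_one, node_even (by omega)]
      rcases Nat.lt_or_ge (m + 1) (Γ.genus i) with hg | hg
      · rw [node_odd hg]
        push_cast
        nlinarith
      · have hg' : m + 1 = Γ.genus i := by omega
        rw [hg', node_last]
        have : (m : ℝ) + 1 = Γ.genus i := by exact_mod_cast hg'
        rw [this]
        have h4 : (0 : ℝ) ≤ Γ.genus i := by positivity
        nlinarith [mul_nonneg hd.le h3, mul_nonneg hd.le h4]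
  · rw [node_odd (by omega)]
    have := node_even (M := M) (i := i) (m := m) (by omega)
    rw [mul_add, mul_one] at this
    rw [this]
    linarith

lemma node_lt_node {k l : ℕ} (hkl : k < l) (hl : l ≤ 2 * Γ.genus i + 1) :
    M.node i k < M.node i l := by
  induction l, hkl using Nat.le_induction with
  | base => exact node_lt_succ (by omega)
  | succ l hl' ih => exact (ih (by omega)).trans (node_lt_succ (by omega))

lemma node_le_node {k l : ℕ} (hkl : k ≤ l) (hl : l ≤ 2 * Γ.genus i + 1) :
    M.node i k ≤ M.node i l := by
  rcases hkl.eq_or_lt with rfl | h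
  · exact le_rfl
  · exact (node_lt_node h hl).le

variable (M) in
/-- The boundary of the half disc as a polygon with `2 * g + 2` sides: the pieces of the real axis
between the nodes, and the arc. -/
def sidePath (i : Fin n) (j : ℕ) (t : ℝ) : ℂ :=
  if j < 2 * Γ.genus i + 1 then ⟨M.node i j + t * (M.node i (j + 1) - M.node i j), 0⟩
  else ⟨M.R i * (1 - 2 * t), 2 * M.R i * √(t * (1 - t))⟩

lemma sidePath_of_lt {j : ℕ} (hj : j < 2 * Γ.genus i + 1) (t : ℝ) : M.sidePath i j t =
    ⟨M.node i j + t * (M.node i (j + 1) - M.node i j), 0⟩ := if_pos hj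

lemma sidePath_last (t : ℝ) : M.sidePath i (2 * Γ.genus i + 1) t =
    ⟨M.R i * (1 - 2 * t), 2 * M.R i * √(t * (1 - t))⟩ := if_neg (lt_irrefl _)

lemma continuous_sidePath (j : ℕ) : Continuous (M.sidePath i j) := by
  have h : ∀ u v : ℝ → ℝ, Continuous u → Continuous v →
      Continuous fun t => (⟨u t, v t⟩ : ℂ) := fun u v hu hv =>
    Complex.equivRealProdCLM.symm.continuous.comp (hu.prodMk hv)
  unfold sidePath
  split_ifs <;> exact h _ _ (by fun_prop) (by fun_prop)

lemma sidePath_one {j : ℕ} (hj : j < 2 * Γ.genus i + 1) :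
    M.sidePath i j 1 = M.sidePath i (j + 1) 0 := by
  rw [sidePath_of_lt hj]
  rcases Nat.lt_or_ge (j + 1) (2 * Γ.genus i + 1) with h | h
  · rw [sidePath_of_lt h]
    congr 1
    ring
  · have h' : j = 2 * Γ.genus i := by omega
    subst h'
    rw [sidePath_last, node_last]
    simp

lemma sidePath_last_one : M.sidePath i (2 * Γ.genus i + 1) 1 = M.sidePath i 0 0 := by
  rw [sidePath_last, sidePath_of_lt (by omega), node_zero]
  norm_num

lemma sidePath_re_mem {j : ℕ} (hj : j < 2 * Γ.genus i + 1) {t : ℝ} (ht : t ∈ I) :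
    M.node i j ≤ (M.sidePath i j t).re ∧ (M.sidePath i j t).re ≤ M.node i (j + 1) := by
  have := node_lt_succ (M := M) hj
  have h0 := ht.1
  have h1 := ht.2
  rw [sidePath_of_lt hj]
  constructor <;> simp only <;> nlinarith

lemma norm_sidePath_last {t : ℝ} (ht : t ∈ I) : ‖M.sidePath i (2 * Γ.genus i + 1) t‖ = M.R i := by
  have hR := R_pos (M := M) (i := i)
  rw [← sq_eq_sq₀ (norm_nonneg _) hR.le, norm_sq_eq, sidePath_last]
  simp only
  rw [mul_pow, mul_pow, Real.sq_sqrt (mul_nonneg ht.1 (by linarith [ht.2]))]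
  ring

lemma norm_mk_zero (x : ℝ) : ‖(⟨x, 0⟩ : ℂ)‖ = |x| :=
  Complex.norm_real x

lemma sidePath_mem {j : ℕ} (hj : j < 2 * Γ.genus i + 2) {t : ℝ} (ht : t ∈ I) :
    M.sidePath i j t ∈ M.halfDisc i ∧
      ((M.sidePath i j t).im = 0 ∨ ‖M.sidePath i j t‖ = M.R i) := by
  have hR := R_pos (M := M) (i := i)
  rcases Nat.lt_or_ge j (2 * Γ.genus i + 1) with h | h
  · have h1 := sidePath_re_mem (M := M) h ht
    have h2 := node_le_node (M := M) (Nat.zero_le j) h.le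
    have h3 := node_le_node (M := M) h le_rfl
    rw [node_zero] at h2
    rw [node_last] at h3
    have him : (M.sidePath i j t).im = 0 := by rw [sidePath_of_lt h]
    refine ⟨⟨?_, him.ge⟩, Or.inl him⟩
    have h4 : M.sidePath i j t = ⟨(M.sidePath i j t).re, 0⟩ := Complex.ext rfl him
    rw [h4, norm_mk_zero, abs_le]
    exact ⟨by linarith, by linarith⟩
  · have h' : j = 2 * Γ.genus i + 1 := by omega
    subst h'
    have h1 := norm_sidePath_last (M := M) (i := i) ht
    refine ⟨⟨h1.le, ?_⟩, Or.inr h1⟩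
    rw [sidePath_last]
    positivity

/-- The even sides miss the holes. -/
lemma le_abs_of_node_le {m : ℕ} (hm : m ≤ Γ.genus i) {x : ℝ} (h0 : M.node i (2 * m) ≤ x)
    (h1 : x ≤ M.node i (2 * m + 1)) (k : Fin (Γ.genus i)) : M.ρ i ≤ |x - M.d i * (k + 1)| := by
  rcases Nat.lt_or_ge (k : ℕ) m with h | h
  · have h2 := node_le_node (M := M) (i := i) (k := 2 * (k + 1)) (l := 2 * m) (by omega) (by omega)
    rw [node_even k.2] at h2
    exact le_abs.2 (Or.inl (by linarith))
  · have h2 := node_le_node (M := M) (i := i) (k := 2 * m + 1) (l := 2 * k + 1) (by omega)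
      (by omega)
    rw [node_odd k.2] at h2
    exact le_abs.2 (Or.inr (by linarith))

lemma lt_abs_of_node_lt {m : ℕ} (hm : m ≤ Γ.genus i) {x : ℝ} (h0 : M.node i (2 * m) < x)
    (h1 : x < M.node i (2 * m + 1)) (k : Fin (Γ.genus i)) : M.ρ i < |x - M.d i * (k + 1)| := by
  rcases Nat.lt_or_ge (k : ℕ) m with h | h
  · have h2 := node_le_node (M := M) (i := i) (k := 2 * (k + 1)) (l := 2 * m) (by omega) (by omega)
    rw [node_even k.2] at h2
    exact lt_abs.2 (Or.inl (by linarith))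
  · have h2 := node_le_node (M := M) (i := i) (k := 2 * m + 1) (l := 2 * k + 1) (by omega)
      (by omega)
    rw [node_odd k.2] at h2
    exact lt_abs.2 (Or.inr (by linarith))

/-- The even sides lie on the real axis. -/
lemma im_straighten_sidePath_even {m : ℕ} (hm : m ≤ Γ.genus i) {t : ℝ} (ht : t ∈ I) :
    (M.straighten i (M.sidePath i (2 * m) t)).im = 0 := by
  rw [im_straighten_eq_zero (sidePath_mem (by omega) ht).1]
  obtain ⟨h0, h1⟩ := sidePath_re_mem (M := M) (i := i) (j := 2 * m) (by omega) ht
  exact ⟨by rw [sidePath_of_lt (by omega)], le_abs_of_node_le hm h0 h1⟩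

/-- The odd sides lie on the boundary circles of the core. -/
lemma gap_straighten_sidePath_odd {m : ℕ} (hm : m ≤ Γ.genus i) {t : ℝ} (ht : t ∈ I) :
    ∃ b, M.gap i b (M.straighten i (M.sidePath i (2 * m + 1) t), 0) = 0 := by
  rw [exists_gap_straighten_eq_zero (sidePath_mem (by omega) ht).1]
  rcases hm.lt_or_eq with h | rfl
  · obtain ⟨h0, h1⟩ := sidePath_re_mem (M := M) (i := i) (j := 2 * m + 1) (by omega) ht
    rw [node_odd h] at h0
    have h2 : M.node i (2 * m + 1 + 1) = _ := node_even (M := M) h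
    rw [h2] at h1
    refine Or.inr ⟨by rw [sidePath_of_lt (by omega)], ⟨m, h⟩, abs_le.2 ⟨?_, ?_⟩⟩
    · simp only; linarith
    · simp only; linarith
  · exact Or.inl (norm_sidePath_last ht)

/-- The corners of the polygon lie both on the real axis and on the boundary circles of the core. -/
lemma corner {j : ℕ} (hj : j < 2 * Γ.genus i + 2) {t : ℝ} (ht : t = 0 ∨ t = 1) :
    (M.straighten i (M.sidePath i j t)).im = 0 ∧
      ∃ b, M.gap i b (M.straighten i (M.sidePath i j t), 0) = 0 := by
  have hI0 : (0 : ℝ) ∈ I := ⟨le_rfl, zero_le_one⟩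
  have hI1 : (1 : ℝ) ∈ I := ⟨zero_le_one, le_rfl⟩
  obtain ⟨m, rfl | rfl⟩ := Nat.even_or_odd' j
  · rcases ht with rfl | rfl
    · refine ⟨im_straighten_sidePath_even (by omega) hI0, ?_⟩
      rcases Nat.eq_zero_or_pos m with rfl | hm
      · rw [mul_zero, ← sidePath_last_one]
        exact gap_straighten_sidePath_odd le_rfl hI1
      · obtain ⟨m, rfl⟩ := Nat.exists_eq_succ_of_ne_zero hm.ne'
        have h1 := sidePath_one (M := M) (i := i) (j := 2 * m + 1) (by omega)
        have h2 := gap_straighten_sidePath_odd (M := M) (i := i) (m := m) (by omega) hI1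
        rw [h1] at h2
        exact h2
    · refine ⟨im_straighten_sidePath_even (by omega) hI1, ?_⟩
      rw [sidePath_one (by omega)]
      exact gap_straighten_sidePath_odd (by omega) hI0
  · rcases ht with rfl | rfl
    · refine ⟨?_, gap_straighten_sidePath_odd (by omega) hI0⟩
      rw [← sidePath_one (by omega)]
      exact im_straighten_sidePath_even (by omega) hI1
    · refine ⟨?_, gap_straighten_sidePath_odd (by omega) hI1⟩
      rcases Nat.lt_or_ge m (Γ.genus i) with h | h
      · rw [sidePath_one (by omega)]
        exact im_straighten_sidePath_even (m := m + 1) (by omega) hI0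
      · have h' : m = Γ.genus i := by omega
        rw [h', sidePath_last_one]
        exact im_straighten_sidePath_even (m := 0) (by omega) hI0

lemma not_gap_straighten_sidePath_even {m : ℕ} (hm : m ≤ Γ.genus i) {t : ℝ} (h0 : 0 < t)
    (h1 : t < 1) : ¬ ∃ b, M.gap i b (M.straighten i (M.sidePath i (2 * m) t), 0) = 0 := by
  have h2 := node_lt_succ (M := M) (i := i) (k := 2 * m) (by omega)
  have hs := sidePath_of_lt (M := M) (i := i) (j := 2 * m) (by omega) t
  have h3 : M.node i (2 * m) < (M.sidePath i (2 * m) t).re := by rw [hs]; simp only; nlinarith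
  have h4 : (M.sidePath i (2 * m) t).re < M.node i (2 * m + 1) := by rw [hs]; simp only; nlinarith
  rw [exists_gap_straighten_eq_zero (sidePath_mem (by omega) ⟨h0.le, h1.le⟩).1]
  rintro (h | ⟨-, k, hk⟩)
  · have h5 := node_le_node (M := M) (i := i) (Nat.zero_le (2 * m)) (by omega)
    have h6 := node_le_node (M := M) (i := i) (k := 2 * m + 1) (by omega) le_rfl
    rw [node_zero] at h5
    rw [node_last] at h6
    have h7 : M.sidePath i (2 * m) t = ⟨(M.sidePath i (2 * m) t).re, 0⟩ :=
      Complex.ext rfl (by rw [hs])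
    rw [h7, norm_mk_zero] at h
    have h8 : |(M.sidePath i (2 * m) t).re| < M.R i := abs_lt.2 ⟨by linarith, by linarith⟩
    exact h8.ne h
  · exact not_le.2 (lt_abs_of_node_lt hm h3 h4 k) hk

lemma im_straighten_sidePath_odd_ne {m : ℕ} (hm : m ≤ Γ.genus i) {t : ℝ} (h0 : 0 < t)
    (h1 : t < 1) : (M.straighten i (M.sidePath i (2 * m + 1) t)).im ≠ 0 := by
  rw [Ne, im_straighten_eq_zero (sidePath_mem (by omega) ⟨h0.le, h1.le⟩).1]
  rintro ⟨h2, h3⟩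
  rcases hm.lt_or_eq with h | rfl
  · have h4 := h3 ⟨m, h⟩
    have h5 : M.node i (2 * m + 1 + 1) = _ := node_even (M := M) h
    rw [sidePath_of_lt (by omega), h5, node_odd h] at h4
    have h6 := M.ρ_pos i
    rcases le_abs.1 h4 with h7 | h7 <;> simp only at h7 <;> nlinarith
  · rw [sidePath_last] at h2
    have h4 : 0 < √(t * (1 - t)) := Real.sqrt_pos.2 (mul_pos h0 (by linarith))
    have := R_pos (M := M) (i := i)
    have h5 : 0 < 2 * M.R i * √(t * (1 - t)) := by positivity
    exact h5.ne' h2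

end PlumbingModel
end

/-! ### The genus of the surfaces -/

noncomputable section

open Set Filter ComplexConjugate unitInterval PolygonVertex

namespace PlumbingModel

variable {n : ℕ} {Γ : PlumbingGraph n} {M : PlumbingModel Γ} {i : Fin n}

lemma val_add_one_of_lt {g : ℕ} {j : Fin (2 * g + 2)} (h : (j : ℕ) < 2 * g + 1) :
    ((j + 1 : Fin (2 * g + 2)) : ℕ) = j + 1 := by
  rw [Fin.val_add_one_of_lt]
  exact Fin.lt_def.2 (by simpa using h)

lemma sidePath_add_one (j : Fin (2 * Γ.genus i + 2)) :
    M.sidePath i (j + 1 : Fin (2 * Γ.genus i + 2)) 0 = M.sidePath i j 1 := by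
  rcases Nat.lt_or_ge j (2 * Γ.genus i + 1) with h | h
  · rw [val_add_one_of_lt h, sidePath_one h]
  · have h1 : (j : ℕ) = 2 * Γ.genus i + 1 := by omega
    have h2 : j = Fin.last (2 * Γ.genus i + 1) := Fin.ext h1
    rw [h1, sidePath_last_one, h2, Fin.last_add_one]
    rfl

lemma samePoint_of_sidePath_eq_of_lt {j j' : Fin (2 * Γ.genus i + 2)} {t t' : ℝ} (ht : t ∈ I)
    (ht' : t' ∈ I) (hjj : j < j') (h : M.sidePath i j t = M.sidePath i j' t') :
    SamePoint j t j' t' := by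
  have hlt : (j : ℕ) < j' := hjj
  have hj : (j : ℕ) < 2 * Γ.genus i + 1 := by omega
  have h1 := node_lt_succ (M := M) hj
  have hre : (M.sidePath i j t).re = M.node i j + t * (M.node i (j + 1) - M.node i j) := by
    rw [sidePath_of_lt hj]
  rcases Nat.lt_or_ge j' (2 * Γ.genus i + 1) with hj' | hj'
  · have h2 := node_lt_succ (M := M) hj'
    have h3 := node_le_node (M := M) (i := i) (k := j + 1) (l := j') hlt (by omega)
    have hre' : (M.sidePath i j' t').re =
        M.node i j' + t' * (M.node i (j' + 1) - M.node i j') := by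
      rw [sidePath_of_lt hj']
    rw [h, hre'] at hre
    have h4 : (1 - t) * (M.node i (j + 1) - M.node i j) = 0 := by
      nlinarith [mul_nonneg (sub_nonneg.2 ht.2) (sub_pos.2 h1).le,
        mul_nonneg ht'.1 (sub_pos.2 h2).le]
    have h5 : t' * (M.node i (j' + 1) - M.node i j') = 0 := by
      nlinarith [mul_nonneg (sub_nonneg.2 ht.2) (sub_pos.2 h1).le,
        mul_nonneg ht'.1 (sub_pos.2 h2).le]
    have h6 : t = 1 := by
      rcases mul_eq_zero.1 h4 with h6 | h6 <;> linarith
    have h7 : t' = 0 := by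
      rcases mul_eq_zero.1 h5 with h7 | h7 <;> linarith
    refine Or.inr (Or.inl ⟨h6, h7, Fin.ext ?_⟩)
    rw [val_add_one_of_lt hj]
    by_contra hne
    have h8 := node_lt_node (M := M) (i := i) (k := j + 1) (l := j') (by omega) (by omega)
    nlinarith
  · have hj'' : (j' : ℕ) = 2 * Γ.genus i + 1 := by omega
    have hR := R_pos (M := M) (i := i)
    rw [hj'', sidePath_last] at h
    have him := congrArg Complex.im h
    rw [h] at hre
    simp only at hre
    rw [sidePath_of_lt hj] at him
    have h2 : t' * (1 - t') = 0 := by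
      rcases mul_eq_zero.1 him.symm with h2 | h2
      · linarith
      · exact (Real.sqrt_eq_zero (mul_nonneg ht'.1 (by linarith [ht'.2]))).1 h2
    rcases mul_eq_zero.1 h2 with rfl | h2
    · have h3 := node_le_node (M := M) (i := i) (k := j + 1) hj le_rfl
      rw [node_last] at h3
      have h4 : (1 - t) * (M.node i (j + 1) - M.node i j) = 0 := by
        nlinarith [mul_nonneg (sub_nonneg.2 ht.2) (sub_pos.2 h1).le]
      have h6 : t = 1 := by
        rcases mul_eq_zero.1 h4 with h6 | h6 <;> linarith
      refine Or.inr (Or.inl ⟨h6, rfl, Fin.ext ?_⟩)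
      rw [val_add_one_of_lt hj, hj'']
      by_contra hne
      have h8 := node_lt_node (M := M) (i := i) (k := j + 1) (l := 2 * Γ.genus i + 1) (by omega)
        le_rfl
      rw [node_last] at h8
      nlinarith
    · have ht1 : t' = 1 := by linarith
      subst ht1
      have h3 := node_le_node (M := M) (i := i) (Nat.zero_le j) (by omega)
      rw [node_zero] at h3
      have h4 : t * (M.node i (j + 1) - M.node i j) = 0 := by
        nlinarith [mul_nonneg ht.1 (sub_pos.2 h1).le]
      have h6 : t = 0 := by
        rcases mul_eq_zero.1 h4 with h6 | h6 <;> linarith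
      have h7 : j' = Fin.last _ := Fin.ext hj''
      refine Or.inr (Or.inr ⟨h6, rfl, ?_⟩)
      rw [h7, Fin.last_add_one]
      by_contra hne
      have h8 := node_lt_node (M := M) (i := i) (k := 0) (l := j)
        (Nat.pos_of_ne_zero fun h => hne (Fin.ext h)) (by omega)
      rw [node_zero] at h8
      nlinarith

/-- The polygonal parametrization of the boundary of the half disc is injective up to the common end
points of consecutive sides. -/
lemma sidePath_eq_sidePath_iff {j j' : Fin (2 * Γ.genus i + 2)} {t t' : ℝ} (ht : t ∈ I)
    (ht' : t' ∈ I) : M.sidePath i j t = M.sidePath i j' t' ↔ SamePoint j t j' t' := by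
  constructor
  · intro h
    rcases lt_trichotomy j j' with hjj | rfl | hjj
    · exact samePoint_of_sidePath_eq_of_lt ht ht' hjj h
    · refine Or.inl ⟨rfl, ?_⟩
      have hre := congrArg Complex.re h
      rcases Nat.lt_or_ge j (2 * Γ.genus i + 1) with hj | hj
      · rw [sidePath_of_lt hj, sidePath_of_lt hj] at hre
        have h1 := node_lt_succ (M := M) hj
        exact mul_right_cancel₀ (sub_pos.2 h1).ne' (add_left_cancel hre)
      · have hj' : (j : ℕ) = 2 * Γ.genus i + 1 := by omega
        rw [hj', sidePath_last, sidePath_last] at hre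
        have := mul_left_cancel₀ (R_pos (M := M) (i := i)).ne' hre
        linarith
    · exact (samePoint_of_sidePath_eq_of_lt ht' ht hjj h.symm).symm
  · rintro (⟨rfl, rfl⟩ | ⟨rfl, rfl, rfl⟩ | ⟨rfl, rfl, rfl⟩)
    · rfl
    · exact (sidePath_add_one j).symm
    · exact sidePath_add_one j'

lemma exists_node_le {x : ℝ} (h0 : -M.R i ≤ x) {k : ℕ} (hk : 0 < k) (hx : x ≤ M.node i k) :
    ∃ j < k, M.node i j ≤ x ∧ x ≤ M.node i (j + 1) := by
  induction k, hk using Nat.le_induction with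
  | base => exact ⟨0, one_pos, h0, hx⟩
  | succ k _ ih =>
    rcases le_total x (M.node i k) with h | h
    · obtain ⟨j, hj, h1⟩ := ih h
      exact ⟨j, by omega, h1⟩
    · exact ⟨k, by omega, h, hx⟩

lemma exists_sidePath_eq {w : ℂ} (hw : w ∈ M.halfDisc i) (hw' : w.im = 0 ∨ ‖w‖ = M.R i) :
    ∃ j : Fin (2 * Γ.genus i + 2), ∃ t ∈ I, M.sidePath i j t = w := by
  have hR := R_pos (M := M) (i := i)
  obtain ⟨h0, h1⟩ := abs_le.1 (mem_halfDisc.1 hw).1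
  rcases hw' with h | h
  · obtain ⟨j, hj, h2, h3⟩ := exists_node_le h0 (k := 2 * Γ.genus i + 1) (by omega)
      (by rwa [node_last])
    have h4 := node_lt_succ (M := M) hj
    refine ⟨⟨j, by omega⟩, (w.re - M.node i j) / (M.node i (j + 1) - M.node i j), ⟨?_, ?_⟩, ?_⟩
    · exact div_nonneg (by linarith) (by linarith)
    · exact (div_le_one (by linarith)).2 (by linarith)
    · simp only
      rw [sidePath_of_lt hj, div_mul_cancel₀ _ (by linarith)]
      exact Complex.ext (by simp) h.symm
  · refine ⟨Fin.last _, (1 - w.re / M.R i) / 2, ⟨?_, ?_⟩, ?_⟩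
    · have := (div_le_one hR).2 h1
      linarith
    · have : -1 ≤ w.re / M.R i := (le_div_iff₀ hR).2 (by linarith)
      linarith
    · simp only [Fin.val_last]
      rw [sidePath_last]
      refine Complex.ext ?_ ?_
      · simp only
        field_simp
        ring
      · simp only
        have h2 : w.re ^ 2 + w.im ^ 2 = M.R i ^ 2 := by rw [← norm_sq_eq, h]
        have h3 : (1 - w.re / M.R i) / 2 * (1 - (1 - w.re / M.R i) / 2) =
            (w.im / (2 * M.R i)) ^ 2 := by
          field_simp
          nlinarith
        rw [h3, Real.sqrt_sq (div_nonneg hw.2 (by linarith)), mul_div_cancel₀ _ (by linarith)]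

variable (M) in
/-- The segments from an interior point of the half disc to the points of its boundary. -/
def cone (i : Fin n) (r : ℝ) (w : ℂ) : ℂ :=
  AffineMap.lineMap (⟨0, M.R i / 2⟩ : ℂ) w r

lemma cone_mem {r : ℝ} (hr : r ∈ I) {w : ℂ} (hw : w ∈ M.halfDisc i) :
    M.cone i r w ∈ M.halfDisc i := by
  have hR := R_pos (M := M) (i := i)
  refine convex_halfDisc.lineMap_mem ⟨?_, ?_⟩ hw hr
  · rw [← sq_le_sq₀ (norm_nonneg _) hR.le, norm_sq_eq]
    simp only
    nlinarith
  · simp only; linarith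

lemma cone_zero (w : ℂ) : M.cone i 0 w = ⟨0, M.R i / 2⟩ := AffineMap.lineMap_apply_zero _ _

lemma cone_one (w : ℂ) : M.cone i 1 w = w := AffineMap.lineMap_apply_one _ _

lemma cone_eq (r : ℝ) (w : ℂ) :
    M.cone i r w = (1 - r) • (⟨0, M.R i / 2⟩ : ℂ) + r • w := AffineMap.lineMap_apply_module _ _ _

lemma cone_injective {r : ℝ} (hr : r ≠ 0) : Function.Injective (M.cone i r) := by
  intro w w' h
  rw [cone_eq, cone_eq, add_right_inj] at h
  exact smul_right_injective ℂ hr h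

lemma cone_cone (r s : ℝ) (w : ℂ) : M.cone i r (M.cone i s w) = M.cone i (r * s) w := by
  simp only [cone_eq, smul_add, smul_smul]
  module

lemma im_cone_pos {r : ℝ} (hr : 0 ≤ r) (hr' : r < 1) {w : ℂ} (hw : w ∈ M.halfDisc i) :
    0 < (M.cone i r w).im := by
  have hR := R_pos (M := M) (i := i)
  have h1 : (M.cone i r w).im = (1 - r) * (M.R i / 2) + r * w.im := by simp [cone_eq]
  rw [h1]
  have := mul_nonneg hr hw.2
  have : 0 < (1 - r) * (M.R i / 2) := mul_pos (by linarith) (by linarith)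
  linarith

lemma norm_cone_lt {r : ℝ} (hr : 0 ≤ r) (hr' : r < 1) {w : ℂ} (hw : w ∈ M.halfDisc i) :
    ‖M.cone i r w‖ < M.R i := by
  have hR := R_pos (M := M) (i := i)
  have h0 : ‖(⟨0, M.R i / 2⟩ : ℂ)‖ = M.R i / 2 := by
    rw [← sq_eq_sq₀ (norm_nonneg _) (by linarith), norm_sq_eq]
    simp
  rw [cone_eq]
  refine (norm_add_le _ _).trans_lt ?_
  rw [norm_smul, norm_smul, h0, Real.norm_of_nonneg hr, Real.norm_of_nonneg (by linarith)]
  have h1 := mul_le_mul_of_nonneg_left hw.1 hr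
  nlinarith [mul_pos (sub_pos.2 hr') hR]

lemma cone_eq_cone_iff {r r' : ℝ} (hr : r ∈ I) (hr' : r' ∈ I) {w w' : ℂ} (hw : w ∈ M.halfDisc i)
    (hw' : w' ∈ M.halfDisc i) (hb : w.im = 0 ∨ ‖w‖ = M.R i) (hb' : w'.im = 0 ∨ ‖w'‖ = M.R i) :
    M.cone i r w = M.cone i r' w' ↔ r = r' ∧ (r ≠ 0 → w = w') := by
  -- boundary points are not interior points of a segment from the apex to another boundary point
  have key : ∀ {r r' : ℝ} {w w' : ℂ}, 0 ≤ r → r < r' → w ∈ M.halfDisc i →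
      (w'.im = 0 ∨ ‖w'‖ = M.R i) → M.cone i r w ≠ M.cone i r' w' := by
    intro r r' w w' h0 h1 hw hb h
    have hpos : 0 < r' := h0.trans_lt h1
    have h2 : w' = M.cone i (r / r') w := by
      refine cone_injective (M := M) (i := i) hpos.ne' ?_
      rw [cone_cone, mul_div_cancel₀ _ hpos.ne', h]
    have h3 : r / r' < 1 := (div_lt_one hpos).2 h1
    rcases hb with hb | hb
    · rw [h2] at hb
      exact (im_cone_pos (div_nonneg h0 hpos.le) h3 hw).ne' hb
    · rw [h2] at hb
      exact (norm_cone_lt (div_nonneg h0 hpos.le) h3 hw).ne hb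
  constructor
  · intro h
    rcases lt_trichotomy r r' with h1 | rfl | h1
    · exact absurd h (key hr.1 h1 hw hb')
    · exact ⟨rfl, fun hr => cone_injective hr h⟩
    · exact absurd h.symm (key hr'.1 h1 hw' hb)
  · rintro ⟨rfl, h⟩
    by_cases hr0 : r = 0
    · rw [hr0, cone_zero, cone_zero]
    · rw [h hr0]

lemma exists_cone_eq {w : ℂ} (hw : w ∈ M.halfDisc i) :
    ∃ r ∈ I, ∃ w' ∈ M.halfDisc i, (w'.im = 0 ∨ ‖w'‖ = M.R i) ∧ M.cone i r w' = w := by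
  have hR := R_pos (M := M) (i := i)
  by_cases hwo : w = ⟨0, M.R i / 2⟩
  · refine ⟨0, ⟨le_rfl, zero_le_one⟩, 0, ⟨by simpa using hR.le, by simp⟩, Or.inl (by simp), ?_⟩
    rw [cone_zero, hwo]
  have hpos : 0 < ‖w - ⟨0, M.R i / 2⟩‖ := norm_pos_iff.2 (sub_ne_zero.2 hwo)
  -- follow the ray through `w` until it leaves the half disc
  set φ : ℝ → ℝ := fun s => min (M.cone i s w).im (M.R i - ‖M.cone i s w‖) with hφ
  have hc : Continuous fun s => M.cone i s w := by
    unfold cone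
    exact AffineMap.lineMap_continuous
  have hφc : Continuous φ :=
    (Complex.continuous_im.comp hc).min (continuous_const.sub hc.norm)
  set S := 1 + 2 * M.R i / ‖w - ⟨0, M.R i / 2⟩‖ with hS
  have hS1 : 1 ≤ S := by
    have : 0 ≤ 2 * M.R i / ‖w - ⟨0, M.R i / 2⟩‖ := by positivity
    linarith
  have h1 : 0 ≤ φ 1 := by
    simp only [hφ, cone_one]
    exact le_min hw.2 (sub_nonneg.2 hw.1)
  have h2 : φ S ≤ 0 := by
    refine (min_le_right _ _).trans (sub_nonpos.2 ?_)
    have h0 : ‖(⟨0, M.R i / 2⟩ : ℂ)‖ = M.R i / 2 := by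
      rw [← sq_eq_sq₀ (norm_nonneg _) (by linarith), norm_sq_eq]
      simp
    have h3 : S • (w - ⟨0, M.R i / 2⟩) = M.cone i S w - ⟨0, M.R i / 2⟩ := by
      rw [cone_eq]
      module
    have h4 : S * ‖w - ⟨0, M.R i / 2⟩‖ ≤ ‖M.cone i S w‖ + M.R i / 2 := by
      have h5 := norm_smul S (w - ⟨0, M.R i / 2⟩)
      rw [Real.norm_of_nonneg (zero_le_one.trans hS1)] at h5
      rw [← h5, h3]
      exact (norm_sub_le _ _).trans (by rw [h0])
    have h5 : S * ‖w - ⟨0, M.R i / 2⟩‖ = ‖w - ⟨0, M.R i / 2⟩‖ + 2 * M.R i := by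
      rw [hS]
      field_simp
    linarith
  obtain ⟨s, hs, hs0⟩ := intermediate_value_Icc' hS1 hφc.continuousOn ⟨h2, h1⟩
  have hs1 : 0 < s := zero_lt_one.trans_le hs.1
  have h3 : 0 ≤ (M.cone i s w).im := hs0.ge.trans (min_le_left _ _)
  have h4 : 0 ≤ M.R i - ‖M.cone i s w‖ := hs0.ge.trans (min_le_right _ _)
  refine ⟨s⁻¹, ⟨by positivity, inv_le_one_of_one_le₀ hs.1⟩, M.cone i s w, ⟨by linarith, h3⟩, ?_, ?_⟩
  · rcases min_choice (M.cone i s w).im (M.R i - ‖M.cone i s w‖) with h | h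
    · exact Or.inl (h.symm.trans hs0)
    · have := h.symm.trans hs0
      exact Or.inr (by linarith)
  · rw [cone_cone, inv_mul_cancel₀ hs1.ne', cone_one]

/-- The conditions under which two pieces of the surface meet along the side `j` say that they have
the same label at this side. -/
lemma label_eq_iff {j : Fin (2 * Γ.genus i + 2)} {t : ℝ} (ht : t ∈ I) (q q' : Bool × Bool) :
    ((q.1 = q'.1 ∨ ∃ b, M.gap i b (M.straighten i (M.sidePath i j t), 0) = 0) ∧
      (q.2 = q'.2 ∨ (M.straighten i (M.sidePath i j t)).im = 0)) ↔
    (0 < t → t < 1 → label j q = label j q') := by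
  by_cases hend : t = 0 ∨ t = 1
  · obtain ⟨h1, h2⟩ := corner (M := M) j.2 hend
    refine iff_of_true ⟨Or.inr h2, Or.inr h1⟩ fun h3 h4 => ?_
    rcases hend with h | h <;> linarith
  push Not at hend
  have h0 : 0 < t := lt_of_le_of_ne ht.1 hend.1.symm
  have h1 : t < 1 := lt_of_le_of_ne ht.2 hend.2
  simp only [h0, h1, true_imp_iff, label]
  obtain ⟨m, hm | hm⟩ := Nat.even_or_odd' (j : ℕ)
  · have h2 := im_straighten_sidePath_even (M := M) (i := i) (m := m) (by omega) ht
    have h3 := not_gap_straighten_sidePath_even (M := M) (i := i) (m := m) (by omega) h0 h1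
    rw [hm, if_pos (even_two_mul m), if_pos (even_two_mul m), or_iff_left h3]
    exact and_iff_left (Or.inr h2)
  · have h2 := gap_straighten_sidePath_odd (M := M) (i := i) (m := m) (by omega) ht
    have h3 := im_straighten_sidePath_odd_ne (M := M) (i := i) (m := m) (by omega) h0 h1
    have h4 : ¬ Even (2 * m + 1) := by simp
    rw [hm, if_neg h4, if_neg h4, or_iff_left h3]
    exact and_iff_right (Or.inr h2)

/-- The surface is glued from four copies of a half disc. As polygons with `2 * g + 2` sides their
even sides are on the real axis, where the pieces in the same sheet meet, and their odd sides are on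
the boundary circles, where those in the same half meet. -/
theorem hasGenus (i : Fin n) : (M.surface i).HasGenus (Γ.genus i) := by
  have hmem : ∀ r ∈ I, ∀ j : Fin (2 * Γ.genus i + 2), ∀ t ∈ I,
      M.straighten i (M.cone i r (M.sidePath i j t)) ∈ M.upperCore i := fun r hr j t ht =>
    bijOn_straighten.mapsTo (cone_mem hr (sidePath_mem j.2 ht).1)
  refine PolygonVertex.exists_homeomorph (S := (M.surfaceGlue i).Space)
    (f := fun r t j q => M.piece i q.1 q.2 (M.straighten i (M.cone i r (M.sidePath i j t))))
    (fun j q => ?_) (fun p => ?_) fun r hr t ht j q r' hr' t' ht' j' q' => ?_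
  · refine (continuousOn_piece q.1 q.2).comp_continuous ?_ fun x => hmem x.1 x.1.2 j x.2 x.2.2
    refine (M.continuous_straighten i).comp ?_
    have h1 := (continuous_sidePath (M := M) (i := i) j).comp
      (continuous_subtype_val.comp (continuous_snd (X := I) (Y := I)))
    simp only [cone_eq]
    have h2 : Continuous fun x : I × I => (x.1 : ℝ) := by fun_prop
    exact ((continuous_const.sub h2).smul continuous_const).add (h2.smul h1)
  · obtain ⟨s, h, w, hw, rfl⟩ := exists_piece p
    obtain ⟨w, hw', rfl⟩ := bijOn_straighten.surjOn hw
    obtain ⟨r, hr, w, hw'', hb, rfl⟩ := exists_cone_eq hw'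
    obtain ⟨j, t, ht, rfl⟩ := exists_sidePath_eq hw'' hb
    exact ⟨r, hr, t, ht, j, (s, h), rfl⟩
  · obtain ⟨hw, hb⟩ := sidePath_mem (M := M) j.2 ht
    obtain ⟨hw', hb'⟩ := sidePath_mem (M := M) j'.2 ht'
    have hinj : M.straighten i (M.cone i r (M.sidePath i j t)) =
        M.straighten i (M.cone i r' (M.sidePath i j' t')) ↔
        r = r' ∧ (r ≠ 0 → SamePoint j t j' t') := by
      rw [bijOn_straighten.injOn.eq_iff (cone_mem hr hw) (cone_mem hr' hw'),
        cone_eq_cone_iff hr hr' hw hw' hb hb', sidePath_eq_sidePath_iff ht ht']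
    refine (piece_eq_piece (hmem r hr j t ht) (hmem r' hr' j' t' ht')).trans ?_
    rw [hinj, Glued, and_assoc]
    refine and_congr_right fun _ => ?_
    rcases eq_or_lt_of_le hr.2 with rfl | hr1
    · rw [cone_one, label_eq_iff ht]
      simp
    · have h1 : ¬ ∃ b, M.gap i b (M.straighten i (M.cone i r (M.sidePath i j t)), 0) = 0 := by
        rw [exists_gap_straighten_eq_zero (cone_mem hr hw)]
        rintro (h | ⟨h, -⟩)
        · exact (norm_cone_lt hr.1 hr1 hw).ne h
        · exact (im_cone_pos hr.1 hr1 hw).ne' h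
      have h2 : (M.straighten i (M.cone i r (M.sidePath i j t))).im ≠ 0 := fun h =>
        (im_cone_pos hr.1 hr1 hw).ne' ((im_straighten_eq_zero (cone_mem hr hw)).1 h).1
      rw [or_iff_left h1, or_iff_left h2, ← Prod.ext_iff]
      constructor
      · rintro ⟨h3, rfl⟩
        exact ⟨fun _ => rfl, fun h => ⟨h3 h, fun _ _ => rfl⟩⟩
      · rintro ⟨h3, h4⟩
        exact ⟨fun h => (h4 h).1, h3 hr1.ne⟩

end PlumbingModel
end

/-! ### Existence of the neighborhood -/

theorem proposition3p2 {n : ℕ} (Γ : PlumbingGraph n)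
    (hz : ∃ z : Fin n → ℝ, (∀ i, 0 < z i) ∧
      -(Γ.intersectionMatrix.mulVec z) = (1 / (2 * Real.pi)) • Γ.area) :
    ∃ (X : Type) (_ : TopologicalSpace X) (_ : ChartedSpace (EuclideanSpace ℝ (Fin 4)) X)
      (_ : IsManifold (𝓡 4) ∞ X) (_ : T2Space X) (_ : SecondCountableTopology X)
      (Ω : DiffForm 4 X 2) (C : Fin n → EmbeddedSurface X) (f : X → ℝ) (V : VecField 4 X),
      IsNeighborhood5Tuple Ω C f V ∧
      (∀ i j, i ≠ j → ((C i).image ∩ (C j).image).encard = (Γ.edges i j : ℕ∞)) ∧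
      (∀ i, (C i).HasSelfIntersection Ω (Γ.selfInt i)) ∧
      (∀ i, (C i).HasArea Ω (Γ.area i)) ∧
      (∀ i, (C i).HasGenus (Γ.genus i)) ∧
      (∃ t₀ > 0, ∀ t, 0 < t → t < t₀ →
        IsConvexNeighborhood Ω (⋃ i, (C i).image) {x | f x ≤ t}) := by
  obtain ⟨M⟩ := PlumbingModel.nonempty Γ hz
  refine ⟨M.glue.Space, inferInstance, inferInstance, inferInstance, inferInstance, inferInstance,
    M.Ω, M.surface, M.heightFun, M.glue.field M.liouville, PlumbingModel.isNeighborhood5Tuple,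
    fun i j hij => PlumbingModel.encard_inter hij, PlumbingModel.hasSelfIntersection,
    PlumbingModel.hasArea, PlumbingModel.hasGenus, M.ε ^ 4 / 64, ?_, fun t ht ht' => ?_⟩
  · have := M.ε_pos
    positivity
  · rw [PlumbingModel.iUnion_image]
    exact PlumbingModel.isConvexNeighborhood_sublevel ht ht'
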